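/- Let $k$ be a commutative ring and $B$ a $k$-bialgebra with product $\mu$, unit $\eta$, coproduct $\delta(x)=x^{(1)}\otimes x^{(2)}$ and counit $\varepsilon$. Put $C_n=C_n(B)=B^{\otimes n}$, write $(x_1,\dots,x_n)$ for an elementary tensor and $\mu_n$ for the multiplication in $n$ elements ($\mu_0=\eta$). For homogeneous elements put $\tau(a\otimes b)=(-1)^{|a||b|}b\otimes a$, $\rho(a\otimes b)=(-1)^{(|a|-1)(|b|-1)}b\otimes a$, $\varrho(a\otimes b)=(-1)^{|a|(|b|-1)}b\otimes a$. A (planar counital) cooperad is a sequence of $k$-modules $\mathcal C(n)$, $n\ge 0$, with linear maps $\epsilon\colon\mathcal C(1)\to k$ and $\Delta_{p,q,i}\colon \mathcal C(p+q-1)\to \mathcal C(p)\otimes \mathcal C(q)$, $1\le i\le p$, such that $(\epsilon\otimes \mathrm{id})\Delta_{1,n,1}=\mathrm{id}$, $(\mathrm{id}\otimes\epsilon)\Delta_{n,1,i}=\mathrm{id}$ and, with $\sigma$ the plain flip, $(\Delta_{p,q,i}\otimes\mathrm{id})\Delta_{p+q-1,r,j}$ equals $(\mathrm{id}\otimes\sigma)(\Delta_{p,r,j-q+1}\otimes\mathrm{id})\Delta_{p+r-1,q,i}$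 if $i\le j-q$, $(\mathrm{id}\otimes\Delta_{q,r,j-i+1})\Delta_{p,q+r-1,i}$ if $j-q<i\le j$, and $(\mathrm{id}\otimes\sigma)(\Delta_{p,r,j}\otimes\mathrm{id})\Delta_{p+r-1,q,i+r-1}$ if $j<i$. A comultiplication on it is a morphism of counital cooperads $\psi\colon\mathcal C\to\mathsf{Ass}^*$, where $\mathsf{Ass}^*(n)=k$ with all $\Delta_{p,q,i}(1)=1\otimes 1$ and $\epsilon=\mathrm{id}$; put $\mu^c=\psi_2$, $e^c=\psi_0$. The induced differential $d\colon\mathcal C(n)\to\mathcal C(n-1)$ is $\sum_{i=0}^n(-1)^id_i$ with $d_0=(\mu^c\otimes\mathrm{id})\Delta_{2,n-1,2}$, $d_i=(\mathrm{id}\otimes\mu^c)\Delta_{n-1,2,i}$ for $1\le i\le n-1$, $d_n=(\mu^c\otimes\mathrm{id})\Delta_{2,n-1,1}$. On $\mathcal C(n)$ put further $$\cup^c=\sum_{j=1}^{n+1}(\mu^c\otimes\mathrm{id}\otimes\mathrm{id})(\Delta_{2,j-1,1}\otimes\mathrm{id})\Delta_{j,n+1-j,j},\qquad \{-\}=(\mathrm{id}-\rho)\sum_{p+q=n+1}\sum_{i=1}^p(-1)^{(q-1)(p-i)}\Delta_{p,q,i},$$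 and let $\bar e^c$ be $e^c$ on $\mathcal C(0)$ and $0$ in positive degrees. A Gerstenhaber coalgebra is a graded module $V=\bigoplus_{n\ge0}V_n$ with a coassociative counital coproduct $\cup^c\colon V_n\to\bigoplus_{p+q=n}V_p\otimes V_q$ such that $\tau\cup^c=\cup^c$, and a cobracket $\{-\}\colon V_n\to\bigoplus_{p+q=n+1}V_p\otimes V_q$ such that $\operatorname{Im}\{-\}\subseteq\operatorname{Im}(\mathrm{id}-\rho)$, $$\big(\mathrm{id}+(\mathrm{id}\otimes\rho)(\rho\otimes\mathrm{id})+(\rho\otimes\mathrm{id})(\mathrm{id}\otimes\rho)\big)(\{-\}\otimes\mathrm{id})\{-\}=0,$$ $$(\mathrm{id}\otimes\cup^c)\{-\}=\big(\{-\}\otimes\mathrm{id}+(\varrho\otimes\mathrm{id})(\mathrm{id}\otimes\{-\})\big)\cup^c .$$ Then the following hold. 1. The modules $C_n(B)$ with the maps $$\Delta_{p,q,i}(x_1,\dots,x_{p+q-1})=(x_1,\dots,x_{i-1},x_i^{(1)}\cdots x_{i+q-1}^{(1)},x_{i+q},\dots,x_{p+q-1})\otimes(x_i^{(2)},\dots,x_{i+q-1}^{(2)}),$$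 the counit $\varepsilon\colon C_1(B)=B\to k$ and $\psi_n=\varepsilon\circ\mu_n$ form a cooperad with comultiplication. Its induced differential is the standard one, $$d(b_1,\dots,b_n)=\varepsilon(b_1)(b_2,\dots,b_n)+\sum_{i=1}^{n-1}(-1)^i(b_1,\dots,b_ib_{i+1},\dots,b_n)+(-1)^n(b_1,\dots,b_{n-1})\varepsilon(b_n).$$ Write $H_n(B,k)$ for its homology (Hopf algebra homology). 2. Without further hypotheses, $C=C_\bullet(B)$ is Gerstenhaber on homology in the following sense: $d^2=0$; $\cup^c$, $\{-\}$, $\bar e^c$ are chain maps $C\to C\otimes C$, $C[1]\to C[1]\otimes C[1]$, $C\to k$; on chains, $\cup^c$ is coassociative with counit $\bar e^c$, $\operatorname{Im}\{-\}\subseteq\operatorname{Im}(\mathrm{id}-\rho)$, and the coJacobi identity holds; on cycles, the identities $\tau\cup^c=\cup^c$ and coLeibniz hold up to boundaries of $C\otimes C$ and of $C[1]\otimes C\otimes C$, respectively. 3. Suppose that $B$ and all $H_n(B,k)$ are projective $k$-modules (automatic if $k$ is a field). Then there is exactly one Gerstenhaber coalgebra structure on $H_\bullet(B,k)$ induced by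 $\cup^c,\{-\},\bar e^c$, i.e. such that, for every cycle $z$, the Künneth map $[x]\otimes[y]\mapsto[x\otimes y]$ sends $\cup^c[z]$ to the class of $\cup^c z$ in $H(C\otimes C)$ and $\{[z]\}$ to the class of $\{z\}$ in $H(C[1]\otimes C[1])$, and the counit sends $[z]$ to $\bar e^c(z)$. 4. If $B$ is $k$-projective, there are isomorphisms $H_n(B,k)\cong\operatorname{Tor}^B_n(k,k)$ for all $n$, namely those given by the bar resolution $B\otimes B^{\otimes\bullet}\to k$ of the trivial module. If moreover all $H_n(B,k)$ are $k$-projective (automatic if $k$ is a field), the groups $\operatorname{Tor}^B_\bullet(k,k)$ carry a Gerstenhaber coalgebra structure (in particular a graded cocommutative $k$-coalgebra structure) for which these isomorphisms identify it with the structure of part 3. -/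

import Mathlib

open scoped TensorProduct DirectSum

universe u v w

noncomputable section

/-! ## Graded modules: flips, homology, Gerstenhaber coalgebras

A graded `k`-module is a family `V : ℕ → Type*` of `k`-modules; its total module is `⨁ n, V n`. -/

section Graded

variable (k : Type u) [CommRing k]
variable (V : ℕ → Type v) [∀ n, AddCommGroup (V n)] [∀ n, Module k (V n)]

/-- The tensor flip `a ⊗ b ↦ (-1) ^ s |a| |b| • b ⊗ a` with a sign prescribed by `s`. -/
def signedFlip (s : ℕ → ℕ → ℕ) :
    (⨁ n, V n) ⊗[k] (⨁ n, V n) →ₗ[k] (⨁ n, V n) ⊗[k] (⨁ n, V n) :=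
  TensorProduct.lift (DirectSum.toModule k ℕ _ fun a =>
    LinearMap.flip (DirectSum.toModule k ℕ _ fun b =>
      (-1 : k) ^ (s a b) •
        (TensorProduct.mk k (⨁ n, V n) (⨁ n, V n)).compl₁₂
          (DirectSum.lof k ℕ V b) (DirectSum.lof k ℕ V a)))

/-- The graded flip `τ (a ⊗ b) = (-1) ^ (|a| |b|) b ⊗ a`. -/
def gradedFlip : (⨁ n, V n) ⊗[k] (⨁ n, V n) →ₗ[k] (⨁ n, V n) ⊗[k] (⨁ n, V n) :=
  signedFlip k V fun a b => a * b

/-- The suspended flip `ρ (a ⊗ b) = (-1) ^ ((|a| - 1) (|b| - 1)) b ⊗ a`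
(`a + 1` and `a - 1` have the same parity). -/
def suspendedFlip : (⨁ n, V n) ⊗[k] (⨁ n, V n) →ₗ[k] (⨁ n, V n) ⊗[k] (⨁ n, V n) :=
  signedFlip k V fun a b => (a + 1) * (b + 1)

/-- The mixed flip `ϱ (a ⊗ b) = (-1) ^ (|a| (|b| - 1)) b ⊗ a`. -/
def mixedFlip : (⨁ n, V n) ⊗[k] (⨁ n, V n) →ₗ[k] (⨁ n, V n) ⊗[k] (⨁ n, V n) :=
  signedFlip k V fun a b => a * (b + 1)

/-- The part `⨁_{p + q = n} V p ⊗ V q` of total degree `n` of `(⨁ n, V n) ⊗ (⨁ n, V n)`. -/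
def tensorDegree (n : ℕ) : Submodule k ((⨁ n, V n) ⊗[k] (⨁ n, V n)) :=
  ⨆ (p : ℕ) (q : ℕ) (_ : p + q = n),
    LinearMap.range (TensorProduct.map (DirectSum.lof k ℕ V p) (DirectSum.lof k ℕ V q))

variable {k V} in
/-- `id ⊗ f` on a threefold tensor product, for `f` with values in a twofold tensor product. -/
def idTensor {W : Type w} [AddCommGroup W] [Module k W] (f : W →ₗ[k] W ⊗[k] W) :
    W ⊗[k] W →ₗ[k] (W ⊗[k] W) ⊗[k] W :=
  (TensorProduct.assoc k W W W).symm.toLinearMap ∘ₗ LinearMap.lTensor W f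

variable {k V} in
/-- `f` applied to the last two factors of a threefold tensor product. -/
def onLastTwo {W : Type w} [AddCommGroup W] [Module k W] (f : W ⊗[k] W →ₗ[k] W ⊗[k] W) :
    (W ⊗[k] W) ⊗[k] W →ₗ[k] (W ⊗[k] W) ⊗[k] W :=
  (TensorProduct.assoc k W W W).symm.toLinearMap ∘ₗ LinearMap.lTensor W f ∘ₗ
    (TensorProduct.assoc k W W W).toLinearMap

/-- The additive group structure on threefold tensor products, as a shortcut instance. -/
instance tripleTensorAddCommGroup :
    AddCommGroup (((⨁ n, V n) ⊗[k] (⨁ n, V n)) ⊗[k] (⨁ n, V n)) :=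
  TensorProduct.addCommGroup

/-- The defect of the coLeibniz identity
`(id ⊗ ∪) ∘ {-} = ({-} ⊗ id + (ϱ ⊗ id) ∘ (id ⊗ {-})) ∘ ∪`. -/
def coLeibnizDefect (cup cobracket : (⨁ n, V n) →ₗ[k] (⨁ n, V n) ⊗[k] (⨁ n, V n)) :
    (⨁ n, V n) →ₗ[k] ((⨁ n, V n) ⊗[k] (⨁ n, V n)) ⊗[k] (⨁ n, V n) :=
  idTensor cup ∘ₗ cobracket -
    (LinearMap.rTensor _ cobracket +
      LinearMap.rTensor _ (mixedFlip k V) ∘ₗ idTensor cobracket) ∘ₗ cup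

/-- The left-hand side of the coJacobi identity of the desuspension,
`(id + (id ⊗ ρ) (ρ ⊗ id) + (ρ ⊗ id) (id ⊗ ρ)) ∘ ({-} ⊗ id) ∘ {-}`. -/
def coJacobiator (cobracket : (⨁ n, V n) →ₗ[k] (⨁ n, V n) ⊗[k] (⨁ n, V n)) :
    (⨁ n, V n) →ₗ[k] ((⨁ n, V n) ⊗[k] (⨁ n, V n)) ⊗[k] (⨁ n, V n) :=
  (LinearMap.id +
      onLastTwo (suspendedFlip k V) ∘ₗ LinearMap.rTensor _ (suspendedFlip k V) +
      LinearMap.rTensor _ (suspendedFlip k V) ∘ₗ onLastTwo (suspendedFlip k V)) ∘ₗ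
    LinearMap.rTensor _ cobracket ∘ₗ cobracket

/-- A Gerstenhaber coalgebra structure on a graded module `V`: a graded cocommutative
(coassociative, counital) coalgebra with a graded Lie cobracket
`V n → ⨁_{p + q = n + 1} V p ⊗ V q` such that the coLeibniz identity holds. -/
structure GerstenhaberCoalgebra where
  cup : (⨁ n, V n) →ₗ[k] (⨁ n, V n) ⊗[k] (⨁ n, V n)
  counit : (⨁ n, V n) →ₗ[k] k
  cobracket : (⨁ n, V n) →ₗ[k] (⨁ n, V n) ⊗[k] (⨁ n, V n)
  cup_mem : ∀ (n : ℕ) (x : V n), cup (DirectSum.lof k ℕ V n x) ∈ tensorDegree k V n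
  counit_eq_zero : ∀ (n : ℕ) (x : V n), n ≠ 0 → counit (DirectSum.lof k ℕ V n x) = 0
  cobracket_mem :
    ∀ (n : ℕ) (x : V n), cobracket (DirectSum.lof k ℕ V n x) ∈ tensorDegree k V (n + 1)
  coassoc : LinearMap.rTensor _ cup ∘ₗ cup = idTensor cup ∘ₗ cup
  counit_left :
    (TensorProduct.lid k _).toLinearMap ∘ₗ LinearMap.rTensor _ counit ∘ₗ cup = LinearMap.id
  counit_right :
    (TensorProduct.rid k _).toLinearMap ∘ₗ LinearMap.lTensor _ counit ∘ₗ cup = LinearMap.id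
  cocomm : gradedFlip k V ∘ₗ cup = cup
  coantisymm :
    LinearMap.range cobracket ≤ LinearMap.range (LinearMap.id - suspendedFlip k V)
  coJacobi : coJacobiator k V cobracket = 0
  coLeibniz : coLeibnizDefect k V cup cobracket = 0

/-- Compatibility of a graded linear map `f : V → V'` with Gerstenhaber coalgebra structures. -/
def GerstenhaberCoalgebra.IsHom {k : Type u} [CommRing k]
    {V : ℕ → Type v} [∀ n, AddCommGroup (V n)] [∀ n, Module k (V n)]
    {V' : ℕ → Type w} [∀ n, AddCommGroup (V' n)] [∀ n, Module k (V' n)]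
    (G : GerstenhaberCoalgebra k V) (G' : GerstenhaberCoalgebra k V')
    (f : ∀ n, V n →ₗ[k] V' n) : Prop :=
  G'.cup ∘ₗ DirectSum.lmap f =
      TensorProduct.map (DirectSum.lmap f) (DirectSum.lmap f) ∘ₗ G.cup ∧
    G'.counit ∘ₗ DirectSum.lmap f = G.counit ∧
    G'.cobracket ∘ₗ DirectSum.lmap f =
      TensorProduct.map (DirectSum.lmap f) (DirectSum.lmap f) ∘ₗ G.cobracket

/-! ### Complexes and their homology -/

variable {k V}
variable (d : ∀ n, V (n + 1) →ₗ[k] V n)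

/-- The `n`-cycles; the differential on `V 0` is zero. -/
def gradedCycles : ∀ n, Submodule k (V n)
  | 0 => ⊤
  | n + 1 => LinearMap.ker (d n)

/-- The homology `ker d / im d` in degree `n`. -/
abbrev gradedHomology (n : ℕ) : Type v :=
  gradedCycles d n ⧸ (LinearMap.range (d n)).submoduleOf (gradedCycles d n)

/-- The class of a cycle. -/
abbrev homologyClass (n : ℕ) : gradedCycles d n →ₗ[k] gradedHomology d n :=
  ((LinearMap.range (d n)).submoduleOf (gradedCycles d n)).mkQ

/-- The differential on the total module. -/
def totalDiff : (⨁ n, V n) →ₗ[k] ⨁ n, V n :=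
  DirectSum.toModule k ℕ _ fun n =>
    match n with
    | 0 => 0
    | n + 1 => DirectSum.lof k ℕ V n ∘ₗ d n

variable (k V) in
/-- The parity operator `x ↦ (-1) ^ |x| x`. -/
def parity : (⨁ n, V n) →ₗ[k] ⨁ n, V n :=
  DirectSum.lmap fun n => (-1 : k) ^ n • (LinearMap.id : V n →ₗ[k] V n)

/-- The differential of `V ⊗ V`: `a ⊗ b ↦ d a ⊗ b + (-1) ^ |a| a ⊗ d b`. -/
def tensorDiff : (⨁ n, V n) ⊗[k] (⨁ n, V n) →ₗ[k] (⨁ n, V n) ⊗[k] (⨁ n, V n) :=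
  TensorProduct.map (totalDiff d) LinearMap.id + TensorProduct.map (parity k V) (totalDiff d)

/-- The differential of `V[1] ⊗ V[1]`, with the degrees of `V`:
`a ⊗ b ↦ d a ⊗ b + (-1) ^ (|a| - 1) a ⊗ d b`. -/
def suspendedTensorDiff : (⨁ n, V n) ⊗[k] (⨁ n, V n) →ₗ[k] (⨁ n, V n) ⊗[k] (⨁ n, V n) :=
  TensorProduct.map (totalDiff d) LinearMap.id - TensorProduct.map (parity k V) (totalDiff d)

/-- The differential of `V[1] ⊗ V ⊗ V`, with the degrees of `V`:
`a ⊗ b ⊗ c ↦ d a ⊗ b ⊗ c + (-1) ^ (|a| - 1) a ⊗ d b ⊗ c + (-1) ^ (|a| + |b| - 1) a ⊗ b ⊗ d c`. -/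
def suspendedTripleDiff :
    ((⨁ n, V n) ⊗[k] (⨁ n, V n)) ⊗[k] (⨁ n, V n) →ₗ[k]
      ((⨁ n, V n) ⊗[k] (⨁ n, V n)) ⊗[k] (⨁ n, V n) :=
  TensorProduct.map (suspendedTensorDiff d) LinearMap.id -
    TensorProduct.map (TensorProduct.map (parity k V) (parity k V)) (totalDiff d)

/-- `t ∈ H ⊗ H` is mapped by the Künneth map `[x] ⊗ [y] ↦ [x ⊗ y]` to the class of `c`,
in the homology of `V ⊗ V` with respect to the differential `D`. -/
def KunnethRepresents
    (D : (⨁ n, V n) ⊗[k] (⨁ n, V n) →ₗ[k] (⨁ n, V n) ⊗[k] (⨁ n, V n))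
    (t : (⨁ n, gradedHomology d n) ⊗[k] (⨁ n, gradedHomology d n))
    (c : (⨁ n, V n) ⊗[k] (⨁ n, V n)) : Prop :=
  ∃ s : (⨁ n, gradedCycles d n) ⊗[k] (⨁ n, gradedCycles d n),
    TensorProduct.map (DirectSum.lmap (homologyClass d)) (DirectSum.lmap (homologyClass d)) s = t ∧
    c - TensorProduct.map (DirectSum.lmap fun n => (gradedCycles d n).subtype)
        (DirectSum.lmap fun n => (gradedCycles d n).subtype) s ∈ LinearMap.range D

/-- The Gerstenhaber coalgebra structure `G` on homology is induced by the given chain level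
operations: on the class of a cycle `z`, the operations of `G` are the classes of the chain level
operations on `z`. -/
def GerstenhaberCoalgebra.IsInducedBy
    (G : GerstenhaberCoalgebra k (gradedHomology d))
    (cup cobracket : (⨁ n, V n) →ₗ[k] (⨁ n, V n) ⊗[k] (⨁ n, V n))
    (counit : (⨁ n, V n) →ₗ[k] k) : Prop :=
  ∀ (n : ℕ) (z : gradedCycles d n),
    KunnethRepresents d (tensorDiff d)
      (G.cup (DirectSum.lof k ℕ (gradedHomology d) n (homologyClass d n z)))
      (cup (DirectSum.lof k ℕ V n z)) ∧
    KunnethRepresents d (suspendedTensorDiff d)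
      (G.cobracket (DirectSum.lof k ℕ (gradedHomology d) n (homologyClass d n z)))
      (cobracket (DirectSum.lof k ℕ V n z)) ∧
    G.counit (DirectSum.lof k ℕ (gradedHomology d) n (homologyClass d n z)) =
      counit (DirectSum.lof k ℕ V n z)

/-- Chain level operations on a complex that satisfy the axioms of a Gerstenhaber coalgebra on
homology, where the identities are read in the homology of the tensor powers of the complex:
the operations are chain maps, and the identities hold on cycles up to boundaries
(some of them hold on all chains). -/
structure IsGerstenhaberOnHomology
    (cup cobracket : (⨁ n, V n) →ₗ[k] (⨁ n, V n) ⊗[k] (⨁ n, V n))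
    (counit : (⨁ n, V n) →ₗ[k] k) : Prop where
  d_comp_d : totalDiff d ∘ₗ totalDiff d = 0
  cup_mem : ∀ (n : ℕ) (x : V n), cup (DirectSum.lof k ℕ V n x) ∈ tensorDegree k V n
  counit_eq_zero : ∀ (n : ℕ) (x : V n), n ≠ 0 → counit (DirectSum.lof k ℕ V n x) = 0
  cobracket_mem :
    ∀ (n : ℕ) (x : V n), cobracket (DirectSum.lof k ℕ V n x) ∈ tensorDegree k V (n + 1)
  cup_comp_d : cup ∘ₗ totalDiff d = tensorDiff d ∘ₗ cup
  cobracket_comp_d : cobracket ∘ₗ totalDiff d = suspendedTensorDiff d ∘ₗ cobracket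
  counit_comp_d : counit ∘ₗ totalDiff d = 0
  coassoc : LinearMap.rTensor _ cup ∘ₗ cup = idTensor cup ∘ₗ cup
  counit_left :
    (TensorProduct.lid k _).toLinearMap ∘ₗ LinearMap.rTensor _ counit ∘ₗ cup = LinearMap.id
  counit_right :
    (TensorProduct.rid k _).toLinearMap ∘ₗ LinearMap.lTensor _ counit ∘ₗ cup = LinearMap.id
  cocomm : ∀ z, totalDiff d z = 0 →
    gradedFlip k V (cup z) - cup z ∈ LinearMap.range (tensorDiff d)
  coantisymm :
    LinearMap.range cobracket ≤ LinearMap.range (LinearMap.id - suspendedFlip k V)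
  coJacobi : coJacobiator k V cobracket = 0
  coLeibniz : ∀ z, totalDiff d z = 0 →
    coLeibnizDefect k V cup cobracket z ∈ LinearMap.range (suspendedTripleDiff d)

end Graded

/-! ## Cooperads with comultiplication -/

section Cooperads

/-- A planar counital cooperad, by partial decompositions
`Δ_{p,q,i} : C (p + q - 1) → C p ⊗ C q` for `1 ≤ i ≤ p` (and zero for all other `i`).
The source is written as `C n` with a proof of `p + q = n + 1`. The three coassociativity relations
are those for `i ≤ j - q`, for `j - q < i ≤ j`, and for `j < i ≤ p`. -/
structure Cooperad (k : Type u) [CommRing k]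
    (C : ℕ → Type v) [∀ n, AddCommGroup (C n)] [∀ n, Module k (C n)] where
  counit : C 1 →ₗ[k] k
  decomp : ∀ {n : ℕ} (p q i : ℕ), p + q = n + 1 → (C n →ₗ[k] C p ⊗[k] C q)
  decomp_eq_zero : ∀ {n : ℕ} (p q i : ℕ) (h : p + q = n + 1),
    ¬(1 ≤ i ∧ i ≤ p) → decomp p q i h = 0
  counit_left : ∀ n : ℕ,
    (TensorProduct.lid k (C n)).toLinearMap ∘ₗ LinearMap.rTensor (C n) counit ∘ₗ
      decomp 1 n 1 (Nat.add_comm 1 n) = LinearMap.id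
  counit_right : ∀ n i : ℕ, 1 ≤ i → i ≤ n →
    (TensorProduct.rid k (C n)).toLinearMap ∘ₗ LinearMap.lTensor (C n) counit ∘ₗ
      decomp n 1 i rfl = LinearMap.id
  coassoc_before : ∀ (p q r i j m l n : ℕ) (h₁ : p + q = m + 1) (h₂ : m + r = n + 1)
    (h₃ : p + r = l + 1) (h₄ : l + q = n + 1), 1 ≤ i → i ≤ p → 1 ≤ j → j ≤ m → i + q ≤ j →
    LinearMap.rTensor (C r) (decomp p q i h₁) ∘ₗ decomp m r j h₂ =
      (TensorProduct.rightComm k (C p) (C r) (C q)).toLinearMap ∘ₗ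
        LinearMap.rTensor (C q) (decomp p r (j + 1 - q) h₃) ∘ₗ decomp l q i h₄
  coassoc_inside : ∀ (p q r i j m l n : ℕ) (h₁ : p + q = m + 1) (h₂ : m + r = n + 1)
    (h₃ : q + r = l + 1) (h₄ : p + l = n + 1), 1 ≤ i → i ≤ p → 1 ≤ j → j ≤ m →
    j < i + q → i ≤ j →
    LinearMap.rTensor (C r) (decomp p q i h₁) ∘ₗ decomp m r j h₂ =
      (TensorProduct.assoc k (C p) (C q) (C r)).symm.toLinearMap ∘ₗ
        LinearMap.lTensor (C p) (decomp q r (j + 1 - i) h₃) ∘ₗ decomp p l i h₄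
  coassoc_after : ∀ (p q r i j m l n : ℕ) (h₁ : p + q = m + 1) (h₂ : m + r = n + 1)
    (h₃ : p + r = l + 1) (h₄ : l + q = n + 1), 1 ≤ i → i ≤ p → 1 ≤ j → j ≤ m → j < i →
    LinearMap.rTensor (C r) (decomp p q i h₁) ∘ₗ decomp m r j h₂ =
      (TensorProduct.rightComm k (C p) (C r) (C q)).toLinearMap ∘ₗ
        LinearMap.rTensor (C q) (decomp p r j h₃) ∘ₗ decomp l q (i + r - 1) h₄

/-- A morphism of counital cooperads. -/
structure Cooperad.Hom {k : Type u} [CommRing k]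
    {C : ℕ → Type v} [∀ n, AddCommGroup (C n)] [∀ n, Module k (C n)]
    {C' : ℕ → Type w} [∀ n, AddCommGroup (C' n)] [∀ n, Module k (C' n)]
    (X : Cooperad k C) (Y : Cooperad k C') where
  map : ∀ n, C n →ₗ[k] C' n
  counit_map : Y.counit ∘ₗ map 1 = X.counit
  decomp_map : ∀ {n : ℕ} (p q i : ℕ) (h : p + q = n + 1), 1 ≤ i → i ≤ p →
    Y.decomp p q i h ∘ₗ map n = TensorProduct.map (map p) (map q) ∘ₗ X.decomp p q i h

/-- The cooperad `Ass^*` dual to the unital associative operad. Since `Ass n` is free on one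
generator `ν_n` with `ν_p ∘_i ν_q = ν_{p + q - 1}` and unit `ν_1`, evaluation at `ν_n` identifies
`Ass^* n` with `k`, every `Δ_{p,q,i}` with `1 ↦ 1 ⊗ 1`, and the counit with the identity. -/
def assDual (k : Type u) [CommRing k] : Cooperad k (fun _ => k) where
  counit := LinearMap.id
  decomp p _ i _ := if 1 ≤ i ∧ i ≤ p then (TensorProduct.lid k k).symm.toLinearMap else 0
  decomp_eq_zero _ _ _ _ hi := if_neg hi
  counit_left n := by ext; simp
  counit_right n i h1 h2 := by ext; simp [h1, h2]
  coassoc_before p q r i j m l n h₁ h₂ h₃ h₄ a b c e f := by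
    rw [if_pos ⟨a, b⟩, if_pos ⟨c, e⟩, if_pos (by omega), if_pos (by omega)]
    ext; simp
  coassoc_inside p q r i j m l n h₁ h₂ h₃ h₄ a b c e f g := by
    have hq : 1 ≤ j + 1 - i ∧ j + 1 - i ≤ q := by omega
    simp only [a, b, c, e, hq, and_self, if_true]
    ext; simp
  coassoc_after p q r i j m l n h₁ h₂ h₃ h₄ a b c e f := by
    rw [if_pos ⟨a, b⟩, if_pos ⟨c, e⟩, if_pos (by omega), if_pos (by omega)]
    ext; simp

/-- A cooperad with comultiplication: a counital cooperad with a morphism to `Ass^*`. -/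
structure ComultiplicativeCooperad (k : Type u) [CommRing k]
    (C : ℕ → Type v) [∀ n, AddCommGroup (C n)] [∀ n, Module k (C n)] extends Cooperad k C where
  psi : Cooperad.Hom toCooperad (assDual k)

namespace ComultiplicativeCooperad

variable {k : Type u} [CommRing k]
variable {C : ℕ → Type v} [∀ n, AddCommGroup (C n)] [∀ n, Module k (C n)]
variable (X : ComultiplicativeCooperad k C)

/-- The distinguished element `μ^c` of `(C 2)^*`. -/
def mu : C 2 →ₗ[k] k := X.psi.map 2

/-- The distinguished element `e^c` of `(C 0)^*`. -/
def e : C 0 →ₗ[k] k := X.psi.map 0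

/-- The faces `d_i : C (n + 1) → C n`, `0 ≤ i ≤ n + 1`: `d_0 = (μ^c ⊗ id) Δ_{2,n,2}`,
`d_i = (id ⊗ μ^c) Δ_{n,2,i}` for `1 ≤ i ≤ n`, and `d_{n+1} = (μ^c ⊗ id) Δ_{2,n,1}`. -/
def face (n i : ℕ) : C (n + 1) →ₗ[k] C n :=
  if i = 0 then
    (TensorProduct.lid k (C n)).toLinearMap ∘ₗ LinearMap.rTensor (C n) X.mu ∘ₗ
      X.decomp 2 n 2 (by omega)
  else if i = n + 1 then
    (TensorProduct.lid k (C n)).toLinearMap ∘ₗ LinearMap.rTensor (C n) X.mu ∘ₗ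
      X.decomp 2 n 1 (by omega)
  else
    (TensorProduct.rid k (C n)).toLinearMap ∘ₗ LinearMap.lTensor (C n) X.mu ∘ₗ
      X.decomp n 2 i (by omega)

/-- The differential induced by the comultiplication. -/
def diff (n : ℕ) : C (n + 1) →ₗ[k] C n :=
  ∑ i ∈ Finset.range (n + 2), (-1 : k) ^ i • X.face n i

/-- The cup coproduct: on `C n`, the sum over `a + b = n` of
`(μ^c ⊗ id ⊗ id) (Δ_{2,a,1} ⊗ id) Δ_{a+1,b,a+1}`. -/
def cup : (⨁ n, C n) →ₗ[k] (⨁ n, C n) ⊗[k] (⨁ n, C n) :=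
  DirectSum.toModule k ℕ _ fun n =>
    ∑ x ∈ (Finset.HasAntidiagonal.antidiagonal n).attach,
      TensorProduct.map (DirectSum.lof k ℕ C x.1.1) (DirectSum.lof k ℕ C x.1.2) ∘ₗ
        LinearMap.rTensor (C x.1.2)
          ((TensorProduct.lid k (C x.1.1)).toLinearMap ∘ₗ LinearMap.rTensor (C x.1.1) X.mu ∘ₗ
            X.decomp 2 x.1.1 1 (by omega)) ∘ₗ
        X.decomp (x.1.1 + 1) x.1.2 (x.1.1 + 1)
          (by have := Finset.HasAntidiagonal.mem_antidiagonal.1 x.2; omega)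

/-- The cobrace: on `C n`, the sum over `p + q = n + 1` and `1 ≤ i ≤ p` of
`(-1) ^ ((q - 1) (p - i)) Δ_{p,q,i}` (`q - 1` and `q + 1` have the same parity). -/
def cobrace : (⨁ n, C n) →ₗ[k] (⨁ n, C n) ⊗[k] (⨁ n, C n) :=
  DirectSum.toModule k ℕ _ fun n =>
    ∑ x ∈ (Finset.HasAntidiagonal.antidiagonal (n + 1)).attach, ∑ i ∈ Finset.Icc 1 x.1.1,
      (-1 : k) ^ ((x.1.2 + 1) * (x.1.1 - i)) •
        (TensorProduct.map (DirectSum.lof k ℕ C x.1.1) (DirectSum.lof k ℕ C x.1.2) ∘ₗ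
          X.decomp x.1.1 x.1.2 i (Finset.HasAntidiagonal.mem_antidiagonal.1 x.2))

/-- The cobracket `{-} = (id - ρ) ∘ [-]`. -/
def cobracket : (⨁ n, C n) →ₗ[k] (⨁ n, C n) ⊗[k] (⨁ n, C n) :=
  (LinearMap.id - suspendedFlip k C) ∘ₗ X.cobrace

/-- The counit of the cup coproduct: `e^c` on `C 0`, and zero in positive degrees. -/
def cupCounit : (⨁ n, C n) →ₗ[k] k :=
  X.e ∘ₗ DirectSum.component k ℕ C 0

end ComultiplicativeCooperad

end Cooperads

/-! ## Bar chains of a bialgebra -/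

section Bar

variable (k : Type u) [CommRing k] (B : Type v) [Ring B] [Bialgebra k B]

/-- The bar chains `C_n(B) = B^{⊗ n}`. -/
abbrev BarChain (n : ℕ) : Type (max u v) := ⨂[k]^n B

/-- The multiplication `μ_n : B^{⊗ n} → B` in `n` elements; `μ_0` is the unit. -/
def barMul (n : ℕ) : BarChain k B n →ₗ[k] B :=
  PiTensorProduct.lift (MultilinearMap.mkPiAlgebraFin k n B)

/-- The algebra map `B → B ⊗ B^{⊗ q}`, `x ↦ x⁽¹⁾ ⊗ (1, …, x⁽²⁾, …, 1)` with `x⁽²⁾` in slot `i`. -/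
def barSlot (q : ℕ) (i : Fin q) : B →ₐ[k] B ⊗[k] BarChain k B q :=
  (Algebra.TensorProduct.map (AlgHom.id k B)
    (PiTensorProduct.singleAlgHom (R := k) (A := fun _ : Fin q => B) i)).comp
      (Bialgebra.comulAlgHom k B)

/-- The codiagonal coaction
`(x_1, …, x_q) ↦ x_1⁽¹⁾ ⋯ x_q⁽¹⁾ ⊗ (x_1⁽²⁾, …, x_q⁽²⁾)`, obtained as the product, in this order, of
the elements `x_i⁽¹⁾ ⊗ (1, …, x_i⁽²⁾, …, 1)` in the algebra `B ⊗ B^{⊗ q}`. -/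
def barCoaction (q : ℕ) : BarChain k B q →ₗ[k] B ⊗[k] BarChain k B q :=
  PiTensorProduct.lift
    ((MultilinearMap.mkPiAlgebraFin k q (B ⊗[k] BarChain k B q)).compLinearMap
      fun i => (barSlot k B q i).toLinearMap)

/-- The concatenation `B^{⊗ a} ⊗ (B ⊗ B^{⊗ b}) → B^{⊗ (a + (1 + b))}`. -/
def barInsert (a b : ℕ) :
    BarChain k B a ⊗[k] (B ⊗[k] BarChain k B b) →ₗ[k] BarChain k B (a + (1 + b)) :=
  TensorPower.mulEquiv.toLinearMap ∘ₗ
    LinearMap.lTensor _ (TensorPower.mulEquiv.toLinearMap ∘ₗ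
      LinearMap.rTensor _ (PiTensorProduct.subsingletonEquiv (R := k) (s := fun _ : Fin 1 => B)
        (0 : Fin 1)).symm.toLinearMap)

/-- The partial decomposition `Δ_{p,q,i}` of bar chains,
`(x_1, …, x_{p+q-1}) ↦
  (x_1, …, x_{i-1}, x_i⁽¹⁾ ⋯ x_{i+q-1}⁽¹⁾, x_{i+q}, …, x_{p+q-1}) ⊗ (x_i⁽²⁾, …, x_{i+q-1}⁽²⁾)`:
split `B^{⊗ n}` as `B^{⊗ (i-1)} ⊗ B^{⊗ q} ⊗ B^{⊗ (p-i)}` and apply the codiagonal coaction to the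
middle factor. -/
def barDecomp {n : ℕ} (p q i : ℕ) (h : p + q = n + 1) :
    BarChain k B n →ₗ[k] BarChain k B p ⊗[k] BarChain k B q :=
  if hi : 1 ≤ i ∧ i ≤ p then
    LinearMap.rTensor _ ((TensorPower.cast k B
        (show (i - 1) + (1 + (p - i)) = p by omega)).toLinearMap ∘ₗ barInsert k B (i - 1) (p - i)) ∘ₗ
      (TensorProduct.assoc k _ _ _).symm.toLinearMap ∘ₗ
      LinearMap.lTensor _ ((TensorProduct.rightComm k _ _ _).toLinearMap ∘ₗ
        LinearMap.rTensor _ (barCoaction k B q) ∘ₗ TensorPower.mulEquiv.symm.toLinearMap) ∘ₗ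
      TensorPower.mulEquiv.symm.toLinearMap ∘ₗ
      (TensorPower.cast k B (show n = (i - 1) + (q + (p - i)) by omega)).toLinearMap
  else 0

/-- The maps `ψ_n = ε ∘ μ_n : B^{⊗ n} → k = Ass^* n`. -/
def barPsi (n : ℕ) : BarChain k B n →ₗ[k] k :=
  Coalgebra.counit ∘ₗ barMul k B n

/-- `(x_1, …, x_{n+1}) ↦ x_1 ⊗ (x_2, …, x_{n+1})`. -/
def barHead (n : ℕ) : BarChain k B (n + 1) →ₗ[k] B ⊗[k] BarChain k B n :=
  PiTensorProduct.lift (LinearMap.uncurryLeft (M := fun _ : Fin (n + 1) => B)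
    { toFun := fun b => (TensorProduct.mk k B (BarChain k B n) b).compMultilinearMap
        (PiTensorProduct.tprod k)
      map_add' := fun b b' => by ext; simp
      map_smul' := fun c b => by ext; simp [TensorProduct.smul_tmul'] })

/-- `(x_1, …, x_{n+1}) ↦ (x_1, …, x_n) ⊗ x_{n+1}`. -/
def barLast (n : ℕ) : BarChain k B (n + 1) →ₗ[k] BarChain k B n ⊗[k] B :=
  PiTensorProduct.lift (MultilinearMap.uncurryRight (M := fun _ : Fin (n + 1) => B)
    ((TensorProduct.mk k (BarChain k B n) B).compMultilinearMap (PiTensorProduct.tprod k)))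

variable {B} in
theorem contractNth_update {n : ℕ} (j : Fin n) (x : Fin (n + 1) → B) (i : Fin (n + 1)) (b : B) :
    Fin.contractNth j.castSucc (· * ·) (Function.update x i b) =
      Function.update (Fin.contractNth j.castSucc (· * ·) x) (j.predAbove i)
        (if i = j.castSucc then b * x j.succ else if i = j.succ then x j.castSucc * b else b) := by
  have hp : (j.predAbove i).val = if j.val < i.val then i.val - 1 else i.val := by
    simp only [Fin.predAbove, Fin.lt_def, Fin.val_castSucc]
    split_ifs <;> simp
  funext l
  simp only [Fin.contractNth, Function.update_apply, Fin.ext_iff, Fin.val_castSucc, Fin.val_succ, hp]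
  obtain ⟨j, hj⟩ := j
  obtain ⟨i, hi⟩ := i
  obtain ⟨l, hl⟩ := l
  simp only [Fin.castSucc_mk, Fin.succ_mk]
  split_ifs <;> first | rfl | (exfalso; omega) | (subst_vars; rfl)

/-- `(x_0, …, x_n) ↦ (x_0, …, x_j x_{j+1}, …, x_n)`. -/
def barContract (n : ℕ) (j : Fin n) : BarChain k B (n + 1) →ₗ[k] BarChain k B n :=
  PiTensorProduct.lift
    { toFun := fun x => PiTensorProduct.tprod k (Fin.contractNth j.castSucc (· * ·) x)
      map_update_add' := fun {inst} x i b b' => by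
        obtain rfl : inst = instDecidableEqFin _ := Subsingleton.elim _ _
        simp only [contractNth_update]
        rw [← MultilinearMap.map_update_add]
        split_ifs <;> simp [add_mul, mul_add]
      map_update_smul' := fun {inst} x i c b => by
        obtain rfl : inst = instDecidableEqFin _ := Subsingleton.elim _ _
        simp only [contractNth_update]
        rw [← MultilinearMap.map_update_smul]
        split_ifs <;> simp }

/-- The standard differential `C_{n+1}(B) → C_n(B)`: the alternating sum of
`ε(b_1) (b_2, …, b_{n+1})`, of the `(b_1, …, b_i b_{i+1}, …, b_{n+1})` for `1 ≤ i ≤ n`, and of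
`(b_1, …, b_n) ε(b_{n+1})`. -/
def barDiff (n : ℕ) : BarChain k B (n + 1) →ₗ[k] BarChain k B n :=
  (TensorProduct.lid k _).toLinearMap ∘ₗ
      LinearMap.rTensor (BarChain k B n) (Coalgebra.counit (R := k) (A := B)) ∘ₗ barHead k B n +
    ∑ j : Fin n, (-1 : k) ^ (j.val + 1) • barContract k B n j +
    (-1 : k) ^ (n + 1) • ((TensorProduct.rid k _).toLinearMap ∘ₗ
      LinearMap.lTensor (BarChain k B n) (Coalgebra.counit (R := k) (A := B)) ∘ₗ barLast k B n)

/-- Hopf algebra homology `H_n(B, k)` with trivial coefficients. -/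
abbrev HopfHomology (n : ℕ) : Type (max u v) := gradedHomology (barDiff k B) n

/-- The differential `B ⊗ B^{⊗ (n+1)} → B ⊗ B^{⊗ n}` of the bar resolution: the alternating sum of
`b b_1 ⊗ (b_2, …, b_{n+1})`, of the `b ⊗ (b_1, …, b_i b_{i+1}, …, b_{n+1})` for `1 ≤ i ≤ n`, and of
`b ⊗ (b_1, …, b_n) ε(b_{n+1})`. -/
def barResDiff (n : ℕ) : B ⊗[k] BarChain k B (n + 1) →ₗ[k] B ⊗[k] BarChain k B n :=
  LinearMap.rTensor _ (LinearMap.mul' k B) ∘ₗ (TensorProduct.assoc k B B _).symm.toLinearMap ∘ₗ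
      LinearMap.lTensor B (barHead k B n) +
    LinearMap.lTensor B (∑ j : Fin n, (-1 : k) ^ (j.val + 1) • barContract k B n j +
      (-1 : k) ^ (n + 1) • ((TensorProduct.rid k _).toLinearMap ∘ₗ
        LinearMap.lTensor (BarChain k B n) (Coalgebra.counit (R := k) (A := B)) ∘ₗ barLast k B n))

end Bar

/-! ## Torsion groups over a bialgebra -/

section Tor

open CategoryTheory

variable (k : Type u) [CommRing k] (B : Type u) [Ring B] [Bialgebra k B]

/-- The relations `c ε(b) ⊗ m = c ⊗ b m` defining `k ⊗_B M` as a quotient of `k ⊗_k M`, where `B`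
acts on `k` through the counit. -/
def trivTensorRel (M : Type w) [AddCommGroup M] [Module k M] [Module B M] :
    Submodule k (k ⊗[k] M) :=
  Submodule.span k {t | ∃ (c : k) (b : B) (m : M),
    t = (c * Coalgebra.counit (R := k) b) ⊗ₜ[k] m - c ⊗ₜ[k] (b • m)}

/-- The tensor product `k ⊗_B M`. -/
abbrev TrivTensor (M : Type w) [AddCommGroup M] [Module k M] [Module B M] : Type (max u w) :=
  (k ⊗[k] M) ⧸ trivTensorRel k B M

/-- `id ⊗_B f : k ⊗_B M → k ⊗_B N`. -/
def trivTensorMap {M N : Type w} [AddCommGroup M] [Module k M] [Module B M] [IsScalarTower k B M]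
    [AddCommGroup N] [Module k N] [Module B N] [IsScalarTower k B N] (f : M →ₗ[B] N) :
    TrivTensor k B M →ₗ[k] TrivTensor k B N :=
  Submodule.mapQ _ _ (LinearMap.lTensor k (f.restrictScalars k)) (by
    rw [trivTensorRel, Submodule.span_le]
    rintro _ ⟨c, b, m, rfl⟩
    refine Submodule.subset_span ⟨c, b, f m, ?_⟩
    simp)

variable {B} in
/-- A `B`-module as a `k`-module. -/
@[reducible]
def baseModule (M : ModuleCat.{u} B) : Module k M := Module.compHom M (algebraMap k B)

section

attribute [local instance] baseModule

variable {B} in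
theorem baseModule_isScalarTower (M : ModuleCat.{u} B) : IsScalarTower k B M :=
  IsScalarTower.of_algebraMap_smul fun _ _ => rfl

attribute [local instance] baseModule_isScalarTower

/-- The functor `k ⊗_B -` from left `B`-modules to `k`-modules. -/
def trivTensorFunctor : ModuleCat.{u} B ⥤ ModuleCat.{u} k where
  obj M := ModuleCat.of k (TrivTensor k B M)
  map f := ModuleCat.ofHom (trivTensorMap k B f.hom)
  map_id M := by
    ext : 1
    refine Submodule.linearMap_qext _ ?_
    refine TensorProduct.ext' fun c m => ?_
    simp [trivTensorMap]
  map_comp f g := by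
    ext : 1
    refine Submodule.linearMap_qext _ ?_
    refine TensorProduct.ext' fun c m => ?_
    simp [trivTensorMap]

instance : (trivTensorFunctor k B).Additive where
  map_add {M N f g} := by
    ext : 1
    refine Submodule.linearMap_qext _ ?_
    refine TensorProduct.ext' fun c m => ?_
    change (trivTensorRel k B N).mkQ (c ⊗ₜ[k] (f.hom m + g.hom m)) =
      (trivTensorRel k B N).mkQ (c ⊗ₜ[k] f.hom m) + (trivTensorRel k B N).mkQ (c ⊗ₜ[k] g.hom m)
    rw [TensorProduct.tmul_add, map_add]

variable {B} in
/-- The map `m ↦ 1 ⊗_B m`. -/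
def oneTensor (M : ModuleCat.{u} B) (m : M) : (trivTensorFunctor k B).obj M :=
  (trivTensorRel k B M).mkQ (1 ⊗ₜ[k] m)

end

/-- The ground ring as a `B`-module, through the counit. -/
def trivModule : ModuleCat.{u} B :=
  (ModuleCat.restrictScalars (Bialgebra.counitAlgHom k B : B →+* k)).obj (ModuleCat.of k k)

/-- The `k`-modules `Tor^B_n(k, k)`: the left derived functors of `k ⊗_B -` at `k`. -/
abbrev bialgebraTor (n : ℕ) : ModuleCat.{u} k :=
  ((trivTensorFunctor k B).leftDerived n).obj (trivModule k B)

/-- `f` is a comparison map from the bar resolution `B ⊗ B^{⊗ n}` of `k` to the projective resolution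
`P` of `k`: a chain map of `B`-modules over the identity of `k`. The augmentation of the bar
resolution is `b ⊗ c ↦ ε(b) c` for `c ∈ B^{⊗ 0} = k`. -/
def IsBarComparison (P : ProjectiveResolution (trivModule k B))
    (f : ∀ n, B ⊗[k] BarChain k B n →ₗ[B] P.complex.X n) : Prop :=
  (∀ (n : ℕ) (t : B ⊗[k] BarChain k B (n + 1)),
    f n (barResDiff k B n t) = (P.complex.d (n + 1) n).hom (f (n + 1) t)) ∧
  ∀ (b : B) (c : BarChain k B 0),
    (show k from (P.π.f 0 ≫ (HomologicalComplex.singleObjXSelf (ComplexShape.down ℕ) 0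
      (trivModule k B)).hom).hom (f 0 (b ⊗ₜ[k] c))) =
      Coalgebra.counit (R := k) b * TensorPower.algebraMap₀.symm c

/-- `e` is the canonical identification of `H_n(B, k)` with `Tor^B_n(k, k)` given by the bar
resolution: for every projective resolution `P` of `k` and every comparison map `f` from the bar
resolution to `P`, it sends the class of a cycle `z` to the class of the cycle `1 ⊗_B f (1 ⊗ z)` of
the complex `k ⊗_B P`. -/
def IsBarTorIso (e : ∀ n, HopfHomology k B n ≃ₗ[k] bialgebraTor k B n) : Prop :=
  ∀ (P : ProjectiveResolution (trivModule k B))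
    (f : ∀ n, B ⊗[k] BarChain k B n →ₗ[B] P.complex.X n), IsBarComparison k B P f →
    ∀ (n : ℕ) (z : gradedCycles (barDiff k B) n)
      (y : (((trivTensorFunctor k B).mapHomologicalComplex
        (ComplexShape.down ℕ)).obj P.complex).cycles n),
      ((((trivTensorFunctor k B).mapHomologicalComplex
          (ComplexShape.down ℕ)).obj P.complex).iCycles n).hom y =
        oneTensor k (P.complex.X n) (f n (1 ⊗ₜ[k] z.1)) →
      e n (homologyClass (barDiff k B) n z) =
        (P.isoLeftDerivedObj (trivTensorFunctor k B) n).inv.hom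
          (((((trivTensorFunctor k B).mapHomologicalComplex
            (ComplexShape.down ℕ)).obj P.complex).homologyπ n).hom y)

end Tor

end

/-! All chain operations are expressed through one family of maps: `Cooperad.block a q b` extracts
`q` consecutive inputs, with `a` inputs before and `b` inputs after them, and leaves one collapsed
input in their place. The cooperad axioms become two relations, one for disjoint blocks
(`block_before`) and one for nested blocks (`block_inside`). A face is a block extraction followed
by evaluation of `ψ_2` on one of the two factors. Hence the simplicial identities and the rules for
exchanging faces and blocks follow from these two relations and from `ψ` being a morphism to
`Ass^*`.

The cobrace is the signed sum of all blocks. In its boundary, the faces that merge the collapsed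
input with a neighbour cancel against the outer faces of the extracted block, and the cup coproduct
and its flip survive (`suspendedTensorDiff_cobrace`). This gives cocommutativity on cycles. The
surviving term is fixed by `ρ`, so `(id - ρ)` kills it and the cobracket is a chain map. When the
cobrace is iterated, the second block precedes the collapsed input, follows it, or contains it. This
trichotomy is the dual pre-Lie relation (`rTensor_cobrace_cobrace_lof`), and its antisymmetrization
is coJacobi (`coJacobiator_eq_zero`). For coLeibniz, the flipped cobrace is a strict coderivation,
since a cut of the remaining inputs passes on one side of the collapsed input
(`idTensor_cup_suspendedFlip_cobrace`). The cobrace itself is a coderivation up to the homotopy that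
extracts two disjoint blocks (`suspendedTripleDiff_coLeibnizHomotopy`). All of this holds for any
cooperad with comultiplication (`isGerstenhaberOnHomology`).

The bar chains together form the tensor algebra of `B`, and the coproduct of `B` extends to an
algebra map from it to its tensor product with `B`. On a product of three words the partial
decomposition is `U V T ↦ U v⁽¹⁾ T ⊗ v⁽²⁾` (`barTotalDecomp_mul`). The cooperad axioms therefore
reduce to coassociativity and counitality of this coaction. These are equalities of algebra maps and
are checked on letters.

If the chains and the homology are projective, the boundaries split off inductively and the complex
retracts onto its homology (`nonempty_homologyRetract`). The operations on homology are the chain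
operations between inclusion and projection. The projection kills boundaries, so identities up to
boundaries become strict. The idempotent between two successive operations may be dropped, because
the first operation produces a cycle and the second, once projected, kills boundaries
(`map_proj_left`, `map_proj_right`). The same projection recovers a class from any Künneth
representative, which gives uniqueness.

For the torsion groups, `b ⊗ x ↦ 1 ⊗ (b, x)` contracts the bar resolution, which consists of
projective `B`-modules when `B` is projective over `k`, and `k ⊗_B -` turns it into the bar complex.
Naturality of left derived functors in the chosen resolution makes the identification independent of
the comparison map (`exists_isBarTorIso`). The coalgebra structure is then transported along it. -/

noncomputable section

/-! ### Extraction of blocks of inputs in a cooperad -/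

namespace Cooperad

variable {k : Type u} [CommRing k]
variable {C : ℕ → Type v} [∀ n, AddCommGroup (C n)] [∀ n, Module k (C n)]
variable (X : Cooperad k C)

/-- The inclusion of `C p ⊗ C q` into the tensor square of the total module. -/
abbrev incl₂ (k : Type u) [CommRing k] (C : ℕ → Type v) [∀ n, AddCommGroup (C n)]
    [∀ n, Module k (C n)] (p q : ℕ) : C p ⊗[k] C q →ₗ[k] (⨁ n, C n) ⊗[k] (⨁ n, C n) :=
  TensorProduct.map (DirectSum.lof k ℕ C p) (DirectSum.lof k ℕ C q)

/-- The partial decomposition `Δ_{p,q,i}` as a map of total modules. -/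
def totalDecomp (n p q i : ℕ) (h : p + q = n + 1) :
    (⨁ n, C n) →ₗ[k] (⨁ n, C n) ⊗[k] (⨁ n, C n) :=
  incl₂ k C p q ∘ₗ X.decomp p q i h ∘ₗ DirectSum.component k ℕ C n

/-- The partial decomposition that extracts a block of `q` inputs, with `a` inputs before it and
`b` inputs after it, as a map of total modules. -/
def block (a q b : ℕ) : (⨁ n, C n) →ₗ[k] (⨁ n, C n) ⊗[k] (⨁ n, C n) :=
  X.totalDecomp (a + q + b) (a + 1 + b) q (a + 1) (by omega)

/-- Both sides are maps of total modules, so the arithmetic identities between degrees are absorbed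
here and no cast between homogeneous components is ever needed. -/
theorem totalDecomp_eq_block {n p q i : ℕ} (h : p + q = n + 1) {a b : ℕ} (hi : i = a + 1)
    (hp : p = a + 1 + b) : X.totalDecomp n p q i h = X.block a q b := by
  subst hi hp
  obtain rfl : n = a + q + b := by omega
  rfl

theorem block_lof (a q b : ℕ) {n : ℕ} (h : a + 1 + b + q = n + 1) (x : C n) :
    X.block a q b (DirectSum.lof k ℕ C n x) =
      incl₂ k C (a + 1 + b) q (X.decomp (a + 1 + b) q (a + 1) h x) := by
  rw [← X.totalDecomp_eq_block h rfl rfl]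
  simp [totalDecomp, DirectSum.component.lof_self]

theorem block_lof_of_ne (a q b : ℕ) {n : ℕ} (h : n ≠ a + q + b) (x : C n) :
    X.block a q b (DirectSum.lof k ℕ C n x) = 0 := by
  simp [block, totalDecomp, DirectSum.component.of, h]

/-- The component of degree `n` onto which the second map projects is the whole left factor, because
`p' = n`. Iterated total decompositions thus compute iterated decompositions of the cooperad. -/
theorem rTensor_totalDecomp {n p q i : ℕ} (h : p + q = n + 1) {n' p' q' i' : ℕ}
    (h' : p' + q' = n' + 1) (hn : p' = n) (x : C n') :
    LinearMap.rTensor _ (X.totalDecomp n p q i h)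
        (X.totalDecomp n' p' q' i' h' (DirectSum.lof k ℕ C n' x)) =
      TensorProduct.map (incl₂ k C p q) (DirectSum.lof k ℕ C q')
        (LinearMap.rTensor _ (X.decomp p q i h) (X.decomp n q' i' (hn ▸ h') x)) := by
  subst hn
  simp only [totalDecomp, LinearMap.coe_comp, Function.comp_apply, DirectSum.component.lof_self]
  induction X.decomp p' q' i' h' x using TensorProduct.induction_on with
  | zero => simp
  | add a b ha hb => simp only [map_add, ha, hb]
  | tmul a b => simp [DirectSum.component.lof_self]

theorem lTensor_totalDecomp {n p q i : ℕ} (h : p + q = n + 1) {n' p' q' i' : ℕ}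
    (h' : p' + q' = n' + 1) (hn : q' = n) (x : C n') :
    LinearMap.lTensor _ (X.totalDecomp n p q i h)
        (X.totalDecomp n' p' q' i' h' (DirectSum.lof k ℕ C n' x)) =
      TensorProduct.map (DirectSum.lof k ℕ C p') (incl₂ k C p q)
        (LinearMap.lTensor _ (X.decomp p q i h) (X.decomp p' n i' (hn ▸ h') x)) := by
  subst hn
  simp only [totalDecomp, LinearMap.coe_comp, Function.comp_apply, DirectSum.component.lof_self]
  induction X.decomp p' q' i' h' x using TensorProduct.induction_on with
  | zero => simp
  | add a b ha hb => simp only [map_add, ha, hb]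
  | tmul a b => simp [DirectSum.component.lof_self]

/-- Disjoint blocks can be extracted in either order. Outside degree `a + q + b + r + c` both sides
vanish, which is why no degree hypothesis appears. The relation `coassoc_after` is this one read
from the other side. -/
theorem block_before (a q b r c : ℕ) (x : ⨁ n, C n) :
    LinearMap.rTensor _ (X.block a q (b + 1 + c)) (X.block (a + q + b) r c x) =
      TensorProduct.rightComm k _ _ _
        (LinearMap.rTensor _ (X.block (a + 1 + b) r c) (X.block a q (b + r + c) x)) := by
  induction x using DirectSum.induction_on with
  | zero => simp
  | add x y hx hy => simp only [map_add, hx, hy]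
  | of n x =>
    change _ = TensorProduct.rightComm k _ _ _ (LinearMap.rTensor _ (X.block (a + 1 + b) r c)
      (X.block a q (b + r + c) (DirectSum.lof k ℕ C n x)))
    change LinearMap.rTensor _ (X.block a q (b + 1 + c))
      (X.block (a + q + b) r c (DirectSum.lof k ℕ C n x)) = _
    by_cases hn : n = a + q + b + r + c
    · have h₁ : a + 1 + (b + 1 + c) + q = a + q + b + 1 + c + 1 := by omega
      have h₂ : a + q + b + 1 + c + r = n + 1 := by omega
      have h₃ : a + 1 + (b + 1 + c) + r = a + 1 + (b + r + c) + 1 := by omega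
      have h₄ : a + 1 + (b + r + c) + q = n + 1 := by omega
      have key := LinearMap.congr_fun (X.coassoc_before (a + 1 + (b + 1 + c)) q r (a + 1)
        (a + q + b + 1) (a + q + b + 1 + c) (a + 1 + (b + r + c)) n h₁ h₂ h₃ h₄ (by omega)
        (by omega) (by omega) (by omega) (by omega)) x
      -- The truncated difference `a + q + b + 1 + 1 - q` is the position of the second block once
      -- the `q` inputs of the first have collapsed to one.
      rw [← X.totalDecomp_eq_block h₁ rfl rfl, ← X.totalDecomp_eq_block h₂ rfl rfl,
        ← X.totalDecomp_eq_block h₄ rfl rfl,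
        ← X.totalDecomp_eq_block (i := a + q + b + 1 + 1 - q) (a := a + 1 + b) (b := c) h₃
          (by omega) (by omega), rTensor_totalDecomp _ _ _ rfl, rTensor_totalDecomp _ _ _ rfl]
      simp only [LinearMap.coe_comp, Function.comp_apply, LinearEquiv.coe_coe] at key
      rw [key]
      generalize LinearMap.rTensor _ (X.decomp (a + 1 + (b + 1 + c)) r (a + q + b + 1 + 1 - q) h₃)
        (X.decomp (a + 1 + (b + r + c)) q (a + 1) h₄ x) = t
      induction t using TensorProduct.induction_on with
      | zero => simp
      | add a b ha hb => simp only [map_add, ha, hb]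
      | tmul s z =>
        induction s using TensorProduct.induction_on with
        | zero => simp
        | add a b ha hb => simp only [TensorProduct.add_tmul, map_add, ha, hb]
        | tmul s y => simp
    · rw [block_lof_of_ne _ _ _ _ (by omega), block_lof_of_ne _ _ _ _ (by omega)]
      simp

/-- Nested blocks: the inner block may be extracted first and then the outer one around its
collapsed input, or the outer block first and the inner one within it. -/
theorem block_inside (a b r c e : ℕ) (x : ⨁ n, C n) :
    LinearMap.rTensor _ (X.block a (b + 1 + c) e) (X.block (a + b) r (c + e) x) =
      (TensorProduct.assoc k _ _ _).symm
        (LinearMap.lTensor _ (X.block b r c) (X.block a (b + r + c) e x)) := by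
  induction x using DirectSum.induction_on with
  | zero => simp
  | add x y hx hy => simp only [map_add, hx, hy]
  | of n x =>
    change LinearMap.rTensor _ (X.block a (b + 1 + c) e)
      (X.block (a + b) r (c + e) (DirectSum.lof k ℕ C n x)) = (TensorProduct.assoc k _ _ _).symm
        (LinearMap.lTensor _ (X.block b r c) (X.block a (b + r + c) e (DirectSum.lof k ℕ C n x)))
    by_cases hn : n = a + b + r + c + e
    · have h₁ : a + 1 + e + (b + 1 + c) = a + b + 1 + (c + e) + 1 := by omega
      have h₂ : a + b + 1 + (c + e) + r = n + 1 := by omega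
      have h₃ : b + 1 + c + r = b + r + c + 1 := by omega
      have h₄ : a + 1 + e + (b + r + c) = n + 1 := by omega
      have key := LinearMap.congr_fun (X.coassoc_inside (a + 1 + e) (b + 1 + c) r (a + 1)
        (a + b + 1) (a + b + 1 + (c + e)) (b + r + c) n h₁ h₂ h₃ h₄ (by omega)
        (by omega) (by omega) (by omega) (by omega) (by omega)) x
      rw [← X.totalDecomp_eq_block h₁ rfl rfl, ← X.totalDecomp_eq_block h₂ rfl rfl,
        ← X.totalDecomp_eq_block h₄ rfl rfl,
        ← X.totalDecomp_eq_block (i := a + b + 1 + 1 - (a + 1)) (a := b) (b := c) h₃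
          (by omega) (by omega), rTensor_totalDecomp _ _ _ rfl, lTensor_totalDecomp _ _ _ rfl]
      simp only [LinearMap.coe_comp, Function.comp_apply, LinearEquiv.coe_coe] at key
      rw [key]
      generalize LinearMap.lTensor _ (X.decomp (b + 1 + c) r (a + b + 1 + 1 - (a + 1)) h₃)
        (X.decomp (a + 1 + e) (b + r + c) (a + 1) h₄ x) = t
      induction t using TensorProduct.induction_on with
      | zero => simp
      | add a b ha hb => simp only [map_add, ha, hb]
      | tmul s z =>
        induction z using TensorProduct.induction_on with
        | zero => simp
        | add a b ha hb => simp only [TensorProduct.tmul_add, map_add, ha, hb]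
        | tmul s y => simp
    · rw [block_lof_of_ne _ _ _ _ (by omega), block_lof_of_ne _ _ _ _ (by omega)]
      simp

end Cooperad

/-! ### Faces as evaluations of the comultiplication on blocks -/

namespace ComultiplicativeCooperad

variable {k : Type u} [CommRing k]
variable {C : ℕ → Type v} [∀ n, AddCommGroup (C n)] [∀ n, Module k (C n)]
variable (X : ComultiplicativeCooperad k C)

/-- The comultiplication `ψ_n` as a functional on the total module. -/
def totalPsi (n : ℕ) : (⨁ n, C n) →ₗ[k] k := X.psi.map n ∘ₗ DirectSum.component k ℕ C n

/-- `f ⊗ id` for a functional `f`. -/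
abbrev evalLeft {W : Type*} {U : Type*} [AddCommGroup W] [Module k W] [AddCommGroup U] [Module k U]
    (f : W →ₗ[k] k) : W ⊗[k] U →ₗ[k] U :=
  (TensorProduct.lid k U).toLinearMap ∘ₗ LinearMap.rTensor U f

/-- `id ⊗ f` for a functional `f`. -/
abbrev evalRight {W : Type*} {U : Type*} [AddCommGroup W] [Module k W] [AddCommGroup U] [Module k U]
    (f : W →ₗ[k] k) : U ⊗[k] W →ₗ[k] U :=
  (TensorProduct.rid k U).toLinearMap ∘ₗ LinearMap.lTensor U f

/-- The `i`-th face on the part of degree `n` of the total module. -/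
def totalFace : ℕ → ℕ → (⨁ n, C n) →ₗ[k] (⨁ n, C n)
  -- There is no face in degree zero; the value `0` makes the formula for the total differential
  -- uniform in the degree.
  | 0, _ => 0
  | n + 1, i => DirectSum.lof k ℕ C n ∘ₗ X.face n i ∘ₗ DirectSum.component k ℕ C (n + 1)

theorem totalFace_lof (n i : ℕ) (x : C (n + 1)) :
    X.totalFace (n + 1) i (DirectSum.lof k ℕ C (n + 1) x) = DirectSum.lof k ℕ C n (X.face n i x) := by
  simp [totalFace, DirectSum.component.lof_self]

theorem totalFace_lof_of_ne {n m : ℕ} (h : m ≠ n) (i : ℕ) (x : C m) :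
    X.totalFace n i (DirectSum.lof k ℕ C m x) = 0 := by
  cases n <;> simp [totalFace, DirectSum.component.of, h]

/-- Two linear maps on the total module agree if they agree on all homogeneous elements. -/
theorem _root_.DirectSum.congr_of_lof {W : Type*} [AddCommGroup W] [Module k W]
    {f g : (⨁ n, C n) →ₗ[k] W}
    (h : ∀ n x, f (DirectSum.lof k ℕ C n x) = g (DirectSum.lof k ℕ C n x)) (x : ⨁ n, C n) :
    f x = g x :=
  LinearMap.congr_fun (DirectSum.linearMap_ext _ fun n => LinearMap.ext (h n)) x

theorem evalLeft_incl₂ (p q : ℕ) (t : C p ⊗[k] C q) :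
    evalLeft (X.totalPsi p) (Cooperad.incl₂ k C p q t) =
      DirectSum.lof k ℕ C q (evalLeft (X.psi.map p) t) := by
  induction t using TensorProduct.induction_on with
  | zero => simp
  | add a b ha hb => simp only [map_add, ha, hb]
  | tmul a b => simp [totalPsi, DirectSum.component.lof_self]

theorem evalRight_incl₂ (p q : ℕ) (t : C p ⊗[k] C q) :
    evalRight (X.totalPsi q) (Cooperad.incl₂ k C p q t) =
      DirectSum.lof k ℕ C p (evalRight (X.psi.map q) t) := by
  induction t using TensorProduct.induction_on with
  | zero => simp
  | add a b ha hb => simp only [map_add, ha, hb]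
  | tmul a b => simp [totalPsi, DirectSum.component.lof_self]

/-- This and the next two lemmas reduce faces to blocks. The outer faces evaluate `ψ_2` on the
binary remainder of a block, and the inner faces evaluate it on an extracted block of two inputs. -/
theorem totalFace_first (n : ℕ) (x : ⨁ n, C n) :
    X.totalFace (n + 1) 0 x = evalLeft (X.totalPsi 2) (X.block 1 n 0 x) := by
  refine DirectSum.congr_of_lof (f := X.totalFace (n + 1) 0)
    (g := evalLeft (X.totalPsi 2) ∘ₗ X.block 1 n 0) (fun m x => ?_) x
  rw [LinearMap.comp_apply]
  by_cases h : m = n + 1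
  · subst h
    rw [totalFace_lof, X.block_lof 1 n 0 (by omega), evalLeft_incl₂]
    rfl
  · rw [totalFace_lof_of_ne _ h, X.block_lof_of_ne _ _ _ (by omega), map_zero]

theorem totalFace_last (n : ℕ) (x : ⨁ n, C n) :
    X.totalFace (n + 1) (n + 1) x = evalLeft (X.totalPsi 2) (X.block 0 n 1 x) := by
  refine DirectSum.congr_of_lof (f := X.totalFace (n + 1) (n + 1))
    (g := evalLeft (X.totalPsi 2) ∘ₗ X.block 0 n 1) (fun m x => ?_) x
  rw [LinearMap.comp_apply]
  by_cases h : m = n + 1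
  · subst h
    rw [totalFace_lof, X.block_lof 0 n 1 (by omega), evalLeft_incl₂]
    simp only [face, Nat.add_eq_zero_iff, one_ne_zero, and_false, if_false, if_true]
    rfl
  · rw [totalFace_lof_of_ne _ h, X.block_lof_of_ne _ _ _ (by omega), map_zero]

theorem totalFace_middle (a b : ℕ) (x : ⨁ n, C n) :
    X.totalFace (a + 2 + b) (a + 1) x = evalRight (X.totalPsi 2) (X.block a 2 b x) := by
  refine DirectSum.congr_of_lof (f := X.totalFace (a + 2 + b) (a + 1))
    (g := evalRight (X.totalPsi 2) ∘ₗ X.block a 2 b) (fun m x => ?_) x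
  rw [LinearMap.comp_apply]
  by_cases h : m = a + 2 + b
  · obtain rfl : m = (a + 1 + b) + 1 := by omega
    have e : a + 2 + b = (a + 1 + b) + 1 := by omega
    rw [e, totalFace_lof, X.block_lof a 2 b (by omega), evalRight_incl₂]
    simp only [face, Nat.add_eq_zero_iff, one_ne_zero, and_false, if_false,
      if_neg (show ¬ a + 1 = a + 1 + b + 1 by omega)]
    rfl
  · rw [totalFace_lof_of_ne _ h, X.block_lof_of_ne _ _ _ (by omega), map_zero]

/-! ### Functionals evaluated on one tensor factor -/

section Naturality

variable {W₁ W₂ W₃ W₄ : Type*} [AddCommGroup W₁] [Module k W₁] [AddCommGroup W₂] [Module k W₂]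
  [AddCommGroup W₃] [Module k W₃] [AddCommGroup W₄] [Module k W₄]

theorem map_evalLeft (φ : W₁ →ₗ[k] k) (f : W₂ →ₗ[k] W₃ ⊗[k] W₄) (t : W₁ ⊗[k] W₂) :
    f (evalLeft φ t) = LinearMap.rTensor _ (evalLeft φ)
      ((TensorProduct.assoc k _ _ _).symm (LinearMap.lTensor _ f t)) := by
  induction t using TensorProduct.induction_on with
  | zero => simp
  | add a b ha hb => simp only [map_add, ha, hb]
  | tmul a b =>
    simp only [LinearMap.comp_apply, LinearMap.rTensor_tmul, LinearMap.lTensor_tmul,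
      LinearEquiv.coe_coe, TensorProduct.lid_tmul, map_smul]
    induction f b using TensorProduct.induction_on with
    | zero => simp
    | add a b ha hb => simp only [smul_add, TensorProduct.tmul_add, map_add, ha, hb]
    | tmul c d => simp [TensorProduct.smul_tmul']

theorem map_evalRight (φ : W₁ →ₗ[k] k) (f : W₂ →ₗ[k] W₃ ⊗[k] W₄) (t : W₂ ⊗[k] W₁) :
    f (evalRight φ t) = evalRight φ (LinearMap.rTensor _ f t) := by
  induction t using TensorProduct.induction_on with
  | zero => simp
  | add a b ha hb => simp only [map_add, ha, hb]
  | tmul a b => simp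

theorem evalRight_rightComm (φ : W₁ →ₗ[k] k) (t : (W₂ ⊗[k] W₁) ⊗[k] W₃) :
    evalRight φ (TensorProduct.rightComm k _ _ _ t) = LinearMap.rTensor _ (evalRight φ) t := by
  induction t using TensorProduct.induction_on with
  | zero => simp
  | add a b ha hb => simp only [map_add, ha, hb]
  | tmul s z =>
    induction s using TensorProduct.induction_on with
    | zero => simp
    | add a b ha hb => simp only [TensorProduct.add_tmul, map_add, ha, hb]
    | tmul x y => simp [TensorProduct.smul_tmul']

theorem evalRight_assoc_symm (φ : W₁ →ₗ[k] k) (t : W₂ ⊗[k] (W₃ ⊗[k] W₁)) :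
    evalRight φ ((TensorProduct.assoc k _ _ _).symm t) = LinearMap.lTensor _ (evalRight φ) t := by
  induction t using TensorProduct.induction_on with
  | zero => simp
  | add a b ha hb => simp only [map_add, ha, hb]
  | tmul s z =>
    induction z using TensorProduct.induction_on with
    | zero => simp
    | add a b ha hb => simp only [TensorProduct.tmul_add, map_add, ha, hb]
    | tmul x y => simp

theorem rTensor_evalRight_assoc_symm (φ : W₁ →ₗ[k] k) (t : W₂ ⊗[k] (W₁ ⊗[k] W₃)) :
    LinearMap.rTensor _ (evalRight φ) ((TensorProduct.assoc k _ _ _).symm t) =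
      LinearMap.lTensor _ (evalLeft φ) t := by
  induction t using TensorProduct.induction_on with
  | zero => simp
  | add a b ha hb => simp only [map_add, ha, hb]
  | tmul s z =>
    induction z using TensorProduct.induction_on with
    | zero => simp
    | add a b ha hb => simp only [TensorProduct.tmul_add, map_add, ha, hb]
    | tmul x y => simp [TensorProduct.smul_tmul']

theorem rightComm_rightComm (t : (W₁ ⊗[k] W₂) ⊗[k] W₃) :
    TensorProduct.rightComm k _ _ _ (TensorProduct.rightComm k _ _ _ t) = t := by
  induction t using TensorProduct.induction_on with
  | zero => simp
  | add a b ha hb => simp only [map_add, ha, hb]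
  | tmul s z =>
    induction s using TensorProduct.induction_on with
    | zero => simp
    | add a b ha hb => simp only [TensorProduct.add_tmul, map_add, ha, hb]
    | tmul x y => simp

theorem rTensor_evalLeft_rightComm (φ : W₁ →ₗ[k] k) (t : (W₁ ⊗[k] W₂) ⊗[k] W₃) :
    LinearMap.rTensor _ (evalLeft φ) (TensorProduct.rightComm k _ _ _ t) =
      TensorProduct.comm k _ _ (LinearMap.rTensor _ (evalLeft φ) t) := by
  induction t using TensorProduct.induction_on with
  | zero => simp
  | add a b ha hb => simp only [map_add, ha, hb]
  | tmul s z =>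
    induction s using TensorProduct.induction_on with
    | zero => simp
    | add a b ha hb => simp only [TensorProduct.add_tmul, map_add, ha, hb]
    | tmul x y => simp [TensorProduct.smul_tmul']

theorem rTensor_rTensor_comp {W₅ : Type*} [AddCommGroup W₅] [Module k W₅]
    (f : W₂ →ₗ[k] W₃) (g : W₁ →ₗ[k] W₂) (t : W₁ ⊗[k] W₅) :
    LinearMap.rTensor W₅ f (LinearMap.rTensor W₅ g t) = LinearMap.rTensor W₅ (f ∘ₗ g) t :=
  (LinearMap.rTensor_comp_apply _ _ _ _).symm

end Naturality

/-! ### Blocks and faces -/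

/-- For `i = 0` the block lies inside the large block of inputs that the face keeps, so the blocks
are nested. For `i > 0` the face merges two inputs disjoint from the block. -/
theorem block_face_before (a q b i : ℕ) (h : i ≤ a) (x : ⨁ n, C n) :
    X.block a q b (X.totalFace (a + q + b + 1) i x) =
      LinearMap.rTensor _ (X.totalFace (a + b + 2) i) (X.block (a + 1) q b x) := by
  cases i with
  | zero =>
    rw [totalFace_first, map_evalLeft]
    have := X.block_inside 1 a q b 0 x
    rw [Nat.add_zero, Nat.add_comm 1 a] at this
    rw [← this, rTensor_rTensor_comp]
    congr 2
    refine LinearMap.ext fun x => ?_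
    rw [show a + b + 2 = (a + 1 + b) + 1 by omega, totalFace_first]
    rfl
  | succ i =>
    obtain ⟨a, rfl⟩ := Nat.exists_eq_add_of_le h
    have := X.block_before i 2 a q b x
    rw [show i + 1 + a + q + b + 1 = i + 2 + (a + q + b) by omega, totalFace_middle, map_evalRight,
      ← rightComm_rightComm (LinearMap.rTensor _ _ (X.block i 2 (a + q + b) x)), ← this,
      evalRight_rightComm, rTensor_rTensor_comp, show i + 2 + a = i + 1 + a + 1 by omega]
    congr 2
    refine LinearMap.ext fun x => ?_
    rw [show i + 1 + a + b + 2 = i + 2 + (a + 1 + b) by omega, totalFace_middle]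
    rfl

/-- The two inputs to be merged form a block nested in the extracted one. -/
theorem block_face_inside (a q b i : ℕ) (h : i < q) (x : ⨁ n, C n) :
    X.block a q b (X.totalFace (a + q + b + 1) (a + 1 + i) x) =
      LinearMap.lTensor _ (X.totalFace (q + 1) (i + 1)) (X.block a (q + 1) b x) := by
  obtain ⟨e, rfl⟩ := Nat.exists_eq_add_of_lt h
  have := X.block_inside a i 2 e b x
  rw [show a + (i + e + 1) + b + 1 = (a + i) + 2 + (e + b) by omega,
    show a + 1 + i = a + i + 1 by omega, totalFace_middle, map_evalRight,
    show i + e + 1 = i + 1 + e by omega, this, evalRight_assoc_symm,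
    ← LinearMap.comp_apply, ← LinearMap.lTensor_comp,
    show i + 1 + e + 1 = i + 2 + e by omega]
  congr 2
  refine LinearMap.ext fun x => ?_
  rw [totalFace_middle]
  rfl

/-- Mirror image of `block_face_before`. Here `j < b` is the case of disjoint blocks, and `j = b` is
the last face, where the blocks are nested. -/
theorem block_face_after (a q b j : ℕ) (h : j ≤ b) (x : ⨁ n, C n) :
    X.block a q b (X.totalFace (a + q + b + 1) (a + q + 1 + j) x) =
      LinearMap.rTensor _ (X.totalFace (a + b + 2) (a + 2 + j)) (X.block a q (b + 1) x) := by
  rcases h.lt_or_eq with h | rfl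
  · obtain ⟨c, rfl⟩ := Nat.exists_eq_add_of_lt h
    have := X.block_before a q j 2 c x
    rw [show a + q + (j + c + 1) + 1 = (a + q + j) + 2 + c by omega,
      show a + q + 1 + j = a + q + j + 1 by omega, totalFace_middle, map_evalRight,
      show j + c + 1 = j + 1 + c by omega, this, evalRight_rightComm, rTensor_rTensor_comp,
      show j + 2 + c = j + 1 + c + 1 by omega]
    congr 2
    refine LinearMap.ext fun x => ?_
    rw [show a + (j + 1 + c) + 2 = (a + 1 + j) + 2 + c by omega,
      show a + 2 + j = a + 1 + j + 1 by omega, totalFace_middle]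
    rfl
  · have := X.block_inside 0 a q j 1 x
    rw [show a + q + 1 + j = a + q + j + 1 by omega, totalFace_last, map_evalLeft, ← this,
      rTensor_rTensor_comp, Nat.zero_add]
    congr 2
    refine LinearMap.ext fun x => ?_
    rw [show a + j + 2 = a + 1 + j + 1 by omega, show a + 2 + j = a + 1 + j + 1 by omega,
      totalFace_last]
    rfl

/-- One can remove the first input of an extracted block, or leave this input out of the block and
afterwards merge it with the collapsed input. Both evaluate `ψ_2` on the middle factor of the same
nested decomposition. This lemma and the next supply the cancelling pairs of the homotopy formulas.
-/
theorem block_lTensor_face_first (a q b : ℕ) (x : ⨁ n, C n) :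
    LinearMap.lTensor _ (X.totalFace (q + 1) 0) (X.block a (q + 1) b x) =
      LinearMap.rTensor _ (X.totalFace (a + b + 2) (a + 1)) (X.block (a + 1) q b x) := by
  have := X.block_inside a 1 q 0 b x
  rw [show a + b + 2 = a + 2 + b by omega]
  rw [show X.totalFace (a + 2 + b) (a + 1) = evalRight (X.totalPsi 2) ∘ₗ X.block a 2 b from
      LinearMap.ext fun x => X.totalFace_middle a b x,
    show X.totalFace (q + 1) 0 = evalLeft (X.totalPsi 2) ∘ₗ X.block 1 q 0 from
      LinearMap.ext fun x => X.totalFace_first q x, LinearMap.rTensor_comp, LinearMap.lTensor_comp,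
    LinearMap.comp_apply, LinearMap.comp_apply, ← rTensor_evalRight_assoc_symm]
  rw [Nat.zero_add, Nat.add_zero, Nat.add_comm 1 q] at this
  rw [← this]

theorem block_lTensor_face_last (a q b : ℕ) (x : ⨁ n, C n) :
    LinearMap.lTensor _ (X.totalFace (q + 1) (q + 1)) (X.block a (q + 1) b x) =
      LinearMap.rTensor _ (X.totalFace (a + b + 2) (a + 1)) (X.block a q (b + 1) x) := by
  have := X.block_inside a 0 q 1 b x
  rw [show a + b + 2 = a + 2 + b by omega]
  rw [show X.totalFace (a + 2 + b) (a + 1) = evalRight (X.totalPsi 2) ∘ₗ X.block a 2 b from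
      LinearMap.ext fun x => X.totalFace_middle a b x,
    show X.totalFace (q + 1) (q + 1) = evalLeft (X.totalPsi 2) ∘ₗ X.block 0 q 1 from
      LinearMap.ext fun x => X.totalFace_last q x, LinearMap.rTensor_comp, LinearMap.lTensor_comp,
    LinearMap.comp_apply, LinearMap.comp_apply, ← rTensor_evalRight_assoc_symm]
  simp only [Nat.zero_add, Nat.add_zero] at this
  rw [← this, Nat.add_comm 1 b]

/-! ### Faces and the comultiplication -/

theorem evalLeft_totalPsi_totalPsi {n p q i : ℕ} (h : p + q = n + 1) (h₁ : 1 ≤ i) (h₂ : i ≤ p)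
    (x : C n) : TensorProduct.lid k k
      (TensorProduct.map (X.psi.map p) (X.psi.map q) (X.decomp p q i h x)) = X.psi.map n x := by
  have := LinearMap.congr_fun (X.psi.decomp_map p q i h h₁ h₂) x
  simp only [LinearMap.comp_apply] at this
  rw [← this]
  simp [assDual, h₁, h₂]

theorem lid_map_totalPsi (a q b : ℕ) (x : ⨁ n, C n) : TensorProduct.lid k k
      (TensorProduct.map (X.totalPsi (a + 1 + b)) (X.totalPsi q) (X.block a q b x)) =
      X.totalPsi (a + q + b) x := by
  refine DirectSum.congr_of_lof (f := (TensorProduct.lid k k).toLinearMap ∘ₗ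
    TensorProduct.map (X.totalPsi (a + 1 + b)) (X.totalPsi q) ∘ₗ X.block a q b)
    (g := X.totalPsi (a + q + b)) (fun m x => ?_) x
  simp only [LinearMap.comp_apply, LinearEquiv.coe_coe]
  by_cases h : m = a + q + b
  · have h' : a + 1 + b + q = m + 1 := by omega
    rw [X.block_lof a q b h', ← LinearMap.comp_apply, ← TensorProduct.map_comp, ← h]
    have e : ∀ n, X.totalPsi n ∘ₗ DirectSum.lof k ℕ C n = X.psi.map n := fun n => by
      ext; simp [totalPsi, DirectSum.component.lof_self]
    rw [e, e, X.evalLeft_totalPsi_totalPsi h' (by omega) (by omega), ← e]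
    rfl
  · rw [X.block_lof_of_ne _ _ _ h]
    simp [totalPsi, DirectSum.component.of, h]

/-- Since `ψ` is a morphism to `Ass^*`, evaluating it on both factors of a decomposition gives `ψ`
again. With `ψ_2` on one factor this says that faces preserve `ψ`, which is the form of
coassociativity of `μ^c` that is used below. -/
theorem totalPsi_totalFace (n i : ℕ) (h : i ≤ n + 1) (x : ⨁ n, C n) :
    X.totalPsi n (X.totalFace (n + 1) i x) = X.totalPsi (n + 1) x := by
  have key : ∀ {p q : ℕ} (t : (⨁ n, C n) ⊗[k] (⨁ n, C n)),
      X.totalPsi q (evalLeft (X.totalPsi p) t) =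
        TensorProduct.lid k k (TensorProduct.map (X.totalPsi p) (X.totalPsi q) t) ∧
      X.totalPsi p (evalRight (X.totalPsi q) t) =
        TensorProduct.lid k k (TensorProduct.map (X.totalPsi p) (X.totalPsi q) t) := fun t => by
    induction t using TensorProduct.induction_on with
    | zero => simp
    | add a b ha hb => simp only [map_add, ha, hb, and_self]
    | tmul a b => simp [mul_comm]
  rcases i with _ | i
  · rw [totalFace_first, (key _).1]
    exact (X.lid_map_totalPsi 1 n 0 x).trans (by congr 2; omega)
  · rcases h.lt_or_eq with h | h
    · obtain ⟨j, rfl⟩ : ∃ j, n = i + 1 + j := ⟨n - (i + 1), by omega⟩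
      rw [show i + 1 + j + 1 = i + 2 + j by omega, totalFace_middle, (key _).2, lid_map_totalPsi]
    · obtain rfl : i = n := by omega
      rw [totalFace_last, (key _).1]
      exact (X.lid_map_totalPsi 0 i 1 x).trans (by congr 2; omega)

theorem evalLeft_rTensor {W U U' : Type*} [AddCommGroup W] [Module k W] [AddCommGroup U]
    [Module k U] [AddCommGroup U'] [Module k U'] (φ : U →ₗ[k] k) (f : U' →ₗ[k] U)
    (t : U' ⊗[k] W) : evalLeft φ (LinearMap.rTensor W f t) = evalLeft (φ ∘ₗ f) t := by
  simp [LinearMap.rTensor_comp]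

theorem evalRight_lTensor {W U U' : Type*} [AddCommGroup W] [Module k W] [AddCommGroup U]
    [Module k U] [AddCommGroup U'] [Module k U'] (φ : U →ₗ[k] k) (f : U' →ₗ[k] U)
    (t : W ⊗[k] U') : evalRight φ (LinearMap.lTensor W f t) = evalRight (φ ∘ₗ f) t := by
  simp [LinearMap.lTensor_comp]

theorem evalLeft_lTensor {W U U' : Type*} [AddCommGroup W] [Module k W] [AddCommGroup U]
    [Module k U] [AddCommGroup U'] [Module k U'] (φ : W →ₗ[k] k) (f : U' →ₗ[k] U)
    (t : W ⊗[k] U') : evalLeft φ (LinearMap.lTensor W f t) = f (evalLeft φ t) := by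
  induction t using TensorProduct.induction_on with
  | zero => simp
  | add a b ha hb => simp only [map_add, ha, hb]
  | tmul a b => simp

theorem evalRight_rTensor {W U U' : Type*} [AddCommGroup W] [Module k W] [AddCommGroup U]
    [Module k U] [AddCommGroup U'] [Module k U'] (φ : W →ₗ[k] k) (f : U' →ₗ[k] U)
    (t : U' ⊗[k] W) : evalRight φ (LinearMap.rTensor W f t) = f (evalRight φ t) := by
  induction t using TensorProduct.induction_on with
  | zero => simp
  | add a b ha hb => simp only [map_add, ha, hb]
  | tmul a b => simp

theorem totalPsi_comp_totalFace (n i : ℕ) (h : i ≤ n + 1) :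
    X.totalPsi n ∘ₗ X.totalFace (n + 1) i = X.totalPsi (n + 1) :=
  LinearMap.ext fun x => X.totalPsi_totalFace n i h x

/-- The simplicial identities. -/
theorem totalFace_totalFace (n i j : ℕ) (hij : i ≤ j) (hj : j ≤ n + 1) (x : ⨁ n, C n) :
    X.totalFace (n + 1) j (X.totalFace (n + 2) i x) =
      X.totalFace (n + 1) i (X.totalFace (n + 2) (j + 1) x) := by
  have left : ∀ (a b i : ℕ), i ≤ 3 → a + b = 1 → ∀ t : (⨁ n, C n) ⊗[k] (⨁ n, C n),
      evalLeft (X.totalPsi 2) (LinearMap.rTensor _ (X.totalFace (a + b + 2) i) t) =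
        evalLeft (X.totalPsi 3) t := fun a b i hi hab t => by
    rw [evalLeft_rTensor, hab, X.totalPsi_comp_totalFace 2 i hi]
  -- If one face acts entirely inside what the other keeps, a commutation rule for blocks suffices.
  -- Otherwise both composites evaluate `ψ_3` on the same factor of one block.
  rcases hj.lt_or_eq with hj | rfl
  · rcases j with _ | a
    · obtain rfl : i = 0 := by omega
      rw [X.totalFace_first n, X.totalFace_first n]
      have h₁ := X.block_face_before 1 n 0 0 (by omega) x
      have h₂ := X.block_face_before 1 n 0 1 (by omega) x
      rw [show 1 + n + 0 + 1 = n + 2 by omega] at h₁ h₂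
      rw [h₁, h₂, left 1 0 _ (by omega) (by omega), left 1 0 _ (by omega) (by omega)]
    · obtain ⟨b, rfl⟩ : ∃ b, n = a + 1 + b := ⟨n - (a + 1), by omega⟩
      rw [show a + 1 + b + 1 = a + 2 + b by omega, show a + 1 + b + 2 = a + 2 + b + 1 by omega,
        totalFace_middle]
      rcases hij.lt_or_eq with hij | rfl
      · rw [X.block_face_before a 2 b i (by omega), evalRight_rTensor,
          show a + 2 + b + 1 = a + 1 + 2 + b by omega, show a + b + 2 = a + 2 + b by omega,
          totalFace_middle]
      · have h₁ := X.block_face_inside a 2 b 0 (by omega) x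
        have h₂ := X.block_face_inside a 2 b 1 (by omega) x
        rw [totalFace_middle]
        rw [Nat.add_zero] at h₁
        rw [h₁, h₂, evalRight_lTensor, evalRight_lTensor,
          X.totalPsi_comp_totalFace 2 _ (by omega), X.totalPsi_comp_totalFace 2 _ (by omega)]
  · rw [X.totalFace_last n]
    rcases i with _ | i
    · rw [X.totalFace_first n]
      have h₁ := X.block_face_before 0 n 1 0 (by omega) x
      have h₂ := X.block_face_after 1 n 0 0 (by omega) x
      rw [show 0 + n + 1 + 1 = n + 2 by omega, Nat.zero_add] at h₁
      rw [show 1 + n + 0 + 1 = n + 2 by omega, Nat.add_zero] at h₂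
      rw [h₁, h₂, evalLeft_rTensor, X.totalPsi_comp_totalFace 2 _ (by omega),
        left 1 0 _ (by omega) (by omega)]
    · rcases hij.lt_or_eq with hij | h
      · have h₁ := X.block_face_inside 0 n 1 i (by omega) x
        rw [show 0 + n + 1 + 1 = n + 2 by omega, Nat.zero_add, Nat.add_comm 1 i] at h₁
        rw [h₁, evalLeft_lTensor, totalFace_last]
      · obtain rfl : i = n := by omega
        rw [totalFace_last]
        have h₁ := X.block_face_after 0 i 1 0 (by omega) x
        have h₂ := X.block_face_after 0 i 1 1 (by omega) x
        rw [show 0 + i + 1 + 1 = i + 2 by omega] at h₁ h₂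
        rw [show 0 + i + 1 + 0 = i + 1 by omega] at h₁
        rw [h₁, h₂, left 0 1 _ (by omega) (by omega), left 0 1 _ (by omega) (by omega)]

/-! ### The components of the cup coproduct -/

/-- The component `C (a + b) → C a ⊗ C b` of the cup coproduct. -/
def cupPart (a b : ℕ) : (⨁ n, C n) →ₗ[k] (⨁ n, C n) ⊗[k] (⨁ n, C n) :=
  LinearMap.rTensor _ (X.totalFace (a + 1) (a + 1)) ∘ₗ X.block a b 0

theorem rTensor_face_last_block (a q : ℕ) (x : ⨁ n, C n) :
    LinearMap.rTensor _ (X.totalFace (a + 1) (a + 1)) (X.block a q 0 x) = X.cupPart a q x := rfl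

/-- Both sides evaluate `ψ_2` on the binary remainder left when two adjacent blocks of `q` and `b`
inputs exhaust all inputs. Only the order of extraction differs, and this order accounts for the
swap of the factors. -/
theorem rTensor_face_first_block (q b : ℕ) (x : ⨁ n, C n) :
    LinearMap.rTensor _ (X.totalFace (b + 1) 0) (X.block 0 q b x) =
      TensorProduct.comm k _ _ (X.cupPart q b x) := by
  have h := X.block_before 0 q 0 b 0 x
  simp only [Nat.add_zero, Nat.zero_add] at h
  rw [cupPart, LinearMap.comp_apply,
    show X.totalFace (b + 1) 0 = evalLeft (X.totalPsi 2) ∘ₗ X.block 1 b 0 from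
      LinearMap.ext fun x => X.totalFace_first b x,
    show X.totalFace (q + 1) (q + 1) = evalLeft (X.totalPsi 2) ∘ₗ X.block 0 q 1 from
      LinearMap.ext fun x => X.totalFace_last q x,
    ← rTensor_rTensor_comp (evalLeft (X.totalPsi 2)) (X.block 1 b 0),
    ← rTensor_rTensor_comp (evalLeft (X.totalPsi 2)) (X.block 0 q 1),
    ← rTensor_evalLeft_rightComm, h, rightComm_rightComm]

/-- The face passes the extracted block unchanged; a simplicial identity then moves it past the last
face in the definition of `cupPart`. -/
theorem cupPart_face_left (a b i : ℕ) (h : i ≤ a) (x : ⨁ n, C n) :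
    X.cupPart a b (X.totalFace (a + b + 1) i x) =
      LinearMap.rTensor _ (X.totalFace (a + 1) i) (X.cupPart (a + 1) b x) := by
  have := X.block_face_before a b 0 i h x
  rw [Nat.add_zero] at this
  rw [cupPart, LinearMap.comp_apply, this, cupPart, LinearMap.comp_apply, rTensor_rTensor_comp,
    rTensor_rTensor_comp]
  congr 2
  exact LinearMap.ext fun x => X.totalFace_totalFace a i (a + 1) (by omega) (by omega) x

theorem lTensor_rTensor_comm {W₁ W₂ U₁ U₂ : Type*} [AddCommGroup W₁] [Module k W₁]
    [AddCommGroup W₂] [Module k W₂] [AddCommGroup U₁] [Module k U₁] [AddCommGroup U₂] [Module k U₂]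
    (f : W₁ →ₗ[k] W₂) (g : U₁ →ₗ[k] U₂) (t : W₁ ⊗[k] U₁) :
    LinearMap.rTensor _ f (LinearMap.lTensor _ g t) =
      LinearMap.lTensor _ g (LinearMap.rTensor _ f t) := by
  rw [← LinearMap.comp_apply, ← LinearMap.comp_apply, LinearMap.rTensor_comp_lTensor,
    LinearMap.lTensor_comp_rTensor]

theorem cupPart_face_right (a b j : ℕ) (h : j ≤ b) (x : ⨁ n, C n) :
    X.cupPart a b (X.totalFace (a + b + 1) (a + 1 + j) x) =
      LinearMap.lTensor _ (X.totalFace (b + 1) (j + 1)) (X.cupPart a (b + 1) x) := by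
  rw [cupPart, LinearMap.comp_apply, cupPart, LinearMap.comp_apply, ← lTensor_rTensor_comm]
  rcases h.lt_or_eq with h | rfl
  · have := X.block_face_inside a b 0 j h x
    rw [Nat.add_zero] at this
    rw [this]
  -- The last face removes an input behind the block. Both sides become two faces applied to `block
  -- a j 1`, and they agree by `d_{a+1} d_{a+1} = d_{a+1} d_{a+2}`.
  · have := X.block_face_after a j 0 0 le_rfl x
    simp only [Nat.add_zero] at this
    rw [show a + 1 + j = a + j + 1 by omega, this, block_lTensor_face_last, rTensor_rTensor_comp, rTensor_rTensor_comp]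
    congr 2
    exact LinearMap.ext fun x =>
      (X.totalFace_totalFace a (a + 1) (a + 1) (by omega) (by omega) x).symm

/-- The first face of the right factor and the last face of the left factor remove the same input,
the one at the cut. These are the two terms of the tensor differential that cancel in
`cup_comp_totalDiff`. -/
theorem cupPart_lTensor_face_first (a b : ℕ) (x : ⨁ n, C n) :
    LinearMap.lTensor _ (X.totalFace (b + 1) 0) (X.cupPart a (b + 1) x) =
      LinearMap.rTensor _ (X.totalFace (a + 1) (a + 1)) (X.cupPart (a + 1) b x) := by
  rw [cupPart, LinearMap.comp_apply, cupPart, LinearMap.comp_apply, ← lTensor_rTensor_comm,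
    block_lTensor_face_first, rTensor_rTensor_comp, rTensor_rTensor_comp]
  congr 2
  exact LinearMap.ext fun x => X.totalFace_totalFace a (a + 1) (a + 1) (by omega) (by omega) x

theorem rTensor_rTensor_rightComm {W U U' W' : Type*} [AddCommGroup W] [Module k W] [AddCommGroup U]
    [Module k U] [AddCommGroup U'] [Module k U'] [AddCommGroup W'] [Module k W']
    (f : U →ₗ[k] U') (t : (U ⊗[k] W) ⊗[k] W') :
    LinearMap.rTensor _ (LinearMap.rTensor _ f) (TensorProduct.rightComm k _ _ _ t) =
      TensorProduct.rightComm k _ _ _ (LinearMap.rTensor _ (LinearMap.rTensor _ f) t) := by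
  induction t using TensorProduct.induction_on with
  | zero => simp
  | add a b ha hb => simp only [map_add, ha, hb]
  | tmul s z =>
    induction s using TensorProduct.induction_on with
    | zero => simp
    | add a b ha hb => simp only [TensorProduct.add_tmul, map_add, ha, hb]
    | tmul x y => simp

theorem rTensor_rTensor_assoc_symm {W U U' W' : Type*} [AddCommGroup W] [Module k W]
    [AddCommGroup U] [Module k U] [AddCommGroup U'] [Module k U'] [AddCommGroup W'] [Module k W']
    (f : U →ₗ[k] U') (t : U ⊗[k] (W ⊗[k] W')) :
    LinearMap.rTensor _ (LinearMap.rTensor _ f) ((TensorProduct.assoc k _ _ _).symm t) =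
      (TensorProduct.assoc k _ _ _).symm (LinearMap.rTensor _ f t) := by
  induction t using TensorProduct.induction_on with
  | zero => simp
  | add a b ha hb => simp only [map_add, ha, hb]
  | tmul s z =>
    induction z using TensorProduct.induction_on with
    | zero => simp
    | add a b ha hb => simp only [TensorProduct.tmul_add, map_add, ha, hb]
    | tmul x y => simp

theorem rTensor_lTensor_assoc_symm {W U U' W' : Type*} [AddCommGroup W] [Module k W]
    [AddCommGroup U] [Module k U] [AddCommGroup U'] [Module k U'] [AddCommGroup W'] [Module k W']
    (f : U →ₗ[k] U') (t : W ⊗[k] (U ⊗[k] W')) :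
    LinearMap.rTensor _ (LinearMap.lTensor _ f) ((TensorProduct.assoc k _ _ _).symm t) =
      (TensorProduct.assoc k _ _ _).symm (LinearMap.lTensor _ (LinearMap.rTensor _ f) t) := by
  induction t using TensorProduct.induction_on with
  | zero => simp
  | add a b ha hb => simp only [map_add, ha, hb]
  | tmul s z =>
    induction z using TensorProduct.induction_on with
    | zero => simp
    | add a b ha hb => simp only [TensorProduct.tmul_add, map_add, ha, hb]
    | tmul x y => simp

theorem block_face_last (a q b : ℕ) (x : ⨁ n, C n) :
    X.block a q b (X.totalFace (a + q + b + 1) (a + q + b + 1) x) =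
      LinearMap.rTensor _ (X.totalFace (a + b + 2) (a + b + 2)) (X.block a q (b + 1) x) := by
  have := X.block_face_after a q b b le_rfl x
  rwa [show a + q + 1 + b = a + q + b + 1 by omega, show a + 2 + b = a + b + 2 by omega] at this

/-- A cut behind the collapsed input splits off final inputs that are disjoint from the block, so
the order of the two extractions is immaterial. -/
theorem rTensor_cupPart_block_left (a q b c : ℕ) (x : ⨁ n, C n) :
    LinearMap.rTensor _ (X.cupPart (a + 1 + b) c) (X.block a q (b + c) x) =
      TensorProduct.rightComm k _ _ _
        (LinearMap.rTensor _ (X.block a q b) (X.cupPart (a + q + b) c x)) := by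
  have h := X.block_before a q b c 0 x
  simp only [Nat.add_zero] at h
  rw [cupPart, cupPart, ← rTensor_rTensor_comp, LinearMap.comp_apply,
    ← rightComm_rightComm (LinearMap.rTensor _ (X.block (a + 1 + b) c 0) _), ← h,
    rTensor_rTensor_rightComm, rTensor_rTensor_comp, rTensor_rTensor_comp]
  congr 3
  refine LinearMap.ext fun x => ?_
  rw [LinearMap.comp_apply, LinearMap.comp_apply, block_face_last,
    show a + 1 + b + 1 = a + b + 2 by omega]

/-- A cut in front of the collapsed input leaves the block nested in the right part of the cut. -/
theorem rTensor_cupPart_block_right (c a q b : ℕ) (x : ⨁ n, C n) :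
    LinearMap.rTensor _ (X.cupPart c (a + 1 + b)) (X.block (c + a) q b x) =
      (TensorProduct.assoc k _ _ _).symm
        (LinearMap.lTensor _ (X.block a q b) (X.cupPart c (a + q + b) x)) := by
  have h := X.block_inside c a q b 0 x
  simp only [Nat.add_zero] at h
  rw [cupPart, cupPart, ← rTensor_rTensor_comp, LinearMap.comp_apply, h, rTensor_rTensor_assoc_symm,
    lTensor_rTensor_comm]

/-- Cutting the extracted block in two amounts to extracting two adjacent blocks and then merging
their collapsed inputs by the inner face `a + 1`. This identifies the middle term of the coLeibniz
homotopy. -/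
theorem lTensor_cupPart_block (a q r c : ℕ) (x : ⨁ n, C n) :
    (TensorProduct.assoc k _ _ _).symm
      (LinearMap.lTensor _ (X.cupPart q r) (X.block a (q + r) c x)) =
      LinearMap.rTensor _ (LinearMap.rTensor _ (X.totalFace (a + c + 2) (a + 1)))
        (LinearMap.rTensor _ (X.block a q (1 + c)) (X.block (a + q) r c x)) := by
  have h := X.block_inside a q r 0 c x
  simp only [Nat.add_zero, Nat.zero_add] at h
  rw [cupPart, LinearMap.lTensor_comp, LinearMap.comp_apply, ← rTensor_lTensor_assoc_symm, ← h, rTensor_rTensor_comp,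
    rTensor_rTensor_comp]
  congr 2
  refine LinearMap.ext fun x => ?_
  rw [LinearMap.comp_apply, LinearMap.comp_apply, block_lTensor_face_last, Nat.add_comm c 1]

/-- This is `lTensor_cupPart_block` with no inputs behind the block. A simplicial identity shows
that the two collapsed inputs can be removed one at a time or merged first. -/
theorem cupPart_coassoc (a b c : ℕ) (x : ⨁ n, C n) :
    LinearMap.rTensor _ (X.cupPart a b) (X.cupPart (a + b) c x) =
      (TensorProduct.assoc k _ _ _).symm
        (LinearMap.lTensor _ (X.cupPart b c) (X.cupPart a (b + c) x)) := by
  have h := X.lTensor_cupPart_block a b c 0 x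
  have e : ∀ a b x, X.cupPart a b x =
    LinearMap.rTensor _ (X.totalFace (a + 1) (a + 1)) (X.block a b 0 x) := fun _ _ _ => rfl
  have h' := X.block_face_last a b 0
  simp only [Nat.add_zero, Nat.zero_add] at h h'
  rw [e a (b + c), ← lTensor_rTensor_comm, ← rTensor_rTensor_assoc_symm, h, e (a + b) c,
    rTensor_rTensor_comp, rTensor_rTensor_comp, rTensor_rTensor_comp]
  congr 2
  refine LinearMap.ext fun x => ?_
  simp only [LinearMap.comp_apply, e, h', rTensor_rTensor_comp]
  congr 2
  exact LinearMap.ext fun x =>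
    (X.totalFace_totalFace a (a + 1) (a + 1) (by omega) (by omega) x).symm

theorem evalLeft_totalPsi_one_block (b : ℕ) (x : ⨁ n, C n) :
    evalLeft (X.totalPsi 1) (X.block 0 b 0 x) =
      DirectSum.lof k ℕ C b (DirectSum.component k ℕ C b x) := by
  refine DirectSum.congr_of_lof (f := evalLeft (X.totalPsi 1) ∘ₗ X.block 0 b 0)
    (g := DirectSum.lof k ℕ C b ∘ₗ DirectSum.component k ℕ C b) (fun m x => ?_) x
  change evalLeft (X.totalPsi 1) (X.block 0 b 0 (DirectSum.lof k ℕ C m x)) =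
    DirectSum.lof k ℕ C b (DirectSum.component k ℕ C b (DirectSum.lof k ℕ C m x))
  by_cases h : m = b
  · subst h
    have h₁ := LinearMap.congr_fun (X.counit_left m) x
    have h₂ : X.psi.map 1 = X.counit := X.psi.counit_map
    rw [X.block_lof 0 m 0 (by omega), DirectSum.component.lof_self]
    refine (X.evalLeft_incl₂ 1 m _).trans ?_
    rw [h₂]
    exact congrArg _ h₁
  · rw [X.block_lof_of_ne _ _ _ (by omega), map_zero]
    simp [DirectSum.component.of, h]

/-- Because `ψ_0 d_1 = ψ_1` and `ψ_1` is the counit of the cooperad, this is the counit axiom for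
the block containing all inputs. -/
theorem evalLeft_cupPart (b : ℕ) (x : ⨁ n, C n) :
    evalLeft (X.totalPsi 0) (X.cupPart 0 b x) =
      DirectSum.lof k ℕ C b (DirectSum.component k ℕ C b x) := by
  rw [← evalLeft_totalPsi_one_block, ← X.totalPsi_comp_totalFace 0 1 (by omega),
    ← evalLeft_rTensor]
  rfl

theorem evalRight_cupPart (a : ℕ) (x : ⨁ n, C n) :
    evalRight (X.totalPsi 0) (X.cupPart a 0 x) =
      DirectSum.lof k ℕ C a (DirectSum.component k ℕ C a x) := by
  have comm : ∀ t : (⨁ n, C n) ⊗[k] (⨁ n, C n),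
      evalRight (X.totalPsi 0) t = evalLeft (X.totalPsi 0) (TensorProduct.comm k _ _ t) := fun t => by
    induction t using TensorProduct.induction_on with
    | zero => simp
    | add a b ha hb => simp only [map_add, ha, hb]
    | tmul a b => simp
  -- In its mirrored form the component also extracts all inputs as one block, so `ψ_0 d_0 = ψ_1`
  -- leads back to the left counit axiom.
  rw [comm, ← rTensor_face_first_block, evalLeft_rTensor, X.totalPsi_comp_totalFace 0 0 (by omega),
    evalLeft_totalPsi_one_block]

end ComultiplicativeCooperad

/-! ### Sums over tuples of natural numbers with a given sum -/


/-- The triples of natural numbers with sum `n`. -/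
def Finset.triples (n : ℕ) : Finset (ℕ × ℕ × ℕ) :=
  (Finset.range (n + 1) ×ˢ Finset.range (n + 1) ×ˢ Finset.range (n + 1)).filter fun t => t.1 + t.2.1 + t.2.2 = n

/-- The quintuples of natural numbers with sum `n`. -/
def Finset.quintuples (n : ℕ) : Finset (ℕ × ℕ × ℕ × ℕ × ℕ) :=
  (Finset.range (n + 1) ×ˢ Finset.range (n + 1) ×ˢ Finset.range (n + 1) ×ˢ Finset.range (n + 1) ×ˢ Finset.range (n + 1)).filter
    fun t => t.1 + t.2.1 + t.2.2.1 + t.2.2.2.1 + t.2.2.2.2 = n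

/-- The quadruples of natural numbers with sum `n`. -/
def Finset.quadruples (n : ℕ) : Finset (ℕ × ℕ × ℕ × ℕ) :=
  (Finset.range (n + 1) ×ˢ Finset.range (n + 1) ×ˢ Finset.range (n + 1) ×ˢ Finset.range (n + 1)).filter
    fun t => t.1 + t.2.1 + t.2.2.1 + t.2.2.2 = n

theorem Finset.mem_triples {n : ℕ} {t : ℕ × ℕ × ℕ} : t ∈ Finset.triples n ↔ t.1 + t.2.1 + t.2.2 = n := by
  simp only [triples, Finset.mem_filter, Finset.mem_product, Finset.mem_range]; omega

theorem Finset.mem_quadruples {n : ℕ} {t : ℕ × ℕ × ℕ × ℕ} :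
    t ∈ Finset.quadruples n ↔ t.1 + t.2.1 + t.2.2.1 + t.2.2.2 = n := by
  simp only [quadruples, Finset.mem_filter, Finset.mem_product, Finset.mem_range]; omega

theorem Finset.mem_quintuples {n : ℕ} {t : ℕ × ℕ × ℕ × ℕ × ℕ} :
    t ∈ Finset.quintuples n ↔ t.1 + t.2.1 + t.2.2.1 + t.2.2.2.1 + t.2.2.2.2 = n := by
  simp only [quintuples, Finset.mem_filter, Finset.mem_product, Finset.mem_range]; omega

/-- A sum over a finite set is the sum over the image of an injection plus the sum over the image
of another injection, if these images form a partition of the set. -/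
theorem Finset.sum_eq_sum_add_sum_of_injOn {ι κ₁ κ₂ M : Type*} [AddCommMonoid M] [DecidableEq ι]
    {s : Finset ι} {t₁ : Finset κ₁} {t₂ : Finset κ₂} (f : ι → M) (i₁ : κ₁ → ι) (i₂ : κ₂ → ι)
    (h₁ : ∀ x ∈ t₁, i₁ x ∈ s) (h₂ : ∀ x ∈ t₂, i₂ x ∈ s)
    (inj₁ : ∀ x y, i₁ x = i₁ y → x = y) (inj₂ : ∀ x y, i₂ x = i₂ y → x = y)
    (disj : ∀ x ∈ t₁, ∀ y ∈ t₂, i₁ x ≠ i₂ y)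
    (surj : ∀ z ∈ s, (∃ x ∈ t₁, i₁ x = z) ∨ ∃ y ∈ t₂, i₂ y = z) :
    ∑ z ∈ s, f z = ∑ x ∈ t₁, f (i₁ x) + ∑ y ∈ t₂, f (i₂ y) := by
  have e : s = t₁.image i₁ ∪ t₂.image i₂ := by
    ext z
    simp only [Finset.mem_union, Finset.mem_image]
    refine ⟨surj z, ?_⟩
    rintro (⟨x, hx, rfl⟩ | ⟨x, hx, rfl⟩)
    exacts [h₁ x hx, h₂ x hx]
  rw [e, Finset.sum_union, Finset.sum_image fun x _ y _ => inj₁ x y, Finset.sum_image fun x _ y _ => inj₂ x y]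
  rw [Finset.disjoint_left]
  intro z hz hz'
  obtain ⟨x, hx, rfl⟩ := Finset.mem_image.1 hz
  obtain ⟨y, hy, hxy⟩ := Finset.mem_image.1 hz'
  exact disj x hx y hy hxy.symm

variable {M : Type*} [AddCommMonoid M]

/-- Splitting off the tuples in which one coordinate vanishes separates boundary terms from terms
that are indexed by tuples of sum `n`. The variants below do the same in the other coordinates. -/
theorem Finset.sum_triples_succ_first (n : ℕ) (f : ℕ × ℕ × ℕ → M) :
    ∑ t ∈ Finset.triples (n + 1), f t = ∑ t ∈ Finset.triples n, f (t.1 + 1, t.2.1, t.2.2) +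
      ∑ t ∈ Finset.HasAntidiagonal.antidiagonal (n + 1), f (0, t.1, t.2) := by
  refine Finset.sum_eq_sum_add_sum_of_injOn f (fun t : ℕ × ℕ × ℕ => (t.1 + 1, t.2.1, t.2.2)) (fun t : ℕ × ℕ => (0, t.1, t.2))
    ?_ ?_ ?_ ?_ ?_ ?_ <;> simp only [Finset.mem_triples, Finset.HasAntidiagonal.mem_antidiagonal, Prod.forall, Prod.exists, Prod.mk.injEq, ne_eq]
  · intros; omega
  · intros; omega
  · intros; omega
  · intros; omega
  · intros; omega
  · rintro a b c h
    rcases a with _ | a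
    · exact Or.inr ⟨b, c, by omega, rfl, rfl, rfl⟩
    · exact Or.inl ⟨a, b, c, by omega, rfl, rfl, rfl⟩

theorem Finset.sum_triples_succ_second (n : ℕ) (f : ℕ × ℕ × ℕ → M) :
    ∑ t ∈ Finset.triples (n + 1), f t = ∑ t ∈ Finset.triples n, f (t.1, t.2.1 + 1, t.2.2) +
      ∑ t ∈ Finset.HasAntidiagonal.antidiagonal (n + 1), f (t.1, 0, t.2) := by
  refine Finset.sum_eq_sum_add_sum_of_injOn f (fun t : ℕ × ℕ × ℕ => (t.1, t.2.1 + 1, t.2.2)) (fun t : ℕ × ℕ => (t.1, 0, t.2))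
    ?_ ?_ ?_ ?_ ?_ ?_ <;> simp only [Finset.mem_triples, Finset.HasAntidiagonal.mem_antidiagonal, Prod.forall, Prod.exists, Prod.mk.injEq, ne_eq]
  · intros; omega
  · intros; omega
  · intros; omega
  · intros; omega
  · intros; omega
  · rintro a b c h
    rcases b with _ | b
    · exact Or.inr ⟨a, c, by omega, rfl, rfl, rfl⟩
    · exact Or.inl ⟨a, b, c, by omega, rfl, rfl, rfl⟩

theorem Finset.sum_triples_succ_third (n : ℕ) (f : ℕ × ℕ × ℕ → M) :
    ∑ t ∈ Finset.triples (n + 1), f t = ∑ t ∈ Finset.triples n, f (t.1, t.2.1, t.2.2 + 1) +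
      ∑ t ∈ Finset.HasAntidiagonal.antidiagonal (n + 1), f (t.1, t.2, 0) := by
  refine Finset.sum_eq_sum_add_sum_of_injOn f (fun t : ℕ × ℕ × ℕ => (t.1, t.2.1, t.2.2 + 1)) (fun t : ℕ × ℕ => (t.1, t.2, 0))
    ?_ ?_ ?_ ?_ ?_ ?_ <;> simp only [Finset.mem_triples, Finset.HasAntidiagonal.mem_antidiagonal, Prod.forall, Prod.exists, Prod.mk.injEq, ne_eq]
  · intros; omega
  · intros; omega
  · intros; omega
  · intros; omega
  · intros; omega
  · rintro a b c h
    rcases c with _ | c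
    · exact Or.inr ⟨a, b, by omega, rfl, rfl, rfl⟩
    · exact Or.inl ⟨a, b, c, by omega, rfl, rfl, rfl⟩



theorem Finset.sum_quintuples_succ_first (n : ℕ) (f : ℕ × ℕ × ℕ × ℕ × ℕ → M) :
    ∑ t ∈ Finset.quintuples (n + 1), f t =
      ∑ t ∈ Finset.quintuples n, f (t.1 + 1, t.2.1, t.2.2.1, t.2.2.2.1, t.2.2.2.2) +
      ∑ t ∈ Finset.quadruples (n + 1), f (0, t.1, t.2.1, t.2.2.1, t.2.2.2) := by
  refine Finset.sum_eq_sum_add_sum_of_injOn f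
    (fun t : ℕ × ℕ × ℕ × ℕ × ℕ => (t.1 + 1, t.2.1, t.2.2.1, t.2.2.2.1, t.2.2.2.2))
    (fun t : ℕ × ℕ × ℕ × ℕ => (0, t.1, t.2.1, t.2.2.1, t.2.2.2)) ?_ ?_ ?_ ?_ ?_ ?_ <;>
    simp only [Finset.mem_quintuples, Finset.mem_quadruples, Prod.forall, Prod.exists,
      Prod.mk.injEq, ne_eq]
  any_goals intros; omega
  rintro a q b r c h
  rcases a with _ | a
  · exact Or.inr ⟨q, b, r, c, by omega, rfl, rfl, rfl, rfl, rfl⟩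
  · exact Or.inl ⟨a, q, b, r, c, by omega, rfl, rfl, rfl, rfl, rfl⟩

theorem Finset.sum_quintuples_succ_second (n : ℕ) (f : ℕ × ℕ × ℕ × ℕ × ℕ → M) :
    ∑ t ∈ Finset.quintuples (n + 1), f t =
      ∑ t ∈ Finset.quintuples n, f (t.1, t.2.1 + 1, t.2.2.1, t.2.2.2.1, t.2.2.2.2) +
      ∑ t ∈ Finset.quadruples (n + 1), f (t.1, 0, t.2.1, t.2.2.1, t.2.2.2) := by
  refine Finset.sum_eq_sum_add_sum_of_injOn f
    (fun t : ℕ × ℕ × ℕ × ℕ × ℕ => (t.1, t.2.1 + 1, t.2.2.1, t.2.2.2.1, t.2.2.2.2))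
    (fun t : ℕ × ℕ × ℕ × ℕ => (t.1, 0, t.2.1, t.2.2.1, t.2.2.2)) ?_ ?_ ?_ ?_ ?_ ?_ <;>
    simp only [Finset.mem_quintuples, Finset.mem_quadruples, Prod.forall, Prod.exists,
      Prod.mk.injEq, ne_eq]
  any_goals intros; omega
  rintro a q b r c h
  rcases q with _ | q
  · exact Or.inr ⟨a, b, r, c, by omega, rfl, rfl, rfl, rfl, rfl⟩
  · exact Or.inl ⟨a, q, b, r, c, by omega, rfl, rfl, rfl, rfl, rfl⟩

theorem Finset.sum_quintuples_succ_third (n : ℕ) (f : ℕ × ℕ × ℕ × ℕ × ℕ → M) :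
    ∑ t ∈ Finset.quintuples (n + 1), f t =
      ∑ t ∈ Finset.quintuples n, f (t.1, t.2.1, t.2.2.1 + 1, t.2.2.2.1, t.2.2.2.2) +
      ∑ t ∈ Finset.quadruples (n + 1), f (t.1, t.2.1, 0, t.2.2.1, t.2.2.2) := by
  refine Finset.sum_eq_sum_add_sum_of_injOn f
    (fun t : ℕ × ℕ × ℕ × ℕ × ℕ => (t.1, t.2.1, t.2.2.1 + 1, t.2.2.2.1, t.2.2.2.2))
    (fun t : ℕ × ℕ × ℕ × ℕ => (t.1, t.2.1, 0, t.2.2.1, t.2.2.2)) ?_ ?_ ?_ ?_ ?_ ?_ <;>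
    simp only [Finset.mem_quintuples, Finset.mem_quadruples, Prod.forall, Prod.exists,
      Prod.mk.injEq, ne_eq]
  any_goals intros; omega
  rintro a q b r c h
  rcases b with _ | b
  · exact Or.inr ⟨a, q, r, c, by omega, rfl, rfl, rfl, rfl, rfl⟩
  · exact Or.inl ⟨a, q, b, r, c, by omega, rfl, rfl, rfl, rfl, rfl⟩

theorem Finset.sum_quintuples_succ_fourth (n : ℕ) (f : ℕ × ℕ × ℕ × ℕ × ℕ → M) :
    ∑ t ∈ Finset.quintuples (n + 1), f t =
      ∑ t ∈ Finset.quintuples n, f (t.1, t.2.1, t.2.2.1, t.2.2.2.1 + 1, t.2.2.2.2) +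
      ∑ t ∈ Finset.quadruples (n + 1), f (t.1, t.2.1, t.2.2.1, 0, t.2.2.2) := by
  refine Finset.sum_eq_sum_add_sum_of_injOn f
    (fun t : ℕ × ℕ × ℕ × ℕ × ℕ => (t.1, t.2.1, t.2.2.1, t.2.2.2.1 + 1, t.2.2.2.2))
    (fun t : ℕ × ℕ × ℕ × ℕ => (t.1, t.2.1, t.2.2.1, 0, t.2.2.2)) ?_ ?_ ?_ ?_ ?_ ?_ <;>
    simp only [Finset.mem_quintuples, Finset.mem_quadruples, Prod.forall, Prod.exists,
      Prod.mk.injEq, ne_eq]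
  any_goals intros; omega
  rintro a q b r c h
  rcases r with _ | r
  · exact Or.inr ⟨a, q, b, c, by omega, rfl, rfl, rfl, rfl, rfl⟩
  · exact Or.inl ⟨a, q, b, r, c, by omega, rfl, rfl, rfl, rfl, rfl⟩

theorem Finset.sum_quintuples_succ_fifth (n : ℕ) (f : ℕ × ℕ × ℕ × ℕ × ℕ → M) :
    ∑ t ∈ Finset.quintuples (n + 1), f t =
      ∑ t ∈ Finset.quintuples n, f (t.1, t.2.1, t.2.2.1, t.2.2.2.1, t.2.2.2.2 + 1) +
      ∑ t ∈ Finset.quadruples (n + 1), f (t.1, t.2.1, t.2.2.1, t.2.2.2, 0) := by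
  refine Finset.sum_eq_sum_add_sum_of_injOn f
    (fun t : ℕ × ℕ × ℕ × ℕ × ℕ => (t.1, t.2.1, t.2.2.1, t.2.2.2.1, t.2.2.2.2 + 1))
    (fun t : ℕ × ℕ × ℕ × ℕ => (t.1, t.2.1, t.2.2.1, t.2.2.2, 0)) ?_ ?_ ?_ ?_ ?_ ?_ <;>
    simp only [Finset.mem_quintuples, Finset.mem_quadruples, Prod.forall, Prod.exists,
      Prod.mk.injEq, ne_eq]
  any_goals intros; omega
  rintro a q b r c h
  rcases c with _ | c
  · exact Or.inr ⟨a, q, b, r, by omega, rfl, rfl, rfl, rfl, rfl⟩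
  · exact Or.inl ⟨a, q, b, r, c, by omega, rfl, rfl, rfl, rfl, rfl⟩

/-! ### Signed sums in which the faces next to a block cancel -/

section SignedSums

variable {k M : Type*} [CommRing k] [AddCommGroup M] [Module k M]

/-- Every comparison of signs below is a comparison of parities of exponents that are polynomial in
the block sizes. -/
theorem neg_one_pow_eq {m n : ℕ} (h : Even m ↔ Even n) : (-1 : k) ^ m = (-1) ^ n := by
  rcases Nat.even_or_odd m with hm | hm
  · rw [hm.neg_one_pow, (h.1 hm).neg_one_pow]
  · rw [hm.neg_one_pow, (Nat.not_even_iff_odd.1 (h.not.1 (Nat.not_even_iff_odd.2 hm))).neg_one_pow]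

theorem neg_one_pow_eq_neg {m n : ℕ} (h : Even m ↔ ¬Even n) : (-1 : k) ^ m = -(-1) ^ n := by
  rw [neg_one_pow_eq (n := n + 1) (by rw [h, Nat.even_add_one]), pow_succ, mul_neg_one]

/-- The cancellation of the faces adjacent to the extracted block. -/
theorem Finset.sum_triples_block_faces (N : ℕ) (G₁ G₂ : ℕ → ℕ → ℕ → ℕ → M)
    (h₀ : ∀ a b i, G₂ a 0 b i = 0)
    (h₁ : ∀ a q b, G₂ a (q + 1) b 0 = G₁ (a + 1) q b (a + 1))
    (h₂ : ∀ a q b, G₂ a (q + 1) b (q + 1) = G₁ a q (b + 1) (a + 1)) :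
    ∑ t ∈ Finset.triples (N + 1), (-1 : k) ^ ((t.2.1 + 1) * t.2.2) •
        (∑ i ∈ Finset.range (t.1 + t.2.2 + 2), (-1 : k) ^ i • G₁ t.1 t.2.1 t.2.2 i -
          (-1 : k) ^ (t.1 + 1 + t.2.2) • ∑ i ∈ Finset.range (t.2.1 + 1), (-1 : k) ^ i • G₂ t.1 t.2.1 t.2.2 i) =
      ∑ t ∈ Finset.triples N, (-1 : k) ^ ((t.2.1 + 1) * t.2.2) •
        (∑ i ∈ Finset.range (t.1 + 1), (-1 : k) ^ i • G₁ (t.1 + 1) t.2.1 t.2.2 i +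
          ∑ i ∈ Finset.range t.2.1, (-1 : k) ^ (t.1 + 1 + i) • G₂ t.1 (t.2.1 + 1) t.2.2 (i + 1) +
          ∑ i ∈ Finset.range (t.2.2 + 1), (-1 : k) ^ (t.1 + t.2.1 + 1 + i) •
            G₁ t.1 t.2.1 (t.2.2 + 1) (t.1 + 2 + i)) +
      (∑ t ∈ Finset.HasAntidiagonal.antidiagonal (N + 1), (-1 : k) ^ ((t.1 + 1) * t.2) • G₁ 0 t.1 t.2 0 -
        ∑ t ∈ Finset.HasAntidiagonal.antidiagonal (N + 1), (-1 : k) ^ t.1 • G₁ t.1 t.2 0 (t.1 + 1)) := by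
  -- The collapsed input has position `a + 1`, so exactly the faces `a` and `a + 1` of the left
  -- factor involve it.
  have split : ∀ a b (f : ℕ → M), ∑ i ∈ Finset.range (a + b + 2), f i =
      ∑ i ∈ Finset.range a, f i + f a + f (a + 1) + ∑ i ∈ Finset.range b, f (a + 2 + i) := fun a b f => by
    rw [show a + b + 2 = (a + 2) + b by omega, Finset.sum_range_add, Finset.sum_range_succ, Finset.sum_range_succ]
  have split' : ∀ b (f : ℕ → M), ∑ i ∈ Finset.range (b + 2), f i =
      f 0 + ∑ i ∈ Finset.range b, f (i + 1) + f (b + 1) := fun b f => by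
    rw [Finset.sum_range_succ, Finset.sum_range_succ', add_comm (∑ i ∈ Finset.range b, f (i + 1))]
  simp only [split, smul_sub, smul_add, Finset.sum_add_distrib, Finset.sum_sub_distrib]
  -- Each group of terms is shifted in the coordinate that has to be positive. Boundary sums survive
  -- only for the face `a` with `a = 0` and for the face `a + 1` with `b = 0`. For the others the
  -- inner sum is empty, or `h₀` applies.
  rw [Finset.sum_triples_succ_first N fun t => (-1 : k) ^ ((t.2.1 + 1) * t.2.2) •
      ∑ i ∈ Finset.range t.1, (-1 : k) ^ i • G₁ t.1 t.2.1 t.2.2 i,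
    Finset.sum_triples_succ_first N fun t => (-1 : k) ^ ((t.2.1 + 1) * t.2.2) • (-1 : k) ^ t.1 • G₁ t.1 t.2.1 t.2.2 t.1,
    Finset.sum_triples_succ_third N fun t => (-1 : k) ^ ((t.2.1 + 1) * t.2.2) • (-1 : k) ^ (t.1 + 1) • G₁ t.1 t.2.1 t.2.2 (t.1 + 1),
    Finset.sum_triples_succ_third N fun t => (-1 : k) ^ ((t.2.1 + 1) * t.2.2) •
      ∑ i ∈ Finset.range t.2.2, (-1 : k) ^ (t.1 + 2 + i) • G₁ t.1 t.2.1 t.2.2 (t.1 + 2 + i),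
    Finset.sum_triples_succ_second N fun t => (-1 : k) ^ ((t.2.1 + 1) * t.2.2) •
      (-1 : k) ^ (t.1 + 1 + t.2.2) • ∑ i ∈ Finset.range (t.2.1 + 1), (-1 : k) ^ i • G₂ t.1 t.2.1 t.2.2 i]
  -- After the shift, all terms with the same triple of sum `N` are compared. The faces adjacent to
  -- the collapsed input cancel against the outer faces of the block by `h₁` and `h₂`.
  have key : ∀ t : ℕ × ℕ × ℕ, (-1 : k) ^ ((t.2.1 + 1) * t.2.2) •
        (∑ i ∈ Finset.range (t.1 + 1), (-1 : k) ^ i • G₁ (t.1 + 1) t.2.1 t.2.2 i) +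
      (-1 : k) ^ ((t.2.1 + 1) * t.2.2) • (-1 : k) ^ (t.1 + 1) • G₁ (t.1 + 1) t.2.1 t.2.2 (t.1 + 1) +
      (-1 : k) ^ ((t.2.1 + 1) * (t.2.2 + 1)) • (-1 : k) ^ (t.1 + 1) •
        G₁ t.1 t.2.1 (t.2.2 + 1) (t.1 + 1) +
      (-1 : k) ^ ((t.2.1 + 1) * (t.2.2 + 1)) • (∑ i ∈ Finset.range (t.2.2 + 1),
        (-1 : k) ^ (t.1 + 2 + i) • G₁ t.1 t.2.1 (t.2.2 + 1) (t.1 + 2 + i)) -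
      (-1 : k) ^ ((t.2.1 + 1 + 1) * t.2.2) • (-1 : k) ^ (t.1 + 1 + t.2.2) •
        (∑ i ∈ Finset.range (t.2.1 + 1 + 1), (-1 : k) ^ i • G₂ t.1 (t.2.1 + 1) t.2.2 i) =
      (-1 : k) ^ ((t.2.1 + 1) * t.2.2) •
        (∑ i ∈ Finset.range (t.1 + 1), (-1 : k) ^ i • G₁ (t.1 + 1) t.2.1 t.2.2 i +
          ∑ i ∈ Finset.range t.2.1, (-1 : k) ^ (t.1 + 1 + i) • G₂ t.1 (t.2.1 + 1) t.2.2 (i + 1) +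
          ∑ i ∈ Finset.range (t.2.2 + 1), (-1 : k) ^ (t.1 + t.2.1 + 1 + i) •
            G₁ t.1 t.2.1 (t.2.2 + 1) (t.1 + 2 + i)) := by
    rintro ⟨a, q, b⟩
    have e₁ : (-1 : k) ^ ((q + 1) * (b + 1)) • (∑ i ∈ Finset.range (b + 1),
        (-1 : k) ^ (a + 2 + i) • G₁ a q (b + 1) (a + 2 + i)) =
        (-1 : k) ^ ((q + 1) * b) • ∑ i ∈ Finset.range (b + 1), (-1 : k) ^ (a + q + 1 + i) •
            G₁ a q (b + 1) (a + 2 + i) := by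
      simp only [Finset.smul_sum, smul_smul, ← pow_add]
      refine Finset.sum_congr rfl fun i _ => ?_
      rw [neg_one_pow_eq]
      grind [Nat.not_even_one]
    have e₂ : (-1 : k) ^ ((q + 1 + 1) * b) • (-1 : k) ^ (a + 1 + b) •
        (∑ i ∈ Finset.range q, (-1 : k) ^ (i + 1) • G₂ a (q + 1) b (i + 1)) =
        -((-1 : k) ^ ((q + 1) * b) •
          ∑ i ∈ Finset.range q, (-1 : k) ^ (a + 1 + i) • G₂ a (q + 1) b (i + 1)) := by
      simp only [Finset.smul_sum, smul_smul, ← pow_add, ← Finset.sum_neg_distrib, ← neg_smul]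
      refine Finset.sum_congr rfl fun i _ => ?_
      rw [neg_one_pow_eq_neg]
      grind [Nat.not_even_one]
    have e₃ : (-1 : k) ^ ((q + 1 + 1) * b) • (-1 : k) ^ (a + 1 + b) • G₁ (a + 1) q b (a + 1) =
        (-1 : k) ^ ((q + 1) * b) • (-1 : k) ^ (a + 1) • G₁ (a + 1) q b (a + 1) := by
      simp only [smul_smul, ← pow_add]
      rw [neg_one_pow_eq]
      grind [Nat.not_even_one]
    have e₄ : (-1 : k) ^ ((q + 1 + 1) * b) • (-1 : k) ^ (a + 1 + b) • (-1 : k) ^ (q + 1) •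
          G₁ a q (b + 1) (a + 1) =
        (-1 : k) ^ ((q + 1) * (b + 1)) • (-1 : k) ^ (a + 1) • G₁ a q (b + 1) (a + 1) := by
      simp only [smul_smul, ← pow_add]
      rw [neg_one_pow_eq]
      grind [Nat.not_even_one]
    simp only [split', h₁, h₂, smul_add, pow_zero, one_smul]
    rw [e₁, e₂, e₃, e₄]
    abel
  have e₁ : ∀ q, (q + 1) * 0 = 0 := fun q => Nat.mul_zero _
  have e₂ : ∑ t ∈ Finset.HasAntidiagonal.antidiagonal (N + 1),
      (-1 : k) ^ t.1 • G₁ t.1 t.2 0 (t.1 + 1) = -∑ t ∈ Finset.HasAntidiagonal.antidiagonal (N + 1),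
      (-1 : k) ^ (t.1 + 1) • G₁ t.1 t.2 0 (t.1 + 1) := by
    simp only [← Finset.sum_neg_distrib, pow_succ, mul_neg_one, neg_smul, neg_neg]
  have key' := Finset.sum_congr (rfl : Finset.triples N = Finset.triples N) fun t _ => key t
  simp only [smul_add, Finset.sum_add_distrib, Finset.sum_sub_distrib] at key'
  simp only [e₁, e₂, pow_zero, one_smul, Finset.range_zero, Finset.sum_empty, smul_zero,
    Finset.sum_const_zero, add_zero, h₀]
  linear_combination (norm := abel) key'

/-- The cancellation of the faces adjacent to two extracted blocks. -/
theorem sum_quintuples_block_faces (N : ℕ) (G₁ G₂ G₃ : ℕ → ℕ → ℕ → ℕ → ℕ → ℕ → M)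
    (h₂ : ∀ a b r c i, G₂ a 0 b r c i = 0) (h₃ : ∀ a q b c i, G₃ a q b 0 c i = 0)
    (h₂_first : ∀ a q b r c, G₂ a (q + 1) b r c 0 = G₁ (a + 1) q b r c (a + 1))
    (h₂_last : ∀ a q b r c, G₂ a (q + 1) b r c (q + 1) = G₁ a q (b + 1) r c (a + 1))
    (h₃_first : ∀ a q b r c, G₃ a q b (r + 1) c 0 = G₁ a q (b + 1) r c (a + 1 + (b + 1)))
    (h₃_last : ∀ a q b r c, G₃ a q b (r + 1) c (r + 1) = G₁ a q b r (c + 1) (a + b + 2)) :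
    ∑ t ∈ Finset.quintuples (N + 1), (-1 : k) ^ (1 + t.1 + t.2.2.2.2 + t.2.1 * t.2.2.1 + t.2.1 * t.2.2.2.2 + t.2.2.2.1 * t.2.2.2.2) •
        (∑ i ∈ Finset.range (t.1 + t.2.2.1 + t.2.2.2.2 + 3), (-1 : k) ^ i • G₁ t.1 t.2.1 t.2.2.1 t.2.2.2.1 t.2.2.2.2 i -
          (-1 : k) ^ (t.1 + t.2.2.1 + t.2.2.2.2) • (∑ i ∈ Finset.range (t.2.1 + 1), (-1 : k) ^ i • G₂ t.1 t.2.1 t.2.2.1 t.2.2.2.1 t.2.2.2.2 i) -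
          (-1 : k) ^ (t.1 + t.2.2.1 + t.2.2.2.2 + t.2.1) •
            ∑ i ∈ Finset.range (t.2.2.2.1 + 1), (-1 : k) ^ i • G₃ t.1 t.2.1 t.2.2.1 t.2.2.2.1 t.2.2.2.2 i) +
      ∑ t ∈ Finset.quintuples N, (-1 : k) ^ (1 + t.1 + t.2.2.2.2 + t.2.1 * t.2.2.1 + t.2.1 * t.2.2.2.2 + t.2.2.2.1 * t.2.2.2.2) •
        (∑ i ∈ Finset.range (t.1 + 1), (-1 : k) ^ i • G₁ (t.1 + 1) t.2.1 t.2.2.1 t.2.2.2.1 t.2.2.2.2 i +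
          ∑ i ∈ Finset.range t.2.1, (-1 : k) ^ (t.1 + 1 + i) • G₂ t.1 (t.2.1 + 1) t.2.2.1 t.2.2.2.1 t.2.2.2.2 (i + 1) +
          ∑ i ∈ Finset.range t.2.2.1, (-1 : k) ^ (t.1 + t.2.1 + 1 + i) • G₁ t.1 t.2.1 (t.2.2.1 + 1) t.2.2.2.1 t.2.2.2.2 (t.1 + 2 + i) +
          ∑ i ∈ Finset.range t.2.2.2.1, (-1 : k) ^ (t.1 + t.2.1 + t.2.2.1 + 1 + i) • G₃ t.1 t.2.1 t.2.2.1 (t.2.2.2.1 + 1) t.2.2.2.2 (i + 1) +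
          ∑ i ∈ Finset.range (t.2.2.2.2 + 1), (-1 : k) ^ (t.1 + t.2.1 + t.2.2.1 + t.2.2.2.1 + 1 + i) •
            G₁ t.1 t.2.1 t.2.2.1 t.2.2.2.1 (t.2.2.2.2 + 1) (t.1 + t.2.2.1 + 3 + i)) =
      ∑ t ∈ Finset.quadruples (N + 1), (-1 : k) ^ (1 + t.2.2.2 + t.1 * t.2.1 + t.1 * t.2.2.2 + t.2.2.1 * t.2.2.2) • G₁ 0 t.1 t.2.1 t.2.2.1 t.2.2.2 0 +
      ∑ t ∈ Finset.quadruples (N + 1), (-1 : k) ^ (t.2.2.2 + t.2.1 * t.2.2.2 + t.2.2.1 * t.2.2.2) • G₁ t.1 t.2.1 0 t.2.2.1 t.2.2.2 (t.1 + 1) +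
      ∑ t ∈ Finset.quadruples (N + 1), (-1 : k) ^ (1 + t.2.2.1 + t.2.1 * t.2.2.1) • G₁ t.1 t.2.1 t.2.2.1 t.2.2.2 0 (t.1 + t.2.2.1 + 2) := by
  -- The collapsed inputs have positions `a + 1` and `a + b + 2`. The middle group has `b + 1`
  -- faces, and for `b = 0` its only face merges the two collapsed inputs.
  have split : ∀ a b c (f : ℕ → M), ∑ i ∈ Finset.range (a + b + c + 3), f i =
      ∑ i ∈ Finset.range a, f i + f a + ∑ i ∈ Finset.range (b + 1), f (a + 1 + i) +
        f (a + b + 2) + ∑ i ∈ Finset.range c, f (a + b + 3 + i) := fun a b c f => by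
    rw [show a + b + c + 3 = a + 1 + (b + 1) + 1 + c by omega, Finset.sum_range_add,
      Finset.sum_range_succ, Finset.sum_range_add, Finset.sum_range_succ]
    simp only [show a + 1 + (b + 1) = a + b + 2 by omega, show a + b + 2 + 1 = a + b + 3 by omega]
  have split' : ∀ b (f : ℕ → M), ∑ i ∈ Finset.range (b + 1 + 1), f i =
      f 0 + ∑ i ∈ Finset.range b, f (i + 1) + f (b + 1) := fun b f => by
    rw [Finset.sum_range_succ, Finset.sum_range_succ', add_comm (∑ i ∈ Finset.range b, f (i + 1))]
  -- There are four cancelling pairs: the first and the last face of each block match the merging of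
  -- a collapsed input with an ordinary neighbour. What remains is minus the term coming from the
  -- faces of the argument.
  have key : ∀ a q b r c : ℕ, (-1 : k) ^ (1 + (a + 1) + c + q * b + q * c + r * c) • (∑ i ∈ Finset.range (a + 1), (-1 : k) ^ i • G₁ (a + 1) q b r c i) +
      (-1 : k) ^ (1 + (a + 1) + c + q * b + q * c + r * c) • (-1 : k) ^ (a + 1) • G₁ (a + 1) q b r c (a + 1) +
      (-1 : k) ^ (1 + a + c + q * (b + 1) + q * c + r * c) • (∑ i ∈ Finset.range ((b + 1) + 1), (-1 : k) ^ (a + 1 + i) • G₁ a q (b + 1) r c (a + 1 + i)) +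
      (-1 : k) ^ (1 + a + (c + 1) + q * b + q * (c + 1) + r * (c + 1)) • (-1 : k) ^ (a + b + 2) • G₁ a q b r (c + 1) (a + b + 2) +
      (-1 : k) ^ (1 + a + (c + 1) + q * b + q * (c + 1) + r * (c + 1)) • (∑ i ∈ Finset.range (c + 1), (-1 : k) ^ (a + b + 3 + i) • G₁ a q b r (c + 1) (a + b + 3 + i)) -
      (-1 : k) ^ (1 + a + c + (q + 1) * b + (q + 1) * c + r * c) • (-1 : k) ^ (a + b + c) • (∑ i ∈ Finset.range ((q + 1) + 1), (-1 : k) ^ i • G₂ a (q + 1) b r c i) -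
      (-1 : k) ^ (1 + a + c + q * b + q * c + (r + 1) * c) • (-1 : k) ^ (a + b + c + q) • (∑ i ∈ Finset.range ((r + 1) + 1), (-1 : k) ^ i • G₃ a q b (r + 1) c i) =
      -((-1 : k) ^ (1 + a + c + q * b + q * c + r * c) •
        (∑ i ∈ Finset.range (a + 1), (-1 : k) ^ i • G₁ (a + 1) q b r c i +
          ∑ i ∈ Finset.range q, (-1 : k) ^ (a + 1 + i) • G₂ a (q + 1) b r c (i + 1) +
          ∑ i ∈ Finset.range b, (-1 : k) ^ (a + q + 1 + i) • G₁ a q (b + 1) r c (a + 2 + i) +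
          ∑ i ∈ Finset.range r, (-1 : k) ^ (a + q + b + 1 + i) • G₃ a q b (r + 1) c (i + 1) +
          ∑ i ∈ Finset.range (c + 1), (-1 : k) ^ (a + q + b + r + 1 + i) •
            G₁ a q b r (c + 1) (a + b + 3 + i))) := by
    intro a q b r c
    have e₁ : (-1 : k) ^ (1 + (a + 1) + c + q * b + q * c + r * c) • (∑ i ∈ Finset.range (a + 1), (-1 : k) ^ i • G₁ (a + 1) q b r c i) =
        -((-1 : k) ^ (1 + a + c + q * b + q * c + r * c) • (∑ i ∈ Finset.range (a + 1), (-1 : k) ^ i • G₁ (a + 1) q b r c i)) := by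
      simp only [Finset.smul_sum, smul_smul, ← pow_add, ← Finset.sum_neg_distrib, ← neg_smul]
      refine Finset.sum_congr rfl fun i _ => ?_
      rw [neg_one_pow_eq_neg]
      grind [Nat.not_even_one]
    have e₂ : (-1 : k) ^ (1 + a + c + (q + 1) * b + (q + 1) * c + r * c) • (-1 : k) ^ (a + b + c) • G₁ (a + 1) q b r c (a + 1) =
        (-1 : k) ^ (1 + (a + 1) + c + q * b + q * c + r * c) • (-1 : k) ^ (a + 1) • G₁ (a + 1) q b r c (a + 1) := by
      simp only [smul_smul, ← pow_add]
      rw [neg_one_pow_eq]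
      grind [Nat.not_even_one]
    have e₃ : (-1 : k) ^ (1 + a + c + (q + 1) * b + (q + 1) * c + r * c) • (-1 : k) ^ (a + b + c) • (∑ i ∈ Finset.range q, (-1 : k) ^ (i + 1) • G₂ a (q + 1) b r c (i + 1)) =
        (-1 : k) ^ (1 + a + c + q * b + q * c + r * c) • (∑ i ∈ Finset.range q, (-1 : k) ^ (a + 1 + i) • G₂ a (q + 1) b r c (i + 1)) := by
      simp only [Finset.smul_sum, smul_smul, ← pow_add]
      refine Finset.sum_congr rfl fun i _ => ?_
      rw [neg_one_pow_eq]
      grind [Nat.not_even_one]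
    have e₄ : (-1 : k) ^ (1 + a + c + (q + 1) * b + (q + 1) * c + r * c) • (-1 : k) ^ (a + b + c) • (-1 : k) ^ (q + 1) • G₁ a q (b + 1) r c (a + 1) =
        (-1 : k) ^ (1 + a + c + q * (b + 1) + q * c + r * c) • (-1 : k) ^ (a + 1) • G₁ a q (b + 1) r c (a + 1) := by
      simp only [smul_smul, ← pow_add]
      rw [neg_one_pow_eq]
      grind [Nat.not_even_one]
    have e₅ : (-1 : k) ^ (1 + a + c + q * (b + 1) + q * c + r * c) • (∑ i ∈ Finset.range b, (-1 : k) ^ (a + 1 + (i + 1)) • G₁ a q (b + 1) r c (a + 1 + (i + 1))) =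
        -((-1 : k) ^ (1 + a + c + q * b + q * c + r * c) • (∑ i ∈ Finset.range b, (-1 : k) ^ (a + q + 1 + i) • G₁ a q (b + 1) r c (a + 1 + (i + 1)))) := by
      simp only [Finset.smul_sum, smul_smul, ← pow_add, ← Finset.sum_neg_distrib, ← neg_smul]
      refine Finset.sum_congr rfl fun i _ => ?_
      rw [neg_one_pow_eq_neg]
      grind [Nat.not_even_one]
    have e₆ : (-1 : k) ^ (1 + a + c + q * b + q * c + (r + 1) * c) • (-1 : k) ^ (a + b + c + q) • G₁ a q (b + 1) r c (a + 1 + (b + 1)) =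
        (-1 : k) ^ (1 + a + c + q * (b + 1) + q * c + r * c) • (-1 : k) ^ (a + 1 + (b + 1)) • G₁ a q (b + 1) r c (a + 1 + (b + 1)) := by
      simp only [smul_smul, ← pow_add]
      rw [neg_one_pow_eq]
      grind [Nat.not_even_one]
    have e₇ : (-1 : k) ^ (1 + a + c + q * b + q * c + (r + 1) * c) • (-1 : k) ^ (a + b + c + q) • (∑ i ∈ Finset.range r, (-1 : k) ^ (i + 1) • G₃ a q b (r + 1) c (i + 1)) =
        (-1 : k) ^ (1 + a + c + q * b + q * c + r * c) • (∑ i ∈ Finset.range r, (-1 : k) ^ (a + q + b + 1 + i) • G₃ a q b (r + 1) c (i + 1)) := by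
      simp only [Finset.smul_sum, smul_smul, ← pow_add]
      refine Finset.sum_congr rfl fun i _ => ?_
      rw [neg_one_pow_eq]
      grind [Nat.not_even_one]
    have e₈ : (-1 : k) ^ (1 + a + c + q * b + q * c + (r + 1) * c) • (-1 : k) ^ (a + b + c + q) • (-1 : k) ^ (r + 1) • G₁ a q b r (c + 1) (a + b + 2) =
        (-1 : k) ^ (1 + a + (c + 1) + q * b + q * (c + 1) + r * (c + 1)) • (-1 : k) ^ (a + b + 2) • G₁ a q b r (c + 1) (a + b + 2) := by
      simp only [smul_smul, ← pow_add]
      rw [neg_one_pow_eq]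
      grind [Nat.not_even_one]
    have e₉ : (-1 : k) ^ (1 + a + (c + 1) + q * b + q * (c + 1) + r * (c + 1)) • (∑ i ∈ Finset.range (c + 1), (-1 : k) ^ (a + b + 3 + i) • G₁ a q b r (c + 1) (a + b + 3 + i)) =
        -((-1 : k) ^ (1 + a + c + q * b + q * c + r * c) • (∑ i ∈ Finset.range (c + 1), (-1 : k) ^ (a + q + b + r + 1 + i) • G₁ a q b r (c + 1) (a + b + 3 + i))) := by
      simp only [Finset.smul_sum, smul_smul, ← pow_add, ← Finset.sum_neg_distrib, ← neg_smul]
      refine Finset.sum_congr rfl fun i _ => ?_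
      rw [neg_one_pow_eq_neg]
      grind [Nat.not_even_one]

    simp only [split', h₂_first, h₂_last, h₃_first, h₃_last, smul_add, pow_zero, one_smul,
      Nat.add_zero]
    rw [e₁, e₂, e₃, e₄, e₅, e₆, e₇, e₈, e₉]
    simp only [show ∀ i, a + 1 + (i + 1) = a + 2 + i by omega]
    abel
  have e₁ : ∀ t : ℕ × ℕ × ℕ × ℕ, (-1 : k) ^ (1 + t.1 + t.2.2.2 + t.2.1 * 0 + t.2.1 * t.2.2.2 + t.2.2.1 * t.2.2.2) • (-1 : k) ^ (t.1 + 1) • G₁ t.1 t.2.1 0 t.2.2.1 t.2.2.2 (t.1 + 1) = (-1 : k) ^ (t.2.2.2 + t.2.1 * t.2.2.2 + t.2.2.1 * t.2.2.2) • G₁ t.1 t.2.1 0 t.2.2.1 t.2.2.2 (t.1 + 1) := by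
    rintro ⟨a, q, r, c⟩
    simp only [smul_smul, ← pow_add]
    rw [neg_one_pow_eq]
    grind [Nat.not_even_one]
  have e₂ : ∀ t : ℕ × ℕ × ℕ × ℕ, (-1 : k) ^ (1 + t.1 + 0 + t.2.1 * t.2.2.1 + t.2.1 * 0 + t.2.2.2 * 0) • (-1 : k) ^ (t.1 + t.2.2.1 + 2) • G₁ t.1 t.2.1 t.2.2.1 t.2.2.2 0 (t.1 + t.2.2.1 + 2) = (-1 : k) ^ (1 + t.2.2.1 + t.2.1 * t.2.2.1) • G₁ t.1 t.2.1 t.2.2.1 t.2.2.2 0 (t.1 + t.2.2.1 + 2) := by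
    rintro ⟨a, q, b, r⟩
    simp only [smul_smul, ← pow_add]
    rw [neg_one_pow_eq]
    grind [Nat.not_even_one]
  have key' := Finset.sum_congr (rfl : Finset.quintuples N = Finset.quintuples N) fun t _ =>
    key t.1 t.2.1 t.2.2.1 t.2.2.2.1 t.2.2.2.2
  simp only [split, smul_sub, smul_add, Finset.sum_add_distrib, Finset.sum_sub_distrib]
  -- The boundary sums that survive are the first face for `a = 0`, the face between the collapsed
  -- inputs for `b = 0`, and the last face for `c = 0`.
  rw [Finset.sum_quintuples_succ_first N fun t => (-1 : k) ^ (1 + t.1 + t.2.2.2.2 + t.2.1 * t.2.2.1 + t.2.1 * t.2.2.2.2 + t.2.2.2.1 * t.2.2.2.2) • (∑ i ∈ Finset.range t.1, (-1 : k) ^ i • G₁ t.1 t.2.1 t.2.2.1 t.2.2.2.1 t.2.2.2.2 i),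
    Finset.sum_quintuples_succ_first N fun t => (-1 : k) ^ (1 + t.1 + t.2.2.2.2 + t.2.1 * t.2.2.1 + t.2.1 * t.2.2.2.2 + t.2.2.2.1 * t.2.2.2.2) • (-1 : k) ^ t.1 • G₁ t.1 t.2.1 t.2.2.1 t.2.2.2.1 t.2.2.2.2 t.1,
    Finset.sum_quintuples_succ_third N fun t => (-1 : k) ^ (1 + t.1 + t.2.2.2.2 + t.2.1 * t.2.2.1 + t.2.1 * t.2.2.2.2 + t.2.2.2.1 * t.2.2.2.2) • (∑ i ∈ Finset.range (t.2.2.1 + 1), (-1 : k) ^ (t.1 + 1 + i) • G₁ t.1 t.2.1 t.2.2.1 t.2.2.2.1 t.2.2.2.2 (t.1 + 1 + i)),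
    Finset.sum_quintuples_succ_fifth N fun t => (-1 : k) ^ (1 + t.1 + t.2.2.2.2 + t.2.1 * t.2.2.1 + t.2.1 * t.2.2.2.2 + t.2.2.2.1 * t.2.2.2.2) • (-1 : k) ^ (t.1 + t.2.2.1 + 2) • G₁ t.1 t.2.1 t.2.2.1 t.2.2.2.1 t.2.2.2.2 (t.1 + t.2.2.1 + 2),
    Finset.sum_quintuples_succ_fifth N fun t => (-1 : k) ^ (1 + t.1 + t.2.2.2.2 + t.2.1 * t.2.2.1 + t.2.1 * t.2.2.2.2 + t.2.2.2.1 * t.2.2.2.2) • (∑ i ∈ Finset.range t.2.2.2.2, (-1 : k) ^ (t.1 + t.2.2.1 + 3 + i) • G₁ t.1 t.2.1 t.2.2.1 t.2.2.2.1 t.2.2.2.2 (t.1 + t.2.2.1 + 3 + i)),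
    Finset.sum_quintuples_succ_second N fun t => (-1 : k) ^ (1 + t.1 + t.2.2.2.2 + t.2.1 * t.2.2.1 + t.2.1 * t.2.2.2.2 + t.2.2.2.1 * t.2.2.2.2) • (-1 : k) ^ (t.1 + t.2.2.1 + t.2.2.2.2) • (∑ i ∈ Finset.range (t.2.1 + 1), (-1 : k) ^ i • G₂ t.1 t.2.1 t.2.2.1 t.2.2.2.1 t.2.2.2.2 i),
    Finset.sum_quintuples_succ_fourth N fun t => (-1 : k) ^ (1 + t.1 + t.2.2.2.2 + t.2.1 * t.2.2.1 + t.2.1 * t.2.2.2.2 + t.2.2.2.1 * t.2.2.2.2) • (-1 : k) ^ (t.1 + t.2.2.1 + t.2.2.2.2 + t.2.1) • (∑ i ∈ Finset.range (t.2.2.2.1 + 1), (-1 : k) ^ i • G₃ t.1 t.2.1 t.2.2.1 t.2.2.2.1 t.2.2.2.2 i)]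
  simp only [← e₁, ← e₂]
  simp only [smul_add, neg_add, Finset.sum_add_distrib, Finset.sum_sub_distrib,
    Finset.sum_neg_distrib] at key'
  simp only [h₂, h₃, pow_zero, one_smul, Finset.range_zero, Finset.sum_empty, smul_zero,
    Finset.sum_const_zero, add_zero, zero_add, Finset.sum_range_one]
  linear_combination (norm := abel) key'

end SignedSums

/-! ### Flips, parity and degree on homogeneous tensors -/

section GradedMaps

variable {k : Type u} [CommRing k]
variable {C : ℕ → Type v} [∀ n, AddCommGroup (C n)] [∀ n, Module k (C n)]

open Cooperad (incl₂)

theorem signedFlip_incl₂ (s : ℕ → ℕ → ℕ) (p q : ℕ) (y : C p ⊗[k] C q) :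
    signedFlip k C s (incl₂ k C p q y) =
      (-1 : k) ^ s p q • TensorProduct.comm k _ _ (incl₂ k C p q y) := by
  induction y using TensorProduct.induction_on with
  | zero => simp
  | add a b ha hb => simp only [map_add, ha, hb, smul_add]
  | tmul a b => simp [signedFlip]

theorem rTensor_congr_incl₂ {W : Type*} [AddCommGroup W] [Module k W]
    {f g : (⨁ n, C n) →ₗ[k] W} {p : ℕ}
    (h : ∀ x, f (DirectSum.lof k ℕ C p x) = g (DirectSum.lof k ℕ C p x)) (q : ℕ)
    (y : C p ⊗[k] C q) :
    LinearMap.rTensor _ f (incl₂ k C p q y) = LinearMap.rTensor _ g (incl₂ k C p q y) := by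
  induction y using TensorProduct.induction_on with
  | zero => simp
  | add a b ha hb => simp only [map_add, ha, hb]
  | tmul a b => simp [h]

theorem lTensor_congr_incl₂ {W : Type*} [AddCommGroup W] [Module k W]
    {f g : (⨁ n, C n) →ₗ[k] W} {q : ℕ}
    (h : ∀ x, f (DirectSum.lof k ℕ C q x) = g (DirectSum.lof k ℕ C q x)) (p : ℕ)
    (y : C p ⊗[k] C q) :
    LinearMap.lTensor _ f (incl₂ k C p q y) = LinearMap.lTensor _ g (incl₂ k C p q y) := by
  induction y using TensorProduct.induction_on with
  | zero => simp
  | add a b ha hb => simp only [map_add, ha, hb]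
  | tmul a b => simp [h]

theorem parity_lof (n : ℕ) (x : C n) :
    parity k C (DirectSum.lof k ℕ C n x) = (-1 : k) ^ n • DirectSum.lof k ℕ C n x := by
  simp [parity, DirectSum.lmap_lof]

theorem rTensor_parity_incl₂ (p q : ℕ) (y : C p ⊗[k] C q) :
    LinearMap.rTensor _ (parity k C) (incl₂ k C p q y) = (-1 : k) ^ p • incl₂ k C p q y := by
  rw [rTensor_congr_incl₂ (g := (-1 : k) ^ p • LinearMap.id) fun x => parity_lof p x,
    LinearMap.rTensor_smul, LinearMap.rTensor_id]
  rfl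

theorem incl₂_mem_tensorDegree (p q : ℕ) (y : C p ⊗[k] C q) :
    incl₂ k C p q y ∈ tensorDegree k C (p + q) :=
  Submodule.mem_iSup_of_mem p (Submodule.mem_iSup_of_mem q (Submodule.mem_iSup_of_mem rfl ⟨y, rfl⟩))

theorem comm_incl₂ (p q : ℕ) (y : C p ⊗[k] C q) :
    TensorProduct.comm k _ _ (incl₂ k C p q y) =
      incl₂ k C q p (TensorProduct.comm k _ _ y) := by
  induction y using TensorProduct.induction_on with
  | zero => simp
  | add a b ha hb => simp only [map_add, ha, hb]
  | tmul a b => simp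

end GradedMaps

namespace Cooperad

variable {k : Type u} [CommRing k]
variable {C : ℕ → Type v} [∀ n, AddCommGroup (C n)] [∀ n, Module k (C n)]
variable (X : Cooperad k C)

theorem exists_block_eq (a q b : ℕ) (x : ⨁ n, C n) :
    ∃ y, X.block a q b x = incl₂ k C (a + 1 + b) q y := ⟨_, rfl⟩

end Cooperad

/-! ### The chain operations as sums over blocks -/

namespace ComultiplicativeCooperad

open Cooperad (incl₂)

variable {k : Type u} [CommRing k]
variable {C : ℕ → Type v} [∀ n, AddCommGroup (C n)] [∀ n, Module k (C n)]
variable (X : ComultiplicativeCooperad k C)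

/-- Both factors are homogeneous of known degree, whatever `x` is, so the signs of flips and parity
operators can be read off. -/
theorem exists_cupPart_eq (a b : ℕ) (x : ⨁ n, C n) :
    ∃ y, X.cupPart a b x = incl₂ k C a b y := by
  refine ⟨LinearMap.rTensor _ (X.face a (a + 1)) (X.decomp (a + 1 + 0) b (a + 1) (by omega)
    (DirectSum.component k ℕ C (a + b + 0) x)), ?_⟩
  rw [cupPart, LinearMap.comp_apply, Cooperad.block, Cooperad.totalDecomp, LinearMap.comp_apply,
    LinearMap.comp_apply]
  generalize X.decomp (a + 1 + 0) b (a + 1) (by omega)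
    (DirectSum.component k ℕ C (a + b + 0) x) = y
  induction y using TensorProduct.induction_on with
  | zero => simp
  | add a b ha hb => simp only [map_add, ha, hb]
  | tmul y z => simpa using congrArg (· ⊗ₜ[k] _) (X.totalFace_lof a (a + 1) y)

theorem totalFace_eq_lof (n i : ℕ) (x : ⨁ n, C n) :
    ∃ y, X.totalFace (n + 1) i x = DirectSum.lof k ℕ C n y := ⟨_, rfl⟩

theorem totalDiff_lof (n : ℕ) (x : C n) :
    totalDiff X.diff (DirectSum.lof k ℕ C n x) =
      ∑ i ∈ Finset.range (n + 1), (-1 : k) ^ i • X.totalFace n i (DirectSum.lof k ℕ C n x) := by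
  cases n with
  | zero => simp [totalDiff, totalFace]
  | succ n =>
    simp only [totalFace_lof]
    simp [totalDiff, diff]

/-- The index `(p, q, i)` is replaced by the numbers `a = i - 1` and `b = p - i` of inputs before
and after the block, which makes the sign exponent `(q + 1) b`. -/
theorem cobrace_lof (n : ℕ) (x : C n) :
    X.cobrace (DirectSum.lof k ℕ C n x) =
      ∑ t ∈ Finset.triples n, (-1 : k) ^ ((t.2.1 + 1) * t.2.2) •
        X.block t.1 t.2.1 t.2.2 (DirectSum.lof k ℕ C n x) := by
  have h₁ : X.cobrace (DirectSum.lof k ℕ C n x) =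
      ∑ t ∈ (Finset.HasAntidiagonal.antidiagonal (n + 1)).attach, ∑ i ∈ Finset.Icc 1 t.1.1,
        (-1 : k) ^ ((t.1.2 + 1) * (t.1.1 - i)) • X.block (i - 1) t.1.2 (t.1.1 - i)
          (DirectSum.lof k ℕ C n x) := by
    simp only [cobrace, DirectSum.toModule_lof, LinearMap.sum_apply, LinearMap.smul_apply]
    refine Finset.sum_congr rfl fun t _ => Finset.sum_congr rfl fun i hi => ?_
    rw [Finset.mem_Icc] at hi
    rw [← X.totalDecomp_eq_block (Finset.HasAntidiagonal.mem_antidiagonal.1 t.2) (i := i)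
      (by omega) (by omega)]
    simp [Cooperad.totalDecomp, DirectSum.component.lof_self]
  rw [h₁, Finset.sum_attach (Finset.HasAntidiagonal.antidiagonal (n + 1)) fun t =>
    ∑ i ∈ Finset.Icc 1 t.1, (-1 : k) ^ ((t.2 + 1) * (t.1 - i)) • X.block (i - 1) t.2 (t.1 - i)
      (DirectSum.lof k ℕ C n x), Finset.sum_sigma']
  refine Finset.sum_bij' (fun t _ => (t.2 - 1, t.1.2, t.1.1 - t.2))
    (fun t _ => ⟨(t.1 + 1 + t.2.2, t.2.1), t.1 + 1⟩) ?_ ?_ ?_ ?_ ?_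
  · rintro ⟨⟨p, q⟩, i⟩ h
    simp only [Finset.mem_sigma, Finset.HasAntidiagonal.mem_antidiagonal, Finset.mem_Icc,
      Finset.mem_triples] at h ⊢
    omega
  · rintro ⟨a, q, b⟩ h
    simp only [Finset.mem_sigma, Finset.HasAntidiagonal.mem_antidiagonal, Finset.mem_Icc,
      Finset.mem_triples] at h ⊢
    omega
  · rintro ⟨⟨p, q⟩, i⟩ h
    simp only [Finset.mem_sigma, Finset.HasAntidiagonal.mem_antidiagonal, Finset.mem_Icc] at h
    simp only [Sigma.mk.injEq, Prod.mk.injEq, heq_eq_eq, and_true]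
    omega
  · rintro ⟨a, q, b⟩ h
    simp only [Prod.mk.injEq, true_and]
    omega
  · rintro ⟨⟨p, q⟩, i⟩ h
    rfl

theorem cup_lof (n : ℕ) (x : C n) :
    X.cup (DirectSum.lof k ℕ C n x) =
      ∑ t ∈ Finset.HasAntidiagonal.antidiagonal n,
        X.cupPart t.1 t.2 (DirectSum.lof k ℕ C n x) := by
  rw [← Finset.sum_attach]
  simp only [cup, DirectSum.toModule_lof, LinearMap.sum_apply]
  refine Finset.sum_congr rfl fun t _ => ?_
  have ht := Finset.HasAntidiagonal.mem_antidiagonal.1 t.2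
  have h : t.1.1 + 1 + t.1.2 = n + 1 := by omega
  change _ = LinearMap.rTensor _ (X.totalFace (t.1.1 + 1) (t.1.1 + 1))
    (X.block t.1.1 t.1.2 0 (DirectSum.lof k ℕ C n x))
  rw [X.block_lof t.1.1 t.1.2 0 h, LinearMap.comp_apply, LinearMap.comp_apply]
  change _ = LinearMap.rTensor _ _ (incl₂ k C (t.1.1 + 1) t.1.2 (X.decomp (t.1.1 + 1) t.1.2 _ h x))
  generalize X.decomp (t.1.1 + 1) t.1.2 (t.1.1 + 1) h x = y
  induction y using TensorProduct.induction_on with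
  | zero => simp
  | add a b ha hb => simp only [map_add, ha, hb]
  | tmul y z =>
    simp only [TensorProduct.map_tmul, LinearMap.rTensor_tmul, totalFace_lof]
    simp only [face, Nat.add_eq_zero_iff, one_ne_zero, and_false, if_false, if_true]

theorem cup_mem_tensorDegree (n : ℕ) (x : C n) :
    X.cup (DirectSum.lof k ℕ C n x) ∈ tensorDegree k C n := by
  rw [cup_lof]
  refine Submodule.sum_mem _ fun t ht => ?_
  obtain ⟨y, hy⟩ := X.exists_cupPart_eq t.1 t.2 (DirectSum.lof k ℕ C n x)
  rw [hy, ← Finset.HasAntidiagonal.mem_antidiagonal.1 ht]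
  exact incl₂_mem_tensorDegree _ _ _

theorem cobracket_mem_tensorDegree (n : ℕ) (x : C n) :
    X.cobracket (DirectSum.lof k ℕ C n x) ∈ tensorDegree k C (n + 1) := by
  rw [cobracket, LinearMap.comp_apply, cobrace_lof, map_sum]
  refine Submodule.sum_mem _ fun t ht => ?_
  obtain ⟨y, hy⟩ := X.exists_block_eq t.1 t.2.1 t.2.2 (DirectSum.lof k ℕ C n x)
  have h := Finset.mem_triples.1 ht
  rw [hy, map_smul, LinearMap.sub_apply, suspendedFlip, signedFlip_incl₂, comm_incl₂]
  refine Submodule.smul_mem _ _ (Submodule.sub_mem _ ?_ (Submodule.smul_mem _ _ ?_))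
  · rw [show n + 1 = t.1 + 1 + t.2.2 + t.2.1 by omega]
    exact incl₂_mem_tensorDegree _ _ _
  · rw [show n + 1 = t.2.1 + (t.1 + 1 + t.2.2) by omega]
    exact incl₂_mem_tensorDegree _ _ _

theorem totalDiff_comp_totalDiff : totalDiff X.diff ∘ₗ totalDiff X.diff = 0 := by
  refine DirectSum.linearMap_ext _ fun n => LinearMap.ext fun x => ?_
  rcases n with _ | _ | n
  · simp [totalDiff]
  · simp [totalDiff]
  · have lof : ∀ i, totalDiff X.diff (X.totalFace (n + 2) i (DirectSum.lof k ℕ C (n + 2) x)) =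
        ∑ j ∈ Finset.range (n + 2), (-1 : k) ^ j •
          X.totalFace (n + 1) j (X.totalFace (n + 2) i (DirectSum.lof k ℕ C (n + 2) x)) := fun i => by
      obtain ⟨y, hy⟩ := X.totalFace_eq_lof (n + 1) i (DirectSum.lof k ℕ C (n + 2) x)
      rw [hy, totalDiff_lof]
    simp only [LinearMap.comp_apply, totalDiff_lof, map_sum, map_smul, lof, Finset.smul_sum,
      LinearMap.zero_apply]
    rw [Finset.sum_sigma', ← Finset.sum_filter_add_sum_filter_not _ fun t => t.1 ≤ t.2,
      add_eq_zero_iff_eq_neg, ← Finset.sum_neg_distrib]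
    -- The classical pairing: a term with `i ≤ j` cancels the term with indices `(j + 1, i)`, by the
    -- simplicial identity.
    refine Finset.sum_bij' (fun t _ => ⟨t.2 + 1, t.1⟩) (fun t _ => ⟨t.2, t.1 - 1⟩) ?_ ?_ ?_ ?_ ?_
    · rintro ⟨i, j⟩ h
      simp only [Finset.mem_filter, Finset.mem_sigma, Finset.mem_range] at h ⊢
      omega
    · rintro ⟨i, j⟩ h
      simp only [Finset.mem_filter, Finset.mem_sigma, Finset.mem_range] at h ⊢
      omega
    · rintro ⟨i, j⟩ h
      simp
    · rintro ⟨i, j⟩ h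
      simp only [Finset.mem_filter, Finset.mem_sigma, Finset.mem_range] at h
      simp only [Sigma.mk.injEq, heq_eq_eq, and_true]
      omega
    · rintro ⟨i, j⟩ h
      simp only [Finset.mem_filter, Finset.mem_sigma, Finset.mem_range] at h ⊢
      rw [X.totalFace_totalFace n i j h.2 (by omega), ← smul_neg, ← neg_smul, smul_smul, smul_smul,
        pow_succ, mul_neg_one, neg_mul_neg, mul_comm]

/-! ### The homotopy for cocommutativity -/

theorem rTensor_totalDiff_block (a q b : ℕ) (x : ⨁ n, C n) :
    LinearMap.rTensor _ (totalDiff X.diff) (X.block a q b x) =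
      ∑ i ∈ Finset.range (a + b + 2), (-1 : k) ^ i •
        LinearMap.rTensor _ (X.totalFace (a + b + 1) i) (X.block a q b x) := by
  obtain ⟨y, hy⟩ := X.exists_block_eq a q b x
  have := rTensor_congr_incl₂ (W := ⨁ n, C n) (f := totalDiff X.diff)
    (g := ∑ i ∈ Finset.range (a + b + 2), (-1 : k) ^ i • X.totalFace (a + b + 1) i)
    (p := a + 1 + b) (fun x => by
      rw [totalDiff_lof, LinearMap.sum_apply, show a + b + 2 = a + 1 + b + 1 by omega,
        show a + b + 1 = a + 1 + b by omega]; rfl) q y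
  rw [hy, this, ← LinearMap.coe_rTensorHom, map_sum, LinearMap.sum_apply]
  simp only [map_smul, LinearMap.smul_apply, LinearMap.coe_rTensorHom]

theorem lTensor_totalDiff_block (a q b : ℕ) (x : ⨁ n, C n) :
    LinearMap.lTensor _ (totalDiff X.diff) (X.block a q b x) =
      ∑ i ∈ Finset.range (q + 1), (-1 : k) ^ i •
        LinearMap.lTensor _ (X.totalFace q i) (X.block a q b x) := by
  obtain ⟨y, hy⟩ := X.exists_block_eq a q b x
  have := lTensor_congr_incl₂ (W := ⨁ n, C n) (f := totalDiff X.diff)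
    (g := ∑ i ∈ Finset.range (q + 1), (-1 : k) ^ i • X.totalFace q i)
    (q := q) (fun x => by rw [totalDiff_lof, LinearMap.sum_apply]; rfl) (a + 1 + b) y
  rw [hy, this, ← LinearMap.coe_lTensorHom, map_sum, LinearMap.sum_apply]
  simp only [map_smul, LinearMap.smul_apply, LinearMap.coe_lTensorHom]

theorem suspendedTensorDiff_apply (t : (⨁ n, C n) ⊗[k] (⨁ n, C n)) :
    suspendedTensorDiff X.diff t = LinearMap.rTensor _ (totalDiff X.diff) t -
      LinearMap.rTensor _ (parity k C) (LinearMap.lTensor _ (totalDiff X.diff) t) := by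
  rw [← LinearMap.comp_apply (LinearMap.rTensor _ _), LinearMap.rTensor_comp_lTensor]
  rfl

theorem suspendedTensorDiff_block (a q b : ℕ) (x : ⨁ n, C n) :
    suspendedTensorDiff X.diff (X.block a q b x) =
      ∑ i ∈ Finset.range (a + b + 2), (-1 : k) ^ i •
        LinearMap.rTensor _ (X.totalFace (a + b + 1) i) (X.block a q b x) -
      (-1 : k) ^ (a + 1 + b) • ∑ i ∈ Finset.range (q + 1), (-1 : k) ^ i •
        LinearMap.lTensor _ (X.totalFace q i) (X.block a q b x) := by
  rw [suspendedTensorDiff_apply, rTensor_totalDiff_block, lTensor_rTensor_comm]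
  obtain ⟨y, hy⟩ := X.exists_block_eq a q b x
  rw [← lTensor_totalDiff_block, hy, rTensor_parity_incl₂, map_smul]

theorem cobrace_totalFace (n i : ℕ) (x : ⨁ n, C n) :
    X.cobrace (X.totalFace (n + 1) i x) =
      ∑ t ∈ Finset.triples n, (-1 : k) ^ ((t.2.1 + 1) * t.2.2) •
        X.block t.1 t.2.1 t.2.2 (X.totalFace (n + 1) i x) := by
  obtain ⟨y, hy⟩ := X.totalFace_eq_lof n i x
  rw [hy, cobrace_lof]

/-- For each block the faces of the argument are sorted into those before, inside and after the
block, and each is rewritten as a face of one of the two factors. -/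
theorem cobrace_totalDiff_lof (N : ℕ) (x : C (N + 1)) :
    X.cobrace (totalDiff X.diff (DirectSum.lof k ℕ C (N + 1) x)) =
      ∑ t ∈ Finset.triples N, (-1 : k) ^ ((t.2.1 + 1) * t.2.2) •
        (∑ i ∈ Finset.range (t.1 + 1), (-1 : k) ^ i •
            LinearMap.rTensor _ (X.totalFace (t.1 + 1 + t.2.2 + 1) i)
              (X.block (t.1 + 1) t.2.1 t.2.2 (DirectSum.lof k ℕ C (N + 1) x)) +
          ∑ i ∈ Finset.range t.2.1, (-1 : k) ^ (t.1 + 1 + i) •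
            LinearMap.lTensor _ (X.totalFace (t.2.1 + 1) (i + 1))
              (X.block t.1 (t.2.1 + 1) t.2.2 (DirectSum.lof k ℕ C (N + 1) x)) +
          ∑ i ∈ Finset.range (t.2.2 + 1), (-1 : k) ^ (t.1 + t.2.1 + 1 + i) •
            LinearMap.rTensor _ (X.totalFace (t.1 + (t.2.2 + 1) + 1) (t.1 + 2 + i))
              (X.block t.1 t.2.1 (t.2.2 + 1) (DirectSum.lof k ℕ C (N + 1) x))) := by
  simp only [totalDiff_lof, map_sum, map_smul, cobrace_totalFace]
  simp only [Finset.smul_sum (r := (-1 : k) ^ (_ : ℕ)) (s := Finset.triples N)]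
  rw [Finset.sum_comm]
  refine Finset.sum_congr rfl fun t ht => ?_
  simp only [smul_comm _ ((-1 : k) ^ ((t.2.1 + 1) * t.2.2)), ← Finset.smul_sum]
  obtain ⟨a, q, b⟩ := t
  obtain rfl : a + q + b = N := Finset.mem_triples.1 ht
  rw [show a + q + b + 1 + 1 = a + 1 + q + (b + 1) by omega, Finset.sum_range_add,
    Finset.sum_range_add]
  congr 2
  · congr 1
    · refine Finset.sum_congr rfl fun i hi => ?_
      rw [X.block_face_before a q b i (by simpa [Nat.lt_succ_iff] using hi),
        show a + 1 + b + 1 = a + b + 2 by omega]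
    · refine Finset.sum_congr rfl fun i hi => ?_
      rw [X.block_face_inside a q b i (by simpa using hi)]
  · refine Finset.sum_congr rfl fun i hi => ?_
    rw [show a + 1 + q + i = a + q + 1 + i by omega,
      X.block_face_after a q b i (by simpa [Nat.lt_succ_iff] using hi),
      show a + (b + 1) + 1 = a + b + 2 by omega]

/-- The cup coproduct lives in the unsuspended tensor square and the cobrace in the suspended one.
The parity operator on the left factor relates the two differentials (`tensorDiff_rTensor_parity`),
hence its presence. -/
theorem gradedFlip_cup_lof (n : ℕ) (x : C n) :
    LinearMap.rTensor _ (parity k C) (gradedFlip k C (X.cup (DirectSum.lof k ℕ C n x)) -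
      X.cup (DirectSum.lof k ℕ C n x)) =
      ∑ t ∈ Finset.HasAntidiagonal.antidiagonal n, (-1 : k) ^ ((t.1 + 1) * t.2) •
        TensorProduct.comm k _ _ (X.cupPart t.1 t.2 (DirectSum.lof k ℕ C n x)) -
      ∑ t ∈ Finset.HasAntidiagonal.antidiagonal n, (-1 : k) ^ t.1 •
        X.cupPart t.1 t.2 (DirectSum.lof k ℕ C n x) := by
  rw [map_sub, cup_lof, map_sum, map_sum, map_sum]
  congr 1 <;> refine Finset.sum_congr rfl fun t _ => ?_ <;>
    obtain ⟨y, hy⟩ := X.exists_cupPart_eq t.1 t.2 (DirectSum.lof k ℕ C n x)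
  · rw [hy, gradedFlip, signedFlip_incl₂, comm_incl₂, map_smul, rTensor_parity_incl₂, smul_smul,
      ← pow_add, add_mul, one_mul]
  · rw [hy, rTensor_parity_incl₂]

/-- The cobrace is a homotopy between the cup coproduct and its flip. -/
theorem suspendedTensorDiff_cobrace (x : ⨁ n, C n) :
    suspendedTensorDiff X.diff (X.cobrace x) - X.cobrace (totalDiff X.diff x) =
      LinearMap.rTensor _ (parity k C) (gradedFlip k C (X.cup x) - X.cup x) := by
  refine DirectSum.congr_of_lof
    (f := suspendedTensorDiff X.diff ∘ₗ X.cobrace - X.cobrace ∘ₗ totalDiff X.diff)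
    (g := LinearMap.rTensor _ (parity k C) ∘ₗ (gradedFlip k C ∘ₗ X.cup - X.cup)) (fun n x => ?_) x
  simp only [LinearMap.sub_apply, LinearMap.comp_apply]
  rw [gradedFlip_cup_lof, cobrace_lof, map_sum]
  simp only [map_smul, suspendedTensorDiff_block]
  cases n with
  | zero =>
    -- In degree zero only the empty block occurs; the two faces of its unary left factor give the
    -- flipped cup coproduct and the cup coproduct.
    have h₀ : Finset.triples 0 = {(0, 0, 0)} := by decide
    have h₁ := X.rTensor_face_first_block 0 0 (DirectSum.lof k ℕ C 0 x)
    have h₂ := X.rTensor_face_last_block 0 0 (DirectSum.lof k ℕ C 0 x)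
    rw [Nat.zero_add] at h₁ h₂
    have h₃ : X.totalFace 0 0 = 0 := rfl
    simp only [totalDiff_lof]
    simp [h₀, Finset.sum_range_succ, h₁, h₂, h₃, sub_eq_add_neg]
    exact (neg_smul (1 : k) (X.cupPart 0 0 (DirectSum.lof k ℕ C 0 x))).trans (congrArg _ (one_smul k _))
  | succ N =>
    rw [Finset.sum_triples_block_faces (k := k) N
      (fun a q b i => LinearMap.rTensor _ (X.totalFace (a + b + 1) i)
        (X.block a q b (DirectSum.lof k ℕ C (N + 1) x)))
      (fun a q b i => LinearMap.lTensor _ (X.totalFace q i)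
        (X.block a q b (DirectSum.lof k ℕ C (N + 1) x))) ?_ ?_ ?_, cobrace_totalDiff_lof,
      add_sub_cancel_left]
    · simp only [Nat.zero_add, Nat.add_zero, rTensor_face_first_block, rTensor_face_last_block]
    · intro a b i
      simp [totalFace]
    · intro a q b
      rw [block_lTensor_face_first, show a + 1 + b + 1 = a + b + 2 by omega]
    · intro a q b
      rw [block_lTensor_face_last, show a + (b + 1) + 1 = a + b + 2 by omega]

end ComultiplicativeCooperad

/-! ### Reindexing of nested sums over blocks and cuts -/

section NestedSums

variable {M : Type*} [AddCommMonoid M]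

theorem Finset.sum_triples_triples_left (n : ℕ) (f : ℕ → ℕ → ℕ → ℕ → ℕ → M) :
    ∑ t ∈ Finset.triples n, ∑ s ∈ Finset.triples t.1, f s.1 s.2.1 s.2.2 t.2.1 t.2.2 =
      ∑ t ∈ Finset.quintuples n, f t.1 t.2.1 t.2.2.1 t.2.2.2.1 t.2.2.2.2 := by
  rw [Finset.sum_sigma']
  refine Finset.sum_bij' (fun t _ => (t.2.1, t.2.2.1, t.2.2.2, t.1.2.1, t.1.2.2))
    (fun t _ => ⟨(t.1 + t.2.1 + t.2.2.1, t.2.2.2.1, t.2.2.2.2), t.1, t.2.1, t.2.2.1⟩)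
    ?_ ?_ ?_ ?_ ?_
  · rintro ⟨⟨A, r, C⟩, a, q, b⟩ h
    simp only [Finset.mem_sigma, Finset.mem_triples, Finset.mem_quintuples] at h ⊢
    omega
  · rintro ⟨a, q, b, r, c⟩ h
    simp only [Finset.mem_sigma, Finset.mem_triples, Finset.mem_quintuples,
      and_true] at h ⊢
    omega
  · rintro ⟨⟨A, r, C⟩, a, q, b⟩ h
    simp only [Finset.mem_sigma, Finset.mem_triples] at h
    simp only [h.2]
  · rintro ⟨a, q, b, r, c⟩ h
    rfl
  · rintro ⟨⟨A, r, C⟩, a, q, b⟩ h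
    rfl

theorem Finset.sum_triples_triples_right (n : ℕ) (f : ℕ → ℕ → ℕ → ℕ → ℕ → M) :
    ∑ t ∈ Finset.triples n, ∑ s ∈ Finset.triples t.2.2, f t.1 t.2.1 s.1 s.2.1 s.2.2 =
      ∑ t ∈ Finset.quintuples n, f t.1 t.2.1 t.2.2.1 t.2.2.2.1 t.2.2.2.2 := by
  rw [Finset.sum_sigma']
  refine Finset.sum_bij' (fun t _ => (t.1.1, t.1.2.1, t.2.1, t.2.2.1, t.2.2.2))
    (fun t _ => ⟨(t.1, t.2.1, t.2.2.1 + t.2.2.2.1 + t.2.2.2.2), t.2.2.1, t.2.2.2.1, t.2.2.2.2⟩)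
    ?_ ?_ ?_ ?_ ?_
  · rintro ⟨⟨A, r, C⟩, a, q, b⟩ h
    simp only [Finset.mem_sigma, Finset.mem_triples, Finset.mem_quintuples] at h ⊢
    omega
  · rintro ⟨a, q, b, r, c⟩ h
    simp only [Finset.mem_sigma, Finset.mem_triples, Finset.mem_quintuples,
      and_true] at h ⊢
    omega
  · rintro ⟨⟨A, r, C⟩, a, q, b⟩ h
    simp only [Finset.mem_sigma, Finset.mem_triples] at h
    simp only [h.2]
  · rintro ⟨a, q, b, r, c⟩ h
    rfl
  · rintro ⟨⟨A, r, C⟩, a, q, b⟩ h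
    rfl

/-- Nested blocks are indexed either by the inner block together with its extension to both sides,
or by the outer block together with a block inside it. -/
theorem Finset.sum_triples_antidiagonal_antidiagonal (n : ℕ) (f : ℕ → ℕ → ℕ → ℕ → ℕ → M) :
    ∑ t ∈ Finset.triples n, ∑ s ∈ Finset.HasAntidiagonal.antidiagonal t.1,
        ∑ u ∈ Finset.HasAntidiagonal.antidiagonal t.2.2, f s.1 s.2 t.2.1 u.1 u.2 =
      ∑ t ∈ Finset.triples n, ∑ s ∈ Finset.triples t.2.1, f t.1 s.1 s.2.1 s.2.2 t.2.2 := by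
  simp only [Finset.sum_sigma']
  refine Finset.sum_bij'
    (fun t _ => ⟨(t.2.1.1, t.2.1.2 + t.1.2.1 + t.2.2.1, t.2.2.2), t.2.1.2, t.1.2.1, t.2.2.1⟩)
    (fun t _ => ⟨(t.1.1 + t.2.1, t.2.2.1, t.2.2.2 + t.1.2.2), (t.1.1, t.2.1), t.2.2.2, t.1.2.2⟩)
    ?_ ?_ ?_ ?_ ?_
  · rintro ⟨⟨A, r, C⟩, ⟨a, b⟩, c, e⟩ h
    simp only [Finset.mem_sigma, Finset.mem_triples, Finset.HasAntidiagonal.mem_antidiagonal,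
      and_true] at h ⊢
    omega
  · rintro ⟨⟨a, s, e⟩, b, r, c⟩ h
    simp only [Finset.mem_sigma, Finset.mem_triples, Finset.HasAntidiagonal.mem_antidiagonal,
      and_true] at h ⊢
    omega
  · rintro ⟨⟨A, r, C⟩, ⟨a, b⟩, c, e⟩ h
    simp only [Finset.mem_sigma, Finset.HasAntidiagonal.mem_antidiagonal] at h
    simp only [h.2.1, h.2.2]
  · rintro ⟨⟨a, s, e⟩, b, r, c⟩ h
    simp only [Finset.mem_sigma, Finset.mem_triples] at h
    simp only [h.2]
  · rintro ⟨⟨A, r, C⟩, ⟨a, b⟩, c, e⟩ h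
    rfl

theorem Finset.sum_antidiagonal_antidiagonal (n : ℕ) (f : ℕ → ℕ → ℕ → M) :
    ∑ t ∈ Finset.HasAntidiagonal.antidiagonal n, ∑ s ∈ Finset.HasAntidiagonal.antidiagonal t.1,
        f s.1 s.2 t.2 =
      ∑ t ∈ Finset.HasAntidiagonal.antidiagonal n, ∑ s ∈ Finset.HasAntidiagonal.antidiagonal t.2,
        f t.1 s.1 s.2 := by
  simp only [Finset.sum_sigma']
  refine Finset.sum_bij' (fun t _ => ⟨(t.2.1, t.2.2 + t.1.2), t.2.2, t.1.2⟩)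
    (fun t _ => ⟨(t.1.1 + t.2.1, t.2.2), t.1.1, t.2.1⟩) ?_ ?_ ?_ ?_ ?_
  · rintro ⟨⟨A, c⟩, a, b⟩ h
    simp only [Finset.mem_sigma, Finset.HasAntidiagonal.mem_antidiagonal,
      and_true] at h ⊢
    omega
  · rintro ⟨⟨a, B⟩, b, c⟩ h
    simp only [Finset.mem_sigma, Finset.HasAntidiagonal.mem_antidiagonal,
      and_true] at h ⊢
    omega
  · rintro ⟨⟨A, c⟩, a, b⟩ h
    simp only [Finset.mem_sigma, Finset.HasAntidiagonal.mem_antidiagonal] at h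
    simp only [h.2]
  · rintro ⟨⟨a, B⟩, b, c⟩ h
    simp only [Finset.mem_sigma, Finset.HasAntidiagonal.mem_antidiagonal] at h
    simp only [h.2]
  · rintro ⟨⟨A, c⟩, a, b⟩ h
    rfl

/-- Trichotomy for a block relative to the distinguished input number `A + 1`: it ends before that
input, begins after it, or contains it. Empty blocks fall under the first two cases. -/
theorem Finset.sum_triples_add_one_add (A C : ℕ) (f : ℕ → ℕ → ℕ → M) :
    ∑ t ∈ Finset.triples (A + 1 + C), f t.1 t.2.1 t.2.2 =
      ∑ t ∈ Finset.triples A, f t.1 t.2.1 (t.2.2 + 1 + C) +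
      ∑ t ∈ Finset.triples C, f (A + 1 + t.1) t.2.1 t.2.2 +
      ∑ s ∈ Finset.HasAntidiagonal.antidiagonal A, ∑ u ∈ Finset.HasAntidiagonal.antidiagonal C,
        f s.1 (s.2 + 1 + u.1) u.2 := by
  classical
  rw [← Finset.sum_filter_add_sum_filter_not _ fun t => t.1 + t.2.1 ≤ A,
    ← Finset.sum_filter_add_sum_filter_not (Finset.filter
      (fun t : ℕ × ℕ × ℕ => ¬(t.1 + t.2.1 ≤ A)) _) fun t => A + 1 ≤ t.1, Finset.sum_sigma',
    add_assoc (G := M)]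
  congr 1
  · refine Finset.sum_bij' (fun t _ => (t.1, t.2.1, t.2.2 - 1 - C))
      (fun t _ => (t.1, t.2.1, t.2.2 + 1 + C)) ?_ ?_ ?_ ?_ ?_
    all_goals
      rintro ⟨a, q, b⟩ h
      simp only [Finset.mem_filter, Finset.mem_triples, Prod.mk.injEq, true_and] at h ⊢
    any_goals omega
    rw [show b - 1 - C + 1 + C = b by omega]
  congr 1
  · refine Finset.sum_bij' (fun t _ => (t.1 - (A + 1), t.2.1, t.2.2))
      (fun t _ => (A + 1 + t.1, t.2.1, t.2.2)) ?_ ?_ ?_ ?_ ?_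
    all_goals
      rintro ⟨a, q, b⟩ h
      simp only [Finset.mem_filter, Finset.mem_triples, Prod.mk.injEq, and_true] at h ⊢
    any_goals omega
    rw [show A + 1 + (a - (A + 1)) = a by omega]
  · refine Finset.sum_bij' (fun t _ => ⟨(t.1, A - t.1), (C - t.2.2, t.2.2)⟩)
      (fun t _ => (t.1.1, t.1.2 + 1 + t.2.1, t.2.2)) ?_ ?_ ?_ ?_ ?_
    · rintro ⟨a, q, b⟩ h
      simp only [Finset.mem_filter, Finset.mem_triples, Finset.mem_sigma,
        Finset.HasAntidiagonal.mem_antidiagonal] at h ⊢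
      omega
    · rintro ⟨⟨a, b⟩, c, e⟩ h
      simp only [Finset.mem_filter, Finset.mem_triples, Finset.mem_sigma,
        Finset.HasAntidiagonal.mem_antidiagonal] at h ⊢
      omega
    · rintro ⟨a, q, b⟩ h
      simp only [Finset.mem_filter, Finset.mem_triples, Prod.mk.injEq, true_and, and_true] at h ⊢
      omega
    · rintro ⟨⟨a, b⟩, c, e⟩ h
      simp only [Finset.mem_sigma, Finset.HasAntidiagonal.mem_antidiagonal] at h
      simp only [Sigma.mk.injEq, Prod.mk.injEq, true_and, and_true, heq_eq_eq]
      omega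
    · rintro ⟨a, q, b⟩ h
      simp only [Finset.mem_filter, Finset.mem_triples] at h ⊢
      rw [show A - a + 1 + (C - b) = q by omega]

/-- A cut never splits the distinguished input, so it lies in front of it or behind it. -/
theorem Finset.sum_antidiagonal_add_one_add (A C : ℕ) (f : ℕ → ℕ → M) :
    ∑ t ∈ Finset.HasAntidiagonal.antidiagonal (A + 1 + C), f t.1 t.2 =
      ∑ t ∈ Finset.HasAntidiagonal.antidiagonal A, f t.1 (t.2 + 1 + C) +
      ∑ t ∈ Finset.HasAntidiagonal.antidiagonal C, f (A + 1 + t.1) t.2 := by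
  rw [← Finset.sum_filter_add_sum_filter_not _ fun t => t.1 ≤ A]
  congr 1
  · refine Finset.sum_bij' (fun t _ => (t.1, t.2 - 1 - C)) (fun t _ => (t.1, t.2 + 1 + C))
      ?_ ?_ ?_ ?_ ?_
    all_goals
      rintro ⟨a, b⟩ h
      simp only [Finset.mem_filter, Finset.HasAntidiagonal.mem_antidiagonal, Prod.mk.injEq,
        true_and] at h ⊢
    any_goals omega
    rw [show b - 1 - C + 1 + C = b by omega]
  · refine Finset.sum_bij' (fun t _ => (t.1 - (A + 1), t.2)) (fun t _ => (A + 1 + t.1, t.2))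
      ?_ ?_ ?_ ?_ ?_
    all_goals
      rintro ⟨a, b⟩ h
      simp only [Finset.mem_filter, Finset.HasAntidiagonal.mem_antidiagonal, Prod.mk.injEq,
        and_true] at h ⊢
    any_goals omega
    rw [show A + 1 + (a - (A + 1)) = a by omega]

end NestedSums

/-! ### Symmetric group relations for suspended flips -/

section TensorExt

variable {k : Type u} [CommRing k]
variable {C : ℕ → Type v} [∀ n, AddCommGroup (C n)] [∀ n, Module k (C n)]

theorem DirectSum.tensor_ext₂ {W : Type*} [AddCommGroup W] [Module k W]
    {f g : (⨁ n, C n) ⊗[k] (⨁ n, C n) →ₗ[k] W}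
    (h : ∀ p q x y, f (DirectSum.lof k ℕ C p x ⊗ₜ DirectSum.lof k ℕ C q y) =
      g (DirectSum.lof k ℕ C p x ⊗ₜ DirectSum.lof k ℕ C q y)) : f = g := by
  refine TensorProduct.ext (DirectSum.linearMap_ext _ fun p => LinearMap.ext fun x =>
    DirectSum.linearMap_ext _ fun q => LinearMap.ext fun y => h p q x y)

theorem DirectSum.tensor_ext₃ {W : Type*} [AddCommGroup W] [Module k W]
    {f g : ((⨁ n, C n) ⊗[k] (⨁ n, C n)) ⊗[k] (⨁ n, C n) →ₗ[k] W}
    (h : ∀ p q r x y z, f (DirectSum.lof k ℕ C p x ⊗ₜ DirectSum.lof k ℕ C q y ⊗ₜ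
        DirectSum.lof k ℕ C r z) =
      g (DirectSum.lof k ℕ C p x ⊗ₜ DirectSum.lof k ℕ C q y ⊗ₜ DirectSum.lof k ℕ C r z)) :
    f = g := by
  refine TensorProduct.ext (DirectSum.tensor_ext₂ fun p q x y =>
    DirectSum.linearMap_ext _ fun r => LinearMap.ext fun z => h p q r x y z)

theorem signedFlip_tmul (s : ℕ → ℕ → ℕ) (p q : ℕ) (x : C p) (y : C q) :
    signedFlip k C s (DirectSum.lof k ℕ C p x ⊗ₜ DirectSum.lof k ℕ C q y) =
      (-1 : k) ^ s p q • (DirectSum.lof k ℕ C q y ⊗ₜ DirectSum.lof k ℕ C p x) := by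
  simp [signedFlip]

theorem onLastTwo_tmul {W : Type w} [AddCommGroup W] [Module k W] (f : W ⊗[k] W →ₗ[k] W ⊗[k] W)
    (x y z : W) : onLastTwo f (x ⊗ₜ y ⊗ₜ z) =
      (TensorProduct.assoc k W W W).symm (x ⊗ₜ f (y ⊗ₜ z)) := rfl

theorem suspendedFlip_suspendedFlip (t : (⨁ n, C n) ⊗[k] (⨁ n, C n)) :
    suspendedFlip k C (suspendedFlip k C t) = t := by
  refine LinearMap.congr_fun (f := suspendedFlip k C ∘ₗ suspendedFlip k C) (g := LinearMap.id)
    (DirectSum.tensor_ext₂ fun p q x y => ?_) t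
  simp only [suspendedFlip, LinearMap.comp_apply, signedFlip_tmul, map_smul, smul_smul, ← pow_add,
    LinearMap.id_apply]
  rw [mul_comm (q + 1), Even.neg_one_pow ⟨_, rfl⟩, one_smul]

/-- Both sides reverse three homogeneous elements, and each pair contributes its sign once, in a
different order. -/
theorem suspendedFlip_braid (t : ((⨁ n, C n) ⊗[k] (⨁ n, C n)) ⊗[k] (⨁ n, C n)) :
    onLastTwo (suspendedFlip k C) (LinearMap.rTensor _ (suspendedFlip k C)
        (onLastTwo (suspendedFlip k C) t)) =
      LinearMap.rTensor _ (suspendedFlip k C) (onLastTwo (suspendedFlip k C)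
        (LinearMap.rTensor _ (suspendedFlip k C) t)) := by
  refine LinearMap.congr_fun (f := onLastTwo (suspendedFlip k C) ∘ₗ
    LinearMap.rTensor _ (suspendedFlip k C) ∘ₗ onLastTwo (suspendedFlip k C))
    (g := LinearMap.rTensor _ (suspendedFlip k C) ∘ₗ onLastTwo (suspendedFlip k C) ∘ₗ
      LinearMap.rTensor _ (suspendedFlip k C))
    (DirectSum.tensor_ext₃ fun p q r x y z => ?_) t
  simp only [suspendedFlip, LinearMap.comp_apply, signedFlip_tmul, onLastTwo_tmul,
    LinearMap.rTensor_tmul, TensorProduct.tmul_smul, map_smul, TensorProduct.assoc_symm_tmul,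
    ← TensorProduct.smul_tmul', smul_smul]
  congr 1
  ring

theorem onLastTwo_onLastTwo_suspendedFlip (t : ((⨁ n, C n) ⊗[k] (⨁ n, C n)) ⊗[k] (⨁ n, C n)) :
    onLastTwo (suspendedFlip k C) (onLastTwo (suspendedFlip k C) t) = t := by
  refine LinearMap.congr_fun (f := onLastTwo (suspendedFlip k C) ∘ₗ onLastTwo (suspendedFlip k C))
    (g := LinearMap.id) (DirectSum.tensor_ext₃ fun p q r x y z => ?_) t
  have := suspendedFlip_suspendedFlip
    (DirectSum.lof k ℕ C q y ⊗ₜ[k] DirectSum.lof k ℕ C r z)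
  simp only [onLastTwo, LinearMap.comp_apply, LinearEquiv.coe_coe, LinearEquiv.apply_symm_apply,
    TensorProduct.assoc_tmul, LinearMap.lTensor_tmul, this, TensorProduct.assoc_symm_tmul,
    LinearMap.id_apply]

theorem rTensor_rTensor_suspendedFlip (t : ((⨁ n, C n) ⊗[k] (⨁ n, C n)) ⊗[k] (⨁ n, C n)) :
    LinearMap.rTensor _ (suspendedFlip k C) (LinearMap.rTensor _ (suspendedFlip k C) t) = t := by
  rw [← LinearMap.comp_apply, ← LinearMap.rTensor_comp,
    show suspendedFlip k C ∘ₗ suspendedFlip k C = LinearMap.id from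
      LinearMap.ext suspendedFlip_suspendedFlip, LinearMap.rTensor_id]
  rfl

theorem tensorDegree_induction {n : ℕ} {P : (⨁ n, C n) ⊗[k] (⨁ n, C n) → Prop}
    (zero : P 0) (add : ∀ s t, P s → P t → P (s + t))
    (tmul : ∀ p q x y, p + q = n → P (DirectSum.lof k ℕ C p x ⊗ₜ DirectSum.lof k ℕ C q y))
    {t : (⨁ n, C n) ⊗[k] (⨁ n, C n)} (ht : t ∈ tensorDegree k C n) : P t := by
  refine Submodule.iSup_induction _ (motive := P) ht (fun p t ht => ?_) zero add
  refine Submodule.iSup_induction _ (motive := P) ht (fun q t ht => ?_) zero add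
  by_cases h : p + q = n
  · rw [iSup_pos h] at ht
    obtain ⟨y, rfl⟩ := ht
    induction y using TensorProduct.induction_on with
    | zero => simpa using zero
    | add a b ha hb => rw [map_add]; exact add _ _ ha hb
    | tmul a b => exact tmul p q a b h
  · rw [iSup_neg h] at ht
    rw [(Submodule.mem_bot k).1 ht]
    exact zero

/-- A map of degree one commutes with the suspended flips. -/
theorem rTensor_suspendedFlip {f : (⨁ n, C n) →ₗ[k] (⨁ n, C n) ⊗[k] (⨁ n, C n)}
    (hf : ∀ (n : ℕ) (x : C n), f (DirectSum.lof k ℕ C n x) ∈ tensorDegree k C (n + 1))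
    (t : (⨁ n, C n) ⊗[k] (⨁ n, C n)) :
    LinearMap.rTensor _ f (suspendedFlip k C t) =
      onLastTwo (suspendedFlip k C) (LinearMap.rTensor _ (suspendedFlip k C) (idTensor f t)) := by
  refine LinearMap.congr_fun (f := LinearMap.rTensor _ f ∘ₗ suspendedFlip k C)
    (g := onLastTwo (suspendedFlip k C) ∘ₗ LinearMap.rTensor _ (suspendedFlip k C) ∘ₗ idTensor f)
    (DirectSum.tensor_ext₂ fun p q x y => ?_) t
  have key := tensorDegree_induction (P := fun t =>
      (-1 : k) ^ ((p + 1) * (q + 1)) • (t ⊗ₜ[k] DirectSum.lof k ℕ C p x) =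
      onLastTwo (suspendedFlip k C) (LinearMap.rTensor _ (suspendedFlip k C)
        ((TensorProduct.assoc k _ _ _).symm (DirectSum.lof k ℕ C p x ⊗ₜ t))))
    (by simp) (fun s t hs ht => by
      simp only [TensorProduct.add_tmul, TensorProduct.tmul_add, map_add, smul_add, hs, ht])
    (fun i j a b h => by
      simp only [suspendedFlip, TensorProduct.assoc_symm_tmul, LinearMap.rTensor_tmul,
        signedFlip_tmul, TensorProduct.smul_tmul', onLastTwo_tmul,
        TensorProduct.tmul_smul, smul_smul]
      rw [← pow_add]
      congr 3
      refine neg_one_pow_eq ?_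
      -- The factors of `f y` have `i + j = q + 1`, so their suspended degrees add up to `q + 1`
      -- modulo two, the suspended degree of `y`.
      obtain rfl : i = q + 1 - j := by omega
      have : j ≤ q + 1 := by omega
      grind [Nat.not_even_one]) (hf q y)
  simp only [LinearMap.comp_apply, idTensor, LinearEquiv.coe_coe, LinearMap.lTensor_tmul]
  rw [← key]
  simp only [suspendedFlip, signedFlip_tmul, map_smul, LinearMap.rTensor_tmul]

end TensorExt

/-! ### Suspension signs and antisymmetrization of pre-Lie cobrackets -/

section GradedMaps

variable {k : Type u} [CommRing k]
variable {C : ℕ → Type v} [∀ n, AddCommGroup (C n)] [∀ n, Module k (C n)]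

open Cooperad (incl₂)

theorem rTensor_incl₂_eq_sum {W ι : Type*} [AddCommGroup W] [Module k W] (s : Finset ι) (c : ι → k)
    {f : (⨁ n, C n) →ₗ[k] W} {g : ι → (⨁ n, C n) →ₗ[k] W} {p : ℕ}
    (h : ∀ x, f (DirectSum.lof k ℕ C p x) = ∑ i ∈ s, c i • g i (DirectSum.lof k ℕ C p x)) (q : ℕ)
    (y : C p ⊗[k] C q) :
    LinearMap.rTensor _ f (incl₂ k C p q y) =
      ∑ i ∈ s, c i • LinearMap.rTensor _ (g i) (incl₂ k C p q y) := by
  induction y using TensorProduct.induction_on with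
  | zero => simp
  | add a b ha hb => simp only [map_add, ha, hb, smul_add, Finset.sum_add_distrib]
  | tmul a b =>
    simp only [TensorProduct.map_tmul, LinearMap.rTensor_tmul, h, TensorProduct.sum_tmul,
      ← TensorProduct.smul_tmul']

theorem lTensor_incl₂_eq_sum {W ι : Type*} [AddCommGroup W] [Module k W] (s : Finset ι) (c : ι → k)
    {f : (⨁ n, C n) →ₗ[k] W} {g : ι → (⨁ n, C n) →ₗ[k] W} {q : ℕ}
    (h : ∀ x, f (DirectSum.lof k ℕ C q x) = ∑ i ∈ s, c i • g i (DirectSum.lof k ℕ C q x)) (p : ℕ)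
    (y : C p ⊗[k] C q) :
    LinearMap.lTensor _ f (incl₂ k C p q y) =
      ∑ i ∈ s, c i • LinearMap.lTensor _ (g i) (incl₂ k C p q y) := by
  induction y using TensorProduct.induction_on with
  | zero => simp
  | add a b ha hb => simp only [map_add, ha, hb, smul_add, Finset.sum_add_distrib]
  | tmul a b =>
    simp only [TensorProduct.map_tmul, LinearMap.lTensor_tmul, h, TensorProduct.tmul_sum,
      TensorProduct.tmul_smul]

theorem TensorProduct.neg_smul_tensor {W₁ W₂ : Type*} [AddCommGroup W₁] [Module k W₁]
    [AddCommGroup W₂] [Module k W₂] (c : k) (t : W₁ ⊗[k] W₂) : (-c) • t = -(c • t) :=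
  neg_smul c t

/-- In bidegree `(p, q)` the exponents of `ρ` and `τ` differ by `p + q + 1`. The parity operator
supplies exactly this sign, so `ρ` exchanges the two terms of the defect with the right signs. This
is why `id - ρ` turns the cobrace into a chain map. -/
theorem suspendedFlip_parity (t : (⨁ n, C n) ⊗[k] (⨁ n, C n)) :
    suspendedFlip k C (LinearMap.rTensor _ (parity k C) (gradedFlip k C t - t)) =
      LinearMap.rTensor _ (parity k C) (gradedFlip k C t - t) := by
  refine LinearMap.congr_fun
    (f := suspendedFlip k C ∘ₗ LinearMap.rTensor _ (parity k C) ∘ₗ (gradedFlip k C - LinearMap.id))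
    (g := LinearMap.rTensor _ (parity k C) ∘ₗ (gradedFlip k C - LinearMap.id))
    (DirectSum.tensor_ext₂ fun p q x y => ?_) t
  simp only [gradedFlip, suspendedFlip, LinearMap.comp_apply, LinearMap.sub_apply, signedFlip_tmul,
    map_sub, map_smul, LinearMap.id_apply, LinearMap.rTensor_tmul, parity_lof,
    ← TensorProduct.smul_tmul', smul_smul, ← pow_add]
  rw [neg_one_pow_eq_neg (m := p * q + q + (q + 1) * (p + 1)) (n := p) (by grind [Nat.not_even_one]),
    neg_one_pow_eq_neg (m := p + (p + 1) * (q + 1)) (n := p * q + q) (by grind [Nat.not_even_one]),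
    TensorProduct.neg_smul_tensor, TensorProduct.neg_smul_tensor]
  abel

variable (d : ∀ n, C (n + 1) →ₗ[k] C n)

theorem totalDiff_lof_zero (x : C 0) : totalDiff d (DirectSum.lof k ℕ C 0 x) = 0 := by
  simp [totalDiff]

theorem totalDiff_lof_succ (n : ℕ) (x : C (n + 1)) :
    totalDiff d (DirectSum.lof k ℕ C (n + 1) x) = DirectSum.lof k ℕ C n (d n x) := by
  simp [totalDiff]

/-- The map `ρ` is the Koszul flip of the desuspension, hence a chain map for the suspended
differential. -/
theorem suspendedTensorDiff_suspendedFlip (t : (⨁ n, C n) ⊗[k] (⨁ n, C n)) :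
    suspendedTensorDiff d (suspendedFlip k C t) = suspendedFlip k C (suspendedTensorDiff d t) := by
  refine LinearMap.congr_fun (f := suspendedTensorDiff d ∘ₗ suspendedFlip k C)
    (g := suspendedFlip k C ∘ₗ suspendedTensorDiff d) (DirectSum.tensor_ext₂ fun p q x y => ?_) t
  rcases p with _ | p <;> rcases q with _ | q <;>
  simp only [suspendedTensorDiff, suspendedFlip, LinearMap.comp_apply, LinearMap.sub_apply,
    signedFlip_tmul, map_sub, map_smul, LinearMap.id_apply, TensorProduct.map_tmul, parity_lof,
    totalDiff_lof_zero, totalDiff_lof_succ, TensorProduct.zero_tmul, TensorProduct.tmul_zero,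
    ← TensorProduct.smul_tmul', smul_smul, ← pow_add, sub_zero, zero_sub, smul_sub, smul_zero,
    map_zero, map_neg, smul_neg]
  · rw [neg_one_pow_eq_neg (m := (0 + 1) * (q + 1 + 1)) (n := 0 + (0 + 1) * (q + 1))
      (by grind [Nat.not_even_one]), TensorProduct.neg_smul_tensor]
  · rw [neg_one_pow_eq_neg (m := (p + 1 + 1) * (0 + 1) + 0) (n := (p + 1) * (0 + 1))
      (by grind [Nat.not_even_one]), TensorProduct.neg_smul_tensor, neg_neg]
  · rw [neg_one_pow_eq_neg (m := (p + 1 + 1) * (q + 1 + 1) + (q + 1)) (n := (p + 1) * (q + 1 + 1))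
      (by grind [Nat.not_even_one]), neg_one_pow_eq_neg (m := (p + 1 + 1) * (q + 1 + 1))
      (n := p + 1 + (p + 1 + 1) * (q + 1)) (by grind [Nat.not_even_one]), TensorProduct.neg_smul_tensor, TensorProduct.neg_smul_tensor]
    abel

/-- The differential of the left factor anticommutes with parity, while the sign in the other term
is opposite for the two differentials. Together they give one global sign. -/
theorem tensorDiff_rTensor_parity (t : (⨁ n, C n) ⊗[k] (⨁ n, C n)) :
    tensorDiff d (LinearMap.rTensor _ (parity k C) t) =
      -LinearMap.rTensor _ (parity k C) (suspendedTensorDiff d t) := by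
  refine LinearMap.congr_fun (f := tensorDiff d ∘ₗ LinearMap.rTensor _ (parity k C))
    (g := -(LinearMap.rTensor _ (parity k C) ∘ₗ suspendedTensorDiff d))
    (DirectSum.tensor_ext₂ fun p q x y => ?_) t
  rcases p with _ | p <;>
  simp only [suspendedTensorDiff, tensorDiff, LinearMap.comp_apply, LinearMap.sub_apply,
    LinearMap.add_apply, LinearMap.neg_apply, LinearMap.rTensor_tmul,
    map_sub, map_smul, LinearMap.id_apply, TensorProduct.map_tmul, parity_lof,
    totalDiff_lof_zero, totalDiff_lof_succ, TensorProduct.zero_tmul, pow_zero, one_smul,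
    ← TensorProduct.smul_tmul', smul_smul, ← pow_add, zero_sub, zero_add,
    map_neg, neg_neg]
  rw [neg_one_pow_eq_neg (m := p + 1) (n := p) (by grind [Nat.not_even_one]), TensorProduct.neg_smul_tensor,
    neg_one_pow_eq_neg (m := p + 1 + (p + 1)) (n := 1) (by grind [Nat.not_even_one]), pow_one, neg_neg,
    one_smul, TensorProduct.neg_smul_tensor, smul_add, smul_neg, smul_smul, ← pow_add,
    Even.neg_one_pow ⟨p, rfl⟩, one_smul]
  abel

theorem parity_parity (x : ⨁ n, C n) : parity k C (parity k C x) = x := by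
  refine DirectSum.congr_of_lof (f := parity k C ∘ₗ parity k C) (g := LinearMap.id) (fun n x => ?_) x
  rw [LinearMap.comp_apply, parity_lof, map_smul, parity_lof, smul_smul, ← pow_add,
    Even.neg_one_pow ⟨n, rfl⟩, one_smul]
  rfl

theorem rTensor_parity_rTensor_parity (t : (⨁ n, C n) ⊗[k] (⨁ n, C n)) :
    LinearMap.rTensor _ (parity k C) (LinearMap.rTensor _ (parity k C) t) = t := by
  rw [← LinearMap.comp_apply, ← LinearMap.rTensor_comp,
    show parity k C ∘ₗ parity k C = LinearMap.id from LinearMap.ext parity_parity,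
    LinearMap.rTensor_id]
  rfl

/-- If `K` satisfies the coassociativity relation of a pre-Lie coalgebra, its antisymmetrization
satisfies the coJacobi identity. -/
theorem coJacobiator_eq_zero {K : (⨁ n, C n) →ₗ[k] (⨁ n, C n) ⊗[k] (⨁ n, C n)}
    (hK : ∀ (n : ℕ) (x : C n), K (DirectSum.lof k ℕ C n x) ∈ tensorDegree k C (n + 1))
    (h : ∀ (n : ℕ) (x : C n), ∃ t, LinearMap.rTensor _ K (K (DirectSum.lof k ℕ C n x)) =
      idTensor K (K (DirectSum.lof k ℕ C n x)) + t + onLastTwo (suspendedFlip k C) t) :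
    coJacobiator k C ((LinearMap.id - suspendedFlip k C) ∘ₗ K) = 0 := by
  refine DirectSum.linearMap_ext _ fun n => LinearMap.ext fun x => ?_
  obtain ⟨t, ht⟩ := h n x
  have h₁ := rTensor_suspendedFlip hK (K (DirectSum.lof k ℕ C n x))
  have h₂ := fun t => suspendedFlip_braid (k := k) (C := C) t
  have h₃ := fun t => onLastTwo_onLastTwo_suspendedFlip (k := k) (C := C) t
  have h₄ := fun t => rTensor_rTensor_suspendedFlip (k := k) (C := C) t
  -- With involutivity and the braid relation, all terms become permutations of `t` and of `(id ⊗ K)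
  -- K x`, and these cancel in pairs.
  simp only [coJacobiator, LinearMap.comp_apply, LinearMap.add_apply, LinearMap.id_apply,
    LinearMap.rTensor_comp, LinearMap.rTensor_sub, LinearMap.rTensor_id, LinearMap.sub_apply,
    map_sub, map_add, h₁, ht, h₃, h₄, h₂, LinearMap.zero_apply]
  abel

end GradedMaps

/-! ### Chain maps, coassociativity, cocommutativity and coJacobi -/

namespace ComultiplicativeCooperad

open Cooperad (incl₂)

variable {k : Type u} [CommRing k]
variable {C : ℕ → Type v} [∀ n, AddCommGroup (C n)] [∀ n, Module k (C n)]
variable (X : ComultiplicativeCooperad k C)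

theorem cobrace_mem_tensorDegree (n : ℕ) (x : C n) :
    X.cobrace (DirectSum.lof k ℕ C n x) ∈ tensorDegree k C (n + 1) := by
  rw [cobrace_lof]
  refine Submodule.sum_mem _ fun t ht => Submodule.smul_mem _ _ ?_
  obtain ⟨y, hy⟩ := X.exists_block_eq t.1 t.2.1 t.2.2 (DirectSum.lof k ℕ C n x)
  have h := Finset.mem_triples.1 ht
  rw [hy, show n + 1 = t.1 + 1 + t.2.2 + t.2.1 by omega]
  exact incl₂_mem_tensorDegree _ _ _

theorem rTensor_cobrace_block (A r D : ℕ) (x : ⨁ n, C n) :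
    LinearMap.rTensor _ X.cobrace (X.block A r D x) =
      ∑ t ∈ Finset.triples (A + 1 + D), (-1 : k) ^ ((t.2.1 + 1) * t.2.2) •
        LinearMap.rTensor _ (X.block t.1 t.2.1 t.2.2) (X.block A r D x) := by
  obtain ⟨y, hy⟩ := X.exists_block_eq A r D x
  rw [hy]
  exact rTensor_incl₂_eq_sum _ _ (fun x => X.cobrace_lof _ x) _ y

theorem lTensor_cobrace_block (A r D : ℕ) (x : ⨁ n, C n) :
    LinearMap.lTensor _ X.cobrace (X.block A r D x) =
      ∑ t ∈ Finset.triples r, (-1 : k) ^ ((t.2.1 + 1) * t.2.2) •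
        LinearMap.lTensor _ (X.block t.1 t.2.1 t.2.2) (X.block A r D x) := by
  obtain ⟨y, hy⟩ := X.exists_block_eq A r D x
  rw [hy]
  exact lTensor_incl₂_eq_sum _ _ (fun x => X.cobrace_lof _ x) _ y

theorem rTensor_cobrace_cupPart (a b : ℕ) (x : ⨁ n, C n) :
    LinearMap.rTensor _ X.cobrace (X.cupPart a b x) =
      ∑ t ∈ Finset.triples a, (-1 : k) ^ ((t.2.1 + 1) * t.2.2) •
        LinearMap.rTensor _ (X.block t.1 t.2.1 t.2.2) (X.cupPart a b x) := by
  obtain ⟨y, hy⟩ := X.exists_cupPart_eq a b x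
  rw [hy]
  exact rTensor_incl₂_eq_sum _ _ (fun x => X.cobrace_lof _ x) _ y

theorem lTensor_cobrace_cupPart (a b : ℕ) (x : ⨁ n, C n) :
    LinearMap.lTensor _ X.cobrace (X.cupPart a b x) =
      ∑ t ∈ Finset.triples b, (-1 : k) ^ ((t.2.1 + 1) * t.2.2) •
        LinearMap.lTensor _ (X.block t.1 t.2.1 t.2.2) (X.cupPart a b x) := by
  obtain ⟨y, hy⟩ := X.exists_cupPart_eq a b x
  rw [hy]
  exact lTensor_incl₂_eq_sum _ _ (fun x => X.cobrace_lof _ x) _ y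

theorem rTensor_cup_block (a q b : ℕ) (x : ⨁ n, C n) :
    LinearMap.rTensor _ X.cup (X.block a q b x) =
      ∑ t ∈ Finset.HasAntidiagonal.antidiagonal (a + 1 + b),
        LinearMap.rTensor _ (X.cupPart t.1 t.2) (X.block a q b x) := by
  obtain ⟨y, hy⟩ := X.exists_block_eq a q b x
  rw [hy]
  simpa using rTensor_incl₂_eq_sum (k := k) (C := C) (f := X.cup) _ (fun _ => 1)
    (fun x => by simpa using X.cup_lof _ x) _ y

theorem lTensor_cup_block (a q b : ℕ) (x : ⨁ n, C n) :
    LinearMap.lTensor _ X.cup (X.block a q b x) =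
      ∑ t ∈ Finset.HasAntidiagonal.antidiagonal q,
        LinearMap.lTensor _ (X.cupPart t.1 t.2) (X.block a q b x) := by
  obtain ⟨y, hy⟩ := X.exists_block_eq a q b x
  rw [hy]
  simpa using lTensor_incl₂_eq_sum (k := k) (C := C) (f := X.cup) _ (fun _ => 1)
    (fun x => by simpa using X.cup_lof _ x) _ y

theorem rTensor_cup_cupPart (a b : ℕ) (x : ⨁ n, C n) :
    LinearMap.rTensor _ X.cup (X.cupPart a b x) =
      ∑ t ∈ Finset.HasAntidiagonal.antidiagonal a,
        LinearMap.rTensor _ (X.cupPart t.1 t.2) (X.cupPart a b x) := by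
  obtain ⟨y, hy⟩ := X.exists_cupPart_eq a b x
  rw [hy]
  simpa using rTensor_incl₂_eq_sum (k := k) (C := C) (f := X.cup) _ (fun _ => 1)
    (fun x => by simpa using X.cup_lof _ x) _ y

theorem lTensor_cup_cupPart (a b : ℕ) (x : ⨁ n, C n) :
    LinearMap.lTensor _ X.cup (X.cupPart a b x) =
      ∑ t ∈ Finset.HasAntidiagonal.antidiagonal b,
        LinearMap.lTensor _ (X.cupPart t.1 t.2) (X.cupPart a b x) := by
  obtain ⟨y, hy⟩ := X.exists_cupPart_eq a b x
  rw [hy]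
  simpa using lTensor_incl₂_eq_sum (k := k) (C := C) (f := X.cup) _ (fun _ => 1)
    (fun x => by simpa using X.cup_lof _ x) _ y

theorem cup_coassoc : LinearMap.rTensor _ X.cup ∘ₗ X.cup = idTensor X.cup ∘ₗ X.cup := by
  refine DirectSum.linearMap_ext _ fun n => LinearMap.ext fun x => ?_
  simp only [LinearMap.comp_apply, idTensor, LinearEquiv.coe_coe]
  rw [cup_lof, map_sum, map_sum, map_sum]
  simp only [rTensor_cup_cupPart, lTensor_cup_cupPart, map_sum]
  have h := Finset.sum_antidiagonal_antidiagonal n fun a b c =>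
    LinearMap.rTensor _ (X.cupPart a b) (X.cupPart (a + b) c (DirectSum.lof k ℕ C n x))
  simp only [cupPart_coassoc] at h
  refine Eq.trans (Finset.sum_congr rfl fun t _ => Finset.sum_congr rfl fun s hs => ?_)
    (h.trans (Finset.sum_congr rfl fun t _ => Finset.sum_congr rfl fun s hs => ?_))
  · rw [← Finset.HasAntidiagonal.mem_antidiagonal.1 hs, cupPart_coassoc]
  · rw [Finset.HasAntidiagonal.mem_antidiagonal.1 hs]

theorem evalLeft_cupPart_of_ne {a : ℕ} (h : a ≠ 0) (b : ℕ) (x : ⨁ n, C n) :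
    evalLeft (X.totalPsi 0) (X.cupPart a b x) = 0 := by
  obtain ⟨y, hy⟩ := X.exists_cupPart_eq a b x
  rw [hy, LinearMap.comp_apply, rTensor_congr_incl₂ (g := 0)
    fun x => by simp [totalPsi, DirectSum.component.of, h]]
  simp

theorem evalRight_cupPart_of_ne (a : ℕ) {b : ℕ} (h : b ≠ 0) (x : ⨁ n, C n) :
    evalRight (X.totalPsi 0) (X.cupPart a b x) = 0 := by
  obtain ⟨y, hy⟩ := X.exists_cupPart_eq a b x
  rw [hy, LinearMap.comp_apply, lTensor_congr_incl₂ (g := 0)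
    fun x => by simp [totalPsi, DirectSum.component.of, h]]
  simp

theorem cup_counit_left : (TensorProduct.lid k _).toLinearMap ∘ₗ
    LinearMap.rTensor _ X.cupCounit ∘ₗ X.cup = LinearMap.id := by
  refine DirectSum.linearMap_ext _ fun n => LinearMap.ext fun x => ?_
  change evalLeft (X.totalPsi 0) (X.cup (DirectSum.lof k ℕ C n x)) = DirectSum.lof k ℕ C n x
  rw [cup_lof, map_sum, Finset.sum_eq_single (0, n), evalLeft_cupPart,
    DirectSum.component.lof_self]
  · intro t ht hne
    refine X.evalLeft_cupPart_of_ne (fun h => hne ?_) _ _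
    have := Finset.HasAntidiagonal.mem_antidiagonal.1 ht
    exact Prod.ext h (by simpa [h] using this)
  · simp

theorem cup_counit_right : (TensorProduct.rid k _).toLinearMap ∘ₗ
    LinearMap.lTensor _ X.cupCounit ∘ₗ X.cup = LinearMap.id := by
  refine DirectSum.linearMap_ext _ fun n => LinearMap.ext fun x => ?_
  change evalRight (X.totalPsi 0) (X.cup (DirectSum.lof k ℕ C n x)) = DirectSum.lof k ℕ C n x
  rw [cup_lof, map_sum, Finset.sum_eq_single (n, 0), evalRight_cupPart,
    DirectSum.component.lof_self]
  · intro t ht hne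
    refine X.evalRight_cupPart_of_ne _ (fun h => hne ?_) _
    have := Finset.HasAntidiagonal.mem_antidiagonal.1 ht
    exact Prod.ext (by simpa [h] using this) h
  · simp

/-- Only degree one matters. There the two faces satisfy `ψ_0 d_0 = ψ_1 = ψ_0 d_1` and enter the
differential with opposite signs. -/
theorem cupCounit_comp_totalDiff : X.cupCounit ∘ₗ totalDiff X.diff = 0 := by
  refine DirectSum.linearMap_ext _ fun n => LinearMap.ext fun x => ?_
  change X.totalPsi 0 (totalDiff X.diff (DirectSum.lof k ℕ C n x)) = 0
  rw [totalDiff_lof]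
  rcases n with _ | _ | n
  · simp [totalFace]
  · simp [Finset.sum_range_succ, totalPsi_totalFace]
  · rw [map_sum]
    refine Finset.sum_eq_zero fun i _ => ?_
    obtain ⟨y, hy⟩ := X.totalFace_eq_lof (n + 1) i (DirectSum.lof k ℕ C (n + 2) x)
    rw [hy]
    simp [totalPsi, DirectSum.component.of]

theorem cup_totalFace (n i : ℕ) (x : ⨁ n, C n) :
    X.cup (X.totalFace (n + 1) i x) =
      ∑ t ∈ Finset.HasAntidiagonal.antidiagonal n, X.cupPart t.1 t.2 (X.totalFace (n + 1) i x) := by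
  obtain ⟨y, hy⟩ := X.totalFace_eq_lof n i x
  rw [hy, cup_lof]

theorem tensorDiff_cupPart (a b : ℕ) (x : ⨁ n, C n) :
    tensorDiff X.diff (X.cupPart a b x) =
      ∑ i ∈ Finset.range (a + 1), (-1 : k) ^ i •
        LinearMap.rTensor _ (X.totalFace a i) (X.cupPart a b x) +
      (-1 : k) ^ a • ∑ i ∈ Finset.range (b + 1), (-1 : k) ^ i •
        LinearMap.lTensor _ (X.totalFace b i) (X.cupPart a b x) := by
  obtain ⟨y, hy⟩ := X.exists_cupPart_eq a b x
  have h : tensorDiff X.diff = LinearMap.rTensor _ (totalDiff X.diff) +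
      LinearMap.lTensor _ (totalDiff X.diff) ∘ₗ LinearMap.rTensor _ (parity k C) := by
    rw [LinearMap.lTensor_comp_rTensor]; rfl
  rw [hy, h, LinearMap.add_apply, LinearMap.comp_apply, rTensor_parity_incl₂, map_smul,
    rTensor_incl₂_eq_sum _ _ (fun x => X.totalDiff_lof _ x),
    lTensor_incl₂_eq_sum _ _ (fun x => X.totalDiff_lof _ x)]

/-- Faces of index at most `a` act on the left factor and the others on the right factor. The tensor
differential has two more faces, both at the cut, and they cancel between neighbouring components.
-/
theorem cup_comp_totalDiff : X.cup ∘ₗ totalDiff X.diff = tensorDiff X.diff ∘ₗ X.cup := by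
  refine DirectSum.linearMap_ext _ fun n => LinearMap.ext fun x => ?_
  simp only [LinearMap.comp_apply, totalDiff_lof]
  rw [cup_lof, map_sum, map_sum]
  simp only [tensorDiff_cupPart, Finset.sum_add_distrib]
  rcases n with _ | N
  · have h₀ : X.totalFace 0 0 = 0 := rfl
    simp [h₀]
  -- The components with `a = 0` have no face on the left factor and those with `b = 0` none on the
  -- right. Splitting them off aligns both sums over `a + b = N`.
  · rw [Finset.Nat.sum_antidiagonal_succ, Finset.Nat.sum_antidiagonal_succ' (f := fun t =>
      (-1 : k) ^ t.1 • ∑ i ∈ Finset.range (t.2 + 1), (-1 : k) ^ i •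
        LinearMap.lTensor _ (X.totalFace t.2 i)
          (X.cupPart t.1 t.2 (DirectSum.lof k ℕ C (N + 1) x)))]
    have h₀ : X.totalFace 0 0 = 0 := rfl
    simp only [h₀, Finset.range_one, Finset.sum_singleton, LinearMap.rTensor_zero,
      LinearMap.lTensor_zero, LinearMap.zero_apply, smul_zero, zero_add, map_smul, cup_totalFace,
      Finset.smul_sum (s := Finset.HasAntidiagonal.antidiagonal N)]
    rw [Finset.sum_comm, ← Finset.sum_add_distrib]
    refine Finset.sum_congr rfl fun t ht => ?_
    obtain ⟨a, b⟩ := t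
    obtain rfl := Finset.HasAntidiagonal.mem_antidiagonal.1 ht
    rw [show a + b + 1 + 1 = a + 1 + (b + 1) by omega, Finset.sum_range_add,
      Finset.sum_range_succ _ (a + 1), Finset.sum_range_succ' _ (b + 1), cupPart_lTensor_face_first,
      smul_add, pow_zero, one_smul, pow_succ, mul_neg_one,
      TensorProduct.neg_smul_tensor, Finset.smul_sum]
    have h₁ : ∀ i ∈ Finset.range (a + 1),
        (-1 : k) ^ i • X.cupPart a b (X.totalFace (a + b + 1) i
          (DirectSum.lof k ℕ C (a + b + 1) x)) =
        (-1 : k) ^ i • LinearMap.rTensor _ (X.totalFace (a + 1) i)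
          (X.cupPart (a + 1) b (DirectSum.lof k ℕ C (a + b + 1) x)) := fun i hi => by
      rw [X.cupPart_face_left a b i (by simpa [Nat.lt_succ_iff] using hi)]
    have h₂ : ∀ i ∈ Finset.range (b + 1),
        (-1 : k) ^ (a + 1 + i) • X.cupPart a b (X.totalFace (a + b + 1) (a + 1 + i)
          (DirectSum.lof k ℕ C (a + b + 1) x)) =
        (-1 : k) ^ a • (-1 : k) ^ (i + 1) • LinearMap.lTensor _ (X.totalFace (b + 1) (i + 1))
          (X.cupPart a (b + 1) (DirectSum.lof k ℕ C (a + b + 1) x)) := fun i hi => by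
      rw [X.cupPart_face_right a b i (by simpa [Nat.lt_succ_iff] using hi), smul_smul, ← pow_add,
        show a + (i + 1) = a + 1 + i by omega]
    rw [Finset.sum_congr rfl h₁, Finset.sum_congr rfl h₂]
    abel

/-- The cobrace fails to be a chain map by a term that `ρ` fixes, and `ρ` itself is a chain map, so
the failure disappears under `id - ρ`. -/
theorem cobracket_comp_totalDiff :
    X.cobracket ∘ₗ totalDiff X.diff = suspendedTensorDiff X.diff ∘ₗ X.cobracket := by
  refine LinearMap.ext fun x => ?_
  have h := sub_eq_iff_eq_add'.1 (X.suspendedTensorDiff_cobrace x)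
  have h' := suspendedFlip_parity (X.cup x)
  generalize LinearMap.rTensor _ (parity k C) (gradedFlip k C (X.cup x) - X.cup x) = y at h h'
  simp only [cobracket, LinearMap.comp_apply, LinearMap.sub_apply, LinearMap.id_apply, map_sub,
    suspendedTensorDiff_suspendedFlip, h, map_add, h', add_sub_add_right_eq_sub]

theorem gradedFlip_cup_mem (z : ⨁ n, C n) (hz : totalDiff X.diff z = 0) :
    gradedFlip k C (X.cup z) - X.cup z ∈ LinearMap.range (tensorDiff X.diff) := by
  -- The parity operator moves the primitive from the suspended to the unsuspended tensor square;
  -- the minus sign compensates `tensorDiff_rTensor_parity`.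
  refine ⟨-LinearMap.rTensor _ (parity k C) (X.cobrace z), ?_⟩
  have h := X.suspendedTensorDiff_cobrace z
  rw [hz, map_zero, sub_zero] at h
  rw [map_neg, tensorDiff_rTensor_parity, h, rTensor_parity_rTensor_parity, neg_neg]

/-- The part of the iterated cobrace where a block of `r` inputs is extracted first, and then a block
of `q` inputs that precedes it; there are `a`, `b`, `c` inputs before, between and after them. -/
def twoBlocks (a q b r c : ℕ) :
    (⨁ n, C n) →ₗ[k] ((⨁ n, C n) ⊗[k] (⨁ n, C n)) ⊗[k] (⨁ n, C n) :=
  LinearMap.rTensor _ (X.block a q (b + 1 + c)) ∘ₗ X.block (a + q + b) r c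

theorem exists_twoBlocks_eq (a q b r c : ℕ) (x : ⨁ n, C n) :
    ∃ y, X.twoBlocks a q b r c x =
      TensorProduct.map (incl₂ k C (a + b + c + 2) q) (DirectSum.lof k ℕ C r) y := by
  obtain ⟨y, hy⟩ := X.exists_block_eq (a + q + b) r c x
  rw [twoBlocks, LinearMap.comp_apply, hy]
  clear hy
  induction y using TensorProduct.induction_on with
  | zero => exact ⟨0, by simp⟩
  | add a b ha hb =>
    obtain ⟨y, hy⟩ := ha
    obtain ⟨z, hz⟩ := hb
    exact ⟨y + z, by rw [map_add, map_add, hy, hz, map_add]⟩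
  | tmul u v =>
    have h : ∀ p, p = a + 1 + (b + 1 + c) → ∃ y, X.block a q (b + 1 + c)
        (DirectSum.lof k ℕ C (a + q + b + 1 + c) u) = incl₂ k C p q y := by
      rintro _ rfl
      exact X.exists_block_eq _ _ _ _
    obtain ⟨y, hy⟩ := h (a + b + c + 2) (by omega)
    exact ⟨y ⊗ₜ v, by simp [hy]⟩

theorem onLastTwo_suspendedFlip_twoBlocks (a q b r c : ℕ) (x : ⨁ n, C n) :
    onLastTwo (suspendedFlip k C) (X.twoBlocks a q b r c x) =
      (-1 : k) ^ ((q + 1) * (r + 1)) • TensorProduct.rightComm k _ _ _ (X.twoBlocks a q b r c x) := by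
  obtain ⟨y, hy⟩ := X.exists_twoBlocks_eq a q b r c x
  rw [hy]
  clear hy
  induction y using TensorProduct.induction_on with
  | zero => simp
  | add a b ha hb => simp only [map_add, ha, hb, smul_add]
  | tmul u v =>
    induction u using TensorProduct.induction_on with
    | zero => simp
    | add a b ha hb => simp only [TensorProduct.add_tmul, map_add, ha, hb, smul_add]
    | tmul u w =>
      simp only [TensorProduct.map_tmul, onLastTwo_tmul, suspendedFlip, signedFlip_tmul,
        TensorProduct.tmul_smul, map_smul, TensorProduct.assoc_symm_tmul,
        TensorProduct.rightComm_tmul]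

/-- The second block precedes the collapsed input, follows it, or contains it. Blocks that contain
it give the cobrace of the second factor. The two disjoint cases correspond under exchange of the
order of extraction, which is the flip of the last two factors. -/
theorem rTensor_cobrace_cobrace_lof (n : ℕ) (x : C n) :
    ∃ t, LinearMap.rTensor _ X.cobrace (X.cobrace (DirectSum.lof k ℕ C n x)) =
      idTensor X.cobrace (X.cobrace (DirectSum.lof k ℕ C n x)) + t +
        onLastTwo (suspendedFlip k C) t := by
  set ξ := DirectSum.lof k ℕ C n x with hξ
  -- The witness collects the terms whose second block precedes the first; the flip produces those
  -- in which it follows.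
  refine ⟨∑ t ∈ Finset.quintuples n,
    (-1 : k) ^ ((t.2.2.2.1 + 1) * t.2.2.2.2 + (t.2.1 + 1) * (t.2.2.1 + 1 + t.2.2.2.2)) •
      X.twoBlocks t.1 t.2.1 t.2.2.1 t.2.2.2.1 t.2.2.2.2 ξ, ?_⟩
  rw [map_sum]
  simp only [map_smul, onLastTwo_suspendedFlip_twoBlocks]
  have h₁ : LinearMap.rTensor _ X.cobrace (X.cobrace ξ) =
      ∑ t ∈ Finset.triples n, ∑ s ∈ Finset.triples (t.1 + 1 + t.2.2),
        (-1 : k) ^ ((t.2.1 + 1) * t.2.2 + (s.2.1 + 1) * s.2.2) •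
          LinearMap.rTensor _ (X.block s.1 s.2.1 s.2.2) (X.block t.1 t.2.1 t.2.2 ξ) := by
    rw [hξ, cobrace_lof, map_sum]
    simp only [map_smul, rTensor_cobrace_block, Finset.smul_sum, smul_smul, ← pow_add]
  have h₂ : idTensor X.cobrace (X.cobrace ξ) =
      ∑ t ∈ Finset.triples n, ∑ s ∈ Finset.triples t.2.1,
        (-1 : k) ^ ((t.2.1 + 1) * t.2.2 + (s.2.1 + 1) * s.2.2) •
          (TensorProduct.assoc k _ _ _).symm
            (LinearMap.lTensor _ (X.block s.1 s.2.1 s.2.2) (X.block t.1 t.2.1 t.2.2 ξ)) := by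
    rw [hξ, cobrace_lof, map_sum]
    simp only [map_smul, idTensor, LinearMap.comp_apply, LinearEquiv.coe_coe, lTensor_cobrace_block,
      Finset.smul_sum, smul_smul, ← pow_add, map_sum]
  have h₃ : ∀ t ∈ Finset.triples n, ∑ s ∈ Finset.triples (t.1 + 1 + t.2.2),
        (-1 : k) ^ ((t.2.1 + 1) * t.2.2 + (s.2.1 + 1) * s.2.2) •
          LinearMap.rTensor _ (X.block s.1 s.2.1 s.2.2) (X.block t.1 t.2.1 t.2.2 ξ) =
      ∑ s ∈ Finset.triples t.1, (-1 : k) ^ ((t.2.1 + 1) * t.2.2 + (s.2.1 + 1) * (s.2.2 + 1 + t.2.2)) •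
          X.twoBlocks s.1 s.2.1 s.2.2 t.2.1 t.2.2 ξ +
      ∑ s ∈ Finset.triples t.2.2,
        ((-1 : k) ^ ((s.2.1 + 1) * s.2.2 + (t.2.1 + 1) * (s.1 + 1 + s.2.2)) *
            (-1 : k) ^ ((t.2.1 + 1) * (s.2.1 + 1))) •
          TensorProduct.rightComm k _ _ _ (X.twoBlocks t.1 t.2.1 s.1 s.2.1 s.2.2 ξ) +
      ∑ s ∈ Finset.HasAntidiagonal.antidiagonal t.1, ∑ u ∈ Finset.HasAntidiagonal.antidiagonal t.2.2,
        (-1 : k) ^ ((s.2 + t.2.1 + u.1 + 1) * u.2 + (t.2.1 + 1) * u.1) •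
          (TensorProduct.assoc k _ _ _).symm (LinearMap.lTensor _ (X.block s.2 t.2.1 u.1)
            (X.block s.1 (s.2 + t.2.1 + u.1) u.2 ξ)) := by
    rintro ⟨A, r, D⟩ -
    -- The collapsed input is the distinguished input number `A + 1`.
    rw [Finset.sum_triples_add_one_add A D fun a q b =>
      (-1 : k) ^ ((r + 1) * D + (q + 1) * b) •
          LinearMap.rTensor _ (X.block a q b) (X.block A r D ξ)]
    congr 1
    · congr 1
      · refine Finset.sum_congr rfl fun s hs => ?_
        obtain ⟨a, q, b⟩ := s
        obtain rfl : a + q + b = A := Finset.mem_triples.1 hs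
        rfl
      · refine Finset.sum_congr rfl fun s hs => ?_
        obtain ⟨b, q, c⟩ := s
        obtain rfl : b + q + c = D := Finset.mem_triples.1 hs
        have := X.block_before A r b q c ξ
        rw [twoBlocks, LinearMap.comp_apply, this, rightComm_rightComm, ← pow_add]
        congr 1
        · exact neg_one_pow_eq (by grind [Nat.not_even_one])
    · refine Finset.sum_congr rfl fun s hs => Finset.sum_congr rfl fun u hu => ?_
      obtain ⟨a, b⟩ := s
      obtain ⟨c, e⟩ := u
      obtain rfl : a + b = A := Finset.HasAntidiagonal.mem_antidiagonal.1 hs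
      obtain rfl : c + e = D := Finset.HasAntidiagonal.mem_antidiagonal.1 hu
      rw [X.block_inside a b r c e ξ]
      congr 1
      exact neg_one_pow_eq (by grind [Nat.not_even_one])
  rw [h₁, Finset.sum_congr rfl h₃, h₂]
  simp only [Finset.sum_add_distrib]
  rw [Finset.sum_triples_triples_left n fun a q b r c =>
      (-1 : k) ^ ((r + 1) * c + (q + 1) * (b + 1 + c)) • X.twoBlocks a q b r c ξ,
    Finset.sum_triples_triples_right n fun a q b r c =>
      ((-1 : k) ^ ((r + 1) * c + (q + 1) * (b + 1 + c)) * (-1 : k) ^ ((q + 1) * (r + 1))) •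
        TensorProduct.rightComm k _ _ _ (X.twoBlocks a q b r c ξ),
    Finset.sum_triples_antidiagonal_antidiagonal n fun a b r c e =>
      (-1 : k) ^ ((b + r + c + 1) * e + (r + 1) * c) •
          (TensorProduct.assoc k _ _ _).symm (LinearMap.lTensor _ (X.block b r c)
            (X.block a (b + r + c) e ξ))]
  simp only [smul_smul]
  rw [add_comm, ← add_assoc]
  congr 2
  refine Finset.sum_congr rfl fun t _ => Finset.sum_congr rfl fun s hs => ?_
  rw [Finset.mem_triples.1 hs]

theorem coJacobiator_cobracket : coJacobiator k C X.cobracket = 0 :=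
  coJacobiator_eq_zero X.cobrace_mem_tensorDegree X.rTensor_cobrace_cobrace_lof

end ComultiplicativeCooperad

/-! ### Reindexing of sums with one block and one cut -/

section NestedSums

variable {M : Type*} [AddCommMonoid M]

theorem Finset.sum_triples_antidiagonal (n : ℕ) (f : ℕ → ℕ → ℕ → ℕ → M) :
    ∑ t ∈ Finset.triples n, ∑ s ∈ Finset.HasAntidiagonal.antidiagonal t.2.1,
        f t.1 s.1 s.2 t.2.2 =
      ∑ t ∈ Finset.quadruples n, f t.1 t.2.1 t.2.2.1 t.2.2.2 := by
  rw [Finset.sum_sigma']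
  refine Finset.sum_bij' (fun t _ => (t.1.1, t.2.1, t.2.2, t.1.2.2))
    (fun t _ => ⟨(t.1, t.2.1 + t.2.2.1, t.2.2.2), t.2.1, t.2.2.1⟩) ?_ ?_ ?_ ?_ ?_
  · rintro ⟨⟨a, s, c⟩, q, r⟩ h
    simp only [Finset.mem_sigma, Finset.mem_triples, Finset.mem_quadruples,
      Finset.HasAntidiagonal.mem_antidiagonal] at h ⊢
    omega
  · rintro ⟨a, q, r, c⟩ h
    simp only [Finset.mem_sigma, Finset.mem_triples, Finset.mem_quadruples,
      Finset.HasAntidiagonal.mem_antidiagonal, and_true] at h ⊢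
    omega
  · rintro ⟨⟨a, s, c⟩, q, r⟩ h
    simp only [Finset.mem_sigma, Finset.HasAntidiagonal.mem_antidiagonal] at h
    simp only [h.2]
  · rintro ⟨a, q, r, c⟩ h
    rfl
  · rintro ⟨⟨a, s, c⟩, q, r⟩ h
    rfl

theorem Finset.sum_antidiagonal_triples_left (n : ℕ) (f : ℕ → ℕ → ℕ → ℕ → M) :
    ∑ t ∈ Finset.HasAntidiagonal.antidiagonal n, ∑ s ∈ Finset.triples t.1,
        f s.1 s.2.1 s.2.2 t.2 =
      ∑ t ∈ Finset.quadruples n, f t.1 t.2.1 t.2.2.1 t.2.2.2 := by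
  rw [Finset.sum_sigma']
  refine Finset.sum_bij' (fun t _ => (t.2.1, t.2.2.1, t.2.2.2, t.1.2))
    (fun t _ => ⟨(t.1 + t.2.1 + t.2.2.1, t.2.2.2), t.1, t.2.1, t.2.2.1⟩) ?_ ?_ ?_ ?_ ?_
  · rintro ⟨⟨s, r⟩, a, q, b⟩ h
    simp only [Finset.mem_sigma, Finset.mem_triples, Finset.mem_quadruples,
      Finset.HasAntidiagonal.mem_antidiagonal] at h ⊢
    omega
  · rintro ⟨a, q, r, c⟩ h
    simp only [Finset.mem_sigma, Finset.mem_triples, Finset.mem_quadruples,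
      Finset.HasAntidiagonal.mem_antidiagonal, and_true] at h ⊢
    omega
  · rintro ⟨⟨s, r⟩, a, q, b⟩ h
    simp only [Finset.mem_sigma, Finset.mem_triples] at h
    simp only [h.2]
  · rintro ⟨a, q, r, c⟩ h
    rfl
  · rintro ⟨⟨s, r⟩, a, q, b⟩ h
    rfl

theorem Finset.sum_antidiagonal_triples_right (n : ℕ) (f : ℕ → ℕ → ℕ → ℕ → M) :
    ∑ t ∈ Finset.HasAntidiagonal.antidiagonal n, ∑ s ∈ Finset.triples t.2,
        f t.1 s.1 s.2.1 s.2.2 =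
      ∑ t ∈ Finset.quadruples n, f t.1 t.2.1 t.2.2.1 t.2.2.2 := by
  rw [Finset.sum_sigma']
  refine Finset.sum_bij' (fun t _ => (t.1.1, t.2.1, t.2.2.1, t.2.2.2))
    (fun t _ => ⟨(t.1, t.2.1 + t.2.2.1 + t.2.2.2), t.2.1, t.2.2.1, t.2.2.2⟩) ?_ ?_ ?_ ?_ ?_
  · rintro ⟨⟨s, r⟩, a, q, b⟩ h
    simp only [Finset.mem_sigma, Finset.mem_triples, Finset.mem_quadruples,
      Finset.HasAntidiagonal.mem_antidiagonal] at h ⊢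
    omega
  · rintro ⟨a, q, r, c⟩ h
    simp only [Finset.mem_sigma, Finset.mem_triples, Finset.mem_quadruples,
      Finset.HasAntidiagonal.mem_antidiagonal, and_true] at h ⊢
    omega
  · rintro ⟨⟨s, r⟩, a, q, b⟩ h
    simp only [Finset.mem_sigma, Finset.mem_triples] at h
    simp only [h.2]
  · rintro ⟨a, q, r, c⟩ h
    rfl
  · rintro ⟨⟨s, r⟩, a, q, b⟩ h
    rfl

theorem Finset.sum_triples_antidiagonal_right (n : ℕ) (f : ℕ → ℕ → ℕ → ℕ → M) :
    ∑ t ∈ Finset.triples n, ∑ s ∈ Finset.HasAntidiagonal.antidiagonal t.2.2,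
        f t.1 t.2.1 s.1 s.2 =
      ∑ t ∈ Finset.quadruples n, f t.1 t.2.1 t.2.2.1 t.2.2.2 := by
  rw [Finset.sum_sigma']
  refine Finset.sum_bij' (fun t _ => (t.1.1, t.1.2.1, t.2.1, t.2.2))
    (fun t _ => ⟨(t.1, t.2.1, t.2.2.1 + t.2.2.2), t.2.2.1, t.2.2.2⟩) ?_ ?_ ?_ ?_ ?_
  · rintro ⟨⟨a, s, c⟩, q, r⟩ h
    simp only [Finset.mem_sigma, Finset.mem_triples, Finset.mem_quadruples,
      Finset.HasAntidiagonal.mem_antidiagonal] at h ⊢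
    omega
  · rintro ⟨a, q, r, c⟩ h
    simp only [Finset.mem_sigma, Finset.mem_triples, Finset.mem_quadruples,
      Finset.HasAntidiagonal.mem_antidiagonal, and_true] at h ⊢
    omega
  · rintro ⟨⟨a, s, c⟩, q, r⟩ h
    simp only [Finset.mem_sigma, Finset.HasAntidiagonal.mem_antidiagonal] at h
    simp only [h.2]
  · rintro ⟨a, q, r, c⟩ h
    rfl
  · rintro ⟨⟨a, s, c⟩, q, r⟩ h
    rfl

theorem Finset.sum_triples_antidiagonal_left (n : ℕ) (f : ℕ → ℕ → ℕ → ℕ → M) :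
    ∑ t ∈ Finset.triples n, ∑ s ∈ Finset.HasAntidiagonal.antidiagonal t.1,
        f s.1 s.2 t.2.1 t.2.2 =
      ∑ t ∈ Finset.quadruples n, f t.1 t.2.1 t.2.2.1 t.2.2.2 := by
  rw [Finset.sum_sigma']
  refine Finset.sum_bij' (fun t _ => (t.2.1, t.2.2, t.1.2.1, t.1.2.2))
    (fun t _ => ⟨(t.1 + t.2.1, t.2.2.1, t.2.2.2), t.1, t.2.1⟩) ?_ ?_ ?_ ?_ ?_
  · rintro ⟨⟨a, s, c⟩, q, r⟩ h
    simp only [Finset.mem_sigma, Finset.mem_triples, Finset.mem_quadruples,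
      Finset.HasAntidiagonal.mem_antidiagonal] at h ⊢
    omega
  · rintro ⟨a, q, r, c⟩ h
    simp only [Finset.mem_sigma, Finset.mem_triples, Finset.mem_quadruples,
      Finset.HasAntidiagonal.mem_antidiagonal, and_true] at h ⊢
    omega
  · rintro ⟨⟨a, s, c⟩, q, r⟩ h
    simp only [Finset.mem_sigma, Finset.HasAntidiagonal.mem_antidiagonal] at h
    simp only [h.2]
  · rintro ⟨a, q, r, c⟩ h
    rfl
  · rintro ⟨⟨a, s, c⟩, q, r⟩ h
    rfl

end NestedSums

/-! ### Permutations of threefold tensor products -/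

section Permutations

variable {k : Type u} [CommRing k] {W₁ W₂ W₃ : Type*} [AddCommGroup W₁] [Module k W₁]
  [AddCommGroup W₂] [Module k W₂] [AddCommGroup W₃] [Module k W₃]

theorem assoc_symm_comm_rightComm (t : (W₁ ⊗[k] W₂) ⊗[k] W₃) :
    (TensorProduct.assoc k _ _ _).symm
        (TensorProduct.comm k _ _ (TensorProduct.rightComm k _ _ _ t)) =
      LinearMap.rTensor _ (TensorProduct.comm k W₁ W₂).toLinearMap t := by
  induction t using TensorProduct.induction_on with
  | zero => simp
  | add a b ha hb => simp only [map_add, ha, hb]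
  | tmul s z =>
    induction s using TensorProduct.induction_on with
    | zero => simp
    | add a b ha hb => simp only [TensorProduct.add_tmul, map_add, ha, hb]
    | tmul a b => simp

theorem assoc_symm_comm_assoc_symm (t : W₁ ⊗[k] (W₂ ⊗[k] W₃)) :
    (TensorProduct.assoc k _ _ _).symm
        (TensorProduct.comm k _ _ ((TensorProduct.assoc k _ _ _).symm t)) =
      LinearMap.rTensor _ (TensorProduct.comm k W₁ W₃).toLinearMap
        ((TensorProduct.assoc k _ _ _).symm
          (LinearMap.lTensor _ (TensorProduct.comm k W₂ W₃).toLinearMap t)) := by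
  induction t using TensorProduct.induction_on with
  | zero => simp
  | add a b ha hb => simp only [map_add, ha, hb]
  | tmul z s =>
    induction s using TensorProduct.induction_on with
    | zero => simp
    | add a b ha hb => simp only [TensorProduct.tmul_add, map_add, ha, hb]
    | tmul a b => simp

variable {C : ℕ → Type v} [∀ n, AddCommGroup (C n)] [∀ n, Module k (C n)]

open Cooperad (incl₂)

theorem rTensor_mixedFlip {s p q : ℕ} {f : (⨁ n, C n) →ₗ[k] (⨁ n, C n) ⊗[k] (⨁ n, C n)}
    (hf : ∀ x, ∃ y, f (DirectSum.lof k ℕ C s x) = incl₂ k C p q y) (c : ℕ) (y : C c ⊗[k] C s) :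
    LinearMap.rTensor _ (mixedFlip k C)
        ((TensorProduct.assoc k _ _ _).symm (LinearMap.lTensor _ f (incl₂ k C c s y))) =
      (-1 : k) ^ (c * (p + 1)) • LinearMap.rTensor _ (TensorProduct.comm k _ _).toLinearMap
        ((TensorProduct.assoc k _ _ _).symm (LinearMap.lTensor _ f (incl₂ k C c s y))) := by
  induction y using TensorProduct.induction_on with
  | zero => simp
  | add a b ha hb => simp only [map_add, ha, hb, smul_add]
  | tmul a b =>
    obtain ⟨y, hy⟩ := hf b
    rw [TensorProduct.map_tmul, LinearMap.lTensor_tmul, hy]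
    clear hy
    induction y using TensorProduct.induction_on with
    | zero => simp
    | add a b ha hb => simp only [TensorProduct.tmul_add, map_add, ha, hb, smul_add]
    | tmul u v =>
      simp only [TensorProduct.map_tmul, TensorProduct.assoc_symm_tmul, LinearMap.rTensor_tmul,
        mixedFlip, signedFlip_tmul, LinearEquiv.coe_coe, TensorProduct.comm_tmul,
        TensorProduct.smul_tmul']

end Permutations

/-! ### The strict half of coLeibniz: the flipped cobrace -/

namespace ComultiplicativeCooperad

open Cooperad (incl₂)

variable {k : Type u} [CommRing k]
variable {C : ℕ → Type v} [∀ n, AddCommGroup (C n)] [∀ n, Module k (C n)]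
variable (X : ComultiplicativeCooperad k C)

theorem suspendedFlip_block (a q b : ℕ) (x : ⨁ n, C n) :
    suspendedFlip k C (X.block a q b x) =
      (-1 : k) ^ ((a + 1 + b + 1) * (q + 1)) • TensorProduct.comm k _ _ (X.block a q b x) := by
  obtain ⟨y, hy⟩ := X.exists_block_eq a q b x
  rw [hy, suspendedFlip, signedFlip_incl₂]

theorem rTensor_mixedFlip_block (a q b c s : ℕ) (x : ⨁ n, C n) :
    LinearMap.rTensor _ (mixedFlip k C) ((TensorProduct.assoc k _ _ _).symm
        (LinearMap.lTensor _ (X.block a q b) (X.cupPart c s x))) =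
      (-1 : k) ^ (c * (a + 1 + b + 1)) • LinearMap.rTensor _ (TensorProduct.comm k _ _).toLinearMap
        ((TensorProduct.assoc k _ _ _).symm
          (LinearMap.lTensor _ (X.block a q b) (X.cupPart c s x))) := by
  obtain ⟨y, hy⟩ := X.exists_cupPart_eq c s x
  rw [hy, rTensor_mixedFlip fun x => X.exists_block_eq a q b _]

theorem rTensor_mixedFlip_comm_block (a q b c s : ℕ) (x : ⨁ n, C n) :
    LinearMap.rTensor _ (mixedFlip k C) ((TensorProduct.assoc k _ _ _).symm
        (LinearMap.lTensor _ ((TensorProduct.comm k _ _).toLinearMap ∘ₗ X.block a q b)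
          (X.cupPart c s x))) =
      (-1 : k) ^ (c * (q + 1)) • LinearMap.rTensor _ (TensorProduct.comm k _ _).toLinearMap
        ((TensorProduct.assoc k _ _ _).symm
          (LinearMap.lTensor _ ((TensorProduct.comm k _ _).toLinearMap ∘ₗ X.block a q b)
            (X.cupPart c s x))) := by
  obtain ⟨y, hy⟩ := X.exists_cupPart_eq c s x
  rw [hy, rTensor_mixedFlip (p := q) (q := a + 1 + b) fun x => ?_]
  obtain ⟨y, hy⟩ := X.exists_block_eq a q b (DirectSum.lof k ℕ C s x)
  exact ⟨_, by rw [LinearMap.comp_apply, hy, LinearEquiv.coe_coe, comm_incl₂]⟩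

/-- The suspended flip turns the exponent `(q + 1) b` into `(q + 1) a` modulo two, so inputs before
the block take the role of those after it. -/
theorem suspendedFlip_cobrace_lof (n : ℕ) (x : C n) :
    suspendedFlip k C (X.cobrace (DirectSum.lof k ℕ C n x)) =
      ∑ t ∈ Finset.triples n, (-1 : k) ^ ((t.2.1 + 1) * t.1) •
        TensorProduct.comm k _ _ (X.block t.1 t.2.1 t.2.2 (DirectSum.lof k ℕ C n x)) := by
  rw [cobrace_lof, map_sum]
  refine Finset.sum_congr rfl fun t _ => ?_
  rw [map_smul, suspendedFlip_block, smul_smul, ← pow_add]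
  congr 1
  exact neg_one_pow_eq (by grind [Nat.not_even_one])

theorem rTensor_suspendedFlip_cobrace_cupPart (a b : ℕ) (x : ⨁ n, C n) :
    LinearMap.rTensor _ (suspendedFlip k C ∘ₗ X.cobrace) (X.cupPart a b x) =
      ∑ t ∈ Finset.triples a, (-1 : k) ^ ((t.2.1 + 1) * t.1) •
        LinearMap.rTensor _ (TensorProduct.comm k _ _).toLinearMap
          (LinearMap.rTensor _ (X.block t.1 t.2.1 t.2.2) (X.cupPart a b x)) := by
  obtain ⟨y, hy⟩ := X.exists_cupPart_eq a b x
  simp only [hy, rTensor_rTensor_comp]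
  exact rTensor_incl₂_eq_sum _ _ (fun x => X.suspendedFlip_cobrace_lof _ x) _ y

theorem lTensor_suspendedFlip_cobrace_cupPart (a b : ℕ) (x : ⨁ n, C n) :
    LinearMap.lTensor _ (suspendedFlip k C ∘ₗ X.cobrace) (X.cupPart a b x) =
      ∑ t ∈ Finset.triples b, (-1 : k) ^ ((t.2.1 + 1) * t.1) •
        LinearMap.lTensor _ ((TensorProduct.comm k _ _).toLinearMap ∘ₗ X.block t.1 t.2.1 t.2.2)
          (X.cupPart a b x) := by
  obtain ⟨y, hy⟩ := X.exists_cupPart_eq a b x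
  rw [hy]
  exact lTensor_incl₂_eq_sum _ _ (fun x => X.suspendedFlip_cobrace_lof _ x) _ y

/-- The flipped cobrace is a coderivation of the cup coproduct. -/
theorem idTensor_cup_suspendedFlip_cobrace (x : ⨁ n, C n) :
    idTensor X.cup (suspendedFlip k C (X.cobrace x)) =
      LinearMap.rTensor _ (suspendedFlip k C ∘ₗ X.cobrace) (X.cup x) +
      LinearMap.rTensor _ (mixedFlip k C)
        (idTensor (suspendedFlip k C ∘ₗ X.cobrace) (X.cup x)) := by
  refine DirectSum.congr_of_lof (f := idTensor X.cup ∘ₗ suspendedFlip k C ∘ₗ X.cobrace)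
    (g := LinearMap.rTensor _ (suspendedFlip k C ∘ₗ X.cobrace) ∘ₗ X.cup +
      LinearMap.rTensor _ (mixedFlip k C) ∘ₗ idTensor (suspendedFlip k C ∘ₗ X.cobrace) ∘ₗ X.cup)
    (fun n x => ?_) x
  simp only [LinearMap.add_apply, LinearMap.comp_apply (idTensor _), LinearMap.comp_apply _ X.cup,
    LinearMap.comp_apply (suspendedFlip k C), LinearMap.comp_apply (LinearMap.rTensor _ _)]
  rw [suspendedFlip_cobrace_lof, cup_lof]
  set ξ := DirectSum.lof k ℕ C n x
  simp only [map_sum, map_smul, rTensor_suspendedFlip_cobrace_cupPart, idTensor,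
    LinearMap.comp_apply _ (LinearMap.lTensor _ _), LinearEquiv.coe_coe,
    lTensor_suspendedFlip_cobrace_cupPart, rTensor_mixedFlip_comm_block]
  have h₁ : ∀ t ∈ Finset.triples n, (-1 : k) ^ ((t.2.1 + 1) * t.1) •
      (TensorProduct.assoc k _ _ _).symm (LinearMap.lTensor _ X.cup
        (TensorProduct.comm k _ _ (X.block t.1 t.2.1 t.2.2 ξ))) =
      ∑ s ∈ Finset.HasAntidiagonal.antidiagonal t.1,
        (-1 : k) ^ ((t.2.1 + 1) * (s.1 + s.2)) •
          LinearMap.rTensor _ (TensorProduct.comm k _ _).toLinearMap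
            ((TensorProduct.assoc k _ _ _).symm
              (LinearMap.lTensor _ ((TensorProduct.comm k _ _).toLinearMap ∘ₗ
                X.block s.2 t.2.1 t.2.2) (X.cupPart s.1 (s.2 + t.2.1 + t.2.2) ξ))) +
      ∑ s ∈ Finset.HasAntidiagonal.antidiagonal t.2.2,
        (-1 : k) ^ ((t.2.1 + 1) * t.1) •
        LinearMap.rTensor _ (TensorProduct.comm k _ _).toLinearMap
          (LinearMap.rTensor _ (X.block t.1 t.2.1 s.1) (X.cupPart (t.1 + t.2.1 + s.1) s.2 ξ)) := by
    rintro ⟨A, q, D⟩ -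
    -- After the flip, the cup coproduct cuts the remainder of `A + 1 + D` inputs, either in front
    -- of the collapsed input or behind it; the two cases are the two summands of the coderivation
    -- rule.
    rw [LinearMap.lTensor, ← LinearEquiv.coe_coe (TensorProduct.comm k _ _), 
      ← LinearMap.comp_apply (TensorProduct.map _ _), TensorProduct.map_comp_comm_eq,
      LinearMap.comp_apply, ← LinearMap.rTensor, rTensor_cup_block,
      Finset.sum_antidiagonal_add_one_add A D fun u v =>
        LinearMap.rTensor _ (X.cupPart u v) (X.block A q D ξ)]
    simp only [map_add, map_sum, smul_add, Finset.smul_sum]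
    congr 1
    · refine Finset.sum_congr rfl fun s hs => ?_
      obtain ⟨c, a⟩ := s
      obtain rfl : c + a = A := Finset.HasAntidiagonal.mem_antidiagonal.1 hs
      rw [rTensor_cupPart_block_right, LinearEquiv.coe_coe, assoc_symm_comm_assoc_symm,
        LinearMap.lTensor_comp, LinearMap.comp_apply]
    · refine Finset.sum_congr rfl fun s hs => ?_
      obtain ⟨b, c⟩ := s
      obtain rfl : b + c = D := Finset.HasAntidiagonal.mem_antidiagonal.1 hs
      rw [rTensor_cupPart_block_left, LinearEquiv.coe_coe, assoc_symm_comm_rightComm]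
  rw [Finset.sum_congr rfl h₁, Finset.sum_add_distrib, add_comm]
  congr 1
  · rw [Finset.sum_triples_antidiagonal_right n fun a q b c => (-1 : k) ^ ((q + 1) * a) •
        LinearMap.rTensor _ (TensorProduct.comm k _ _).toLinearMap
          (LinearMap.rTensor _ (X.block a q b) (X.cupPart (a + q + b) c ξ)),
      ← Finset.sum_antidiagonal_triples_left n fun a q b c => (-1 : k) ^ ((q + 1) * a) •
        LinearMap.rTensor _ (TensorProduct.comm k _ _).toLinearMap
          (LinearMap.rTensor _ (X.block a q b) (X.cupPart (a + q + b) c ξ))]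
    refine Finset.sum_congr rfl fun t _ => Finset.sum_congr rfl fun s hs => ?_
    rw [Finset.mem_triples.1 hs]
  · rw [Finset.sum_triples_antidiagonal_left n fun c a q b => (-1 : k) ^ ((q + 1) * (c + a)) •
          LinearMap.rTensor _ (TensorProduct.comm k _ _).toLinearMap
            ((TensorProduct.assoc k _ _ _).symm
              (LinearMap.lTensor _ ((TensorProduct.comm k _ _).toLinearMap ∘ₗ
                X.block a q b) (X.cupPart c (a + q + b) ξ))),
      ← Finset.sum_antidiagonal_triples_right n fun c a q b => (-1 : k) ^ ((q + 1) * (c + a)) •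
          LinearMap.rTensor _ (TensorProduct.comm k _ _).toLinearMap
            ((TensorProduct.assoc k _ _ _).symm
              (LinearMap.lTensor _ ((TensorProduct.comm k _ _).toLinearMap ∘ₗ
                X.block a q b) (X.cupPart c (a + q + b) ξ)))]
    refine Finset.sum_congr rfl fun t _ => Finset.sum_congr rfl fun s hs => ?_
    rw [Finset.mem_triples.1 hs, smul_smul, ← pow_add]
    congr 2
    ring

end ComultiplicativeCooperad

/-! ### The homotopy half of coLeibniz: two disjoint blocks -/

namespace ComultiplicativeCooperad

open Cooperad (incl₂)

variable {k : Type u} [CommRing k]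
variable {C : ℕ → Type v} [∀ n, AddCommGroup (C n)] [∀ n, Module k (C n)]
variable (X : ComultiplicativeCooperad k C)

theorem twoBlocks_apply (a q b r c : ℕ) (x : ⨁ n, C n) :
    X.twoBlocks a q b r c x =
      LinearMap.rTensor _ (X.block a q (b + 1 + c)) (X.block (a + q + b) r c x) := rfl

theorem rTensor_apply_congr {W W' U : Type*} [AddCommGroup W] [Module k W] [AddCommGroup W']
    [Module k W'] [AddCommGroup U] [Module k U] {f g : W →ₗ[k] W'} (h : ∀ x, f x = g x)
    (t : W ⊗[k] U) : LinearMap.rTensor U f t = LinearMap.rTensor U g t := by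
  rw [LinearMap.ext h]

/-- The five lemmas of this kind distribute the faces of the argument over the five intervals cut
out by two disjoint blocks. Each applies the one-block rule twice, or once if the face enters the
later block. -/
theorem twoBlocks_face_first (a q b r c i : ℕ) (h : i ≤ a) (x : ⨁ n, C n) :
    X.twoBlocks a q b r c (X.totalFace (a + q + b + r + c + 1) i x) =
      LinearMap.rTensor _ (LinearMap.rTensor _ (X.totalFace (a + 1 + b + c + 2) i))
        (X.twoBlocks (a + 1) q b r c x) := by
  rw [twoBlocks_apply, twoBlocks_apply, X.block_face_before (a + q + b) r c i (by omega),
    rTensor_rTensor_comp, rTensor_rTensor_comp, show a + q + b + 1 = a + 1 + q + b by omega]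
  refine rTensor_apply_congr (fun x => ?_) _
  have := X.block_face_before a q (b + 1 + c) i h x
  rw [LinearMap.comp_apply, LinearMap.comp_apply, show a + 1 + b + c + 2 = a + (b + 1 + c) + 2 by omega,
    ← this, show a + q + (b + 1 + c) + 1 = a + q + b + c + 2 by omega]

theorem twoBlocks_face_second (a q b r c i : ℕ) (h : i < q) (x : ⨁ n, C n) :
    X.twoBlocks a q b r c (X.totalFace (a + q + b + r + c + 1) (a + 1 + i) x) =
      LinearMap.rTensor _ (LinearMap.lTensor _ (X.totalFace (q + 1) (i + 1)))
        (X.twoBlocks a (q + 1) b r c x) := by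
  rw [twoBlocks_apply, twoBlocks_apply, X.block_face_before (a + q + b) r c (a + 1 + i) (by omega),
    rTensor_rTensor_comp, rTensor_rTensor_comp, show a + (q + 1) + b = a + q + b + 1 by omega]
  refine rTensor_apply_congr (fun x => ?_) _
  have := X.block_face_inside a q (b + 1 + c) i h x
  rw [LinearMap.comp_apply, LinearMap.comp_apply,
    ← this, show a + q + (b + 1 + c) + 1 = a + q + b + c + 2 by omega]

theorem twoBlocks_face_third (a q b r c i : ℕ) (h : i < b) (x : ⨁ n, C n) :
    X.twoBlocks a q b r c (X.totalFace (a + q + b + r + c + 1) (a + q + 1 + i) x) =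
      LinearMap.rTensor _ (LinearMap.rTensor _ (X.totalFace (a + (b + 1) + c + 2) (a + 2 + i)))
        (X.twoBlocks a q (b + 1) r c x) := by
  rw [twoBlocks_apply, twoBlocks_apply, X.block_face_before (a + q + b) r c (a + q + 1 + i) (by omega),
    rTensor_rTensor_comp, rTensor_rTensor_comp]
  refine rTensor_apply_congr (fun x => ?_) _
  have := X.block_face_after a q (b + 1 + c) i (by omega) x
  rw [LinearMap.comp_apply, LinearMap.comp_apply, show a + (b + 1) + c + 2 = a + (b + 1 + c) + 2 by omega,
    show b + 1 + 1 + c = b + 1 + c + 1 by omega,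
    ← this, show a + q + (b + 1 + c) + 1 = a + q + b + c + 2 by omega]

theorem twoBlocks_face_fourth (a q b r c i : ℕ) (h : i < r) (x : ⨁ n, C n) :
    X.twoBlocks a q b r c (X.totalFace (a + q + b + r + c + 1) (a + q + b + 1 + i) x) =
      LinearMap.lTensor _ (X.totalFace (r + 1) (i + 1)) (X.twoBlocks a q b (r + 1) c x) := by
  rw [twoBlocks_apply, twoBlocks_apply, X.block_face_inside (a + q + b) r c i h,
    lTensor_rTensor_comm]

theorem twoBlocks_face_fifth (a q b r c i : ℕ) (h : i ≤ c) (x : ⨁ n, C n) :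
    X.twoBlocks a q b r c (X.totalFace (a + q + b + r + c + 1) (a + q + b + r + 1 + i) x) =
      LinearMap.rTensor _ (LinearMap.rTensor _ (X.totalFace (a + b + (c + 1) + 2) (a + b + 3 + i)))
        (X.twoBlocks a q b r (c + 1) x) := by
  rw [twoBlocks_apply, twoBlocks_apply, X.block_face_after (a + q + b) r c i (by omega),
    rTensor_rTensor_comp, rTensor_rTensor_comp]
  refine rTensor_apply_congr (fun x => ?_) _
  have := X.block_face_after a q (b + 1 + c) (b + 1 + i) (by omega) x
  rw [LinearMap.comp_apply, LinearMap.comp_apply, show a + b + (c + 1) + 2 = a + (b + 1 + c) + 2 by omega,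
    show b + 1 + (c + 1) = b + 1 + c + 1 by omega, show a + b + 3 + i = a + 2 + (b + 1 + i) by omega,
    ← this, show a + q + (b + 1 + c) + 1 = a + q + b + c + 2 by omega,
    show a + q + b + 2 + i = a + q + 1 + (b + 1 + i) by omega]

/-- An outer face of a block removes an end input. The same result arises if this input stays
outside and is merged with the collapsed input. The four lemmas of this kind are the cancelling
pairs of `sum_quintuples_block_faces`. -/
theorem twoBlocks_merge_second_first (a q b r c : ℕ) (x : ⨁ n, C n) :
    LinearMap.rTensor _ (LinearMap.lTensor _ (X.totalFace (q + 1) 0)) (X.twoBlocks a (q + 1) b r c x) =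
      LinearMap.rTensor _ (LinearMap.rTensor _ (X.totalFace (a + 1 + b + c + 2) (a + 1)))
        (X.twoBlocks (a + 1) q b r c x) := by
  rw [twoBlocks_apply, twoBlocks_apply, rTensor_rTensor_comp, rTensor_rTensor_comp,
    show a + (q + 1) + b = a + 1 + q + b by omega]
  refine rTensor_apply_congr (fun x => ?_) _
  rw [LinearMap.comp_apply, LinearMap.comp_apply, block_lTensor_face_first,
    show a + 1 + b + c + 2 = a + (b + 1 + c) + 2 by omega]

theorem twoBlocks_merge_second_last (a q b r c : ℕ) (x : ⨁ n, C n) :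
    LinearMap.rTensor _ (LinearMap.lTensor _ (X.totalFace (q + 1) (q + 1)))
        (X.twoBlocks a (q + 1) b r c x) =
      LinearMap.rTensor _ (LinearMap.rTensor _ (X.totalFace (a + (b + 1) + c + 2) (a + 1)))
        (X.twoBlocks a q (b + 1) r c x) := by
  rw [twoBlocks_apply, twoBlocks_apply, rTensor_rTensor_comp, rTensor_rTensor_comp,
    show a + (q + 1) + b = a + q + (b + 1) by omega]
  refine rTensor_apply_congr (fun x => ?_) _
  rw [LinearMap.comp_apply, LinearMap.comp_apply, block_lTensor_face_last,
    show a + (b + 1) + c + 2 = a + (b + 1 + c) + 2 by omega,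
    show b + 1 + 1 + c = b + 1 + c + 1 by omega]

theorem twoBlocks_merge_third_first (a q b r c : ℕ) (x : ⨁ n, C n) :
    LinearMap.lTensor _ (X.totalFace (r + 1) 0) (X.twoBlocks a q b (r + 1) c x) =
      LinearMap.rTensor _ (LinearMap.rTensor _ (X.totalFace (a + (b + 1) + c + 2) (a + 1 + (b + 1))))
        (X.twoBlocks a q (b + 1) r c x) := by
  rw [twoBlocks_apply, twoBlocks_apply, ← lTensor_rTensor_comm, block_lTensor_face_first,
    rTensor_rTensor_comp, rTensor_rTensor_comp]
  refine rTensor_apply_congr (fun x => ?_) _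
  have := X.block_face_after a q (b + 1 + c) b (by omega) x
  rw [LinearMap.comp_apply, LinearMap.comp_apply, show a + (b + 1) + c + 2 = a + (b + 1 + c) + 2 by omega,
    show b + 1 + 1 + c = b + 1 + c + 1 by omega, show a + 1 + (b + 1) = a + 2 + b by omega,
    ← this, show a + q + (b + 1 + c) + 1 = a + q + b + c + 2 by omega,
    show a + q + 1 + b = a + q + b + 1 by omega]

theorem twoBlocks_merge_third_last (a q b r c : ℕ) (x : ⨁ n, C n) :
    LinearMap.lTensor _ (X.totalFace (r + 1) (r + 1)) (X.twoBlocks a q b (r + 1) c x) =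
      LinearMap.rTensor _ (LinearMap.rTensor _ (X.totalFace (a + b + (c + 1) + 2) (a + b + 2)))
        (X.twoBlocks a q b r (c + 1) x) := by
  rw [twoBlocks_apply, twoBlocks_apply, ← lTensor_rTensor_comm, block_lTensor_face_last,
    rTensor_rTensor_comp, rTensor_rTensor_comp]
  refine rTensor_apply_congr (fun x => ?_) _
  have := X.block_face_after a q (b + 1 + c) b (by omega) x
  rw [LinearMap.comp_apply, LinearMap.comp_apply, show a + b + (c + 1) + 2 = a + (b + 1 + c) + 2 by omega,
    show b + 1 + (c + 1) = b + 1 + c + 1 by omega, show a + b + 2 = a + 2 + b by omega,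
    ← this, show a + q + (b + 1 + c) + 1 = a + q + b + c + 2 by omega,
    show a + q + 1 + b = a + q + b + 1 by omega]

/-- With no input before the first block, the first face removes its collapsed input. What remains
is a cut after `q` inputs, a block in its right part, and a swap: the term of coLeibniz that carries
the mixed flip. -/
theorem twoBlocks_outer_first (q b r c : ℕ) (x : ⨁ n, C n) :
    LinearMap.rTensor _ (LinearMap.rTensor _ (X.totalFace (0 + b + c + 2) 0)) (X.twoBlocks 0 q b r c x) =
      LinearMap.rTensor _ (TensorProduct.comm k _ _).toLinearMap ((TensorProduct.assoc k _ _ _).symm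
        (LinearMap.lTensor _ (X.block b r c) (X.cupPart q (b + r + c) x))) := by
  have h := X.rTensor_cupPart_block_right q b r c x
  simp only [← h, twoBlocks_apply, rTensor_rTensor_comp, Nat.zero_add]
  refine rTensor_apply_congr (fun x => ?_) _
  rw [LinearMap.comp_apply, LinearMap.comp_apply, show b + c + 2 = b + 1 + c + 1 by omega,
    rTensor_face_first_block, LinearEquiv.coe_coe]

/-- Adjacent blocks whose collapsed inputs are merged form one block that has been cut; this is the
cup coproduct applied to the extracted factor. -/
theorem twoBlocks_outer_middle (a q r c : ℕ) (x : ⨁ n, C n) :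
    LinearMap.rTensor _ (LinearMap.rTensor _ (X.totalFace (a + 0 + c + 2) (a + 1)))
        (X.twoBlocks a q 0 r c x) =
      (TensorProduct.assoc k _ _ _).symm
        (LinearMap.lTensor _ (X.cupPart q r) (X.block a (q + r) c x)) := by
  simp only [lTensor_cupPart_block, twoBlocks_apply, Nat.zero_add, Nat.add_zero]

/-- With no input after the second block, the last face removes its collapsed input, so this block
becomes the right part of a cut. -/
theorem twoBlocks_outer_last (a q b r : ℕ) (x : ⨁ n, C n) :
    LinearMap.rTensor _ (LinearMap.rTensor _ (X.totalFace (a + b + 0 + 2) (a + b + 2)))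
        (X.twoBlocks a q b r 0 x) =
      LinearMap.rTensor _ (X.block a q b) (X.cupPart (a + q + b) r x) := by
  rw [← rTensor_face_last_block, twoBlocks_apply, rTensor_rTensor_comp, rTensor_rTensor_comp]
  refine rTensor_apply_congr (fun x => ?_) _
  rw [LinearMap.comp_apply, LinearMap.comp_apply, block_face_last]

theorem suspendedTripleDiff_twoBlocks (a q b r c : ℕ) (x : ⨁ n, C n) :
    suspendedTripleDiff X.diff (X.twoBlocks a q b r c x) =
      ∑ i ∈ Finset.range (a + b + c + 3), (-1 : k) ^ i •
        LinearMap.rTensor _ (LinearMap.rTensor _ (X.totalFace (a + b + c + 2) i))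
          (X.twoBlocks a q b r c x) -
      (-1 : k) ^ (a + b + c) • (∑ i ∈ Finset.range (q + 1), (-1 : k) ^ i •
        LinearMap.rTensor _ (LinearMap.lTensor _ (X.totalFace q i)) (X.twoBlocks a q b r c x)) -
      (-1 : k) ^ (a + b + c + q) • ∑ i ∈ Finset.range (r + 1), (-1 : k) ^ i •
        LinearMap.lTensor _ (X.totalFace r i) (X.twoBlocks a q b r c x) := by
  have h₁ : LinearMap.rTensor _ (suspendedTensorDiff X.diff) (X.twoBlocks a q b r c x) =
      ∑ i ∈ Finset.range (a + b + c + 3), (-1 : k) ^ i •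
        LinearMap.rTensor _ (LinearMap.rTensor _ (X.totalFace (a + b + c + 2) i))
          (X.twoBlocks a q b r c x) -
      (-1 : k) ^ (a + b + c) • (∑ i ∈ Finset.range (q + 1), (-1 : k) ^ i •
        LinearMap.rTensor _ (LinearMap.lTensor _ (X.totalFace q i)) (X.twoBlocks a q b r c x)) := by
    simp only [twoBlocks_apply, rTensor_rTensor_comp]
    generalize X.block (a + q + b) r c x = t
    induction t using TensorProduct.induction_on with
    | zero => simp
    | add s t hs ht =>
      simp only [map_add, hs, ht, smul_add, Finset.sum_add_distrib]
      abel
    | tmul y z =>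
      simp only [LinearMap.rTensor_tmul, LinearMap.comp_apply, suspendedTensorDiff_block,
        TensorProduct.sub_tmul, TensorProduct.sum_tmul, ← TensorProduct.smul_tmul']
      rw [show a + (b + 1 + c) + 2 = a + b + c + 3 by omega,
        show a + (b + 1 + c) + 1 = a + b + c + 2 by omega,
        neg_one_pow_eq (k := k) (m := a + 1 + (b + 1 + c)) (n := a + b + c)
          (by grind [Nat.not_even_one])]
  have h₂ : LinearMap.lTensor _ (totalDiff X.diff) (X.twoBlocks a q b r c x) =
      ∑ i ∈ Finset.range (r + 1), (-1 : k) ^ i •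
        LinearMap.lTensor _ (X.totalFace r i) (X.twoBlocks a q b r c x) := by
    simp only [twoBlocks_apply, ← lTensor_rTensor_comm, lTensor_totalDiff_block, map_sum, map_smul]
  have h₃ : LinearMap.rTensor _ (TensorProduct.map (parity k C) (parity k C))
      (X.twoBlocks a q b r c x) = (-1 : k) ^ (a + b + c + q) • X.twoBlocks a q b r c x := by
    obtain ⟨y, hy⟩ := X.exists_twoBlocks_eq a q b r c x
    rw [hy]
    clear hy
    induction y using TensorProduct.induction_on with
    | zero => simp
    | add a b ha hb => simp only [map_add, ha, hb, smul_add]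
    | tmul u v =>
      induction u using TensorProduct.induction_on with
      | zero => simp
      | add a b ha hb => simp only [TensorProduct.add_tmul, map_add, ha, hb, smul_add]
      | tmul u w =>
        simp only [TensorProduct.map_tmul, LinearMap.rTensor_tmul, parity_lof,
          TensorProduct.tmul_smul, ← TensorProduct.smul_tmul', smul_smul, ← pow_add]
        congr 1
        exact neg_one_pow_eq (by grind [Nat.not_even_one])
  have h₄ : suspendedTripleDiff X.diff = LinearMap.rTensor _ (suspendedTensorDiff X.diff) -
      LinearMap.lTensor _ (totalDiff X.diff) ∘ₗ
        LinearMap.rTensor _ (TensorProduct.map (parity k C) (parity k C)) := by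
    rw [LinearMap.lTensor_comp_rTensor]
    rfl
  rw [h₄, LinearMap.sub_apply, LinearMap.comp_apply, h₃, map_smul, h₁, h₂]

/-- The homotopy for the coLeibniz identity. -/
def coLeibnizHomotopy : (⨁ n, C n) →ₗ[k] ((⨁ n, C n) ⊗[k] (⨁ n, C n)) ⊗[k] (⨁ n, C n) :=
  DirectSum.toModule k ℕ _ fun n =>
    (∑ t ∈ Finset.quintuples n,
      (-1 : k) ^ (1 + t.1 + t.2.2.2.2 + t.2.1 * t.2.2.1 + t.2.1 * t.2.2.2.2 +
          t.2.2.2.1 * t.2.2.2.2) •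
        X.twoBlocks t.1 t.2.1 t.2.2.1 t.2.2.2.1 t.2.2.2.2) ∘ₗ DirectSum.lof k ℕ C n

theorem coLeibnizHomotopy_lof (n : ℕ) (x : C n) :
    X.coLeibnizHomotopy (DirectSum.lof k ℕ C n x) =
      ∑ t ∈ Finset.quintuples n,
        (-1 : k) ^ (1 + t.1 + t.2.2.2.2 + t.2.1 * t.2.2.1 + t.2.1 * t.2.2.2.2 +
            t.2.2.2.1 * t.2.2.2.2) •
          X.twoBlocks t.1 t.2.1 t.2.2.1 t.2.2.2.1 t.2.2.2.2 (DirectSum.lof k ℕ C n x) := by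
  simp [coLeibnizHomotopy]

theorem coLeibnizHomotopy_totalFace (n i : ℕ) (x : ⨁ n, C n) :
    X.coLeibnizHomotopy (X.totalFace (n + 1) i x) =
      ∑ t ∈ Finset.quintuples n,
        (-1 : k) ^ (1 + t.1 + t.2.2.2.2 + t.2.1 * t.2.2.1 + t.2.1 * t.2.2.2.2 +
            t.2.2.2.1 * t.2.2.2.2) •
          X.twoBlocks t.1 t.2.1 t.2.2.1 t.2.2.2.1 t.2.2.2.2 (X.totalFace (n + 1) i x) := by
  obtain ⟨y, hy⟩ := X.totalFace_eq_lof n i x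
  rw [hy, coLeibnizHomotopy_lof]

theorem coLeibnizHomotopy_totalDiff_lof (N : ℕ) (x : C (N + 1)) :
    X.coLeibnizHomotopy (totalDiff X.diff (DirectSum.lof k ℕ C (N + 1) x)) =
      ∑ t ∈ Finset.quintuples N,
        (-1 : k) ^ (1 + t.1 + t.2.2.2.2 + t.2.1 * t.2.2.1 + t.2.1 * t.2.2.2.2 +
            t.2.2.2.1 * t.2.2.2.2) •
        (∑ i ∈ Finset.range (t.1 + 1), (-1 : k) ^ i •
            LinearMap.rTensor _ (LinearMap.rTensor _
              (X.totalFace (t.1 + 1 + t.2.2.1 + t.2.2.2.2 + 2) i))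
              (X.twoBlocks (t.1 + 1) t.2.1 t.2.2.1 t.2.2.2.1 t.2.2.2.2
                (DirectSum.lof k ℕ C (N + 1) x)) +
          ∑ i ∈ Finset.range t.2.1, (-1 : k) ^ (t.1 + 1 + i) •
            LinearMap.rTensor _ (LinearMap.lTensor _ (X.totalFace (t.2.1 + 1) (i + 1)))
              (X.twoBlocks t.1 (t.2.1 + 1) t.2.2.1 t.2.2.2.1 t.2.2.2.2
                (DirectSum.lof k ℕ C (N + 1) x)) +
          ∑ i ∈ Finset.range t.2.2.1, (-1 : k) ^ (t.1 + t.2.1 + 1 + i) •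
            LinearMap.rTensor _ (LinearMap.rTensor _
              (X.totalFace (t.1 + (t.2.2.1 + 1) + t.2.2.2.2 + 2) (t.1 + 2 + i)))
              (X.twoBlocks t.1 t.2.1 (t.2.2.1 + 1) t.2.2.2.1 t.2.2.2.2
                (DirectSum.lof k ℕ C (N + 1) x)) +
          ∑ i ∈ Finset.range t.2.2.2.1, (-1 : k) ^ (t.1 + t.2.1 + t.2.2.1 + 1 + i) •
            LinearMap.lTensor _ (X.totalFace (t.2.2.2.1 + 1) (i + 1))
              (X.twoBlocks t.1 t.2.1 t.2.2.1 (t.2.2.2.1 + 1) t.2.2.2.2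
                (DirectSum.lof k ℕ C (N + 1) x)) +
          ∑ i ∈ Finset.range (t.2.2.2.2 + 1),
            (-1 : k) ^ (t.1 + t.2.1 + t.2.2.1 + t.2.2.2.1 + 1 + i) •
            LinearMap.rTensor _ (LinearMap.rTensor _
              (X.totalFace (t.1 + t.2.2.1 + (t.2.2.2.2 + 1) + 2) (t.1 + t.2.2.1 + 3 + i)))
              (X.twoBlocks t.1 t.2.1 t.2.2.1 t.2.2.2.1 (t.2.2.2.2 + 1)
                (DirectSum.lof k ℕ C (N + 1) x))) := by
  simp only [totalDiff_lof, map_sum, map_smul, coLeibnizHomotopy_totalFace]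
  simp only [Finset.smul_sum (r := (-1 : k) ^ (_ : ℕ)) (s := Finset.quintuples N)]
  rw [Finset.sum_comm]
  refine Finset.sum_congr rfl fun t ht => ?_
  simp only [smul_comm _ ((-1 : k) ^ (1 + t.1 + t.2.2.2.2 + t.2.1 * t.2.2.1 + t.2.1 * t.2.2.2.2 +
            t.2.2.2.1 * t.2.2.2.2)), ← Finset.smul_sum]
  obtain ⟨a, q, b, r, c⟩ := t
  obtain rfl : a + q + b + r + c = N := Finset.mem_quintuples.1 ht
  rw [show a + q + b + r + c + 1 + 1 = a + 1 + q + b + r + (c + 1) by omega, Finset.sum_range_add,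
    Finset.sum_range_add, Finset.sum_range_add, Finset.sum_range_add]
  refine congrArg _ (congrArg₂ _ (congrArg₂ _ (congrArg₂ _ (congrArg₂ _ ?_ ?_) ?_) ?_) ?_) <;>
    refine Finset.sum_congr rfl fun i hi => ?_ <;> simp only [Finset.mem_range] at hi
  · rw [X.twoBlocks_face_first a q b r c i (by omega)]
  · rw [X.twoBlocks_face_second a q b r c i (by omega)]
  · rw [show a + 1 + q + i = a + q + 1 + i by omega, X.twoBlocks_face_third a q b r c i (by omega)]
  · rw [show a + 1 + q + b + i = a + q + b + 1 + i by omega,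
      X.twoBlocks_face_fourth a q b r c i (by omega)]
  · rw [show a + 1 + q + b + r + i = a + q + b + r + 1 + i by omega,
      X.twoBlocks_face_fifth a q b r c i (by omega)]

/-- The three composites of the coLeibniz identity are matched, with signs, with the three families
of faces that do not cancel in the boundary of the two-block homotopy. -/
theorem coLeibniz_cobrace_lof (n : ℕ) (x : C n) :
    idTensor X.cup (X.cobrace (DirectSum.lof k ℕ C n x)) -
      LinearMap.rTensor _ X.cobrace (X.cup (DirectSum.lof k ℕ C n x)) -
      LinearMap.rTensor _ (mixedFlip k C) (idTensor X.cobrace (X.cup (DirectSum.lof k ℕ C n x))) =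
    ∑ t ∈ Finset.quadruples n, (-1 : k) ^ (1 + t.2.2.2 + t.1 * t.2.1 + t.1 * t.2.2.2 +
        t.2.2.1 * t.2.2.2) • LinearMap.rTensor _ (LinearMap.rTensor _
          (X.totalFace (0 + t.2.1 + t.2.2.2 + 2) 0))
          (X.twoBlocks 0 t.1 t.2.1 t.2.2.1 t.2.2.2 (DirectSum.lof k ℕ C n x)) +
      ∑ t ∈ Finset.quadruples n, (-1 : k) ^ (t.2.2.2 + t.2.1 * t.2.2.2 + t.2.2.1 * t.2.2.2) •
        LinearMap.rTensor _ (LinearMap.rTensor _ (X.totalFace (t.1 + 0 + t.2.2.2 + 2) (t.1 + 1)))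
          (X.twoBlocks t.1 t.2.1 0 t.2.2.1 t.2.2.2 (DirectSum.lof k ℕ C n x)) +
      ∑ t ∈ Finset.quadruples n, (-1 : k) ^ (1 + t.2.2.1 + t.2.1 * t.2.2.1) •
        LinearMap.rTensor _ (LinearMap.rTensor _
          (X.totalFace (t.1 + t.2.2.1 + 0 + 2) (t.1 + t.2.2.1 + 2)))
          (X.twoBlocks t.1 t.2.1 t.2.2.1 t.2.2.2 0 (DirectSum.lof k ℕ C n x)) := by
  set ξ := DirectSum.lof k ℕ C n x with hξ
  have h₁ : idTensor X.cup (X.cobrace ξ) =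
      ∑ t ∈ Finset.quadruples n, (-1 : k) ^ (t.2.2.2 + t.2.1 * t.2.2.2 + t.2.2.1 * t.2.2.2) •
        LinearMap.rTensor _ (LinearMap.rTensor _ (X.totalFace (t.1 + 0 + t.2.2.2 + 2) (t.1 + 1)))
          (X.twoBlocks t.1 t.2.1 0 t.2.2.1 t.2.2.2 ξ) := by
    simp only [twoBlocks_outer_middle]
    rw [← Finset.sum_triples_antidiagonal n fun a q r c => (-1 : k) ^ (c + q * c + r * c) •
      (TensorProduct.assoc k _ _ _).symm
        (LinearMap.lTensor _ (X.cupPart q r) (X.block a (q + r) c ξ)), hξ, cobrace_lof, map_sum]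
    refine Finset.sum_congr rfl fun t _ => ?_
    simp only [map_smul, idTensor, LinearMap.comp_apply, LinearEquiv.coe_coe, lTensor_cup_block,
      map_sum, Finset.smul_sum]
    refine Finset.sum_congr rfl fun s hs => ?_
    rw [← Finset.HasAntidiagonal.mem_antidiagonal.1 hs]
    congr 1
    ring
  have h₂ : LinearMap.rTensor _ X.cobrace (X.cup ξ) =
      -∑ t ∈ Finset.quadruples n, (-1 : k) ^ (1 + t.2.2.1 + t.2.1 * t.2.2.1) •
        LinearMap.rTensor _ (LinearMap.rTensor _
          (X.totalFace (t.1 + t.2.2.1 + 0 + 2) (t.1 + t.2.2.1 + 2)))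
          (X.twoBlocks t.1 t.2.1 t.2.2.1 t.2.2.2 0 ξ) := by
    simp only [twoBlocks_outer_last]
    rw [← Finset.sum_antidiagonal_triples_left n fun a q b r => (-1 : k) ^ (1 + b + q * b) •
      LinearMap.rTensor _ (X.block a q b) (X.cupPart (a + q + b) r ξ), hξ, cup_lof, map_sum,
      ← Finset.sum_neg_distrib]
    refine Finset.sum_congr rfl fun t _ => ?_
    rw [rTensor_cobrace_cupPart, ← Finset.sum_neg_distrib]
    refine Finset.sum_congr rfl fun s hs => ?_
    rw [Finset.mem_triples.1 hs, neg_one_pow_eq_neg (k := k) (m := (s.2.1 + 1) * s.2.2)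
      (n := 1 + s.2.2 + s.2.1 * s.2.2) (by grind [Nat.not_even_one]), TensorProduct.neg_smul_tensor]
  have h₃ : LinearMap.rTensor _ (mixedFlip k C) (idTensor X.cobrace (X.cup ξ)) =
      -∑ t ∈ Finset.quadruples n, (-1 : k) ^ (1 + t.2.2.2 + t.1 * t.2.1 + t.1 * t.2.2.2 +
        t.2.2.1 * t.2.2.2) • LinearMap.rTensor _ (LinearMap.rTensor _
          (X.totalFace (0 + t.2.1 + t.2.2.2 + 2) 0))
          (X.twoBlocks 0 t.1 t.2.1 t.2.2.1 t.2.2.2 ξ) := by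
    simp only [twoBlocks_outer_first]
    rw [← Finset.sum_antidiagonal_triples_right n fun q b r c =>
      (-1 : k) ^ (1 + c + q * b + q * c + r * c) •
      LinearMap.rTensor _ (TensorProduct.comm k _ _).toLinearMap ((TensorProduct.assoc k _ _ _).symm
        (LinearMap.lTensor _ (X.block b r c) (X.cupPart q (b + r + c) ξ))), hξ, cup_lof, map_sum,
      map_sum, ← Finset.sum_neg_distrib]
    refine Finset.sum_congr rfl fun t _ => ?_
    simp only [idTensor, LinearMap.comp_apply, LinearEquiv.coe_coe, lTensor_cobrace_cupPart,
      map_sum, map_smul, rTensor_mixedFlip_block]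
    rw [← Finset.sum_neg_distrib]
    refine Finset.sum_congr rfl fun s hs => ?_
    rw [Finset.mem_triples.1 hs, smul_smul, ← pow_add, neg_one_pow_eq_neg (k := k)
      (m := (s.2.1 + 1) * s.2.2 + t.1 * (s.1 + 1 + s.2.2 + 1))
      (n := 1 + s.2.2 + t.1 * s.1 + t.1 * s.2.2 + s.2.1 * s.2.2) (by grind [Nat.not_even_one]),
      TensorProduct.neg_smul_tensor]
  rw [h₁, h₂, h₃]
  abel

theorem suspendedTripleDiff_coLeibnizHomotopy (x : ⨁ n, C n) :
    suspendedTripleDiff X.diff (X.coLeibnizHomotopy x) + X.coLeibnizHomotopy (totalDiff X.diff x) =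
      idTensor X.cup (X.cobrace x) - LinearMap.rTensor _ X.cobrace (X.cup x) -
        LinearMap.rTensor _ (mixedFlip k C) (idTensor X.cobrace (X.cup x)) := by
  refine DirectSum.congr_of_lof
    (f := suspendedTripleDiff X.diff ∘ₗ X.coLeibnizHomotopy +
      X.coLeibnizHomotopy ∘ₗ totalDiff X.diff)
    (g := idTensor X.cup ∘ₗ X.cobrace - LinearMap.rTensor _ X.cobrace ∘ₗ X.cup -
      LinearMap.rTensor _ (mixedFlip k C) ∘ₗ idTensor X.cobrace ∘ₗ X.cup) (fun n x => ?_) x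
  refine Eq.trans ?_ (X.coLeibniz_cobrace_lof n x).symm
  rw [LinearMap.add_apply, LinearMap.comp_apply, LinearMap.comp_apply, coLeibnizHomotopy_lof,
    map_sum]
  simp only [map_smul, suspendedTripleDiff_twoBlocks]
  cases n with
  | zero =>
    -- In degree zero both blocks are empty, and the three faces of the binary remaining factor give
    -- the three terms.
    have h₀ : Finset.quintuples 0 = {(0, 0, 0, 0, 0)} := by decide
    have h₁ : Finset.quadruples 0 = {(0, 0, 0, 0)} := by decide
    have h₂ : X.totalFace 0 0 = 0 := rfl
    simp only [totalDiff_lof_zero, h₀, h₁, Finset.sum_singleton, map_zero, add_zero, zero_add,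
      Nat.mul_zero, Finset.sum_range_succ, Finset.sum_range_zero, h₂, LinearMap.lTensor_zero,
      LinearMap.rTensor_zero, LinearMap.zero_apply, smul_zero, sub_zero, pow_zero, one_smul, pow_one,
      smul_add, smul_smul]
    norm_num
  | succ N =>
    rw [coLeibnizHomotopy_totalDiff_lof]
    refine sum_quintuples_block_faces (k := k) N
      (fun a q b r c i => LinearMap.rTensor _ (LinearMap.rTensor _ (X.totalFace (a + b + c + 2) i))
        (X.twoBlocks a q b r c (DirectSum.lof k ℕ C (N + 1) x)))
      (fun a q b r c i => LinearMap.rTensor _ (LinearMap.lTensor _ (X.totalFace q i))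
        (X.twoBlocks a q b r c (DirectSum.lof k ℕ C (N + 1) x)))
      (fun a q b r c i => LinearMap.lTensor _ (X.totalFace r i)
        (X.twoBlocks a q b r c (DirectSum.lof k ℕ C (N + 1) x))) ?_ ?_ ?_ ?_ ?_ ?_
    · intro a b r c i
      simp [totalFace]
    · intro a b r c i
      simp [totalFace]
    · intro a q b r c
      exact X.twoBlocks_merge_second_first a q b r c _
    · intro a q b r c
      exact X.twoBlocks_merge_second_last a q b r c _
    · intro a q b r c
      exact X.twoBlocks_merge_third_first a q b r c _
    · intro a q b r c
      exact X.twoBlocks_merge_third_last a q b r c _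

/-- The cobracket is the cobrace minus its flip. The flip satisfies coLeibniz strictly, so only the
defect of the cobrace contributes, and that is the boundary of the homotopy. -/
theorem coLeibnizDefect_cobracket (x : ⨁ n, C n) :
    coLeibnizDefect k C X.cup X.cobracket x = suspendedTripleDiff X.diff (X.coLeibnizHomotopy x) +
      X.coLeibnizHomotopy (totalDiff X.diff x) := by
  have h : idTensor X.cobracket = idTensor X.cobrace - idTensor (suspendedFlip k C ∘ₗ X.cobrace) := by
    simp only [cobracket, idTensor, ← LinearMap.comp_sub, ← LinearMap.lTensor_sub]
    rfl
  have h' : LinearMap.rTensor (⨁ n, C n) X.cobracket =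
      LinearMap.rTensor _ X.cobrace - LinearMap.rTensor _ (suspendedFlip k C ∘ₗ X.cobrace) := by
    rw [← LinearMap.rTensor_sub]
    rfl
  rw [suspendedTripleDiff_coLeibnizHomotopy, coLeibnizDefect, h, h']
  simp only [LinearMap.sub_apply, LinearMap.comp_apply, LinearMap.add_apply, cobracket,
    LinearMap.id_apply, map_sub, idTensor_cup_suspendedFlip_cobrace]
  abel

theorem isGerstenhaberOnHomology :
    IsGerstenhaberOnHomology X.diff X.cup X.cobracket X.cupCounit where
  d_comp_d := X.totalDiff_comp_totalDiff
  cup_mem := X.cup_mem_tensorDegree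
  counit_eq_zero n x h := by
    rw [cupCounit, LinearMap.comp_apply, DirectSum.component.of, dif_neg h, map_zero]
  cobracket_mem := X.cobracket_mem_tensorDegree
  cup_comp_d := X.cup_comp_totalDiff
  cobracket_comp_d := X.cobracket_comp_totalDiff
  counit_comp_d := X.cupCounit_comp_totalDiff
  coassoc := X.cup_coassoc
  counit_left := X.cup_counit_left
  counit_right := X.cup_counit_right
  cocomm := X.gradedFlip_cup_mem
  coantisymm := LinearMap.range_comp_le_range _ _
  coJacobi := X.coJacobiator_cobracket
  coLeibniz z hz := ⟨X.coLeibnizHomotopy z, by rw [coLeibnizDefect_cobracket, hz, map_zero, add_zero]⟩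

end ComultiplicativeCooperad

/-! ### The tensor algebra of a bialgebra and its coaction -/

section BarAlgebra

variable (k : Type u) [CommRing k] (B : Type v) [Ring B] [Bialgebra k B]

/-- The total module of the bar chains, which is the tensor algebra of `B`. -/
abbrev BarAlgebra : Type (max u v) := ⨁ n, BarChain k B n

/-- The inclusion of the bar chains of length `n`. -/
abbrev barLof (n : ℕ) : BarChain k B n →ₗ[k] BarAlgebra k B :=
  DirectSum.lof k ℕ (fun n => BarChain k B n) n

/-- The inclusion of `B` as the bar chains of length one. -/
def barGen : B →ₗ[k] BarAlgebra k B :=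
  barLof k B 1 ∘ₗ
    (PiTensorProduct.subsingletonEquiv (R := k) (s := fun _ : Fin 1 => B) 0).symm.toLinearMap

variable {k B}

theorem barGen_apply (b : B) :
    barGen k B b = barLof k B 1 (PiTensorProduct.tprod k fun _ => b) := by
  simp [barGen]

theorem barLof_mul {m n : ℕ} (x : BarChain k B m) (y : BarChain k B n) :
    barLof k B m x * barLof k B n y = barLof k B (m + n) (TensorPower.mulEquiv (x ⊗ₜ[k] y)) := by
  simp only [DirectSum.lof_eq_of]
  exact DirectSum.of_mul_of x y

theorem barLof_cast {m n : ℕ} (h : m = n) (x : BarChain k B m) :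
    barLof k B n (TensorPower.cast k B h x) = barLof k B m x := by
  subst h
  simp

theorem barLof_one : barLof k B 0 (PiTensorProduct.tprod k Fin.elim0) = 1 := by
  simp only [DirectSum.lof_eq_of]
  rfl

theorem barLof_tprod_cons {n : ℕ} (b : B) (y : Fin n → B) :
    barLof k B (n + 1) (PiTensorProduct.tprod k (Fin.cons b y)) =
      barGen k B b * barLof k B n (PiTensorProduct.tprod k y) := by
  rw [barGen_apply, barLof_mul, ← barLof_cast (Nat.add_comm 1 n)]
  congr 1
  have := TensorPower.tprod_mul_tprod k (fun _ : Fin 1 => b) y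
  rw [TensorPower.gMul_def] at this
  rw [this, TensorPower.cast_tprod]
  congr 1
  funext i
  refine Fin.cases ?_ (fun j => ?_) i
  · simp [Fin.append, Fin.addCases]
  · simp only [Fin.cons_succ, Function.comp_apply]
    rw [show Fin.cast (Nat.add_comm 1 n).symm j.succ = Fin.natAdd 1 j by
      ext; simp [Nat.add_comm], Fin.append_right]

theorem barLof_tprod_succ {n : ℕ} (y : Fin (n + 1) → B) :
    barLof k B (n + 1) (PiTensorProduct.tprod k y) =
      barGen k B (y 0) * barLof k B n (PiTensorProduct.tprod k (Fin.tail y)) := by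
  rw [← barLof_tprod_cons, Fin.cons_self_tail]

theorem barLof_tprod_snoc {n : ℕ} (y : Fin (n + 1) → B) :
    barLof k B (n + 1) (PiTensorProduct.tprod k y) =
      barLof k B n (PiTensorProduct.tprod k (Fin.init y)) * barGen k B (y (Fin.last n)) := by
  rw [barGen_apply, barLof_mul]
  congr 1
  have := TensorPower.tprod_mul_tprod k (Fin.init y) (fun _ : Fin 1 => y (Fin.last n))
  rw [TensorPower.gMul_def] at this
  rw [this]
  congr 1
  funext i
  refine Fin.lastCases ?_ (fun j => ?_) i
  · exact (Fin.append_right (Fin.init y) (fun _ : Fin 1 => y (Fin.last n)) 0).symm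
  · exact (Fin.append_left (Fin.init y) (fun _ : Fin 1 => y (Fin.last n)) j).symm

/-- Algebra maps on the tensor algebra of `B` agree if they agree on `B`. -/
theorem barAlgebra_algHom_ext {A : Type*} [Semiring A] [Algebra k A]
    {f g : BarAlgebra k B →ₐ[k] A} (h : ∀ b, f (barGen k B b) = g (barGen k B b)) : f = g := by
  have : f.comp TensorAlgebra.toDirectSum = g.comp TensorAlgebra.toDirectSum := by
    refine TensorAlgebra.hom_ext (LinearMap.ext fun b => ?_)
    have := h b
    rw [barGen_apply, DirectSum.lof_eq_of] at this
    simpa using this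
  refine AlgHom.ext fun x => ?_
  rw [← TensorAlgebra.toDirectSum_ofDirectSum x]
  exact AlgHom.congr_fun this _

variable (k B)

/-- The algebra map on the tensor algebra of `B` that extends a linear map on `B`. -/
def barLift {A : Type*} [Semiring A] [Algebra k A] (f : B →ₗ[k] A) : BarAlgebra k B →ₐ[k] A :=
  (TensorAlgebra.lift k f).comp TensorAlgebra.ofDirectSum

theorem barLift_barGen {A : Type*} [Semiring A] [Algebra k A] (f : B →ₗ[k] A) (b : B) :
    barLift k B f (barGen k B b) = f b := by
  rw [barGen_apply, DirectSum.lof_eq_of, barLift, AlgHom.comp_apply,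
    TensorAlgebra.ofDirectSum_of_tprod]
  simp [TensorAlgebra.tprod_apply]

/-- The coaction of `B` on its tensor algebra. -/
def barCoactionHom : BarAlgebra k B →ₐ[k] B ⊗[k] BarAlgebra k B :=
  barLift k B (LinearMap.lTensor B (barGen k B) ∘ₗ Coalgebra.comul)

theorem barCoactionHom_barGen (b : B) : barCoactionHom k B (barGen k B b) =
    LinearMap.lTensor B (barGen k B) (Coalgebra.comul b) :=
  barLift_barGen k B _ b

/-- The character of the tensor algebra of `B` given by the counit. -/
def barCharacter : BarAlgebra k B →ₐ[k] k := barLift k B Coalgebra.counit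

theorem barCharacter_barGen (b : B) :
    barCharacter k B (barGen k B b) = Coalgebra.counit (R := k) b :=
  barLift_barGen k B _ b

variable {k B}

/-- All the `ψ_n` are restrictions of a single character of the tensor algebra, because the counit
of a bialgebra is multiplicative. -/
theorem barCharacter_barLof {n : ℕ} (x : BarChain k B n) :
    barCharacter k B (barLof k B n x) = barPsi k B n x := by
  refine LinearMap.congr_fun (f := (barCharacter k B).toLinearMap ∘ₗ barLof k B n)
    (g := barPsi k B n) (PiTensorProduct.ext (MultilinearMap.ext fun y => ?_)) x
  change barCharacter k B (barLof k B n (PiTensorProduct.tprod k y)) =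
    Coalgebra.counit (barMul k B n (PiTensorProduct.tprod k y))
  induction n with
  | zero =>
    rw [Subsingleton.elim y Fin.elim0, barLof_one, map_one]
    simp [barMul]
  | succ n ih =>
    rw [barLof_tprod_succ, map_mul, ih, barCharacter_barGen]
    · simp only [barMul, PiTensorProduct.lift.tprod, MultilinearMap.mkPiAlgebraFin_apply,
        List.ofFn_succ, List.prod_cons, Bialgebra.counit_mul]
      rfl
    · exact 0

/-- `x ↦ (1, x_1, …, x_n)`. -/
def barConsOne (n : ℕ) : BarChain k B n →ₐ[k] BarChain k B (n + 1) :=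
  PiTensorProduct.liftAlgHom
    (MultilinearMap.curryLeft (M := fun _ : Fin (n + 1) => B) (PiTensorProduct.tprod k) 1)
    (by
      rw [MultilinearMap.curryLeft_apply, PiTensorProduct.one_def]
      refine congrArg _ (funext fun i => ?_)
      refine Fin.cases ?_ (fun j => ?_) i <;> simp)
    (fun x y => by
      simp only [MultilinearMap.curryLeft_apply, PiTensorProduct.tprod_mul_tprod]
      refine congrArg _ (funext fun i => ?_)
      refine Fin.cases ?_ (fun j => ?_) i <;> simp)

theorem barConsOne_tprod {n : ℕ} (y : Fin n → B) :
    barConsOne n (PiTensorProduct.tprod k y) =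
      PiTensorProduct.tprod k (Fin.cons 1 y : Fin (n + 1) → B) := by
  simp [barConsOne, MultilinearMap.curryLeft_apply]

theorem barConsOne_singleAlgHom {n : ℕ} (i : Fin n) (b : B) :
    barConsOne n (PiTensorProduct.singleAlgHom (R := k) (A := fun _ : Fin n => B) i b) =
      PiTensorProduct.singleAlgHom (R := k) (A := fun _ : Fin (n + 1) => B) i.succ b := by
  simp only [PiTensorProduct.singleAlgHom_apply, barConsOne_tprod]
  congr 1
  funext j
  refine Fin.cases ?_ (fun j => ?_) j
  · simp [(Fin.succ_ne_zero i).symm]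
  · simp [Pi.mulSingle_apply]

theorem lTensor_barConsOne_barSlot {n : ℕ} (i : Fin n) (b : B) :
    Algebra.TensorProduct.map (AlgHom.id k B) (barConsOne n) (barSlot k B n i b) =
      barSlot k B (n + 1) i.succ b := by
  simp only [barSlot, AlgHom.comp_apply]
  generalize Bialgebra.comulAlgHom k B b = t
  induction t using TensorProduct.induction_on with
  | zero => simp
  | add s t hs ht => simp only [map_add, hs, ht]
  | tmul x y =>
    simp only [Algebra.TensorProduct.map_tmul, AlgHom.id_apply, barConsOne_singleAlgHom]

theorem singleAlgHom_mul_barConsOne {n : ℕ} (b : B) (v : BarChain k B n) :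
    barLof k B (n + 1) (PiTensorProduct.singleAlgHom (R := k) (A := fun _ : Fin (n + 1) => B) 0 b *
      barConsOne n v) = barGen k B b * barLof k B n v := by
  induction v using PiTensorProduct.induction_on with
  | smul_tprod r y =>
    simp only [map_smul, mul_smul_comm, barConsOne_tprod, PiTensorProduct.singleAlgHom_apply,
      PiTensorProduct.tprod_mul_tprod, ← barLof_tprod_cons]
    congr 3
    funext j
    refine Fin.cases ?_ (fun j => ?_) j <;> simp
  | add v w hv hw => simp only [map_add, mul_add, hv, hw]

/-- The codiagonal coaction is an ordered product in the slotwise algebra `B ⊗ B^{⊗ n}`, whereas in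
the tensor algebra multiplication is concatenation. Peeling off the first letter shows that the two
descriptions agree, so that multiplicativity under concatenation becomes available. -/
theorem barCoactionHom_barLof {n : ℕ} (x : BarChain k B n) :
    barCoactionHom k B (barLof k B n x) = LinearMap.lTensor B (barLof k B n) (barCoaction k B n x) := by
  refine LinearMap.congr_fun (f := (barCoactionHom k B).toLinearMap ∘ₗ barLof k B n)
    (g := LinearMap.lTensor B (barLof k B n) ∘ₗ barCoaction k B n)
    (PiTensorProduct.ext (MultilinearMap.ext fun y => ?_)) x
  have eval : ∀ {n : ℕ} (y : Fin n → B), barCoaction k B n (PiTensorProduct.tprod k y) =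
      (List.ofFn fun i => barSlot k B n i (y i)).prod := fun y => by
    simp [barCoaction]
  change barCoactionHom k B (barLof k B n (PiTensorProduct.tprod k y)) =
    LinearMap.lTensor B (barLof k B n) (barCoaction k B n (PiTensorProduct.tprod k y))
  clear x
  induction n with
  | zero =>
    rw [eval, Subsingleton.elim y Fin.elim0, barLof_one, map_one, List.ofFn_zero, List.prod_nil]
    change _ = (1 : B) ⊗ₜ[k] barLof k B 0 (PiTensorProduct.tprod k 1)
    rw [Subsingleton.elim (1 : Fin 0 → B) Fin.elim0, barLof_one, Algebra.TensorProduct.one_def]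
  | succ n ih =>
    -- The factors for the later slots are the factors for the tail, moved up one slot by prepending
    -- `1`.
    have step : barCoaction k B (n + 1) (PiTensorProduct.tprod k y) =
        barSlot k B (n + 1) 0 (y 0) * Algebra.TensorProduct.map (AlgHom.id k B) (barConsOne n)
          (barCoaction k B n (PiTensorProduct.tprod k (Fin.tail y))) := by
      rw [eval, eval, List.ofFn_succ, List.prod_cons, map_list_prod, List.map_ofFn]
      congr 3
      funext i
      exact (lTensor_barConsOne_barSlot i _).symm
    rw [step, barLof_tprod_succ, map_mul, ih, barCoactionHom_barGen, barSlot, AlgHom.comp_apply,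
      Bialgebra.comulAlgHom_apply]
    generalize barCoaction k B n (PiTensorProduct.tprod k (Fin.tail y)) = t
    generalize (Coalgebra.comul (y 0) : B ⊗[k] B) = s
    induction s using TensorProduct.induction_on with
    | zero => simp
    | add s s' hs hs' => simp only [map_add, add_mul, hs, hs']
    | tmul b b' =>
      induction t using TensorProduct.induction_on with
      | zero => simp
      | add s s' hs hs' => simp only [map_add, mul_add, hs, hs']
      | tmul c v =>
        simp only [Algebra.TensorProduct.map_tmul, AlgHom.id_apply,
          Algebra.TensorProduct.tmul_mul_tmul, LinearMap.lTensor_tmul, singleAlgHom_mul_barConsOne]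

/-- The coproduct of `B` is an algebra map, so both sides are algebra maps in `x`. On letters the
identity is coassociativity of `B`. -/
theorem barCoactionHom_coassoc (x : BarAlgebra k B) :
    TensorProduct.assoc k _ _ _ (LinearMap.rTensor _ Coalgebra.comul (barCoactionHom k B x)) =
      LinearMap.lTensor B (barCoactionHom k B).toLinearMap (barCoactionHom k B x) := by
  refine AlgHom.congr_fun
    (φ₁ := (Algebra.TensorProduct.assoc k k k B B (BarAlgebra k B)).toAlgHom.comp
      ((Algebra.TensorProduct.map (Bialgebra.comulAlgHom k B) (AlgHom.id k _)).comp
        (barCoactionHom k B)))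
    (φ₂ := (Algebra.TensorProduct.map (AlgHom.id k B) (barCoactionHom k B)).comp
      (barCoactionHom k B)) (barAlgebra_algHom_ext fun b => ?_) x
  change TensorProduct.assoc k _ _ _ (LinearMap.rTensor _ Coalgebra.comul
    (barCoactionHom k B (barGen k B b))) = LinearMap.lTensor B (barCoactionHom k B).toLinearMap
      (barCoactionHom k B (barGen k B b))
  have h₁ : (barCoactionHom k B).toLinearMap ∘ₗ barGen k B =
      LinearMap.lTensor B (barGen k B) ∘ₗ Coalgebra.comul :=
    LinearMap.ext fun b => barCoactionHom_barGen k B b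
  rw [barCoactionHom_barGen, ComultiplicativeCooperad.lTensor_rTensor_comm, ← LinearMap.comp_apply (LinearMap.lTensor B _),
    ← LinearMap.lTensor_comp, h₁, LinearMap.lTensor_comp, LinearMap.comp_apply,
    ← Coalgebra.coassoc_apply]
  exact LinearMap.congr_fun (f := (TensorProduct.assoc k B B (BarAlgebra k B)).toLinearMap ∘ₗ
      LinearMap.lTensor (B ⊗[k] B) (barGen k B))
    (g := LinearMap.lTensor B (LinearMap.lTensor B (barGen k B)) ∘ₗ
      (TensorProduct.assoc k B B B).toLinearMap)
    (TensorProduct.ext_threefold fun _ _ _ => rfl) _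

theorem barCoactionHom_counit (x : BarAlgebra k B) :
    TensorProduct.lid k _ (LinearMap.rTensor _ Coalgebra.counit (barCoactionHom k B x)) = x := by
  refine AlgHom.congr_fun (φ₁ := (Algebra.TensorProduct.lid k (BarAlgebra k B)).toAlgHom.comp
      ((Algebra.TensorProduct.map (Bialgebra.counitAlgHom k B) (AlgHom.id k _)).comp
        (barCoactionHom k B))) (φ₂ := AlgHom.id k _) (barAlgebra_algHom_ext fun b => ?_) x
  change TensorProduct.lid k _ (LinearMap.rTensor _ Coalgebra.counit
    (barCoactionHom k B (barGen k B b))) = barGen k B b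
  rw [barCoactionHom_barGen, ComultiplicativeCooperad.lTensor_rTensor_comm, Coalgebra.rTensor_counit_comul]
  simp

end BarAlgebra

/-! ### Partial decompositions inside the tensor algebra -/

section BarDecomposition

open Cooperad (incl₂)

variable {k : Type u} [CommRing k] {B : Type v} [Ring B] [Bialgebra k B]

variable (k B) in
/-- The homogeneous elements of degree `n` in the tensor algebra of `B`. -/
def barDegree (n : ℕ) : Submodule k (BarAlgebra k B) := LinearMap.range (barLof k B n)

theorem barLof_mem {n : ℕ} (x : BarChain k B n) : barLof k B n x ∈ barDegree k B n := ⟨x, rfl⟩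

theorem barGen_mem (b : B) : barGen k B b ∈ barDegree k B 1 := ⟨_, rfl⟩

theorem one_mem_barDegree : (1 : BarAlgebra k B) ∈ barDegree k B 0 := ⟨_, barLof_one⟩

theorem mul_mem_barDegree {m n : ℕ} {x y : BarAlgebra k B} (hx : x ∈ barDegree k B m)
    (hy : y ∈ barDegree k B n) : x * y ∈ barDegree k B (m + n) := by
  obtain ⟨x, rfl⟩ := hx
  obtain ⟨y, rfl⟩ := hy
  exact ⟨_, (barLof_mul x y).symm⟩

theorem barLof_injective (n : ℕ) : Function.Injective (barLof k B n) := by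
  intro x y h
  exact DirectSum.of_injective (β := fun n => BarChain k B n) n h

/-- Linear maps on bar chains agree if they agree on products of three homogeneous elements. -/
theorem barChain_ext₃ {W : Type*} [AddCommMonoid W] [Module k W] {n a q b : ℕ} (hn : n = a + q + b)
    {f g : BarChain k B n →ₗ[k] W}
    (h : ∀ U ∈ barDegree k B a, ∀ V ∈ barDegree k B q, ∀ T ∈ barDegree k B b, ∀ x,
      barLof k B n x = U * V * T → f x = g x) (x : BarChain k B n) : f x = g x := by
  subst hn
  obtain ⟨s, rfl⟩ := TensorPower.mulEquiv.surjective x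
  induction s using TensorProduct.induction_on with
  | zero => simp
  | add s t hs ht => simp only [map_add, hs, ht]
  | tmul y t =>
    obtain ⟨s, rfl⟩ := TensorPower.mulEquiv.surjective y
    induction s using TensorProduct.induction_on with
    | zero => simp
    | add s t hs ht => simp only [map_add, TensorProduct.add_tmul, hs, ht]
    | tmul u v =>
      exact h _ (barLof_mem u) _ (barLof_mem v) _ (barLof_mem t) _
        (by rw [barLof_mul, barLof_mul])

theorem barChain_ext₅ {W : Type*} [AddCommMonoid W] [Module k W] {n a q b r c : ℕ}
    (hn : n = a + q + b + r + c) {f g : BarChain k B n →ₗ[k] W}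
    (h : ∀ U ∈ barDegree k B a, ∀ V ∈ barDegree k B q, ∀ S ∈ barDegree k B b,
      ∀ Z ∈ barDegree k B r, ∀ T ∈ barDegree k B c, ∀ x,
      barLof k B n x = U * V * S * Z * T → f x = g x) (x : BarChain k B n) : f x = g x := by
  refine barChain_ext₃ hn (fun U hU Z hZ T hT x hx => ?_) x
  obtain ⟨U, rfl⟩ := hU
  obtain ⟨Z', rfl⟩ := hZ
  obtain ⟨T', rfl⟩ := hT
  -- Multiplication on the right by the fixed words `Z'` and `T'`, so that the three-factor
  -- principle applies again to the first factor.
  let L : BarChain k B (a + q + b) →ₗ[k] BarChain k B n :=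
    (TensorPower.cast k B hn.symm).toLinearMap ∘ₗ TensorPower.mulEquiv.toLinearMap ∘ₗ
      (TensorProduct.mk k _ _).flip T' ∘ₗ TensorPower.mulEquiv.toLinearMap ∘ₗ
        (TensorProduct.mk k _ _).flip Z'
  have hL : ∀ y, barLof k B n (L y) = barLof k B _ y * barLof k B _ Z' * barLof k B _ T' := fun y => by
    rw [barLof_mul, barLof_mul]
    exact barLof_cast _ _
  obtain rfl : x = L U := barLof_injective n (hx.trans (hL U).symm)
  refine barChain_ext₃ (f := f ∘ₗ L) (g := g ∘ₗ L) rfl (fun U hU V hV S hS y hy => ?_) U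
  exact h U hU V hV S hS _ (barLof_mem Z') _ (barLof_mem T') (L y) (by rw [hL, hy])

/-- `b ⊗ v ↦ (U b T) ⊗ v`. -/
def barInsertion (U T : BarAlgebra k B) :
    B ⊗[k] BarAlgebra k B →ₗ[k] BarAlgebra k B ⊗[k] BarAlgebra k B :=
  LinearMap.rTensor _ (LinearMap.mulRight k T ∘ₗ LinearMap.mulLeft k U ∘ₗ barGen k B)

theorem barInsertion_tmul (U T : BarAlgebra k B) (b : B) (v : BarAlgebra k B) :
    barInsertion U T (b ⊗ₜ[k] v) = (U * barGen k B b * T) ⊗ₜ[k] v := rfl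

variable (k B) in
/-- The partial decomposition of bar chains as a map on the tensor algebra. -/
def barTotalDecomp {n : ℕ} (p q i : ℕ) (h : p + q = n + 1) :
    BarAlgebra k B →ₗ[k] BarAlgebra k B ⊗[k] BarAlgebra k B :=
  incl₂ k (BarChain k B) p q ∘ₗ barDecomp k B p q i h ∘ₗ
    DirectSum.component k ℕ (fun n => BarChain k B n) n

theorem barTotalDecomp_barLof {n : ℕ} (p q i : ℕ) (h : p + q = n + 1) (x : BarChain k B n) :
    barTotalDecomp k B p q i h (barLof k B n x) = incl₂ k (BarChain k B) p q (barDecomp k B p q i h x) := by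
  simp only [barTotalDecomp, LinearMap.comp_apply, DirectSum.component.lof_self]

theorem barDecomp_eq {n : ℕ} {p q i : ℕ} (h : p + q = n + 1) {a b : ℕ} (ha : i - 1 = a)
    (hb : p - i = b) (hi : 1 ≤ i ∧ i ≤ p) :
    barDecomp k B p q i h =
      LinearMap.rTensor _ ((TensorPower.cast k B (show a + (1 + b) = p by omega)).toLinearMap ∘ₗ
        barInsert k B a b) ∘ₗ
      (TensorProduct.assoc k _ _ _).symm.toLinearMap ∘ₗ
      LinearMap.lTensor _ ((TensorProduct.rightComm k _ _ _).toLinearMap ∘ₗ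
        LinearMap.rTensor _ (barCoaction k B q) ∘ₗ TensorPower.mulEquiv.symm.toLinearMap) ∘ₗ
      TensorPower.mulEquiv.symm.toLinearMap ∘ₗ
      (TensorPower.cast k B (show n = a + (q + b) by omega)).toLinearMap := by
  subst ha hb
  exact dif_pos hi

theorem barLof_barInsert (a b : ℕ) (u : BarChain k B a) (x : B) (t : BarChain k B b) :
    barLof k B _ (barInsert k B a b (u ⊗ₜ[k] (x ⊗ₜ[k] t))) =
      barLof k B a u * barGen k B x * barLof k B b t := by
  rw [mul_assoc, barGen, LinearMap.comp_apply, barLof_mul, barLof_mul]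
  rfl

set_option synthInstance.maxHeartbeats 200000 in
-- The working formula `U V T ↦ U v⁽¹⁾ T ⊗ v⁽²⁾`. Since every bar chain is a sum of such products,
-- it determines the decomposition and replaces its definition by casts and reassociations.
theorem barTotalDecomp_mul {n : ℕ} {p q i : ℕ} (h : p + q = n + 1) {a b : ℕ} (ha : i = a + 1)
    (hb : p = a + 1 + b) {U V T : BarAlgebra k B} (hU : U ∈ barDegree k B a)
    (hV : V ∈ barDegree k B q) (hT : T ∈ barDegree k B b) :
    barTotalDecomp k B p q i h (U * V * T) = barInsertion U T (barCoactionHom k B V) := by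
  obtain ⟨u, rfl⟩ := hU
  obtain ⟨v, rfl⟩ := hV
  obtain ⟨t, rfl⟩ := hT
  rw [mul_assoc, barLof_mul, barLof_mul, ← barLof_cast (show a + (q + b) = n by omega),
    barTotalDecomp_barLof, barDecomp_eq h (a := a) (b := b) (by omega) (by omega) (by omega),
    barCoactionHom_barLof]
  simp only [LinearMap.comp_apply, LinearEquiv.coe_coe, TensorPower.cast_cast,
    TensorPower.cast_refl, LinearEquiv.refl_apply, LinearEquiv.symm_apply_apply,
    LinearMap.lTensor_tmul, LinearMap.rTensor_tmul]
  generalize barCoaction k B q v = s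
  induction s using TensorProduct.induction_on with
  | zero => simp
  | add s t hs ht => simp only [TensorProduct.add_tmul, TensorProduct.tmul_add, map_add, hs, ht]
  | tmul x y =>
    simp only [TensorProduct.rightComm_tmul, TensorProduct.assoc_symm_tmul, LinearMap.rTensor_tmul,
      LinearMap.comp_apply, LinearEquiv.coe_coe, TensorProduct.map_tmul, LinearMap.lTensor_tmul,
      barInsertion_tmul]
    congr 1
    exact (barLof_cast _ _).trans (barLof_barInsert a b u x t)

variable (k B) in
/-- The inclusion of a tensor product of three modules of bar chains. -/
abbrev barIncl₃ (p q r : ℕ) :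
    (BarChain k B p ⊗[k] BarChain k B q) ⊗[k] BarChain k B r →ₗ[k]
      (BarAlgebra k B ⊗[k] BarAlgebra k B) ⊗[k] BarAlgebra k B :=
  TensorProduct.map (incl₂ k (BarChain k B) p q) (barLof k B r)

/-- Projection to components is a left inverse that survives tensoring, so the cooperad relations
can be verified in the threefold tensor power of the tensor algebra without any flatness. -/
theorem barIncl₃_injective (p q r : ℕ) : Function.Injective (barIncl₃ k B p q r) := by
  refine Function.LeftInverse.injective (g := TensorProduct.map (TensorProduct.map
    (DirectSum.component k ℕ (fun n => BarChain k B n) p)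
    (DirectSum.component k ℕ (fun n => BarChain k B n) q))
    (DirectSum.component k ℕ (fun n => BarChain k B n) r)) fun x => ?_
  have h : ∀ n, DirectSum.component k ℕ (fun n => BarChain k B n) n ∘ₗ barLof k B n = LinearMap.id :=
    fun n => LinearMap.ext fun x => DirectSum.component.lof_self k n x
  rw [← LinearMap.comp_apply, ← TensorProduct.map_comp, ← TensorProduct.map_comp, h, h, h,
    TensorProduct.map_id, TensorProduct.map_id, LinearMap.id_apply]

theorem barIncl₃_rTensor {p q i m : ℕ} (h : p + q = m + 1) (r : ℕ)
    (y : BarChain k B m ⊗[k] BarChain k B r) :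
    barIncl₃ k B p q r (LinearMap.rTensor _ (barDecomp k B p q i h) y) =
      LinearMap.rTensor _ (barTotalDecomp k B p q i h) (incl₂ k (BarChain k B) m r y) := by
  refine LinearMap.congr_fun (f := barIncl₃ k B p q r ∘ₗ LinearMap.rTensor _ (barDecomp k B p q i h))
    (g := LinearMap.rTensor _ (barTotalDecomp k B p q i h) ∘ₗ incl₂ k (BarChain k B) m r)
    (TensorProduct.ext' fun x y => ?_) y
  change incl₂ k (BarChain k B) p q (barDecomp k B p q i h x) ⊗ₜ[k] barLof k B r y =
    barTotalDecomp k B p q i h (barLof k B m x) ⊗ₜ[k] barLof k B r y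
  rw [barTotalDecomp_barLof]

theorem barIncl₃_rightComm (p q r : ℕ)
    (y : (BarChain k B p ⊗[k] BarChain k B r) ⊗[k] BarChain k B q) :
    barIncl₃ k B p q r (TensorProduct.rightComm k _ _ _ y) =
      TensorProduct.rightComm k _ _ _ (barIncl₃ k B p r q y) :=
  LinearMap.congr_fun (f := barIncl₃ k B p q r ∘ₗ (TensorProduct.rightComm k _ _ _).toLinearMap)
    (g := (TensorProduct.rightComm k _ _ _).toLinearMap ∘ₗ barIncl₃ k B p r q)
    (TensorProduct.ext_threefold fun _ _ _ => rfl) y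

theorem barIncl₃_assoc (p q r : ℕ)
    (y : BarChain k B p ⊗[k] (BarChain k B q ⊗[k] BarChain k B r)) :
    barIncl₃ k B p q r ((TensorProduct.assoc k _ _ _).symm y) =
      (TensorProduct.assoc k _ _ _).symm
        (TensorProduct.map (barLof k B p) (incl₂ k (BarChain k B) q r) y) := by
  obtain ⟨y, rfl⟩ := (TensorProduct.assoc k _ _ _).surjective y
  rw [LinearEquiv.symm_apply_apply, LinearEquiv.eq_symm_apply]
  exact LinearMap.congr_fun
    (f := (TensorProduct.assoc k _ _ _).toLinearMap ∘ₗ barIncl₃ k B p q r)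
    (g := TensorProduct.map (barLof k B p) (incl₂ k (BarChain k B) q r) ∘ₗ
      (TensorProduct.assoc k _ _ _).toLinearMap)
    (TensorProduct.ext_threefold fun _ _ _ => rfl) y

theorem barIncl₃_lTensor {q r j l : ℕ} (h : q + r = l + 1) (p : ℕ)
    (y : BarChain k B p ⊗[k] BarChain k B l) :
    barIncl₃ k B p q r ((TensorProduct.assoc k _ _ _).symm
        (LinearMap.lTensor _ (barDecomp k B q r j h) y)) =
      (TensorProduct.assoc k _ _ _).symm (LinearMap.lTensor _ (barTotalDecomp k B q r j h)
        (incl₂ k (BarChain k B) p l y)) := by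
  rw [barIncl₃_assoc]
  congr 1
  refine LinearMap.congr_fun (f := TensorProduct.map (barLof k B p) (incl₂ k (BarChain k B) q r) ∘ₗ
      LinearMap.lTensor _ (barDecomp k B q r j h))
    (g := LinearMap.lTensor _ (barTotalDecomp k B q r j h) ∘ₗ incl₂ k (BarChain k B) p l)
    (TensorProduct.ext' fun x y => ?_) y
  change barLof k B p x ⊗ₜ[k] incl₂ k (BarChain k B) q r (barDecomp k B q r j h y) =
    barLof k B p x ⊗ₜ[k] barTotalDecomp k B q r j h (barLof k B l y)
  rw [barTotalDecomp_barLof]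

set_option synthInstance.maxHeartbeats 200000 in
-- In `U V S Z T` the coactions on `V` and on `Z` do not interact: both sides are the sum of `U v⁽¹⁾
-- S z⁽¹⁾ T ⊗ v⁽²⁾ ⊗ z⁽²⁾`.
theorem barDecomp_coassoc_before (p q r i j m l n : ℕ) (h₁ : p + q = m + 1) (h₂ : m + r = n + 1)
    (h₃ : p + r = l + 1) (h₄ : l + q = n + 1) (hi : 1 ≤ i) (hm : j ≤ m)
    (hij : i + q ≤ j) (x : BarChain k B n) :
    LinearMap.rTensor _ (barDecomp k B p q i h₁) (barDecomp k B m r j h₂ x) =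
      TensorProduct.rightComm k _ _ _
        (LinearMap.rTensor _ (barDecomp k B p r (j + 1 - q) h₃) (barDecomp k B l q i h₄ x)) := by
  obtain ⟨a, rfl⟩ : ∃ a, i = a + 1 := ⟨i - 1, by omega⟩
  obtain ⟨b, rfl⟩ : ∃ b, j = a + 1 + q + b := ⟨j - (a + 1 + q), by omega⟩
  obtain ⟨c, rfl⟩ : ∃ c, m = a + 1 + q + b + c := ⟨m - (a + 1 + q + b), by omega⟩
  refine barChain_ext₅ (f := LinearMap.rTensor _ (barDecomp k B p q _ h₁) ∘ₗ barDecomp k B _ r _ h₂)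
    (g := (TensorProduct.rightComm k _ _ _).toLinearMap ∘ₗ
      LinearMap.rTensor _ (barDecomp k B p r _ h₃) ∘ₗ barDecomp k B l q _ h₄)
    (a := a) (q := q) (b := b) (r := r) (c := c) (by omega)
    (fun U hU V hV S hS Z hZ T hT x hx => barIncl₃_injective p q r ?_) x
  simp only [LinearMap.comp_apply, LinearEquiv.coe_coe, barIncl₃_rightComm, barIncl₃_rTensor,
    ← barTotalDecomp_barLof, hx]
  rw [barTotalDecomp_mul h₂ (a := a + q + b) (b := c) (by omega) (by omega)
      (mul_mem_barDegree (mul_mem_barDegree hU hV) hS) hZ hT,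
    show U * V * S * Z * T = U * V * (S * Z * T) by simp only [mul_assoc],
    barTotalDecomp_mul h₄ (a := a) (b := b + r + c) rfl (by omega) hU hV
      (mul_mem_barDegree (mul_mem_barDegree hS hZ) hT)]
  obtain ⟨s, hs⟩ := TensorProduct.exists_finset (barCoactionHom k B V)
  obtain ⟨t, ht⟩ := TensorProduct.exists_finset (barCoactionHom k B Z)
  have e₁ : ∀ x : B, barTotalDecomp k B p q (a + 1) h₁ (U * V * S * barGen k B x * T) =
      ∑ y ∈ s, (U * barGen k B y.1 * S * barGen k B x * T) ⊗ₜ[k] y.2 := fun x => by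
    rw [show U * V * S * barGen k B x * T = U * V * (S * barGen k B x * T) by simp only [mul_assoc],
      barTotalDecomp_mul h₁ (a := a) (b := b + 1 + c) rfl (by omega) hU hV
        (mul_mem_barDegree (mul_mem_barDegree hS (barGen_mem x)) hT), hs, map_sum]
    simp only [barInsertion_tmul, mul_assoc]
  have e₂ : ∀ x : B, barTotalDecomp k B p r (a + 1 + q + b + 1 - q) h₃
      (U * barGen k B x * (S * Z * T)) =
      ∑ y ∈ t, (U * barGen k B x * S * barGen k B y.1 * T) ⊗ₜ[k] y.2 := fun x => by
    rw [show U * barGen k B x * (S * Z * T) = U * barGen k B x * S * Z * T by simp only [mul_assoc],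
      barTotalDecomp_mul h₃ (a := a + 1 + b) (b := c) (by omega) (by omega)
        (mul_mem_barDegree (mul_mem_barDegree hU (barGen_mem x)) hS) hZ hT, ht, map_sum]
    simp only [barInsertion_tmul]
  rw [hs, ht]
  simp only [map_sum, barInsertion_tmul, LinearMap.rTensor_tmul, e₁, e₂, TensorProduct.sum_tmul,
    TensorProduct.rightComm_tmul]
  exact Finset.sum_comm

theorem exists_barCoactionHom_eq_sum {n : ℕ} {V : BarAlgebra k B} (hV : V ∈ barDegree k B n) :
    ∃ s : Finset (B × BarChain k B n),
      barCoactionHom k B V = ∑ y ∈ s, y.1 ⊗ₜ[k] barLof k B n y.2 := by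
  obtain ⟨v, rfl⟩ := hV
  obtain ⟨s, hs⟩ := TensorProduct.exists_finset (barCoaction k B n v)
  exact ⟨s, by rw [barCoactionHom_barLof, hs, map_sum]; rfl⟩

theorem map_tmul_eq_assoc_symm {M N P Q R : Type*} [AddCommMonoid M] [Module k M] [AddCommMonoid N]
    [Module k N] [AddCommMonoid P] [Module k P] [AddCommMonoid Q] [Module k Q] [AddCommMonoid R]
    [Module k R] (f : M →ₗ[k] P) (g : N →ₗ[k] Q) (y : M ⊗[k] N) (z : R) :
    TensorProduct.map f g y ⊗ₜ[k] z = (TensorProduct.assoc k P Q R).symm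
      (TensorProduct.map f (LinearMap.rTensor R g) (TensorProduct.assoc k M N R (y ⊗ₜ[k] z))) := by
  induction y using TensorProduct.induction_on with
  | zero => simp only [map_zero, TensorProduct.zero_tmul]
  | add s t hs ht => simp only [TensorProduct.add_tmul, map_add, hs, ht]
  | tmul x y => simp

/-- `x ↦ u x w` for `u, w` in `B` and `x` in `B`, followed by `x ↦ U x T` into the tensor algebra. -/
def barOuter (U T : BarAlgebra k B) (u w : B) : B →ₗ[k] BarAlgebra k B :=
  LinearMap.mulRight k T ∘ₗ LinearMap.mulLeft k U ∘ₗ barGen k B ∘ₗ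
    LinearMap.mulRight k w ∘ₗ LinearMap.mulLeft k u

/-- `x ↦ U x T` from `B` to its tensor algebra. -/
def barInner (U T : BarAlgebra k B) : B →ₗ[k] BarAlgebra k B :=
  LinearMap.mulRight k T ∘ₗ LinearMap.mulLeft k U ∘ₗ barGen k B

theorem barInsertion_mul_comul (U T : BarAlgebra k B) (u w x : B) (v v' : BarAlgebra k B) :
    barInsertion U T ((u ⊗ₜ[k] v) * barCoactionHom k B (barGen k B x) * (w ⊗ₜ[k] v')) =
      TensorProduct.map (barOuter U T u w) (barInner v v') (Coalgebra.comul x) := by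
  rw [barCoactionHom_barGen]
  generalize (Coalgebra.comul x : B ⊗[k] B) = y
  induction y using TensorProduct.induction_on with
  | zero => simp only [map_zero, mul_zero, zero_mul]
  | add s t hs ht => simp only [map_add, add_mul, mul_add, hs, ht]
  | tmul x y =>
    simp only [LinearMap.lTensor_tmul, Algebra.TensorProduct.tmul_mul_tmul, barInsertion_tmul,
      TensorProduct.map_tmul]
    rfl

/-- Both sides are the sum of `U (v⁽¹⁾ z⁽¹⁾ s⁽¹⁾) T ⊗ v⁽²⁾ z⁽²⁾ s⁽²⁾ ⊗ z⁽³⁾`. On the left the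
collapsed letter `z⁽¹⁾` is split again by the coproduct; on the right the coaction is applied again
to `z⁽²⁾`. The equality is coassociativity of the coaction on `Z`. -/
theorem barInsertion_coassoc {b r c : ℕ} {U V Z S T : BarAlgebra k B} (hV : V ∈ barDegree k B b)
    (hZ : Z ∈ barDegree k B r) (hS : S ∈ barDegree k B c)
    {D₁ D₂ : BarAlgebra k B →ₗ[k] BarAlgebra k B ⊗[k] BarAlgebra k B}
    (e₁ : ∀ x : B, D₁ (U * V * barGen k B x * (S * T)) =
      barInsertion U T (barCoactionHom k B V * barCoactionHom k B (barGen k B x) *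
        barCoactionHom k B S))
    (e₂ : ∀ v ∈ barDegree k B b, ∀ y ∈ barDegree k B r, ∀ w ∈ barDegree k B c,
      D₂ (v * y * w) = barInsertion v w (barCoactionHom k B y)) :
    LinearMap.rTensor _ D₁ (barInsertion (U * V) (S * T) (barCoactionHom k B Z)) =
      (TensorProduct.assoc k _ _ _).symm (LinearMap.lTensor _ D₂ (barInsertion U T
        (barCoactionHom k B V * barCoactionHom k B Z * barCoactionHom k B S))) := by
  obtain ⟨s, hs⟩ := exists_barCoactionHom_eq_sum hV
  obtain ⟨t, ht⟩ := exists_barCoactionHom_eq_sum hS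
  obtain ⟨z, hz⟩ := exists_barCoactionHom_eq_sum hZ
  -- For fixed Sweedler components of `V` and `S`, both sides are the same linear map `M` applied to
  -- the two iterated coactions of `Z`.
  let M : B × BarChain k B b → B × BarChain k B c → B ⊗[k] (B ⊗[k] BarAlgebra k B) →ₗ[k]
      (BarAlgebra k B ⊗[k] BarAlgebra k B) ⊗[k] BarAlgebra k B := fun v w =>
    (TensorProduct.assoc k _ _ _).symm.toLinearMap ∘ₗ TensorProduct.map (barOuter U T v.1 w.1)
      (LinearMap.rTensor _ (barInner (barLof k B b v.2) (barLof k B c w.2)))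
  have left : ∀ y : B × BarChain k B r,
      LinearMap.rTensor _ D₁ (barInsertion (U * V) (S * T) (y.1 ⊗ₜ[k] barLof k B r y.2)) =
      ∑ v ∈ s, ∑ w ∈ t, M v w (TensorProduct.assoc k _ _ _
        (LinearMap.rTensor _ Coalgebra.comul (y.1 ⊗ₜ[k] barLof k B r y.2))) := fun y => by
    rw [barInsertion_tmul, LinearMap.rTensor_tmul, e₁, hs, ht, Finset.sum_mul, Finset.sum_mul,
      map_sum, TensorProduct.sum_tmul]
    refine Finset.sum_congr rfl fun v _ => ?_
    rw [Finset.mul_sum, map_sum, TensorProduct.sum_tmul]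
    refine Finset.sum_congr rfl fun w _ => ?_
    rw [barInsertion_mul_comul, map_tmul_eq_assoc_symm]
    rfl
  have right : ∀ y : B × BarChain k B r,
      (TensorProduct.assoc k _ _ _).symm.toLinearMap (LinearMap.lTensor _ D₂ (barInsertion U T
        (barCoactionHom k B V * (y.1 ⊗ₜ[k] barLof k B r y.2) * barCoactionHom k B S))) =
      ∑ v ∈ s, ∑ w ∈ t, M v w (LinearMap.lTensor B (barCoactionHom k B).toLinearMap
        (y.1 ⊗ₜ[k] barLof k B r y.2)) := fun y => by
    rw [hs, ht, Finset.sum_mul, Finset.sum_mul, map_sum, map_sum, map_sum]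
    refine Finset.sum_congr rfl fun v _ => ?_
    rw [Finset.mul_sum, map_sum, map_sum, map_sum]
    refine Finset.sum_congr rfl fun w _ => ?_
    rw [Algebra.TensorProduct.tmul_mul_tmul, Algebra.TensorProduct.tmul_mul_tmul, barInsertion_tmul,
      LinearMap.lTensor_tmul, e₂ _ (barLof_mem _) _ (barLof_mem _) _ (barLof_mem _)]
    rfl
  have swap : ∀ F : B × BarChain k B r → B ⊗[k] (B ⊗[k] BarAlgebra k B),
      ∑ y ∈ z, ∑ v ∈ s, ∑ w ∈ t, M v w (F y) = ∑ v ∈ s, ∑ w ∈ t, M v w (∑ y ∈ z, F y) := fun F => by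
    rw [Finset.sum_comm]
    refine Finset.sum_congr rfl fun v _ => ?_
    rw [Finset.sum_comm]
    exact Finset.sum_congr rfl fun w _ => (map_sum _ _ _).symm
  have key : ∑ y ∈ z, (TensorProduct.assoc k _ _ _).toLinearMap
      (LinearMap.rTensor _ Coalgebra.comul (y.1 ⊗ₜ[k] barLof k B r y.2)) =
      ∑ y ∈ z, LinearMap.lTensor B (barCoactionHom k B).toLinearMap
        (y.1 ⊗ₜ[k] barLof k B r y.2) := by
    rw [← map_sum, ← map_sum, ← map_sum, ← hz]
    exact barCoactionHom_coassoc Z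
  change _ = (TensorProduct.assoc k _ _ _).symm.toLinearMap _
  rw [hz, map_sum, map_sum, Finset.mul_sum, Finset.sum_mul, map_sum, map_sum, map_sum,
    Finset.sum_congr rfl fun y _ => left y, Finset.sum_congr rfl fun y _ => right y, swap, swap]
  exact Finset.sum_congr rfl fun v _ => Finset.sum_congr rfl fun w _ => congrArg (M v w) key

theorem barDecomp_coassoc_inside (p q r i j m l n : ℕ) (h₁ : p + q = m + 1) (h₂ : m + r = n + 1)
    (h₃ : q + r = l + 1) (h₄ : p + l = n + 1) (hi : 1 ≤ i) (hp : i ≤ p) (hj : j < i + q)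
    (hij : i ≤ j) (x : BarChain k B n) :
    LinearMap.rTensor _ (barDecomp k B p q i h₁) (barDecomp k B m r j h₂ x) =
      (TensorProduct.assoc k _ _ _).symm
        (LinearMap.lTensor _ (barDecomp k B q r (j + 1 - i) h₃) (barDecomp k B p l i h₄ x)) := by
  obtain ⟨a, rfl⟩ : ∃ a, i = a + 1 := ⟨i - 1, by omega⟩
  obtain ⟨b, rfl⟩ : ∃ b, j = a + 1 + b := ⟨j - (a + 1), by omega⟩
  obtain ⟨c, rfl⟩ : ∃ c, q = b + 1 + c := ⟨q - (b + 1), by omega⟩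
  obtain ⟨e, rfl⟩ : ∃ e, p = a + 1 + e := ⟨p - (a + 1), by omega⟩
  refine barChain_ext₅
    (f := LinearMap.rTensor _ (barDecomp k B _ (b + 1 + c) _ h₁) ∘ₗ barDecomp k B _ r _ h₂)
    (g := (TensorProduct.assoc k _ _ _).symm.toLinearMap ∘ₗ
      LinearMap.lTensor _ (barDecomp k B _ r _ h₃) ∘ₗ barDecomp k B _ l _ h₄)
    (a := a) (q := b) (b := r) (r := c) (c := e) (by omega)
    (fun U hU V hV Z hZ S hS T hT x hx => barIncl₃_injective _ _ r ?_) x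
  simp only [LinearMap.comp_apply, LinearEquiv.coe_coe, barIncl₃_lTensor, barIncl₃_rTensor,
    ← barTotalDecomp_barLof, hx]
  rw [show U * V * Z * S * T = U * V * Z * (S * T) by simp only [mul_assoc],
    barTotalDecomp_mul h₂ (a := a + b) (b := c + e) (by omega) (by omega)
      (mul_mem_barDegree hU hV) hZ (mul_mem_barDegree hS hT),
    show U * V * Z * (S * T) = U * (V * Z * S) * T by simp only [mul_assoc],
    barTotalDecomp_mul h₄ (a := a) (b := e) rfl (by omega) hU
      (show l = b + r + c by omega ▸ mul_mem_barDegree (mul_mem_barDegree hV hZ) hS) hT,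
    map_mul (barCoactionHom k B), map_mul (barCoactionHom k B)]
  have e₁ : ∀ x : B, barTotalDecomp k B (a + 1 + e) (b + 1 + c) (a + 1) h₁
      (U * V * barGen k B x * (S * T)) =
      barInsertion U T (barCoactionHom k B V * barCoactionHom k B (barGen k B x) *
        barCoactionHom k B S) := fun x => by
    rw [show U * V * barGen k B x * (S * T) = U * (V * barGen k B x * S) * T by
        simp only [mul_assoc],
      barTotalDecomp_mul h₁ (a := a) (b := e) rfl rfl hU
        (mul_mem_barDegree (mul_mem_barDegree hV (barGen_mem x)) hS) hT,
      map_mul (barCoactionHom k B), map_mul (barCoactionHom k B)]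
  have e₂ : ∀ v ∈ barDegree k B b, ∀ y ∈ barDegree k B r, ∀ w ∈ barDegree k B c,
      barTotalDecomp k B (b + 1 + c) r (a + 1 + b + 1 - (a + 1)) h₃ (v * y * w) =
        barInsertion v w (barCoactionHom k B y) := fun v hv y hy w hw =>
    barTotalDecomp_mul h₃ (a := b) (b := c) (by omega) (by omega) hv hy hw
  generalize barTotalDecomp k B (a + 1 + e) (b + 1 + c) (a + 1) h₁ = D₁ at e₁ ⊢
  generalize barTotalDecomp k B (b + 1 + c) r (a + 1 + b + 1 - (a + 1)) h₃ = D₂ at e₂ ⊢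
  exact barInsertion_coassoc hV hZ hS e₁ e₂

end BarDecomposition

/-! ### The cooperad of bar chains and its faces -/

section BarCooperad

open Cooperad (incl₂)
open ComultiplicativeCooperad (evalLeft evalRight)

variable {k : Type u} [CommRing k] {B : Type v} [Ring B] [Bialgebra k B]

theorem barLof_evalLeft_barPsi (p q : ℕ) (t : BarChain k B p ⊗[k] BarChain k B q) :
    barLof k B q (evalLeft (barPsi k B p) t) =
      evalLeft (barCharacter k B).toLinearMap (incl₂ k (BarChain k B) p q t) := by
  induction t using TensorProduct.induction_on with
  | zero => simp only [map_zero]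
  | add s t hs ht => simp only [map_add, hs, ht]
  | tmul x y =>
    have := barCharacter_barLof x
    simp only [LinearMap.comp_apply, LinearEquiv.coe_coe, LinearMap.rTensor_tmul,
      TensorProduct.map_tmul, TensorProduct.lid_tmul, AlgHom.toLinearMap_apply, map_smul, this]

theorem barLof_evalRight_barPsi (p q : ℕ) (t : BarChain k B p ⊗[k] BarChain k B q) :
    barLof k B p (evalRight (barPsi k B q) t) =
      evalRight (barCharacter k B).toLinearMap (incl₂ k (BarChain k B) p q t) := by
  induction t using TensorProduct.induction_on with
  | zero => simp only [map_zero]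
  | add s t hs ht => simp only [map_add, hs, ht]
  | tmul x y =>
    have := barCharacter_barLof y
    simp only [LinearMap.comp_apply, LinearEquiv.coe_coe, LinearMap.lTensor_tmul,
      TensorProduct.map_tmul, TensorProduct.rid_tmul, AlgHom.toLinearMap_apply, map_smul, this]

/-- The character is multiplicative and restricts to the counit on the inserted letter; counitality
of the coaction then recovers `V`. -/
theorem evalLeft_barInsertion (U T V : BarAlgebra k B) :
    evalLeft (barCharacter k B).toLinearMap (barInsertion U T (barCoactionHom k B V)) =
      (barCharacter k B U * barCharacter k B T) • V := by
  conv_rhs => rw [← barCoactionHom_counit V]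
  generalize barCoactionHom k B V = t
  induction t using TensorProduct.induction_on with
  | zero => simp only [map_zero, smul_zero]
  | add s t hs ht => simp only [map_add, smul_add, hs, ht]
  | tmul x y =>
    simp only [barInsertion_tmul, LinearMap.comp_apply, LinearEquiv.coe_coe, LinearMap.rTensor_tmul,
      TensorProduct.lid_tmul, AlgHom.toLinearMap_apply, map_mul, barCharacter_barGen, smul_smul]
    congr 1
    ring

theorem evalRight_barInsertion_apply (U T : BarAlgebra k B) (t : B ⊗[k] BarAlgebra k B) :
    evalRight (barCharacter k B).toLinearMap (barInsertion U T t) =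
      U * barGen k B (evalRight (barCharacter k B).toLinearMap t) * T := by
  induction t using TensorProduct.induction_on with
  | zero => simp only [map_zero, mul_zero, zero_mul]
  | add s t hs ht => simp only [map_add, mul_add, add_mul, hs, ht]
  | tmul x y =>
    simp only [barInsertion_tmul, LinearMap.comp_apply, LinearEquiv.coe_coe, LinearMap.lTensor_tmul,
      TensorProduct.rid_tmul, AlgHom.toLinearMap_apply, map_smul, mul_smul_comm, smul_mul_assoc]

/-- Both sides are algebra maps to `B` that fix the letters, by the counit axiom of `B`. Hence an
inner face multiplies the letters of its block. -/
theorem evalRight_barCoactionHom (V : BarAlgebra k B) :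
    evalRight (barCharacter k B).toLinearMap (barCoactionHom k B V) =
      barLift k B LinearMap.id V := by
  refine AlgHom.congr_fun (φ₁ := (Algebra.TensorProduct.rid k k B).toAlgHom.comp
    ((Algebra.TensorProduct.map (AlgHom.id k B) (barCharacter k B)).comp (barCoactionHom k B)))
    (φ₂ := barLift k B LinearMap.id) (barAlgebra_algHom_ext fun b => ?_) V
  rw [barLift_barGen]
  change TensorProduct.rid k B (LinearMap.lTensor B (barCharacter k B).toLinearMap
    (barCoactionHom k B (barGen k B b))) = b
  have h : (barCharacter k B).toLinearMap ∘ₗ barGen k B = Coalgebra.counit :=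
    LinearMap.ext fun b => barCharacter_barGen k B b
  rw [barCoactionHom_barGen, ← LinearMap.comp_apply (LinearMap.lTensor B _), ← LinearMap.lTensor_comp,
    h, Coalgebra.lTensor_counit_comul, TensorProduct.rid_tmul, one_smul]

theorem evalRight_barInsertion (U T V : BarAlgebra k B) :
    evalRight (barCharacter k B).toLinearMap (barInsertion U T (barCoactionHom k B V)) =
      U * barGen k B (barLift k B LinearMap.id V) * T := by
  rw [evalRight_barInsertion_apply, evalRight_barCoactionHom]

theorem barGen_barLift {V : BarAlgebra k B} (hV : V ∈ barDegree k B 1) :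
    barGen k B (barLift k B LinearMap.id V) = V := by
  obtain ⟨v, rfl⟩ := hV
  obtain ⟨b, rfl⟩ := (PiTensorProduct.subsingletonEquiv (R := k) (s := fun _ : Fin 1 => B)
    0).symm.surjective v
  exact congrArg _ (barLift_barGen k B LinearMap.id b)

/-- The counit of the cooperad of bar chains. -/
def barCounit (k : Type u) [CommRing k] (B : Type v) [Ring B] [Bialgebra k B] :
    BarChain k B 1 →ₗ[k] k :=
  Coalgebra.counit ∘ₗ
    (PiTensorProduct.subsingletonEquiv (R := k) (s := fun _ : Fin 1 => B) 0).toLinearMap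

theorem barCounit_eq : barCounit k B = barPsi k B 1 := by
  refine PiTensorProduct.ext (MultilinearMap.ext fun y => ?_)
  simp [barCounit, barPsi, barMul]

theorem barLof_evalLeft_barDecomp {n : ℕ} {p q i : ℕ} (h : p + q = n + 1) {a b : ℕ} (ha : i = a + 1)
    (hb : p = a + 1 + b) {U V T : BarAlgebra k B} (hU : U ∈ barDegree k B a)
    (hV : V ∈ barDegree k B q) (hT : T ∈ barDegree k B b) {x : BarChain k B n}
    (hx : barLof k B n x = U * V * T) :
    barLof k B q (evalLeft (barPsi k B p) (barDecomp k B p q i h x)) =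
      (barCharacter k B U * barCharacter k B T) • V := by
  rw [barLof_evalLeft_barPsi, ← barTotalDecomp_barLof, hx, barTotalDecomp_mul h ha hb hU hV hT,
    evalLeft_barInsertion]

theorem barLof_evalRight_barDecomp {n : ℕ} {p q i : ℕ} (h : p + q = n + 1) {a b : ℕ}
    (ha : i = a + 1) (hb : p = a + 1 + b) {U V T : BarAlgebra k B} (hU : U ∈ barDegree k B a)
    (hV : V ∈ barDegree k B q) (hT : T ∈ barDegree k B b) {x : BarChain k B n}
    (hx : barLof k B n x = U * V * T) :
    barLof k B p (evalRight (barPsi k B q) (barDecomp k B p q i h x)) =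
      U * barGen k B (barLift k B LinearMap.id V) * T := by
  rw [barLof_evalRight_barPsi, ← barTotalDecomp_barLof, hx, barTotalDecomp_mul h ha hb hU hV hT,
    evalRight_barInsertion]

/-- By the previous formulas, both sides are the product of the values of the character on `U`, `V`
and `T`. -/
theorem map_barPsi_barDecomp {n : ℕ} (p q i : ℕ) (h : p + q = n + 1) (hi : 1 ≤ i) (hp : i ≤ p)
    (x : BarChain k B n) :
    TensorProduct.lid k k (TensorProduct.map (barPsi k B p) (barPsi k B q)
      (barDecomp k B p q i h x)) = barPsi k B n x := by
  obtain ⟨a, rfl⟩ : ∃ a, i = a + 1 := ⟨i - 1, by omega⟩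
  obtain ⟨b, rfl⟩ : ∃ b, p = a + 1 + b := ⟨p - (a + 1), by omega⟩
  refine barChain_ext₃ (f := (TensorProduct.lid k k).toLinearMap ∘ₗ
      TensorProduct.map (barPsi k B _) (barPsi k B q) ∘ₗ barDecomp k B _ q _ h)
    (g := barPsi k B n) (a := a) (q := q) (b := b) (by omega) (fun U hU V hV T hT x hx => ?_) x
  have key : ∀ t : BarChain k B (a + 1 + b) ⊗[k] BarChain k B q,
      TensorProduct.lid k k (TensorProduct.map (barPsi k B _) (barPsi k B q) t) =
        barPsi k B q (evalLeft (barPsi k B _) t) := fun t => by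
    induction t using TensorProduct.induction_on with
    | zero => simp only [map_zero]
    | add s t hs ht => simp only [map_add, hs, ht]
    | tmul x y => simp
  simp only [LinearMap.comp_apply (TensorProduct.lid k k).toLinearMap, LinearEquiv.coe_coe,
    LinearMap.comp_apply (TensorProduct.map _ _)]
  rw [key, ← barCharacter_barLof, ← barCharacter_barLof,
    barLof_evalLeft_barDecomp h rfl rfl hU hV hT hx, hx, map_smul, map_mul, map_mul, smul_eq_mul]
  ring

variable (k B) in
/-- The cooperad with comultiplication of bar chains. -/
def barCooperad : ComultiplicativeCooperad k (BarChain k B) where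
  counit := barCounit k B
  decomp p q i h := barDecomp k B p q i h
  decomp_eq_zero p q i h hi := dif_neg hi
  counit_left n := LinearMap.ext fun x => barLof_injective n (by
    rw [barCounit_eq]
    have := barLof_evalLeft_barDecomp (Nat.add_comm 1 n) (a := 0) (b := 0) rfl rfl one_mem_barDegree
      (barLof_mem x) one_mem_barDegree (x := x) (by rw [one_mul, mul_one])
    rwa [map_one, one_mul, one_smul] at this)
  counit_right n i hi hn := by
    obtain ⟨a, rfl⟩ : ∃ a, i = a + 1 := ⟨i - 1, by omega⟩
    obtain ⟨b, rfl⟩ : ∃ b, n = a + 1 + b := ⟨n - (a + 1), by omega⟩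
    refine LinearMap.ext fun x => barChain_ext₃ (a := a) (q := 1) (b := b) rfl
      (fun U hU V hV T hT x hx => barLof_injective _ ?_) x
    rw [barCounit_eq]
    have := barLof_evalRight_barDecomp rfl (a := a) (b := b) rfl rfl hU hV hT hx
    rw [barGen_barLift hV, ← hx] at this
    exact this
  coassoc_before p q r i j m l n h₁ h₂ h₃ h₄ hi _ _ hm hij :=
    LinearMap.ext fun x => barDecomp_coassoc_before p q r i j m l n h₁ h₂ h₃ h₄ hi hm hij x
  coassoc_inside p q r i j m l n h₁ h₂ h₃ h₄ hi hp _ _ hj hij :=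
    LinearMap.ext fun x => barDecomp_coassoc_inside p q r i j m l n h₁ h₂ h₃ h₄ hi hp hj hij x
  coassoc_after p q r i j m l n h₁ h₂ h₃ h₄ hi hp hj hm hij := LinearMap.ext fun x => by
    -- The relation `coassoc_after` is `coassoc_before` with the two blocks interchanged, since
    -- exchanging the last two factors is an involution.
    have := barDecomp_coassoc_before p r q j (i + r - 1) l m n h₃ h₄ h₁ h₂ hj (by omega) (by omega) x
    rw [show i + r - 1 + 1 - r = i by omega] at this
    simp only [LinearMap.comp_apply, LinearEquiv.coe_coe]
    rw [this, ComultiplicativeCooperad.rightComm_rightComm]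
  psi :=
    { map := barPsi k B
      counit_map := barCounit_eq.symm
      decomp_map := fun p q i h hi hp => LinearMap.ext fun x => by
        refine (TensorProduct.lid k k).injective (Eq.trans ?_ (map_barPsi_barDecomp p q i h hi hp x).symm)
        simp [assDual, hi, hp] }

/-- Isolates the two letters to be multiplied between a prefix and a suffix shared by both words,
which is the shape required by the formulas for faces. -/
theorem exists_eq_mul_contractNth {n : ℕ} (y : Fin (n + 1) → B) (j : Fin n) {b : ℕ}
    (hb : j.val + 1 + b = n) :
    ∃ U ∈ barDegree k B j.val, ∃ T ∈ barDegree k B b,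
      barLof k B (n + 1) (PiTensorProduct.tprod k y) =
        U * (barGen k B (y j.castSucc) * barGen k B (y j.succ)) * T ∧
      barLof k B n (PiTensorProduct.tprod k (Fin.contractNth j.castSucc (· * ·) y)) =
        U * barGen k B (y j.castSucc * y j.succ) * T := by
  induction n with
  | zero => exact j.elim0
  | succ n ih =>
    induction j using Fin.cases with
    | zero =>
      obtain rfl : b = n := by simp at hb; omega
      refine ⟨1, one_mem_barDegree, _, barLof_mem (PiTensorProduct.tprod k (Fin.tail (Fin.tail y))),
        ?_, ?_⟩
      · rw [barLof_tprod_succ, barLof_tprod_succ, one_mul, mul_assoc]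
        rfl
      · rw [one_mul, ← barLof_tprod_cons]
        congr 2
        funext i
        refine Fin.cases ?_ (fun i => ?_) i <;> simp [Fin.contractNth, Fin.tail]
    | succ j =>
      obtain ⟨U, hU, T, hT, h₁, h₂⟩ := ih (Fin.tail y) j (by simp at hb; omega)
      refine ⟨barGen k B (y 0) * U, ?_, T, hT, ?_, ?_⟩
      · have := mul_mem_barDegree (barGen_mem (k := k) (y 0)) hU
        rwa [Nat.add_comm] at this
      · rw [barLof_tprod_succ, h₁]
        simp only [mul_assoc]
        rfl
      · rw [show Fin.contractNth j.succ.castSucc (· * ·) y =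
          Fin.cons (y 0) (Fin.contractNth j.castSucc (· * ·) (Fin.tail y)) from ?_,
          barLof_tprod_cons, h₂]
        · simp only [mul_assoc]
          rfl
        · funext i
          refine Fin.cases ?_ (fun i => ?_) i <;> simp [Fin.contractNth, Fin.tail]

theorem barCooperad_face_zero (n : ℕ) :
    (barCooperad k B).face n 0 = (TensorProduct.lid k _).toLinearMap ∘ₗ
      LinearMap.rTensor (BarChain k B n) (Coalgebra.counit (R := k) (A := B)) ∘ₗ barHead k B n := by
  refine PiTensorProduct.ext (MultilinearMap.ext fun y => barLof_injective n ?_)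
  have := barLof_evalLeft_barDecomp (show 2 + n = n + 1 + 1 by omega) (a := 1) (b := 0) rfl rfl
    (barGen_mem (y 0)) (barLof_mem (PiTensorProduct.tprod k (Fin.tail y))) one_mem_barDegree
    (x := PiTensorProduct.tprod k y) (by rw [mul_one, barLof_tprod_succ])
  refine Eq.trans this ?_
  simp [barHead, barCharacter_barGen]

theorem barCooperad_face_last (n : ℕ) :
    (barCooperad k B).face n (n + 1) = (TensorProduct.rid k _).toLinearMap ∘ₗ
      LinearMap.lTensor (BarChain k B n) (Coalgebra.counit (R := k) (A := B)) ∘ₗ barLast k B n := by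
  refine PiTensorProduct.ext (MultilinearMap.ext fun y => barLof_injective n ?_)
  have := barLof_evalLeft_barDecomp (show 2 + n = n + 1 + 1 by omega) (a := 0) (b := 1) rfl rfl
    one_mem_barDegree (barLof_mem (PiTensorProduct.tprod k (Fin.init y))) (barGen_mem (y (Fin.last n)))
    (x := PiTensorProduct.tprod k y) (by rw [one_mul, barLof_tprod_snoc])
  rw [ComultiplicativeCooperad.face, if_neg (by omega), if_pos rfl]
  refine Eq.trans this ?_
  simp [barLast, barCharacter_barGen]

theorem barCooperad_face_succ (n : ℕ) (j : Fin n) :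
    (barCooperad k B).face n (j.val + 1) = barContract k B n j := by
  refine PiTensorProduct.ext (MultilinearMap.ext fun y => barLof_injective n ?_)
  obtain ⟨U, hU, T, hT, h₁, h₂⟩ := exists_eq_mul_contractNth (k := k) y j (b := n - (j.val + 1))
    (by omega)
  have := barLof_evalRight_barDecomp (show n + 2 = n + 1 + 1 by omega) rfl (by omega) hU
    (mul_mem_barDegree (barGen_mem _) (barGen_mem _)) hT h₁
  rw [ComultiplicativeCooperad.face, if_neg (by omega), if_neg (by omega)]
  refine Eq.trans this ?_
  rw [map_mul, barLift_barGen, barLift_barGen, LinearMap.id_apply, LinearMap.id_apply, ← h₂]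
  simp [barContract]

theorem barCooperad_diff (n : ℕ) : (barCooperad k B).diff n = barDiff k B n := by
  rw [ComultiplicativeCooperad.diff, Finset.sum_range_succ, Finset.sum_range_succ',
    Finset.sum_range fun i => (-1 : k) ^ (i + 1) • (barCooperad k B).face n (i + 1)]
  simp only [barCooperad_face_zero, barCooperad_face_last, barCooperad_face_succ, barDiff, pow_zero,
    one_smul]
  rw [add_comm (∑ i : Fin n, _)]

theorem barChain_projective [Module.Projective k B] (n : ℕ) :
    Module.Projective k (BarChain k B n) := by
  induction n with
  | zero => exact Module.Projective.of_equiv (PiTensorProduct.isEmptyEquiv (Fin 0)).symm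
  | succ n ih =>
    have : Module.Projective k (BarChain k B 1) := Module.Projective.of_equiv
      (PiTensorProduct.subsingletonEquiv (R := k) (s := fun _ : Fin 1 => B) 0).symm
    exact Module.Projective.of_equiv (TensorPower.mulEquiv (R := k) (M := B) (n := n) (m := 1))

end BarCooperad

/-! ### Deformation retracts of complexes -/

section Perturbation

variable {k : Type u} [CommRing k] {W : Type v} [AddCommGroup W] [Module k W]

/-- The data of a projection `e` of a complex `(W, D)`, graded by the sign operator `P`, that kills
boundaries, has values in cycles, and is homotopic to the identity by `h`. -/
structure IsHomotopyProjection (D h e P : W →ₗ[k] W) : Prop where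
  homotopy : ∀ x, x - e x = D (h x) + h (D x)
  sign_sign : ∀ x, P (P x) = x
  diff_proj : ∀ x, D (e x) = 0
  proj_diff : ∀ x, e (D x) = 0
  sign_diff : ∀ x, P (D x) = -D (P x)
  sign_homotopy : ∀ x, P (h x) = -h (P x)
  sign_proj : ∀ x, P (e x) = e (P x)

namespace IsHomotopyProjection

variable {D h e P : W →ₗ[k] W} (H : IsHomotopyProjection D h e P)
include H

/-- Replacing `P` by `-P` turns the differential of the tensor square into that of the suspended
tensor square, so each statement covers both. -/
theorem neg : IsHomotopyProjection D h e (-P) where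
  homotopy := H.homotopy
  sign_sign x := by simp [H.sign_sign]
  diff_proj := H.diff_proj
  proj_diff := H.proj_diff
  sign_diff x := by simp [H.sign_diff]
  sign_homotopy x := by simp [H.sign_homotopy]
  sign_proj x := by simp [H.sign_proj]

/-- Since `f` kills boundaries, `f - f e = f h D`. On a cycle of the tensor square, `D ⊗ id` equals
`-(P ⊗ D)`, and `g` kills the image of `D` in the second factor. -/
theorem map_proj_left {X Y : Type*} [AddCommGroup X] [Module k X] [AddCommGroup Y] [Module k Y]
    {f : W →ₗ[k] X} {g : W →ₗ[k] Y} (hf : ∀ x, f (D x) = 0) (hg : ∀ x, g (D x) = 0)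
    {c : W ⊗[k] W} (hc : TensorProduct.map D LinearMap.id c + TensorProduct.map P D c = 0) :
    TensorProduct.map (f ∘ₗ e) g c = TensorProduct.map f g c := by
  have h₁ : TensorProduct.map f g - TensorProduct.map (f ∘ₗ e) g =
      TensorProduct.map (f ∘ₗ h) g ∘ₗ (TensorProduct.map D LinearMap.id + TensorProduct.map P D) := by
    refine TensorProduct.ext' fun x y => ?_
    have := congrArg f (H.homotopy x)
    rw [map_sub, map_add, hf, zero_add] at this
    simp only [LinearMap.sub_apply, LinearMap.comp_apply, LinearMap.add_apply, TensorProduct.map_tmul,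
      map_add, LinearMap.id_apply, hg, TensorProduct.tmul_zero, add_zero, ← this,
      TensorProduct.sub_tmul]
  have h₂ := LinearMap.congr_fun h₁ c
  rw [LinearMap.comp_apply, LinearMap.add_apply, hc, map_zero, LinearMap.sub_apply,
    sub_eq_zero] at h₂
  exact h₂.symm

theorem map_proj_right {X Y : Type*} [AddCommGroup X] [Module k X] [AddCommGroup Y] [Module k Y]
    {f : W →ₗ[k] X} {g : W →ₗ[k] Y} (hf : ∀ x, f (D x) = 0) (hg : ∀ x, g (D x) = 0)
    {c : W ⊗[k] W} (hc : TensorProduct.map D LinearMap.id c + TensorProduct.map P D c = 0) :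
    TensorProduct.map f (g ∘ₗ e) c = TensorProduct.map f g c := by
  have h₁ : TensorProduct.map f g - TensorProduct.map f (g ∘ₗ e) =
      -- The extra `P` undoes the sign operator in the second term of the differential.
      TensorProduct.map (f ∘ₗ P) (g ∘ₗ h) ∘ₗ
        (TensorProduct.map D LinearMap.id + TensorProduct.map P D) := by
    refine TensorProduct.ext' fun x y => ?_
    have := congrArg g (H.homotopy y)
    rw [map_sub, map_add, hg, zero_add] at this
    simp only [LinearMap.sub_apply, LinearMap.comp_apply, LinearMap.add_apply, TensorProduct.map_tmul,
      map_add, LinearMap.id_apply, H.sign_diff, map_neg, hf, neg_zero, TensorProduct.zero_tmul,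
      zero_add, H.sign_sign, ← this, TensorProduct.tmul_sub]
  have h₂ := LinearMap.congr_fun h₁ c
  rw [LinearMap.comp_apply, LinearMap.add_apply, hc, map_zero, LinearMap.sub_apply,
    sub_eq_zero] at h₂
  exact h₂.symm

theorem sub_map_proj_mem {c : W ⊗[k] W}
    (hc : TensorProduct.map D LinearMap.id c + TensorProduct.map P D c = 0) :
    c - TensorProduct.map e e c ∈
      LinearMap.range (TensorProduct.map D LinearMap.id + TensorProduct.map P D) := by
  -- The standard homotopy for a tensor product of homotopies: first from `id` to `e` on the left
  -- factor, then, behind `e`, on the right factor.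
  refine ⟨(TensorProduct.map h LinearMap.id + TensorProduct.map (P ∘ₗ e) h :
    W ⊗[k] W →ₗ[k] W ⊗[k] W) c, ?_⟩
  have h₁ : (TensorProduct.map D LinearMap.id + TensorProduct.map P D) ∘ₗ
        (TensorProduct.map h LinearMap.id + TensorProduct.map (P ∘ₗ e) h) +
      (TensorProduct.map h LinearMap.id + TensorProduct.map (P ∘ₗ e) h) ∘ₗ
        (TensorProduct.map D LinearMap.id + TensorProduct.map P D) =
      LinearMap.id - TensorProduct.map e e := by
    refine TensorProduct.ext' fun x y => ?_
    have hx : x ⊗ₜ[k] y - e x ⊗ₜ[k] e y = (x - e x) ⊗ₜ[k] y + e x ⊗ₜ[k] (y - e y) := by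
      rw [TensorProduct.sub_tmul, TensorProduct.tmul_sub]; abel
    have hDP : ∀ x, D (P (e x)) = 0 := fun x => by
      rw [← neg_eq_zero, ← H.sign_diff, H.diff_proj, map_zero]
    simp only [LinearMap.sub_apply, LinearMap.comp_apply, LinearMap.add_apply, TensorProduct.map_tmul,
      map_add, LinearMap.id_apply, hx, H.homotopy, hDP, H.proj_diff, map_zero,
      TensorProduct.zero_tmul, ← H.sign_proj, H.sign_sign, H.sign_homotopy, TensorProduct.add_tmul,
      TensorProduct.tmul_add, TensorProduct.neg_tmul]
    abel
  have h₂ := LinearMap.congr_fun h₁ c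
  rw [LinearMap.add_apply, LinearMap.comp_apply, LinearMap.comp_apply, LinearMap.add_apply _ _ c, LinearMap.add_apply _ _ c, hc, map_zero, add_zero] at h₂
  rw [← LinearMap.add_apply _ _ c] at h₂
  exact h₂

end IsHomotopyProjection

end Perturbation

/-! ### Retraction of a complex with projective terms and homology -/

section HomologyRetract

variable {k : Type u} [CommRing k]
variable {V : ℕ → Type v} [∀ n, AddCommGroup (V n)] [∀ n, Module k (V n)]

/-- A deformation retract of a complex onto its homology. -/
structure HomologyRetract (d : ∀ n, V (n + 1) →ₗ[k] V n) where
  incl : ∀ n, gradedHomology d n →ₗ[k] gradedCycles d n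
  proj : ∀ n, V n →ₗ[k] gradedHomology d n
  homotopy : ∀ n, V n →ₗ[k] V (n + 1)
  class_incl : ∀ n y, homologyClass d n (incl n y) = y
  proj_cycle : ∀ n (z : gradedCycles d n), proj n z = homologyClass d n z
  sub_zero : ∀ x, x - (incl 0 (proj 0 x) : V 0) = d 0 (homotopy 0 x)
  sub_succ : ∀ n x, x - (incl (n + 1) (proj (n + 1) x) : V (n + 1)) =
    d (n + 1) (homotopy (n + 1) x) + homotopy n (d n x)

variable (d : ∀ n, V (n + 1) →ₗ[k] V n)

theorem diff_mem_gradedCycles (hd : ∀ n x, d n (d (n + 1) x) = 0) :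
    ∀ n x, d n x ∈ gradedCycles d n
  | 0, _ => Submodule.mem_top
  | n + 1, x => hd n x

variable {d} in
theorem homologyClass_eq_zero {n : ℕ} {z : gradedCycles d n} :
    homologyClass d n z = 0 ↔ ∃ x, d n x = z :=
  Submodule.Quotient.mk_eq_zero _

/-- A retraction onto the cycles yields a section of the differential on the boundaries. -/
theorem exists_boundary_section (hd : ∀ n x, d n (d (n + 1) x) = 0)
    [∀ n, Module.Projective k (V n)] [∀ n, Module.Projective k (gradedHomology d n)] (n : ℕ)
    {p : V n →ₗ[k] gradedCycles d n} (hp : ∀ z : gradedCycles d n, p z = z) :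
    ∃ s : LinearMap.range (d n) →ₗ[k] V (n + 1), ∀ b, d n (s b) = b := by
  obtain ⟨σ, hσ⟩ := Module.projective_lifting_property (homologyClass d n) LinearMap.id
    (Submodule.mkQ_surjective _)
  have hmem : ∀ z, ((z - σ (homologyClass d n z) : gradedCycles d n) : V n) ∈
      LinearMap.range (d n) := fun z => homologyClass_eq_zero.1 (by
    rw [map_sub, ← LinearMap.comp_apply _ σ, hσ, LinearMap.id_apply, sub_self])
  -- Subtracting the chosen representative of the class projects cycles onto boundaries. Together
  -- with `p` this makes the boundaries a direct summand of `V n`, hence projective, so that `d n`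
  -- splits over its range.
  let q : V n →ₗ[k] LinearMap.range (d n) :=
    LinearMap.codRestrict _ ((gradedCycles d n).subtype ∘ₗ
      (LinearMap.id - σ ∘ₗ homologyClass d n) ∘ₗ p) fun x => by
      simpa only [LinearMap.comp_apply, LinearMap.sub_apply, LinearMap.id_apply,
        Submodule.subtype_apply] using hmem (p x)
  have hq : q ∘ₗ (LinearMap.range (d n)).subtype = LinearMap.id := LinearMap.ext fun b => by
    obtain ⟨_, x, rfl⟩ := b
    have h₁ : p (d n x) = ⟨d n x, diff_mem_gradedCycles d hd n x⟩ :=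
      hp ⟨d n x, diff_mem_gradedCycles d hd n x⟩
    have h₂ : homologyClass d n ⟨d n x, diff_mem_gradedCycles d hd n x⟩ = 0 :=
      homologyClass_eq_zero.2 ⟨x, rfl⟩
    refine Subtype.ext ?_
    change ((p (d n x) - σ (homologyClass d n (p (d n x))) : gradedCycles d n) : V n) = d n x
    rw [h₁, h₂, map_zero, sub_zero]
  have : Module.Projective k (LinearMap.range (d n)) := Module.Projective.of_split _ q hq
  obtain ⟨s, hs⟩ := Module.projective_lifting_property (d n).rangeRestrict LinearMap.id
    (d n).surjective_rangeRestrict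
  exact ⟨s, fun b => congrArg Subtype.val (LinearMap.congr_fun hs b)⟩

/-- The retraction onto the cycles given by a section of the differential on the boundaries. -/
def cycleRetraction {n : ℕ} {s : LinearMap.range (d n) →ₗ[k] V (n + 1)} (hs : ∀ b, d n (s b) = b) :
    V (n + 1) →ₗ[k] gradedCycles d (n + 1) :=
  LinearMap.codRestrict _ (LinearMap.id - s ∘ₗ (d n).rangeRestrict) fun x => by
    change d n (x - s ((d n).rangeRestrict x)) = 0
    rw [map_sub, hs]
    exact sub_self _

theorem cycleRetraction_cycle {n : ℕ} {s : LinearMap.range (d n) →ₗ[k] V (n + 1)}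
    (hs : ∀ b, d n (s b) = b) (z : gradedCycles d (n + 1)) : cycleRetraction d hs z = z := by
  refine Subtype.ext ?_
  have h : (d n).rangeRestrict z = 0 := Subtype.ext z.2
  change (z : V (n + 1)) - s ((d n).rangeRestrict z) = z
  rw [h, map_zero, sub_zero]

/-- Induction on the degree: all of `V 0` consists of cycles, and a section `s` over the boundaries
of degree `n` gives the retraction `x - s d x` onto the cycles of degree `n + 1`, which is what the
next section requires. -/
theorem exists_section (hd : ∀ n x, d n (d (n + 1) x) = 0)
    [∀ n, Module.Projective k (V n)] [∀ n, Module.Projective k (gradedHomology d n)] (n : ℕ) :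
    ∃ s : LinearMap.range (d n) →ₗ[k] V (n + 1), ∀ b, d n (s b) = b := by
  induction n with
  | zero =>
    exact exists_boundary_section d hd 0
      (p := LinearMap.codRestrict _ LinearMap.id fun _ => Submodule.mem_top) fun z => rfl
  | succ n ih =>
    obtain ⟨s, hs⟩ := ih
    exact exists_boundary_section d hd (n + 1) (cycleRetraction_cycle d hs)

/-- The homotopy projects to boundaries by `q` and lifts them by `s`. With the cycle retraction `p`
and the section `σ` of the class map, `d s q = p - σ [p]`, and in positive degrees `s q d = id - p`;
the sum is `id - σ [p]`. -/
theorem nonempty_homologyRetract (hd : ∀ n x, d n (d (n + 1) x) = 0)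
    [∀ n, Module.Projective k (V n)] [∀ n, Module.Projective k (gradedHomology d n)] :
    Nonempty (HomologyRetract d) := by
  choose s hs using exists_section d hd
  have hσ : ∀ n, ∃ σ : gradedHomology d n →ₗ[k] gradedCycles d n,
      homologyClass d n ∘ₗ σ = LinearMap.id := fun n =>
    Module.projective_lifting_property (homologyClass d n) LinearMap.id (Submodule.mkQ_surjective _)
  choose σ hσ using hσ
  have class_σ : ∀ n y, homologyClass d n (σ n y) = y := fun n y => LinearMap.congr_fun (hσ n) y
  let p : ∀ n, V n →ₗ[k] gradedCycles d n := fun n =>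
    match n with
    | 0 => LinearMap.codRestrict _ LinearMap.id fun _ => Submodule.mem_top
    | n + 1 => cycleRetraction d (hs n)
  have hp : ∀ n (z : gradedCycles d n), p n z = z := fun n z =>
    match n, z with
    | 0, _ => rfl
    | n + 1, z => cycleRetraction_cycle d (hs n) z
  have hmem : ∀ n z, ((z - σ n (homologyClass d n z) : gradedCycles d n) : V n) ∈
      LinearMap.range (d n) := fun n z => homologyClass_eq_zero.1 (by
    rw [map_sub, class_σ, sub_self])
  let q : ∀ n, V n →ₗ[k] LinearMap.range (d n) := fun n =>
    LinearMap.codRestrict _ ((gradedCycles d n).subtype ∘ₗ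
      (LinearMap.id - σ n ∘ₗ homologyClass d n) ∘ₗ p n) fun x => by
      simpa only [LinearMap.comp_apply, LinearMap.sub_apply, LinearMap.id_apply,
        Submodule.subtype_apply] using hmem n (p n x)
  have hdq : ∀ n x, d n (s n (q n x)) = p n x - σ n (homologyClass d n (p n x)) := fun n x => hs n _
  have hqd : ∀ n x, q n (d n x) = (d n).rangeRestrict x := fun n x => by
    have h₁ : p n (d n x) = ⟨d n x, diff_mem_gradedCycles d hd n x⟩ :=
      hp n ⟨d n x, diff_mem_gradedCycles d hd n x⟩
    have h₂ : homologyClass d n ⟨d n x, diff_mem_gradedCycles d hd n x⟩ = 0 :=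
      homologyClass_eq_zero.2 ⟨x, rfl⟩
    refine Subtype.ext ?_
    change ((p n (d n x) - σ n (homologyClass d n (p n (d n x))) : gradedCycles d n) : V n) = d n x
    rw [h₁, h₂, map_zero, sub_zero]
  exact ⟨{
    incl := σ
    proj := fun n => homologyClass d n ∘ₗ p n
    homotopy := fun n => s n ∘ₗ q n
    class_incl := class_σ
    proj_cycle := fun n z => congrArg _ (hp n z)
    sub_zero := fun x => (hdq 0 x).symm
    sub_succ := fun n x => by
      change _ = d (n + 1) (s (n + 1) (q (n + 1) x)) + s n (q n (d n x))
      rw [hdq, hqd]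
      change _ = x - s n ((d n).rangeRestrict x) - _ + _
      rw [sub_add_eq_add_sub, sub_add_cancel]
      rfl }⟩

namespace HomologyRetract

variable {d} (R : HomologyRetract d)

/-- The inclusion of the homology, on total modules. -/
def totalIncl : (⨁ n, gradedHomology d n) →ₗ[k] ⨁ n, V n :=
  DirectSum.lmap fun n => (gradedCycles d n).subtype ∘ₗ R.incl n

/-- The projection to the homology, on total modules. -/
def totalProj : (⨁ n, V n) →ₗ[k] ⨁ n, gradedHomology d n := DirectSum.lmap R.proj

/-- The homotopy, on total modules. -/
def totalHomotopy : (⨁ n, V n) →ₗ[k] ⨁ n, V n :=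
  DirectSum.toModule k ℕ _ fun n => DirectSum.lof k ℕ V (n + 1) ∘ₗ R.homotopy n

theorem totalIncl_lof (n : ℕ) (y : gradedHomology d n) :
    R.totalIncl (DirectSum.lof k ℕ _ n y) = DirectSum.lof k ℕ V n (R.incl n y) := by
  simp [totalIncl, DirectSum.lmap_lof]

theorem totalProj_lof (n : ℕ) (x : V n) :
    R.totalProj (DirectSum.lof k ℕ V n x) = DirectSum.lof k ℕ _ n (R.proj n x) := by
  simp [totalProj, DirectSum.lmap_lof]

theorem totalHomotopy_lof (n : ℕ) (x : V n) :
    R.totalHomotopy (DirectSum.lof k ℕ V n x) = DirectSum.lof k ℕ V (n + 1) (R.homotopy n x) := by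
  simp [totalHomotopy]

theorem totalDiff_cycle (n : ℕ) (z : gradedCycles d n) :
    totalDiff d (DirectSum.lof k ℕ V n z) = 0 := by
  cases n with
  | zero => rw [totalDiff_lof_zero]
  | succ n => rw [totalDiff_lof_succ, show d n z = 0 from z.2, map_zero]

theorem totalProj_totalIncl (y : ⨁ n, gradedHomology d n) : R.totalProj (R.totalIncl y) = y := by
  refine DirectSum.congr_of_lof (W := ⨁ n, gradedHomology d n) (f := R.totalProj ∘ₗ R.totalIncl) (g := LinearMap.id)
    (fun n y => ?_) y
  rw [LinearMap.comp_apply, totalIncl_lof, totalProj_lof, R.proj_cycle, R.class_incl,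
    LinearMap.id_apply]

theorem totalDiff_totalIncl (y : ⨁ n, gradedHomology d n) : totalDiff d (R.totalIncl y) = 0 := by
  refine DirectSum.congr_of_lof (f := totalDiff d ∘ₗ R.totalIncl) (g := 0) (fun n y => ?_) y
  rw [LinearMap.comp_apply, totalIncl_lof, totalDiff_cycle, LinearMap.zero_apply]

theorem totalProj_totalDiff (hd : ∀ n x, d n (d (n + 1) x) = 0) (x : ⨁ n, V n) :
    R.totalProj (totalDiff d x) = 0 := by
  refine DirectSum.congr_of_lof (W := ⨁ n, gradedHomology d n) (f := R.totalProj ∘ₗ totalDiff d) (g := 0) (fun n x => ?_) x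
  rw [LinearMap.comp_apply, LinearMap.zero_apply]
  cases n with
  | zero => rw [totalDiff_lof_zero, map_zero]
  | succ n =>
    have h₁ := R.proj_cycle n ⟨d n x, diff_mem_gradedCycles d hd n x⟩
    have h₂ : homologyClass d n ⟨d n x, diff_mem_gradedCycles d hd n x⟩ = 0 :=
      homologyClass_eq_zero.2 ⟨x, rfl⟩
    rw [totalDiff_lof_succ, totalProj_lof, h₁.trans h₂, map_zero]

theorem isHomotopyProjection (hd : ∀ n x, d n (d (n + 1) x) = 0) :
    IsHomotopyProjection (totalDiff d) R.totalHomotopy (R.totalIncl ∘ₗ R.totalProj)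
      (parity k V) where
  homotopy x := by
    refine DirectSum.congr_of_lof (f := LinearMap.id - R.totalIncl ∘ₗ R.totalProj)
      (g := totalDiff d ∘ₗ R.totalHomotopy + R.totalHomotopy ∘ₗ totalDiff d) (fun n x => ?_) x
    simp only [LinearMap.sub_apply, LinearMap.add_apply, LinearMap.comp_apply, LinearMap.id_apply,
      totalProj_lof, totalIncl_lof, totalHomotopy_lof, totalDiff_lof_succ]
    cases n with
    | zero => rw [totalDiff_lof_zero, map_zero, add_zero, ← map_sub, R.sub_zero]
    | succ n => rw [totalDiff_lof_succ, totalHomotopy_lof, ← map_sub, ← map_add, R.sub_succ]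
  sign_sign := parity_parity
  diff_proj x := R.totalDiff_totalIncl _
  proj_diff x := by rw [LinearMap.comp_apply, R.totalProj_totalDiff hd, map_zero]
  sign_diff x := by
    refine DirectSum.congr_of_lof (f := parity k V ∘ₗ totalDiff d) (g := -(totalDiff d ∘ₗ parity k V))
      (fun n x => ?_) x
    simp only [LinearMap.neg_apply, LinearMap.comp_apply, parity_lof, map_smul]
    cases n with
    | zero => simp [totalDiff_lof_zero]
    | succ n => rw [totalDiff_lof_succ, parity_lof, pow_succ]; simp
  sign_homotopy x := by
    refine DirectSum.congr_of_lof (f := parity k V ∘ₗ R.totalHomotopy)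
      (g := -(R.totalHomotopy ∘ₗ parity k V)) (fun n x => ?_) x
    simp only [LinearMap.neg_apply, LinearMap.comp_apply, parity_lof, map_smul, totalHomotopy_lof,
      pow_succ, mul_neg_one, neg_smul]
  sign_proj x := by
    refine DirectSum.congr_of_lof (f := parity k V ∘ₗ R.totalIncl ∘ₗ R.totalProj)
      (g := (R.totalIncl ∘ₗ R.totalProj) ∘ₗ parity k V) (fun n x => ?_) x
    simp only [LinearMap.comp_apply, parity_lof, map_smul, totalProj_lof, totalIncl_lof]

end HomologyRetract

end HomologyRetract

/-! ### Transfer of Gerstenhaber coalgebra structures -/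

section TensorTransfer

variable {k : Type u} [CommRing k]
variable {W : Type v} {W' : Type w} [AddCommGroup W] [Module k W] [AddCommGroup W'] [Module k W']

/-- `F ⊗ F`. -/
abbrev tensorSquareMap {k : Type u} [CommRing k] {W : Type v} {W' : Type w} [AddCommMonoid W]
    [Module k W] [AddCommMonoid W'] [Module k W'] (F : W →ₗ[k] W') : W ⊗[k] W →ₗ[k] W' ⊗[k] W' := TensorProduct.map F F

/-- `F ⊗ F ⊗ F`. -/
abbrev tensorCubeMap {k : Type u} [CommRing k] {W : Type v} {W' : Type w} [AddCommMonoid W]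
    [Module k W] [AddCommMonoid W'] [Module k W'] (F : W →ₗ[k] W') : (W ⊗[k] W) ⊗[k] W →ₗ[k] (W' ⊗[k] W') ⊗[k] W' :=
  TensorProduct.map (TensorProduct.map F F) F

variable {F : W →ₗ[k] W'} {J : W' →ₗ[k] W}

theorem tensorCubeMap_rTensor {s : W ⊗[k] W →ₗ[k] W ⊗[k] W} {s' : W' ⊗[k] W' →ₗ[k] W' ⊗[k] W'}
    (hs : ∀ t, tensorSquareMap F (s t) = s' (tensorSquareMap F t)) (t : (W ⊗[k] W) ⊗[k] W) :
    tensorCubeMap F (LinearMap.rTensor W s t) = LinearMap.rTensor W' s' (tensorCubeMap F t) := by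
  refine LinearMap.congr_fun (f := tensorCubeMap F ∘ₗ LinearMap.rTensor W s)
    (g := LinearMap.rTensor W' s' ∘ₗ tensorCubeMap F) (TensorProduct.ext' fun x y => ?_) t
  simp only [LinearMap.comp_apply, LinearMap.rTensor_tmul, TensorProduct.map_tmul, hs]

theorem tensorCubeMap_assoc_symm (t : W ⊗[k] (W ⊗[k] W)) :
    tensorCubeMap F ((TensorProduct.assoc k W W W).symm t) =
      (TensorProduct.assoc k W' W' W').symm (TensorProduct.map F (tensorSquareMap F) t) := by
  obtain ⟨t, rfl⟩ := (TensorProduct.assoc k W W W).surjective t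
  rw [LinearEquiv.symm_apply_apply, LinearEquiv.eq_symm_apply]
  exact LinearMap.congr_fun (f := (TensorProduct.assoc k W' W' W').toLinearMap ∘ₗ tensorCubeMap F)
    (g := TensorProduct.map F (tensorSquareMap F) ∘ₗ (TensorProduct.assoc k W W W).toLinearMap)
    (TensorProduct.ext_threefold fun _ _ _ => rfl) t

theorem tensorCubeMap_onLastTwo {s : W ⊗[k] W →ₗ[k] W ⊗[k] W}
    {s' : W' ⊗[k] W' →ₗ[k] W' ⊗[k] W'}
    (hs : ∀ t, tensorSquareMap F (s t) = s' (tensorSquareMap F t)) (t : (W ⊗[k] W) ⊗[k] W) :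
    tensorCubeMap F (onLastTwo s t) = onLastTwo s' (tensorCubeMap F t) := by
  obtain ⟨t, rfl⟩ := (TensorProduct.assoc k W W W).symm.surjective t
  simp only [onLastTwo, LinearMap.comp_apply, LinearEquiv.coe_coe, tensorCubeMap_assoc_symm,
    LinearEquiv.apply_symm_apply]
  congr 1
  refine LinearMap.congr_fun (f := TensorProduct.map F (tensorSquareMap F) ∘ₗ LinearMap.lTensor W s)
    (g := LinearMap.lTensor W' s' ∘ₗ TensorProduct.map F (tensorSquareMap F))
    (TensorProduct.ext' fun x y => ?_) t
  simp only [LinearMap.comp_apply, LinearMap.lTensor_tmul, TensorProduct.map_tmul, hs]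

/-- The hypothesis allows `J F` to be dropped between two successive operations. An iterate of
transferred operations is then the image of the iterate of the original ones. -/
theorem rTensor_tensorSquareMap {c : W →ₗ[k] W ⊗[k] W} {t : W ⊗[k] W}
    (ht : TensorProduct.map ((tensorSquareMap F ∘ₗ c) ∘ₗ J ∘ₗ F) F t =
      TensorProduct.map (tensorSquareMap F ∘ₗ c) F t) :
    LinearMap.rTensor W' (tensorSquareMap F ∘ₗ c ∘ₗ J) (tensorSquareMap F t) =
      tensorCubeMap F (LinearMap.rTensor W c t) := by
  rw [← LinearMap.comp_apply, LinearMap.rTensor_comp_map, ← LinearMap.comp_apply (tensorCubeMap F),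
    LinearMap.map_comp_rTensor]
  exact ht

theorem idTensor_tensorSquareMap {c : W →ₗ[k] W ⊗[k] W} {t : W ⊗[k] W}
    (ht : TensorProduct.map F ((tensorSquareMap F ∘ₗ c) ∘ₗ J ∘ₗ F) t =
      TensorProduct.map F (tensorSquareMap F ∘ₗ c) t) :
    idTensor (tensorSquareMap F ∘ₗ c ∘ₗ J) (tensorSquareMap F t) =
      tensorCubeMap F (idTensor c t) := by
  simp only [idTensor, LinearMap.comp_apply, LinearEquiv.coe_coe, tensorCubeMap_assoc_symm]
  congr 1
  rw [← LinearMap.comp_apply (LinearMap.lTensor _ _), LinearMap.lTensor_comp_map,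
    ← LinearMap.comp_apply (TensorProduct.map _ _), LinearMap.map_comp_lTensor]
  exact ht

theorem evalLeft_tensorSquareMap {c : W →ₗ[k] k} {t : W ⊗[k] W}
    (ht : TensorProduct.map (c ∘ₗ J ∘ₗ F) F t = TensorProduct.map c F t) :
    TensorProduct.lid k W' (LinearMap.rTensor W' (c ∘ₗ J) (tensorSquareMap F t)) =
      F (TensorProduct.lid k W (LinearMap.rTensor W c t)) := by
  rw [← LinearMap.comp_apply, LinearMap.rTensor_comp_map, LinearMap.comp_assoc, ht]
  refine LinearMap.congr_fun (f := (TensorProduct.lid k W').toLinearMap ∘ₗ TensorProduct.map c F)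
    (g := F ∘ₗ (TensorProduct.lid k W).toLinearMap ∘ₗ LinearMap.rTensor W c)
    (TensorProduct.ext' fun x y => ?_) t
  simp

theorem evalRight_tensorSquareMap {c : W →ₗ[k] k} {t : W ⊗[k] W}
    (ht : TensorProduct.map F (c ∘ₗ J ∘ₗ F) t = TensorProduct.map F c t) :
    TensorProduct.rid k W' (LinearMap.lTensor W' (c ∘ₗ J) (tensorSquareMap F t)) =
      F (TensorProduct.rid k W (LinearMap.lTensor W c t)) := by
  rw [← LinearMap.comp_apply, LinearMap.lTensor_comp_map, LinearMap.comp_assoc, ht]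
  refine LinearMap.congr_fun (f := (TensorProduct.rid k W').toLinearMap ∘ₗ TensorProduct.map F c)
    (g := F ∘ₗ (TensorProduct.rid k W).toLinearMap ∘ₗ LinearMap.lTensor W c)
    (TensorProduct.ext' fun x y => ?_) t
  simp

end TensorTransfer

/-! ### Gerstenhaber structures carried along a graded retraction -/

section GradedTransfer

variable {k : Type u} [CommRing k]
variable {V : ℕ → Type v} [∀ n, AddCommGroup (V n)] [∀ n, Module k (V n)]
variable {V' : ℕ → Type w} [∀ n, AddCommGroup (V' n)] [∀ n, Module k (V' n)]

theorem tensorSquareMap_signedFlip (f : ∀ n, V n →ₗ[k] V' n) (s : ℕ → ℕ → ℕ)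
    (t : (⨁ n, V n) ⊗[k] (⨁ n, V n)) :
    tensorSquareMap (DirectSum.lmap f) (signedFlip k V s t) =
      signedFlip k V' s (tensorSquareMap (DirectSum.lmap f) t) := by
  refine LinearMap.congr_fun (f := tensorSquareMap (DirectSum.lmap f) ∘ₗ signedFlip k V s)
    (g := signedFlip k V' s ∘ₗ tensorSquareMap (DirectSum.lmap f))
    (DirectSum.tensor_ext₂ fun p q x y => ?_) t
  simp only [LinearMap.comp_apply, signedFlip_tmul, map_smul, TensorProduct.map_tmul,
    DirectSum.lmap_lof]

theorem tensorSquareMap_mem (f : ∀ n, V n →ₗ[k] V' n) {n : ℕ} {t : (⨁ n, V n) ⊗[k] (⨁ n, V n)}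
    (ht : t ∈ tensorDegree k V n) :
    tensorSquareMap (DirectSum.lmap f) t ∈ tensorDegree k V' n := by
  refine tensorDegree_induction
    (P := fun t => tensorSquareMap (DirectSum.lmap f) t ∈ tensorDegree k V' n) ?_ ?_ ?_ ht
  · rw [map_zero]; exact Submodule.zero_mem _
  · intro s t hs ht
    rw [map_add]; exact Submodule.add_mem _ hs ht
  · intro p q x y h
    rw [TensorProduct.map_tmul, DirectSum.lmap_lof, DirectSum.lmap_lof]
    exact Submodule.mem_iSup_of_mem p (Submodule.mem_iSup_of_mem q
      (Submodule.mem_iSup_of_mem h ⟨f p x ⊗ₜ[k] f q y, rfl⟩))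

/-- Operations on `V`, together with graded maps `f : V → V'` and `j : V' → V` with `f ∘ j = id`,
such that the operations induced on `V'` form a Gerstenhaber coalgebra: the axioms hold after
application of `f` on the image of `j`, and there `j ∘ f` may be inserted between two operations. -/
structure GerstenhaberTransfer (f : ∀ n, V n →ₗ[k] V' n) (j : ∀ n, V' n →ₗ[k] V n)
    (cup cobracket : (⨁ n, V n) →ₗ[k] (⨁ n, V n) ⊗[k] (⨁ n, V n))
    (counit : (⨁ n, V n) →ₗ[k] k) : Prop where
  section_eq : ∀ y, DirectSum.lmap f (DirectSum.lmap j y) = y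
  cup_mem : ∀ (n : ℕ) (x : V n), cup (DirectSum.lof k ℕ V n x) ∈ tensorDegree k V n
  counit_eq_zero : ∀ (n : ℕ) (x : V n), n ≠ 0 → counit (DirectSum.lof k ℕ V n x) = 0
  cobracket_mem :
    ∀ (n : ℕ) (x : V n), cobracket (DirectSum.lof k ℕ V n x) ∈ tensorDegree k V (n + 1)
  cup_cup_left : ∀ y,
    TensorProduct.map ((tensorSquareMap (DirectSum.lmap f) ∘ₗ cup) ∘ₗ
        DirectSum.lmap j ∘ₗ DirectSum.lmap f) (DirectSum.lmap f) (cup (DirectSum.lmap j y)) =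
      TensorProduct.map (tensorSquareMap (DirectSum.lmap f) ∘ₗ cup) (DirectSum.lmap f)
        (cup (DirectSum.lmap j y))
  cup_cup_right : ∀ y,
    TensorProduct.map (DirectSum.lmap f) ((tensorSquareMap (DirectSum.lmap f) ∘ₗ cup) ∘ₗ
        DirectSum.lmap j ∘ₗ DirectSum.lmap f) (cup (DirectSum.lmap j y)) =
      TensorProduct.map (DirectSum.lmap f) (tensorSquareMap (DirectSum.lmap f) ∘ₗ cup)
        (cup (DirectSum.lmap j y))
  cobracket_cup_left : ∀ y,
    TensorProduct.map ((tensorSquareMap (DirectSum.lmap f) ∘ₗ cobracket) ∘ₗ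
        DirectSum.lmap j ∘ₗ DirectSum.lmap f) (DirectSum.lmap f) (cup (DirectSum.lmap j y)) =
      TensorProduct.map (tensorSquareMap (DirectSum.lmap f) ∘ₗ cobracket) (DirectSum.lmap f)
        (cup (DirectSum.lmap j y))
  cobracket_cup_right : ∀ y,
    TensorProduct.map (DirectSum.lmap f) ((tensorSquareMap (DirectSum.lmap f) ∘ₗ cobracket) ∘ₗ
        DirectSum.lmap j ∘ₗ DirectSum.lmap f) (cup (DirectSum.lmap j y)) =
      TensorProduct.map (DirectSum.lmap f) (tensorSquareMap (DirectSum.lmap f) ∘ₗ cobracket)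
        (cup (DirectSum.lmap j y))
  cobracket_cobracket_left : ∀ y,
    TensorProduct.map ((tensorSquareMap (DirectSum.lmap f) ∘ₗ cobracket) ∘ₗ
        DirectSum.lmap j ∘ₗ DirectSum.lmap f) (DirectSum.lmap f) (cobracket (DirectSum.lmap j y)) =
      TensorProduct.map (tensorSquareMap (DirectSum.lmap f) ∘ₗ cobracket) (DirectSum.lmap f)
        (cobracket (DirectSum.lmap j y))
  cup_cobracket_right : ∀ y,
    TensorProduct.map (DirectSum.lmap f) ((tensorSquareMap (DirectSum.lmap f) ∘ₗ cup) ∘ₗ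
        DirectSum.lmap j ∘ₗ DirectSum.lmap f) (cobracket (DirectSum.lmap j y)) =
      TensorProduct.map (DirectSum.lmap f) (tensorSquareMap (DirectSum.lmap f) ∘ₗ cup)
        (cobracket (DirectSum.lmap j y))
  counit_cup_left : ∀ y,
    TensorProduct.map (counit ∘ₗ DirectSum.lmap j ∘ₗ DirectSum.lmap f) (DirectSum.lmap f)
        (cup (DirectSum.lmap j y)) =
      TensorProduct.map counit (DirectSum.lmap f) (cup (DirectSum.lmap j y))
  counit_cup_right : ∀ y,
    TensorProduct.map (DirectSum.lmap f) (counit ∘ₗ DirectSum.lmap j ∘ₗ DirectSum.lmap f)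
        (cup (DirectSum.lmap j y)) =
      TensorProduct.map (DirectSum.lmap f) counit (cup (DirectSum.lmap j y))
  coassoc : LinearMap.rTensor _ cup ∘ₗ cup = idTensor cup ∘ₗ cup
  counit_left :
    (TensorProduct.lid k _).toLinearMap ∘ₗ LinearMap.rTensor _ counit ∘ₗ cup = LinearMap.id
  counit_right :
    (TensorProduct.rid k _).toLinearMap ∘ₗ LinearMap.lTensor _ counit ∘ₗ cup = LinearMap.id
  cocomm : ∀ y, tensorSquareMap (DirectSum.lmap f) (gradedFlip k V (cup (DirectSum.lmap j y))) =
    tensorSquareMap (DirectSum.lmap f) (cup (DirectSum.lmap j y))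
  coantisymm :
    LinearMap.range cobracket ≤ LinearMap.range (LinearMap.id - suspendedFlip k V)
  coJacobi : coJacobiator k V cobracket = 0
  coLeibniz : ∀ y, tensorCubeMap (DirectSum.lmap f)
    (coLeibnizDefect k V cup cobracket (DirectSum.lmap j y)) = 0

namespace GerstenhaberTransfer

variable {f : ∀ n, V n →ₗ[k] V' n} {j : ∀ n, V' n →ₗ[k] V n}
  {cup cobracket : (⨁ n, V n) →ₗ[k] (⨁ n, V n) ⊗[k] (⨁ n, V n)} {counit : (⨁ n, V n) →ₗ[k] k}
  (T : GerstenhaberTransfer f j cup cobracket counit)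
include T

theorem transferred_coassoc (y : ⨁ n, V' n) :
    LinearMap.rTensor _ (tensorSquareMap (DirectSum.lmap f) ∘ₗ cup ∘ₗ DirectSum.lmap j)
        (tensorSquareMap (DirectSum.lmap f) (cup (DirectSum.lmap j y))) =
      idTensor (tensorSquareMap (DirectSum.lmap f) ∘ₗ cup ∘ₗ DirectSum.lmap j)
        (tensorSquareMap (DirectSum.lmap f) (cup (DirectSum.lmap j y))) := by
  rw [rTensor_tensorSquareMap (T.cup_cup_left y), idTensor_tensorSquareMap (T.cup_cup_right y)]
  exact congrArg _ (LinearMap.congr_fun T.coassoc (DirectSum.lmap j y))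

theorem transferred_coJacobi :
    coJacobiator k V' (tensorSquareMap (DirectSum.lmap f) ∘ₗ cobracket ∘ₗ DirectSum.lmap j) = 0 := by
  refine LinearMap.ext fun y => ?_
  have h := congrArg (tensorCubeMap (DirectSum.lmap f))
    (LinearMap.congr_fun T.coJacobi (DirectSum.lmap j y))
  have hs := tensorSquareMap_signedFlip (k := k) f fun a b => (a + 1) * (b + 1)
  rw [LinearMap.zero_apply, map_zero] at h
  rw [LinearMap.zero_apply, ← h]
  simp only [coJacobiator, LinearMap.comp_apply, LinearMap.add_apply, LinearMap.id_apply, map_add,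
    suspendedFlip]
  rw [tensorCubeMap_onLastTwo hs, tensorCubeMap_rTensor hs, tensorCubeMap_rTensor hs,
    tensorCubeMap_onLastTwo hs, ← rTensor_tensorSquareMap (T.cobracket_cobracket_left y)]

theorem transferred_coLeibniz :
    coLeibnizDefect k V' (tensorSquareMap (DirectSum.lmap f) ∘ₗ cup ∘ₗ DirectSum.lmap j)
      (tensorSquareMap (DirectSum.lmap f) ∘ₗ cobracket ∘ₗ DirectSum.lmap j) = 0 := by
  refine LinearMap.ext fun y => ?_
  have h := T.coLeibniz y
  have hs := tensorSquareMap_signedFlip (k := k) f fun a b => a * (b + 1)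
  rw [LinearMap.zero_apply, ← h]
  simp only [coLeibnizDefect, LinearMap.comp_apply, LinearMap.add_apply, LinearMap.sub_apply,
    map_add, map_sub, mixedFlip]
  rw [tensorCubeMap_rTensor hs, ← rTensor_tensorSquareMap (T.cobracket_cup_left y),
    ← idTensor_tensorSquareMap (T.cobracket_cup_right y),
    ← idTensor_tensorSquareMap (T.cup_cobracket_right y)]

/-- The transferred Gerstenhaber coalgebra. -/
def coalgebra : GerstenhaberCoalgebra k V' where
  cup := tensorSquareMap (DirectSum.lmap f) ∘ₗ cup ∘ₗ DirectSum.lmap j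
  counit := counit ∘ₗ DirectSum.lmap j
  cobracket := tensorSquareMap (DirectSum.lmap f) ∘ₗ cobracket ∘ₗ DirectSum.lmap j
  cup_mem n x := by
    rw [LinearMap.comp_apply, LinearMap.comp_apply, DirectSum.lmap_lof]
    exact tensorSquareMap_mem f (T.cup_mem n _)
  counit_eq_zero n x hn := by
    rw [LinearMap.comp_apply, DirectSum.lmap_lof]
    exact T.counit_eq_zero n _ hn
  cobracket_mem n x := by
    rw [LinearMap.comp_apply, LinearMap.comp_apply, DirectSum.lmap_lof]
    exact tensorSquareMap_mem f (T.cobracket_mem n _)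
  coassoc := LinearMap.ext T.transferred_coassoc
  counit_left := LinearMap.ext fun y =>
    (evalLeft_tensorSquareMap (T.counit_cup_left y)).trans
      ((congrArg _ (LinearMap.congr_fun T.counit_left (DirectSum.lmap j y))).trans (T.section_eq y))
  counit_right := LinearMap.ext fun y =>
    (evalRight_tensorSquareMap (T.counit_cup_right y)).trans
      ((congrArg _ (LinearMap.congr_fun T.counit_right (DirectSum.lmap j y))).trans (T.section_eq y))
  cocomm := LinearMap.ext fun y =>
    (tensorSquareMap_signedFlip f _ _).symm.trans (T.cocomm y)
  coantisymm := by
    rintro _ ⟨y, rfl⟩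
    obtain ⟨t, ht⟩ := T.coantisymm ⟨DirectSum.lmap j y, rfl⟩
    refine ⟨tensorSquareMap (DirectSum.lmap f) t, ?_⟩
    rw [LinearMap.comp_apply, LinearMap.comp_apply, ← ht, LinearMap.sub_apply, LinearMap.sub_apply,
      LinearMap.id_apply, LinearMap.id_apply, map_sub, suspendedFlip, suspendedFlip,
      tensorSquareMap_signedFlip]
  coJacobi := T.transferred_coJacobi
  coLeibniz := T.transferred_coLeibniz

end GerstenhaberTransfer

/-- The transfer of a Gerstenhaber coalgebra structure along an isomorphism. -/
theorem GerstenhaberCoalgebra.transfer (G : GerstenhaberCoalgebra k V) (e : ∀ n, V n ≃ₗ[k] V' n) :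
    GerstenhaberTransfer (fun n => (e n).toLinearMap) (fun n => (e n).symm.toLinearMap)
      G.cup G.cobracket G.counit := by
  have h : (DirectSum.lmap fun n => (e n).symm.toLinearMap) ∘ₗ
      (DirectSum.lmap fun n => (e n).toLinearMap) = (LinearMap.id : (⨁ n, V n) →ₗ[k] _) :=
    LinearMap.ext fun x => DirectSum.congr_of_lof (f := _ ∘ₗ _) (g := LinearMap.id)
      (fun n x => by simp [DirectSum.lmap_lof]) x
  have h' : (DirectSum.lmap fun n => (e n).toLinearMap) ∘ₗ
      (DirectSum.lmap fun n => (e n).symm.toLinearMap) = (LinearMap.id : (⨁ n, V' n) →ₗ[k] _) :=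
    LinearMap.ext fun x => DirectSum.congr_of_lof (f := _ ∘ₗ _) (g := LinearMap.id)
      (fun n x => by simp [DirectSum.lmap_lof]) x
  constructor
  case section_eq => exact LinearMap.congr_fun h'
  case cup_mem => exact G.cup_mem
  case counit_eq_zero => exact G.counit_eq_zero
  case cobracket_mem => exact G.cobracket_mem
  case coassoc => exact G.coassoc
  case counit_left => exact G.counit_left
  case counit_right => exact G.counit_right
  case cocomm => exact fun y => congrArg _ (LinearMap.congr_fun G.cocomm _)
  case coantisymm => exact G.coantisymm
  case coJacobi => exact G.coJacobi
  case coLeibniz => exact fun y => by rw [G.coLeibniz, LinearMap.zero_apply, map_zero]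
  -- For an isomorphism `j ∘ f` is the identity, so all insertion conditions are trivial.
  all_goals exact fun y => by rw [h, LinearMap.comp_id]

end GradedTransfer

/-! ### The induced structure on homology: existence and uniqueness -/

section HomologyCoalgebra

variable {k : Type u} [CommRing k]
variable {V : ℕ → Type v} [∀ n, AddCommGroup (V n)] [∀ n, Module k (V n)]
variable {d : ∀ n, V (n + 1) →ₗ[k] V n}

theorem suspendedTensorDiff_eq :
    suspendedTensorDiff d = TensorProduct.map (totalDiff d) LinearMap.id +
      TensorProduct.map (-parity k V) (totalDiff d) := by
  refine TensorProduct.ext' fun x y => ?_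
  simp only [suspendedTensorDiff, LinearMap.sub_apply, LinearMap.add_apply, TensorProduct.map_tmul,
    LinearMap.neg_apply, TensorProduct.neg_tmul, sub_eq_add_neg]

section Proj

variable {k : Type u} [CommRing k] {W : Type v} {W' : Type w} [AddCommMonoid W] [Module k W]
  [AddCommMonoid W'] [Module k W'] {F : W →ₗ[k] W'} {D P : W →ₗ[k] W}

theorem tensorSquareMap_boundary (hF : ∀ x, F (D x) = 0) (t : W ⊗[k] W) :
    tensorSquareMap F ((TensorProduct.map D LinearMap.id + TensorProduct.map P D :
      W ⊗[k] W →ₗ[k] W ⊗[k] W) t) = 0 := by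
  refine LinearMap.congr_fun (f := tensorSquareMap F ∘ₗ (TensorProduct.map D LinearMap.id +
    TensorProduct.map P D)) (g := 0) (TensorProduct.ext' fun x y => ?_) t
  simp only [LinearMap.comp_apply, LinearMap.add_apply, TensorProduct.map_tmul, map_add, hF,
    TensorProduct.zero_tmul, TensorProduct.tmul_zero, add_zero, LinearMap.zero_apply]

end Proj

namespace IsGerstenhaberOnHomology

variable {cup cobracket : (⨁ n, V n) →ₗ[k] (⨁ n, V n) ⊗[k] (⨁ n, V n)}
  {counit : (⨁ n, V n) →ₗ[k] k} (H : IsGerstenhaberOnHomology d cup cobracket counit)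
include H

theorem diff_diff (n : ℕ) (x : V (n + 2)) : d n (d (n + 1) x) = 0 := by
  have := LinearMap.congr_fun H.d_comp_d (DirectSum.lof k ℕ V (n + 2) x)
  rw [LinearMap.comp_apply, totalDiff_lof_succ, totalDiff_lof_succ, LinearMap.zero_apply] at this
  exact DirectSum.of_injective (β := V) n (this.trans (map_zero _).symm)

variable (R : HomologyRetract d)

theorem tensorSquareMap_tensorDiff (t : (⨁ n, V n) ⊗[k] (⨁ n, V n)) :
    tensorSquareMap R.totalProj (tensorDiff d t) = 0 :=
  tensorSquareMap_boundary (R.totalProj_totalDiff H.diff_diff) t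

theorem tensorSquareMap_suspendedTensorDiff (t : (⨁ n, V n) ⊗[k] (⨁ n, V n)) :
    tensorSquareMap R.totalProj (suspendedTensorDiff d t) = 0 := by
  rw [suspendedTensorDiff_eq]
  exact tensorSquareMap_boundary (R.totalProj_totalDiff H.diff_diff) t

theorem tensorCubeMap_suspendedTripleDiff (t : ((⨁ n, V n) ⊗[k] (⨁ n, V n)) ⊗[k] (⨁ n, V n)) :
    tensorCubeMap R.totalProj (suspendedTripleDiff d t) = 0 := by
  have h₁ : tensorCubeMap R.totalProj ∘ₗ
      TensorProduct.map (suspendedTensorDiff d) LinearMap.id = 0 :=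
    TensorProduct.ext' fun x y => by
      rw [LinearMap.comp_apply, TensorProduct.map_tmul, TensorProduct.map_tmul,
        H.tensorSquareMap_suspendedTensorDiff R, TensorProduct.zero_tmul, LinearMap.zero_apply]
  have h₂ : tensorCubeMap R.totalProj ∘ₗ
      TensorProduct.map (TensorProduct.map (parity k V) (parity k V)) (totalDiff d) = 0 :=
    TensorProduct.ext' fun x y => by
      rw [LinearMap.comp_apply, TensorProduct.map_tmul, TensorProduct.map_tmul,
        R.totalProj_totalDiff H.diff_diff, TensorProduct.tmul_zero, LinearMap.zero_apply]
  have h₃ := LinearMap.congr_fun h₁ t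
  rw [LinearMap.comp_apply, ← sub_add_cancel (TensorProduct.map (suspendedTensorDiff d) _ t)
    (TensorProduct.map (TensorProduct.map (parity k V) (parity k V)) (totalDiff d) t), map_add,
    ← LinearMap.comp_apply (tensorCubeMap _) (TensorProduct.map (TensorProduct.map _ _) _), h₂,
    LinearMap.zero_apply, add_zero] at h₃
  exact h₃

theorem tensorDiff_cup {x : ⨁ n, V n} (hx : totalDiff d x = 0) : tensorDiff d (cup x) = 0 := by
  rw [← LinearMap.comp_apply, ← H.cup_comp_d, LinearMap.comp_apply, hx, map_zero]

theorem suspendedTensorDiff_cobracket {x : ⨁ n, V n} (hx : totalDiff d x = 0) :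
    suspendedTensorDiff d (cobracket x) = 0 := by
  rw [← LinearMap.comp_apply, ← H.cobracket_comp_d, LinearMap.comp_apply, hx, map_zero]

theorem projected_cup_totalDiff (x : ⨁ n, V n) :
    (tensorSquareMap R.totalProj ∘ₗ cup) (totalDiff d x) = 0 := by
  rw [LinearMap.comp_apply, ← LinearMap.comp_apply cup, H.cup_comp_d, LinearMap.comp_apply,
    H.tensorSquareMap_tensorDiff]

theorem projected_cobracket_totalDiff (x : ⨁ n, V n) :
    (tensorSquareMap R.totalProj ∘ₗ cobracket) (totalDiff d x) = 0 := by
  rw [LinearMap.comp_apply, ← LinearMap.comp_apply cobracket, H.cobracket_comp_d,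
    LinearMap.comp_apply, H.tensorSquareMap_suspendedTensorDiff]

/-- The projection kills boundaries, so identities that hold on cycles up to boundaries become
strict. The insertion conditions hold because the chain maps send cycles to cycles and, after
projection, kill boundaries. -/
theorem transfer : GerstenhaberTransfer R.proj (fun n => (gradedCycles d n).subtype ∘ₗ R.incl n)
    cup cobracket counit := by
  have hR := R.totalProj_totalDiff H.diff_diff
  have hP := R.isHomotopyProjection H.diff_diff
  have hcup := fun y => H.tensorDiff_cup (R.totalDiff_totalIncl y)
  have hcob : ∀ y, (TensorProduct.map (totalDiff d) LinearMap.id +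
      TensorProduct.map (-parity k V) (totalDiff d) : _ →ₗ[k] _)
        (cobracket (R.totalIncl y)) = 0 := fun y => by
    rw [← suspendedTensorDiff_eq]
    exact H.suspendedTensorDiff_cobracket (R.totalDiff_totalIncl y)
  have hc : ∀ x, counit (totalDiff d x) = 0 := LinearMap.congr_fun H.counit_comp_d
  have pcup := H.projected_cup_totalDiff R
  have pcob := H.projected_cobracket_totalDiff R
  constructor
  case section_eq => exact R.totalProj_totalIncl
  case cup_mem => exact H.cup_mem
  case counit_eq_zero => exact H.counit_eq_zero
  case cobracket_mem => exact H.cobracket_mem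
  case coassoc => exact H.coassoc
  case counit_left => exact H.counit_left
  case counit_right => exact H.counit_right
  case coantisymm => exact H.coantisymm
  case coJacobi => exact H.coJacobi
  case cocomm =>
    intro y
    obtain ⟨t, ht⟩ := H.cocomm _ (R.totalDiff_totalIncl y)
    refine sub_eq_zero.1 ((map_sub _ _ _).symm.trans ((congrArg _ ht.symm).trans ?_))
    exact H.tensorSquareMap_tensorDiff R t
  case coLeibniz =>
    intro y
    obtain ⟨t, ht⟩ := H.coLeibniz _ (R.totalDiff_totalIncl y)
    exact (congrArg _ ht.symm).trans (H.tensorCubeMap_suspendedTripleDiff R t)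
  case cup_cup_left => exact fun y => hP.map_proj_left pcup hR (hcup y)
  case cup_cup_right => exact fun y => hP.map_proj_right hR pcup (hcup y)
  case cobracket_cup_left => exact fun y => hP.map_proj_left pcob hR (hcup y)
  case cobracket_cup_right => exact fun y => hP.map_proj_right hR pcob (hcup y)
  case cobracket_cobracket_left => exact fun y => hP.neg.map_proj_left pcob hR (hcob y)
  case cup_cobracket_right => exact fun y => hP.neg.map_proj_right hR pcup (hcob y)
  case counit_cup_left => exact fun y => hP.map_proj_left hc hR (hcup y)
  case counit_cup_right => exact fun y => hP.map_proj_right hR hc (hcup y)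

end IsGerstenhaberOnHomology

/-- The Künneth map identifies the projection of a cycle with the class of the cycle. -/
theorem HomologyRetract.kunnethRepresents (R : HomologyRetract d)
    {D : (⨁ n, V n) ⊗[k] (⨁ n, V n) →ₗ[k] (⨁ n, V n) ⊗[k] (⨁ n, V n)}
    {c c' : (⨁ n, V n) ⊗[k] (⨁ n, V n)} (hc : c - c' ∈ LinearMap.range D)
    (hc' : c' - TensorProduct.map (R.totalIncl ∘ₗ R.totalProj) (R.totalIncl ∘ₗ R.totalProj) c' ∈
      LinearMap.range D) :
    KunnethRepresents d D (tensorSquareMap R.totalProj c') c := by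
  refine ⟨tensorSquareMap (DirectSum.lmap R.incl) (tensorSquareMap R.totalProj c'), ?_, ?_⟩
  · have h : DirectSum.lmap (homologyClass d) ∘ₗ DirectSum.lmap R.incl =
        (LinearMap.id : (⨁ n, gradedHomology d n) →ₗ[k] ⨁ n, gradedHomology d n) :=
      DirectSum.linearMap_ext _ fun n => LinearMap.ext fun y => by
        simp only [LinearMap.comp_apply, DirectSum.lmap_lof, R.class_incl, LinearMap.id_apply]
    rw [← LinearMap.comp_apply (TensorProduct.map _ _), ← TensorProduct.map_comp, h,
      TensorProduct.map_id, LinearMap.id_apply]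
  · have h : DirectSum.lmap (fun n => (gradedCycles d n).subtype) ∘ₗ DirectSum.lmap R.incl =
        R.totalIncl :=
      DirectSum.linearMap_ext _ fun n => LinearMap.ext fun y => by
        simp only [LinearMap.comp_apply, DirectSum.lmap_lof, R.totalIncl_lof, Submodule.subtype_apply]
    rw [← LinearMap.comp_apply (TensorProduct.map _ _), ← TensorProduct.map_comp, h,
      ← LinearMap.comp_apply (TensorProduct.map _ _), ← TensorProduct.map_comp,
      ← sub_add_sub_cancel c c']
    exact Submodule.add_mem _ hc hc'

/-- The projection sends a tensor of cycles to the tensor of their classes and annihilates the error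
term. The represented element is thus determined by `c`, which is the source of uniqueness. -/
theorem HomologyRetract.eq_of_kunnethRepresents (R : HomologyRetract d)
    {D : (⨁ n, V n) ⊗[k] (⨁ n, V n) →ₗ[k] (⨁ n, V n) ⊗[k] (⨁ n, V n)}
    (hD : ∀ t, tensorSquareMap R.totalProj (D t) = 0) {c : (⨁ n, V n) ⊗[k] (⨁ n, V n)}
    {t : (⨁ n, gradedHomology d n) ⊗[k] (⨁ n, gradedHomology d n)}
    (h : KunnethRepresents d D t c) : t = tensorSquareMap R.totalProj c := by
  obtain ⟨s, rfl, x, hx⟩ := h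
  have hp : R.totalProj ∘ₗ DirectSum.lmap (fun n => (gradedCycles d n).subtype) =
      DirectSum.lmap (homologyClass d) :=
    DirectSum.linearMap_ext _ fun n => LinearMap.ext fun z => by
      simp only [LinearMap.comp_apply, DirectSum.lmap_lof, R.totalProj_lof, Submodule.subtype_apply,
        R.proj_cycle]
  rw [← sub_add_cancel c (TensorProduct.map _ _ s), ← hx, map_add, hD, zero_add,
    ← LinearMap.comp_apply (tensorSquareMap R.totalProj), ← TensorProduct.map_comp, hp]

namespace IsGerstenhaberOnHomology

variable {cup cobracket : (⨁ n, V n) →ₗ[k] (⨁ n, V n) ⊗[k] (⨁ n, V n)}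
  {counit : (⨁ n, V n) →ₗ[k] k} (H : IsGerstenhaberOnHomology d cup cobracket counit)
include H

/-- A cycle differs from the chosen representative of its class by a boundary, which the chain maps
preserve. The value on the representative is a cycle of the tensor square, hence homologous to its
image under `e ⊗ e`. -/
theorem isInducedBy_transfer (R : HomologyRetract d) :
    (H.transfer R).coalgebra.IsInducedBy d cup cobracket counit := by
  intro n z
  have hP := R.isHomotopyProjection H.diff_diff
  have hz : R.totalIncl (DirectSum.lof k ℕ _ n (homologyClass d n z)) =
      R.totalIncl (R.totalProj (DirectSum.lof k ℕ V n z)) := by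
    rw [R.totalProj_lof, R.proj_cycle]
  have hdiff : DirectSum.lof k ℕ V n z -
      R.totalIncl (DirectSum.lof k ℕ _ n (homologyClass d n z)) =
        totalDiff d (R.totalHomotopy (DirectSum.lof k ℕ V n z)) := by
    have := hP.homotopy (DirectSum.lof k ℕ V n z)
    rwa [HomologyRetract.totalDiff_cycle, map_zero, add_zero, LinearMap.comp_apply, ← hz] at this
  generalize DirectSum.lof k ℕ _ n (homologyClass d n z) = y at hz hdiff
  generalize DirectSum.lof k ℕ V n z = x at hz hdiff
  have hcob : (TensorProduct.map (totalDiff d) LinearMap.id +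
      TensorProduct.map (-parity k V) (totalDiff d) : _ →ₗ[k] _)
        (cobracket (R.totalIncl y)) = 0 := by
    rw [← suspendedTensorDiff_eq]
    exact H.suspendedTensorDiff_cobracket (R.totalDiff_totalIncl y)
  refine ⟨R.kunnethRepresents (c' := cup (R.totalIncl y)) ?_ ?_,
    R.kunnethRepresents (c' := cobracket (R.totalIncl y)) ?_ ?_, ?_⟩
  · rw [← map_sub, hdiff, ← LinearMap.comp_apply, H.cup_comp_d]
    exact ⟨_, rfl⟩
  · exact hP.sub_map_proj_mem (H.tensorDiff_cup (R.totalDiff_totalIncl y))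
  · rw [← map_sub, hdiff, ← LinearMap.comp_apply, H.cobracket_comp_d]
    exact ⟨_, rfl⟩
  · rw [suspendedTensorDiff_eq]
    exact hP.neg.sub_map_proj_mem hcob
  · refine (sub_eq_zero.1 ((map_sub counit x (R.totalIncl y)).symm.trans ?_)).symm
    rw [hdiff, ← LinearMap.comp_apply, H.counit_comp_d, LinearMap.zero_apply]

theorem eq_of_isInducedBy (R : HomologyRetract d) {G G' : GerstenhaberCoalgebra k (gradedHomology d)}
    (hG : G.IsInducedBy d cup cobracket counit) (hG' : G'.IsInducedBy d cup cobracket counit) :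
    G = G' := by
  have hcup : G.cup = G'.cup := DirectSum.linearMap_ext _ fun n => LinearMap.ext fun y => by
    obtain ⟨z, rfl⟩ := Submodule.mkQ_surjective _ y
    exact (R.eq_of_kunnethRepresents (H.tensorSquareMap_tensorDiff R) (hG n z).1).trans
      (R.eq_of_kunnethRepresents (H.tensorSquareMap_tensorDiff R) (hG' n z).1).symm
  have hcob : G.cobracket = G'.cobracket :=
    DirectSum.linearMap_ext _ fun n => LinearMap.ext fun y => by
      obtain ⟨z, rfl⟩ := Submodule.mkQ_surjective _ y
      exact (R.eq_of_kunnethRepresents (H.tensorSquareMap_suspendedTensorDiff R) (hG n z).2.1).trans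
        (R.eq_of_kunnethRepresents (H.tensorSquareMap_suspendedTensorDiff R) (hG' n z).2.1).symm
  have hcounit : G.counit = G'.counit :=
    DirectSum.linearMap_ext _ fun n => LinearMap.ext fun y => by
      obtain ⟨z, rfl⟩ := Submodule.mkQ_surjective _ y
      exact (hG n z).2.2.trans (hG' n z).2.2.symm
  cases G
  cases G'
  congr

theorem existsUnique_isInducedBy [∀ n, Module.Projective k (V n)]
    [∀ n, Module.Projective k (gradedHomology d n)] :
    ∃! G : GerstenhaberCoalgebra k (gradedHomology d), G.IsInducedBy d cup cobracket counit := by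
  obtain ⟨R⟩ := nonempty_homologyRetract d H.diff_diff
  exact ⟨_, H.isInducedBy_transfer R, fun G hG => H.eq_of_isInducedBy R hG (H.isInducedBy_transfer R)⟩

end IsGerstenhaberOnHomology

end HomologyCoalgebra

/-! ### The bar resolution -/

section BarResolution

variable (k : Type u) [CommRing k] (B : Type v) [Ring B] [Bialgebra k B]

/-- `b ⊗ (x_1, …, x_n) ↦ (b, x_1, …, x_n)`. -/
def barCons (n : ℕ) : B ⊗[k] BarChain k B n →ₗ[k] BarChain k B (n + 1) :=
  (TensorPower.cast k B (Nat.add_comm 1 n)).toLinearMap ∘ₗ TensorPower.mulEquiv.toLinearMap ∘ₗ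
    LinearMap.rTensor _ (PiTensorProduct.subsingletonEquiv (R := k) (s := fun _ : Fin 1 => B)
      (0 : Fin 1)).symm.toLinearMap

/-- The part of the differential of the bar resolution that does not involve the coefficients. -/
def barTailDiff (n : ℕ) : BarChain k B (n + 1) →ₗ[k] BarChain k B n :=
  ∑ j : Fin n, (-1 : k) ^ (j.val + 1) • barContract k B n j +
    (-1 : k) ^ (n + 1) • ((TensorProduct.rid k _).toLinearMap ∘ₗ
      LinearMap.lTensor (BarChain k B n) (Coalgebra.counit (R := k) (A := B)) ∘ₗ barLast k B n)

/-- The contraction `b ⊗ x ↦ 1 ⊗ (b, x)` of the bar resolution. -/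
def barContraction (n : ℕ) : B ⊗[k] BarChain k B n →ₗ[k] B ⊗[k] BarChain k B (n + 1) :=
  TensorProduct.mk k B _ 1 ∘ₗ barCons k B n

/-- `b ⊗ x ↦ ε(b) x`. -/
def barAugment (n : ℕ) : B ⊗[k] BarChain k B n →ₗ[k] BarChain k B n :=
  (TensorProduct.lid k _).toLinearMap ∘ₗ LinearMap.rTensor _ Coalgebra.counit

variable {k B}

theorem barCons_tprod {n : ℕ} (b : B) (y : Fin n → B) :
    barCons k B n (b ⊗ₜ[k] PiTensorProduct.tprod k y) =
      PiTensorProduct.tprod k (Fin.cons b y : Fin (n + 1) → B) := by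
  refine barLof_injective (k := k) (B := B) _ ?_
  rw [barLof_tprod_cons, barGen, LinearMap.comp_apply, barLof_mul]
  exact barLof_cast (Nat.add_comm 1 n) (TensorPower.mulEquiv
    ((PiTensorProduct.subsingletonEquiv (R := k) (s := fun _ : Fin 1 => B) 0).symm b ⊗ₜ[k]
      PiTensorProduct.tprod k y))
theorem barHead_tprod {n : ℕ} (y : Fin (n + 1) → B) :
    barHead k B n (PiTensorProduct.tprod k y) = y 0 ⊗ₜ[k] PiTensorProduct.tprod k (Fin.tail y) := by
  simp [barHead]

theorem barCons_barHead {n : ℕ} (x : BarChain k B (n + 1)) : barCons k B n (barHead k B n x) = x := by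
  refine LinearMap.congr_fun (f := barCons k B n ∘ₗ barHead k B n) (g := LinearMap.id)
    (PiTensorProduct.ext (MultilinearMap.ext fun y => ?_)) x
  change barCons k B n (barHead k B n (PiTensorProduct.tprod k y)) = PiTensorProduct.tprod k y
  rw [barHead_tprod, barCons_tprod, Fin.cons_self_tail]

theorem bar_ext_tmul {n : ℕ} {W : Type*} [AddCommMonoid W] [Module k W]
    {f g : B ⊗[k] BarChain k B n →ₗ[k] W}
    (h : ∀ b y, f (b ⊗ₜ[k] PiTensorProduct.tprod k y) = g (b ⊗ₜ[k] PiTensorProduct.tprod k y)) :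
    f = g :=
  TensorProduct.ext (LinearMap.ext fun b => PiTensorProduct.ext (MultilinearMap.ext fun y => h b y))

theorem barHead_barCons {n : ℕ} (t : B ⊗[k] BarChain k B n) :
    barHead k B n (barCons k B n t) = t := by
  refine LinearMap.congr_fun (f := barHead k B n ∘ₗ barCons k B n) (g := LinearMap.id)
    (bar_ext_tmul fun b y => ?_) t
  rw [LinearMap.comp_apply, barCons_tprod, barHead_tprod, Fin.cons_zero, Fin.tail_cons,
    LinearMap.id_apply]

theorem barResDiff_tmul {n : ℕ} (b : B) (x : BarChain k B (n + 1)) :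
    barResDiff k B n (b ⊗ₜ[k] x) =
      LinearMap.rTensor _ (LinearMap.mulLeft k b) (barHead k B n x) + b ⊗ₜ[k] barTailDiff k B n x := by
  rw [barResDiff, LinearMap.add_apply]
  congr 1
  simp only [LinearMap.comp_apply, LinearEquiv.coe_coe, LinearMap.lTensor_tmul]
  generalize barHead k B n x = t
  induction t using TensorProduct.induction_on with
  | zero => simp only [TensorProduct.tmul_zero, map_zero]
  | add s t hs ht => simp only [TensorProduct.tmul_add, map_add, hs, ht]
  | tmul c w => simp

theorem barResDiff_smul {n : ℕ} (a : B) (t : B ⊗[k] BarChain k B (n + 1)) :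
    barResDiff k B n (a • t) = a • barResDiff k B n t := by
  induction t using TensorProduct.induction_on with
  | zero => rw [smul_zero, map_zero, smul_zero]
  | add s t hs ht => simp only [smul_add, map_add, hs, ht]
  | tmul b x =>
    rw [TensorProduct.smul_tmul', barResDiff_tmul, barResDiff_tmul, smul_add, TensorProduct.smul_tmul']
    congr 1
    generalize barHead k B n x = t
    induction t using TensorProduct.induction_on with
    | zero => rw [map_zero, map_zero, smul_zero]
    | add s t hs ht => simp only [smul_add, map_add, hs, ht]
    | tmul c w => simp [TensorProduct.smul_tmul']

theorem barLast_tprod {n : ℕ} (y : Fin (n + 1) → B) :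
    barLast k B n (PiTensorProduct.tprod k y) =
      PiTensorProduct.tprod k (Fin.init y) ⊗ₜ[k] y (Fin.last n) := by
  simp [barLast]

theorem barTailDiff_tprod {n : ℕ} (y : Fin (n + 1) → B) :
    barTailDiff k B n (PiTensorProduct.tprod k y) =
      ∑ j : Fin n, (-1 : k) ^ (j.val + 1) •
        PiTensorProduct.tprod k (Fin.contractNth j.castSucc (· * ·) y) +
      (-1 : k) ^ (n + 1) • Coalgebra.counit (R := k) (y (Fin.last n)) •
        PiTensorProduct.tprod k (Fin.init y) := by
  simp [barTailDiff, barLast_tprod, barContract]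

theorem contractNth_zero_cons {n : ℕ} (b : B) (y : Fin (n + 1) → B) :
    Fin.contractNth (Fin.castSucc 0) (· * ·) (Fin.cons b y : Fin (n + 2) → B) =
      Fin.cons (b * y 0) (Fin.tail y) := by
  funext i
  refine Fin.cases ?_ (fun i => ?_) i <;> simp [Fin.contractNth, Fin.tail]

theorem contractNth_succ_cons {n : ℕ} (b : B) (y : Fin (n + 1) → B) (j : Fin n) :
    Fin.contractNth j.succ.castSucc (· * ·) (Fin.cons b y : Fin (n + 2) → B) =
      Fin.cons b (Fin.contractNth j.castSucc (· * ·) y) := by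
  funext i
  refine Fin.cases ?_ (fun i => ?_) i
  · simp [Fin.contractNth]
  · simp only [Fin.contractNth, Fin.val_succ, Fin.val_castSucc, Fin.cons_succ,
      add_lt_add_iff_right, add_left_inj, ← Fin.succ_castSucc]

theorem init_cons {A : Type*} {n : ℕ} (b : A) (y : Fin (n + 1) → A) :
    Fin.init (Fin.cons b y : Fin (n + 2) → A) = Fin.cons b (Fin.init y) := by
  funext i
  refine Fin.cases ?_ (fun i => ?_) i
  · simp [Fin.init]
  · simp only [Fin.init, Fin.cons_succ, ← Fin.succ_castSucc]

/-- Prepending the coefficient shifts every index by one, which reverses all signs, and turns the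
action on the coefficient into the first contraction. -/
theorem barTailDiff_barCons {n : ℕ} (t : B ⊗[k] BarChain k B (n + 1)) :
    barTailDiff k B (n + 1) (barCons k B (n + 1) t) = -barCons k B n (barResDiff k B n t) := by
  refine LinearMap.congr_fun (f := barTailDiff k B (n + 1) ∘ₗ barCons k B (n + 1))
    (g := -(barCons k B n ∘ₗ barResDiff k B n)) (bar_ext_tmul fun b y => ?_) t
  rw [LinearMap.neg_apply, LinearMap.comp_apply, LinearMap.comp_apply, barCons_tprod,
    barTailDiff_tprod, barResDiff_tmul, barHead_tprod, barTailDiff_tprod, LinearMap.rTensor_tmul,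
    LinearMap.mulLeft_apply, map_add, barCons_tprod, TensorProduct.tmul_add, map_add,
    TensorProduct.tmul_sum, map_sum, Fin.sum_univ_succ, contractNth_zero_cons, init_cons]
  simp only [TensorProduct.tmul_smul, map_smul, barCons_tprod, contractNth_succ_cons, Fin.val_zero,
    Fin.val_succ, ← Fin.succ_last, Fin.cons_succ]
  rw [neg_add, neg_add, ← Finset.sum_neg_distrib]
  have hp : ∀ m, (-1 : k) ^ (m + 1 + 1) = -(-1) ^ (m + 1) := fun m => by rw [pow_succ, mul_neg_one]
  simp only [hp, neg_smul, zero_add, pow_one, one_smul]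
  rw [add_assoc]

/-- The leading term of the differential of `1 ⊗ (b, x)` is `b ⊗ x`, and the remaining terms are
minus the contraction of the differential. -/
theorem barResDiff_barContraction {n : ℕ} (t : B ⊗[k] BarChain k B (n + 1)) :
    barResDiff k B (n + 1) (barContraction k B (n + 1) t) +
      barContraction k B n (barResDiff k B n t) = t := by
  simp only [barContraction, LinearMap.comp_apply, TensorProduct.mk_apply]
  rw [barResDiff_tmul, barHead_barCons, barTailDiff_barCons, TensorProduct.tmul_neg,
    neg_add_cancel_right, LinearMap.mulLeft_one, LinearMap.rTensor_id, LinearMap.id_apply]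

theorem barResDiff_barContraction_zero (t : B ⊗[k] BarChain k B 0) :
    barResDiff k B 0 (barContraction k B 0 t) + 1 ⊗ₜ[k] barAugment k B 0 t = t := by
  simp only [barContraction, LinearMap.comp_apply, TensorProduct.mk_apply]
  have h : barTailDiff k B 0 (barCons k B 0 t) = -barAugment k B 0 t := by
    refine LinearMap.congr_fun (f := barTailDiff k B 0 ∘ₗ barCons k B 0)
      (g := -barAugment k B 0) (bar_ext_tmul fun b y => ?_) t
    rw [LinearMap.comp_apply, barCons_tprod, barTailDiff_tprod]
    simp only [Finset.univ_eq_empty, Finset.sum_empty, zero_add, pow_one, neg_smul, one_smul,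
      LinearMap.neg_apply, barAugment, LinearMap.comp_apply, LinearEquiv.coe_coe,
      LinearMap.rTensor_tmul, TensorProduct.lid_tmul, Fin.last_zero, Fin.cons_zero]
    rw [Subsingleton.elim (Fin.init _) y]
  rw [barResDiff_tmul, barHead_barCons, h, TensorProduct.tmul_neg,
    neg_add_cancel_right, LinearMap.mulLeft_one, LinearMap.rTensor_id, LinearMap.id_apply]

theorem barAugment_smul {n : ℕ} (b : B) (t : B ⊗[k] BarChain k B n) :
    barAugment k B n (b • t) = Coalgebra.counit (R := k) b • barAugment k B n t := by
  induction t using TensorProduct.induction_on with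
  | zero => rw [smul_zero, map_zero, smul_zero]
  | add s t hs ht => simp only [smul_add, map_add, hs, ht]
  | tmul c w => simp [barAugment, TensorProduct.smul_tmul', mul_smul]

/-- By semilinearity over the counit it suffices to take coefficient `1`, where the augmented
leading term is the face that evaluates the counit on the first letter. -/
theorem barAugment_barResDiff {n : ℕ} (t : B ⊗[k] BarChain k B (n + 1)) :
    barAugment k B n (barResDiff k B n t) = barDiff k B n (barAugment k B (n + 1) t) := by
  induction t using TensorProduct.induction_on with
  | zero => simp only [map_zero]
  | add s t hs ht => simp only [map_add, hs, ht]
  | tmul b x =>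
    rw [show b ⊗ₜ[k] x = b • ((1 : B) ⊗ₜ[k] x) by rw [TensorProduct.smul_tmul', smul_eq_mul, mul_one],
      barResDiff_smul, barAugment_smul, barAugment_smul, map_smul, barResDiff_tmul,
      LinearMap.mulLeft_one, LinearMap.rTensor_id, LinearMap.id_apply, map_add]
    have h : ∀ {n : ℕ} (x : BarChain k B n), barAugment k B n (1 ⊗ₜ[k] x) = x := fun x => by
      simp [barAugment]
    rw [h, h, barDiff, add_assoc]
    rfl

theorem barDiff_zero_eq_zero : barDiff k B 0 = 0 := by
  refine PiTensorProduct.ext (MultilinearMap.ext fun y => ?_)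
  simp [barDiff, barHead_tprod, barLast_tprod]
  rw [Subsingleton.elim (Fin.init y) (Fin.tail y)]
  simp

theorem barContraction_barHead {n : ℕ} (x : BarChain k B (n + 1)) :
    barContraction k B n (barHead k B n x) = 1 ⊗ₜ[k] x := by
  rw [barContraction, LinearMap.comp_apply, barCons_barHead, TensorProduct.mk_apply]

/-- Instead of cancelling double faces, the contraction is used. By `B`-linearity it suffices to
treat `1 ⊗ x`, which is the contraction of the head of `x`, and the contraction identity carries the
induction. -/
theorem barResDiff_barResDiff (n : ℕ) (t : B ⊗[k] BarChain k B (n + 2)) :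
    barResDiff k B n (barResDiff k B (n + 1) t) = 0 := by
  have key : ∀ n, (∀ t : B ⊗[k] BarChain k B (n + 1), barResDiff k B n (barContraction k B n
      (barResDiff k B n t)) = barResDiff k B n t) → ∀ t : B ⊗[k] BarChain k B (n + 2),
      barResDiff k B n (barResDiff k B (n + 1) t) = 0 := fun n h t => by
    induction t using TensorProduct.induction_on with
    | zero => simp only [map_zero]
    | add s t hs ht => simp only [map_add, hs, ht, add_zero]
    | tmul b x =>
      have h₁ := barResDiff_barContraction (barHead k B (n + 1) x)
      rw [barContraction_barHead] at h₁
      rw [show b ⊗ₜ[k] x = b • ((1 : B) ⊗ₜ[k] x) by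
          rw [TensorProduct.smul_tmul', smul_eq_mul, mul_one],
        barResDiff_smul, barResDiff_smul, eq_sub_of_add_eq h₁, map_sub, h, sub_self, smul_zero]
  induction n with
  | zero =>
    -- In the lowest degree the error term contains the augmented boundary, which vanishes because
    -- the bar differential in degree one is the difference of two equal counit terms.
    refine key 0 (fun t => ?_) t
    have h := barResDiff_barContraction_zero (barResDiff k B 0 t)
    rwa [barAugment_barResDiff, barDiff_zero_eq_zero, LinearMap.zero_apply, TensorProduct.tmul_zero,
      add_zero] at h
  | succ n ih =>
    refine key (n + 1) (fun t => ?_) t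
    have h := barResDiff_barContraction (barResDiff k B (n + 1) t)
    rwa [ih, map_zero, add_zero] at h

end BarResolution

/-! ### Homology of complexes of modules -/

section ModuleComplex

open CategoryTheory

variable {k : Type u} [CommRing k] (K : ChainComplex (ModuleCat.{u} k) ℕ)
variable {V : ℕ → Type u} [∀ n, AddCommGroup (V n)] [∀ n, Module k (V n)]
variable {d : ∀ n, V (n + 1) →ₗ[k] V n}

theorem ModuleCat.iCycles_injective (n : ℕ) : Function.Injective (K.iCycles n).hom :=
  (ModuleCat.mono_iff_injective _).1 inferInstance

theorem ModuleCat.exists_toCycles_eq {n : ℕ} {y : K.cycles n} (hy : (K.homologyπ n).hom y = 0) :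
    ∃ x, (K.toCycles (n + 1) n).hom x = y := by
  have h := ShortComplex.exact_of_g_is_cokernel
    (ShortComplex.mk _ _ (K.toCycles_comp_homologyπ (n + 1) n))
    (K.homologyIsCokernel (n + 1) n (by simp))
  exact (ShortComplex.moduleCat_exact_iff _).1 h y hy

variable {K} in
theorem exists_liftCycles (φ : ∀ n, V n ≃ₗ[k] K.X n)
    (hφ : ∀ n x, φ n (d n x) = (K.d (n + 1) n).hom (φ (n + 1) x)) (n : ℕ) :
    ∃ L : gradedCycles d n →ₗ[k] K.cycles n, ∀ z, (K.iCycles n).hom (L z) = φ n z := by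
  let f : ModuleCat.of k (gradedCycles d n) ⟶ K.X n :=
    ModuleCat.ofHom ((φ n).toLinearMap ∘ₗ (gradedCycles d n).subtype)
  have hf : f ≫ K.d n ((ComplexShape.down ℕ).next n) = 0 := by
    cases n with
    | zero =>
      rw [K.shape _ _ (by simp), Limits.comp_zero]
    | succ n =>
      rw [ChainComplex.next_nat_succ]
      ext z
      change (K.d (n + 1) n).hom (φ (n + 1) z) = 0
      rw [← hφ, show d n z = 0 from z.2, map_zero]
  refine ⟨(K.liftCycles f _ rfl hf).hom, fun z => ?_⟩
  rw [← LinearMap.comp_apply, ← ModuleCat.hom_comp, K.liftCycles_i]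
  rfl

/-- The homology of a complex of modules, in terms of an isomorphic graded module with differential. -/
theorem exists_homologyEquiv (φ : ∀ n, V n ≃ₗ[k] K.X n)
    (hφ : ∀ n x, φ n (d n x) = (K.d (n + 1) n).hom (φ (n + 1) x)) (n : ℕ) :
    ∃ e : gradedHomology d n ≃ₗ[k] K.homology n, ∀ (z : gradedCycles d n) (y : K.cycles n),
      (K.iCycles n).hom y = φ n z → e (homologyClass d n z) = (K.homologyπ n).hom y := by
  obtain ⟨L, hL⟩ := exists_liftCycles φ hφ n
  have hbound : ∀ z : gradedCycles d n, (K.homologyπ n).hom (L z) = 0 ↔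
      z ∈ (LinearMap.range (d n)).submoduleOf (gradedCycles d n) := fun z => by
    constructor
    · intro h
      obtain ⟨x, hx⟩ := ModuleCat.exists_toCycles_eq K h
      refine ⟨(φ (n + 1)).symm x, (φ n).injective ?_⟩
      rw [hφ, LinearEquiv.apply_symm_apply, ← K.toCycles_i, ModuleCat.hom_comp, LinearMap.comp_apply,
        hx, hL]
      rfl
    · rintro ⟨x, hx⟩
      have h : L z = (K.toCycles (n + 1) n).hom (φ (n + 1) x) := by
        refine ModuleCat.iCycles_injective K n ?_
        rw [hL, ← LinearMap.comp_apply, ← ModuleCat.hom_comp, K.toCycles_i, ← hφ, hx]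
        rfl
      rw [h, ← LinearMap.comp_apply, ← ModuleCat.hom_comp, K.toCycles_comp_homologyπ]
      rfl
  let e : gradedHomology d n →ₗ[k] K.homology n :=
    Submodule.liftQ _ ((K.homologyπ n).hom ∘ₗ L) fun z hz => (hbound z).2 hz
  have he : ∀ z, e (homologyClass d n z) = (K.homologyπ n).hom (L z) := fun z => rfl
  refine ⟨LinearEquiv.ofBijective e ⟨?_, ?_⟩, fun z y hy => ?_⟩
  · refine (injective_iff_map_eq_zero e).2 fun c hc => ?_
    obtain ⟨z, rfl⟩ := Submodule.mkQ_surjective _ c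
    exact (Submodule.Quotient.mk_eq_zero _).2 ((hbound z).1 hc)
  · intro c
    obtain ⟨y, rfl⟩ := (ModuleCat.epi_iff_surjective (K.homologyπ n)).1 inferInstance c
    have hz : (φ n).symm ((K.iCycles n).hom y) ∈ gradedCycles d n := by
      cases n with
      | zero => exact Submodule.mem_top
      | succ n =>
        refine LinearMap.mem_ker.2 ((φ n).injective ?_)
        rw [hφ, LinearEquiv.apply_symm_apply, ← LinearMap.comp_apply, ← ModuleCat.hom_comp,
          K.iCycles_d, map_zero]
        rfl
    refine ⟨homologyClass d n ⟨_, hz⟩, (he _).trans (congrArg _ ?_)⟩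
    refine ModuleCat.iCycles_injective K n ?_
    rw [hL]
    exact (φ n).apply_symm_apply _
  · refine (he z).trans (congrArg _ (ModuleCat.iCycles_injective K n ?_))
    rw [hL, hy]

end ModuleComplex

/-! ### Coinvariants of induced modules -/

section TrivTensorFree

open CategoryTheory

variable (k : Type u) [CommRing k] {B : Type u} [Ring B] [Bialgebra k B]

section

attribute [local instance] baseModule baseModule_isScalarTower

variable {k} in
-- In `k ⊗_B M` the element `b m` equals `ε(b) m`, so every element of the `B`-span of the image of
-- `ι` has the same class as `ι` of its augmentation.
theorem oneTensor_eq (M : ModuleCat.{u} B) {C : Type u} [AddCommGroup C] [Module k C]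
    {ι : C →+ M} (hι : ∀ (c : k) x, ι (c • x) = algebraMap k B c • ι x)
    {a : M →+ C} (ha : ∀ (b : B) m, a (b • m) = Coalgebra.counit (R := k) b • a m)
    (haι : ∀ x, a (ι x) = x) (hspan : ∀ m, m ∈ Submodule.span B (Set.range ι)) (m : M) :
    oneTensor k M m = oneTensor k M (ι (a m)) := by
  have add : ∀ m m' : M, oneTensor k M (m + m') = oneTensor k M m + oneTensor k M m' := fun m m' =>
    (congrArg (trivTensorRel k B M).mkQ (TensorProduct.tmul_add (1 : k) m m')).trans
      (map_add (trivTensorRel k B M).mkQ _ _)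
  have rel : ∀ (b : B) m, oneTensor k M (b • m) = Coalgebra.counit (R := k) b • oneTensor k M m :=
    fun b m => by
      refine Eq.trans ?_ (map_smul (trivTensorRel k B M).mkQ (Coalgebra.counit (R := k) b)
        ((1 : k) ⊗ₜ[k] (m : M)))
      change (trivTensorRel k B M).mkQ _ = _
      rw [TensorProduct.smul_tmul', eq_comm, ← sub_eq_zero, ← map_sub]
      refine (Submodule.Quotient.mk_eq_zero _).2 (Submodule.subset_span ⟨1, b, m, ?_⟩)
      rw [one_mul, smul_eq_mul, mul_one]
  refine Submodule.span_induction (p := fun m _ => oneTensor k M m = oneTensor k M (ι (a m)))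
    ?_ ?_ ?_ ?_ (hspan m)
  · rintro _ ⟨x, rfl⟩
    rw [haι]
  · rw [map_zero, map_zero]
  · intro m m' _ _ h h'
    rw [add, map_add, map_add, add, h, h']
  · intro b m _ h
    rw [rel, h, ha, hι, rel]
    simp

/-- The module `k ⊗_B M` for a `B`-module `M` that is induced from a `k`-module `C`. -/
theorem exists_trivTensorEquiv (M : ModuleCat.{u} B) {C : Type u} [AddCommGroup C] [Module k C]
    {ι : C →+ M} (hι : ∀ (c : k) x, ι (c • x) = algebraMap k B c • ι x)
    {a : M →+ C} (ha : ∀ (b : B) m, a (b • m) = Coalgebra.counit (R := k) b • a m)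
    (haι : ∀ x, a (ι x) = x) (hspan : ∀ m, m ∈ Submodule.span B (Set.range ι)) :
    ∃ φ : C ≃ₗ[k] (trivTensorFunctor k B).obj M, ∀ x, φ x = oneTensor k M (ι x) := by
  let ι' : C →ₗ[k] M := { ι with map_smul' := hι }
  let a' : M →ₗ[k] C :=
    { a with
      map_smul' := fun c m => by
        refine (ha (algebraMap k B c) m).trans ?_
        simp }
  let ψ : TrivTensor k B M →ₗ[k] C :=
    Submodule.liftQ _ ((TensorProduct.lid k C).toLinearMap ∘ₗ LinearMap.lTensor k a') (by
      rw [trivTensorRel, Submodule.span_le]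
      rintro _ ⟨c, b, m, rfl⟩
      have h : a' (b • m) = Coalgebra.counit (R := k) b • a' m := ha b m
      simp only [SetLike.mem_coe, LinearMap.mem_ker, LinearMap.comp_apply, map_sub,
        LinearMap.lTensor_tmul, LinearEquiv.coe_coe, TensorProduct.lid_tmul, h, mul_smul, sub_self])
  let φ : C →ₗ[k] TrivTensor k B M := (trivTensorRel k B M).mkQ ∘ₗ TensorProduct.mk k k M 1 ∘ₗ ι'
  have hψ : ∀ m, ψ ((trivTensorRel k B M).mkQ (1 ⊗ₜ[k] m)) = a m := fun m => by
    change TensorProduct.lid k C (1 ⊗ₜ[k] a' m) = a m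
    rw [TensorProduct.lid_tmul, one_smul]
    rfl
  refine ⟨LinearEquiv.ofLinearMap φ ψ ?_ ?_, fun x => rfl⟩
  · refine Submodule.linearMap_qext _ (TensorProduct.ext' fun c m => ?_)
    have h : c ⊗ₜ[k] m = c • (1 : k) ⊗ₜ[k] m := by
      rw [TensorProduct.smul_tmul', smul_eq_mul, mul_one]
    rw [h, map_smul, map_smul]
    congr 1
    change φ (ψ ((trivTensorRel k B M).mkQ (1 ⊗ₜ[k] m))) = oneTensor k M m
    rw [hψ, oneTensor_eq M hι ha haι hspan m]
    rfl
  · refine LinearMap.ext fun x => ?_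
    exact (hψ (ι x)).trans (haι x)

end

end TrivTensorFree

/-! ### The bar complex as a resolution of the trivial module -/

section BarTor

open CategoryTheory

variable (k : Type u) [CommRing k] (B : Type u) [Ring B] [Bialgebra k B]

/-- The differential of the bar resolution, as a map of `B`-modules. -/
def barResMap (n : ℕ) : B ⊗[k] BarChain k B (n + 1) →ₗ[B] B ⊗[k] BarChain k B n :=
  { barResDiff k B n with map_smul' := barResDiff_smul }

/-- The complex of the bar resolution. -/
def barComplex : ChainComplex (ModuleCat.{u} B) ℕ :=
  ChainComplex.of (fun n => ModuleCat.of B (B ⊗[k] BarChain k B n))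
    (fun n => ModuleCat.ofHom (barResMap k B n)) fun n =>
      ModuleCat.hom_ext (LinearMap.ext fun t => barResDiff_barResDiff n t)

theorem barComplex_d (n : ℕ) : (barComplex k B).d (n + 1) n = ModuleCat.ofHom (barResMap k B n) :=
  (ChainComplex.of_d (fun n => ModuleCat.of B (B ⊗[k] BarChain k B n))
    (fun n => ModuleCat.ofHom (barResMap k B n)) n)

/-- The augmentation of the bar resolution. -/
def barResAugment : B ⊗[k] BarChain k B 0 →ₗ[B] trivModule k B where
  toFun t := (show k from TensorPower.algebraMap₀.symm (barAugment k B 0 t))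
  map_add' s t := by rw [map_add, map_add]; rfl
  map_smul' b t := by
    rw [barAugment_smul, map_smul]
    rfl

theorem exists_barResDiff_zero {t : B ⊗[k] BarChain k B 0} (ht : barResAugment k B t = 0) :
    ∃ s, barResDiff k B 0 s = t := by
  have h : barAugment k B 0 t = 0 :=
    TensorPower.algebraMap₀.symm.injective (ht.trans (map_zero _).symm)
  have h' := barResDiff_barContraction_zero t
  rw [h, TensorProduct.tmul_zero, add_zero] at h'
  exact ⟨_, h'⟩

theorem barResAugment_barResDiff (t : B ⊗[k] BarChain k B 1) :
    barResAugment k B (barResDiff k B 0 t) = 0 := by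
  change TensorPower.algebraMap₀.symm (barAugment k B 0 (barResDiff k B 0 t)) = (0 : k)
  rw [barAugment_barResDiff, barDiff_zero_eq_zero, LinearMap.zero_apply, map_zero]

theorem barResAugment_surjective : Function.Surjective (barResAugment k B) := fun c =>
  ⟨1 ⊗ₜ[k] TensorPower.algebraMap₀ (show k from c), by
    change TensorPower.algebraMap₀.symm (barAugment k B 0 _) = (show k from c)
    simp [barAugment]
    exact LinearEquiv.symm_apply_apply _ _⟩

/-- The augmentation of the bar resolution, as a morphism of modules. -/
def barResAugmentHom : (barComplex k B).X 0 ⟶ trivModule k B :=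
  (ModuleCat.ofHom (Y := trivModule k B) (barResAugment k B) :
    ModuleCat.of B (B ⊗[k] BarChain k B 0) ⟶ ModuleCat.of B (trivModule k B))

/-- The augmentation of the bar resolution, as a chain map. -/
def barComplexAugment : barComplex k B ⟶ (ChainComplex.single₀ _).obj (trivModule k B) :=
  (ChainComplex.toSingle₀Equiv _ _).symm ⟨barResAugmentHom k B, by
    rw [barComplex_d]
    refine ModuleCat.hom_ext (M := ModuleCat.of B (B ⊗[k] BarChain k B 1)) (LinearMap.ext fun t => ?_)
    exact barResAugment_barResDiff k B t⟩

theorem barComplexAugment_f_zero :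
    (barComplexAugment k B).f 0 = barResAugmentHom k B := by
  rw [barComplexAugment, ChainComplex.toSingle₀Equiv_symm_apply_f_zero]

/-- Exactness is a statement about underlying groups, so the contraction suffices although it is
only `k`-linear; projectivity plays no role here. -/
theorem barComplexAugment_quasiIso : QuasiIso (barComplexAugment k B) := ⟨fun n => by
  cases n with
  | zero =>
    rw [ChainComplex.quasiIsoAt₀_iff, ShortComplex.quasiIso_iff_of_zeros']
    · refine ⟨(ShortComplex.moduleCat_exact_iff _).2 fun t ht => ?_,
        (ModuleCat.epi_iff_surjective _).2 ?_⟩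
      · change ((barComplexAugment k B).f 0).hom t = 0 at ht
        change ∃ s, ((barComplex k B).d 1 0).hom s = t
        rw [barComplexAugment_f_zero] at ht
        rw [barComplex_d]
        exact exists_barResDiff_zero k B ht
      · change Function.Surjective ((barComplexAugment k B).f 0).hom
        rw [barComplexAugment_f_zero]
        exact barResAugment_surjective k B
    all_goals rfl
  | succ n =>
    rw [quasiIsoAt_iff_exactAt' _ _ (ChainComplex.exactAt_succ_single_obj _ _),
      HomologicalComplex.exactAt_iff' _ (n + 1 + 1) (n + 1) n (by simp) (by simp)]
    refine (ShortComplex.moduleCat_exact_iff _).2 fun t ht => ?_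
    change ((barComplex k B).d (n + 1) n).hom t = 0 at ht
    change ∃ s, ((barComplex k B).d (n + 2) (n + 1)).hom s = t
    rw [barComplex_d] at ht ⊢
    have h := barResDiff_barContraction (k := k) (B := B) t
    rw [show barResDiff k B n t = 0 from ht, map_zero, add_zero] at h
    exact ⟨_, h⟩⟩

end BarTor

/-! ### Identification of Hopf algebra homology with torsion groups -/

section BarResolution

open CategoryTheory

variable (k : Type u) [CommRing k] (B : Type u) [Ring B] [Bialgebra k B]

/-- The bar resolution of the trivial module. -/
def barResolution [Module.Projective k B] : ProjectiveResolution (trivModule k B) where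
  complex := barComplex k B
  projective n := by
    -- The module `B ⊗ B^{⊗ n}` is induced from a projective `k`-module, hence projective over `B`.
    have := barChain_projective (k := k) (B := B) n
    change Projective (ModuleCat.of B (B ⊗[k] BarChain k B n))
    infer_instance
  π := barComplexAugment k B
  quasiIso := barComplexAugment_quasiIso k B

/-- The terms of the bar resolution are induced from the bar chains. The transported differential of
`x` is the augmentation of the resolution differential of `1 ⊗ x`, which is the standard
differential. -/
theorem exists_trivTensorBarEquiv :
    ∃ φ : ∀ n, BarChain k B n ≃ₗ[k] (((trivTensorFunctor k B).mapHomologicalComplex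
        (ComplexShape.down ℕ)).obj (barComplex k B)).X n,
      (∀ n x, φ n x = oneTensor k ((barComplex k B).X n) ((1 : B) ⊗ₜ[k] x)) ∧
      ∀ n x, φ n (barDiff k B n x) = ((((trivTensorFunctor k B).mapHomologicalComplex
        (ComplexShape.down ℕ)).obj (barComplex k B)).d (n + 1) n).hom (φ (n + 1) x) := by
  have hι : ∀ n (c : k) (x : BarChain k B n), (1 : B) ⊗ₜ[k] (c • x) =
      algebraMap k B c • ((1 : B) ⊗ₜ[k] x) := fun n c x => by
    rw [algebraMap_smul, TensorProduct.tmul_smul]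
  have ha : ∀ n (b : B) (m : B ⊗[k] BarChain k B n), barAugment k B n (b • m) =
      Coalgebra.counit (R := k) b • barAugment k B n m := fun n => barAugment_smul
  have haι : ∀ n (x : BarChain k B n), barAugment k B n ((1 : B) ⊗ₜ[k] x) = x := fun n x => by
    simp [barAugment]
  have hspan : ∀ n (m : B ⊗[k] BarChain k B n),
      m ∈ Submodule.span B (Set.range (TensorProduct.mk k B (BarChain k B n) 1)) := fun n m => by
    induction m with
    | zero => exact Submodule.zero_mem _
    | add s t hs ht => exact Submodule.add_mem _ hs ht
    | tmul b x =>
      have h : b ⊗ₜ[k] x = b • ((1 : B) ⊗ₜ[k] x) := by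
        rw [TensorProduct.smul_tmul', smul_eq_mul, mul_one]
      rw [h]
      exact Submodule.smul_mem _ _ (Submodule.subset_span ⟨x, rfl⟩)
  choose φ hφ using fun n => exists_trivTensorEquiv k (ModuleCat.of B (B ⊗[k] BarChain k B n))
    (ι := (TensorProduct.mk k B (BarChain k B n) 1).toAddMonoidHom) (hι n)
    (a := (barAugment k B n).toAddMonoidHom) (ha n) (haι n) (hspan n)
  refine ⟨φ, hφ, fun n x => ?_⟩
  have h : oneTensor k ((barComplex k B).X n) (barResDiff k B n ((1 : B) ⊗ₜ[k] x)) =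
      oneTensor k ((barComplex k B).X n)
        ((1 : B) ⊗ₜ[k] barAugment k B n (barResDiff k B n ((1 : B) ⊗ₜ[k] x))) :=
    oneTensor_eq (ModuleCat.of B (B ⊗[k] BarChain k B n))
    (ι := (TensorProduct.mk k B (BarChain k B n) 1).toAddMonoidHom) (hι n)
    (a := (barAugment k B n).toAddMonoidHom) (ha n) (haι n) (hspan n) _
  rw [barAugment_barResDiff, haι] at h
  have h' : (((trivTensorFunctor k B).mapHomologicalComplex (ComplexShape.down ℕ)).obj
      (barComplex k B)).d (n + 1) n =
      (trivTensorFunctor k B).map (ModuleCat.ofHom (barResMap k B n)) :=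
    congrArg (trivTensorFunctor k B).map (barComplex_d k B n)
  rw [h']
  refine (hφ n _).trans (h.symm.trans ?_)
  exact congrArg ((trivTensorFunctor k B).map (ModuleCat.ofHom (barResMap k B n))).hom
    (hφ (n + 1) x).symm

/-- A comparison map from the bar resolution, as a chain map. -/
def barComparison {P : ProjectiveResolution (trivModule k B)}
    {f : ∀ n, B ⊗[k] BarChain k B n →ₗ[B] P.complex.X n} (hf : IsBarComparison k B P f) :
    barComplex k B ⟶ P.complex where
  f n := (ModuleCat.ofHom (Y := P.complex.X n) (f n) :
    ModuleCat.of B (B ⊗[k] BarChain k B n) ⟶ ModuleCat.of B (P.complex.X n))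
  comm' := by
    rintro _ n rfl
    rw [barComplex_d]
    refine ModuleCat.hom_ext (LinearMap.ext fun t => ?_)
    exact (hf.1 n t).symm

variable {k B} in
theorem barComparison_comp {P : ProjectiveResolution (trivModule k B)}
    {f : ∀ n, B ⊗[k] BarChain k B n →ₗ[B] P.complex.X n} (hf : IsBarComparison k B P f) :
    (barComparison k B hf).f 0 ≫ P.π.f 0 = (barComplexAugment k B).f 0 := by
  rw [barComplexAugment_f_zero]
  let g : B ⊗[k] BarChain k B 0 →ₗ[B] trivModule k B :=
    ((barComparison k B hf).f 0 ≫ P.π.f 0).hom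
  refine ModuleCat.hom_ext ((?_ : g = barResAugment k B))
  refine LinearMap.ext fun t => ?_
  induction t with
  | zero => rw [map_zero, map_zero]
  | add s t hs ht => rw [map_add, map_add, hs, ht]
  | tmul b c =>
    refine (hf.2 b c).trans ?_
    change _ = TensorPower.algebraMap₀.symm (barAugment k B 0 (b ⊗ₜ[k] c))
    simp [barAugment]

/-- The isomorphism is built from the bar resolution itself. A comparison map to another resolution
is a chain map over the identity of `k`, so naturality of the description of derived functors by
resolutions gives the formula for every `P` and `f`. -/
theorem exists_isBarTorIso [Module.Projective k B] :
    ∃ e : ∀ n, HopfHomology k B n ≃ₗ[k] bialgebraTor k B n, IsBarTorIso k B e := by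
  obtain ⟨φ, hφ, hφd⟩ := exists_trivTensorBarEquiv k B
  choose e he using exists_homologyEquiv _ φ hφd
  refine ⟨fun n => (e n).trans
    ((barResolution k B).isoLeftDerivedObj (trivTensorFunctor k B) n).symm.toLinearEquiv, ?_⟩
  intro P f hf n z y hy
  obtain ⟨L, hL⟩ := exists_liftCycles φ hφd n
  let F := trivTensorFunctor k B
  let Φ := (F.mapHomologicalComplex (ComplexShape.down ℕ)).map (barComparison k B hf)
  -- A cycle is determined by its underlying chain, so the given `y` is the image of `z` under the
  -- comparison map.
  have hΦ : (HomologicalComplex.cyclesMap Φ n).hom (L z) = y := by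
    refine ModuleCat.iCycles_injective _ n ?_
    rw [hy, ← LinearMap.comp_apply, ← ModuleCat.hom_comp, HomologicalComplex.cyclesMap_i,
      ModuleCat.hom_comp, LinearMap.comp_apply, hL, hφ]
    rfl
  have nat := (barResolution k B).isoLeftDerivedObj_inv_naturality (𝟙 _) P (barComparison k B hf)
    ((barComparison_comp hf).trans (Category.comp_id _).symm) F n
  rw [CategoryTheory.Functor.map_id, Category.comp_id] at nat
  change ((barResolution k B).isoLeftDerivedObj F n).inv.hom (e n (homologyClass _ n z)) = _
  rw [he n z (L z) (hL z), nat, ← hΦ]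
  change ((P.isoLeftDerivedObj F n).inv.hom ((HomologicalComplex.homologyMap Φ n).hom
    ((HomologicalComplex.homologyπ (((trivTensorFunctor k B).mapHomologicalComplex
      (ComplexShape.down ℕ)).obj (barComplex k B)) n).hom (L z)))) = _
  rw [← LinearMap.comp_apply (HomologicalComplex.homologyMap Φ n).hom, ← ModuleCat.hom_comp,
    HomologicalComplex.homologyπ_naturality, ModuleCat.hom_comp, LinearMap.comp_apply]

end BarResolution

/-! ### Transport along a graded isomorphism -/

section Transport

variable {k : Type u} [CommRing k]
  {V : ℕ → Type v} [∀ n, AddCommGroup (V n)] [∀ n, Module k (V n)]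
  {V' : ℕ → Type w} [∀ n, AddCommGroup (V' n)] [∀ n, Module k (V' n)]

theorem GerstenhaberCoalgebra.isHom_transfer (G : GerstenhaberCoalgebra k V)
    (e : ∀ n, V n ≃ₗ[k] V' n) :
    G.IsHom (G.transfer e).coalgebra (fun n => (e n).toLinearMap) := by
  have h : ∀ x, DirectSum.lmap (fun n => (e n).symm.toLinearMap)
      (DirectSum.lmap (fun n => (e n).toLinearMap) x) = x := fun x =>
    DirectSum.congr_of_lof (f := DirectSum.lmap (fun n => (e n).symm.toLinearMap) ∘ₗ
      DirectSum.lmap (fun n => (e n).toLinearMap)) (g := LinearMap.id)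
      (fun n x => by simp [DirectSum.lmap_lof]) x
  refine ⟨LinearMap.ext fun x => ?_, LinearMap.ext fun x => ?_, LinearMap.ext fun x => ?_⟩
  · exact congrArg (fun y => tensorSquareMap (DirectSum.lmap fun n => (e n).toLinearMap) (G.cup y)) (h x)
  · exact congrArg G.counit (h x)
  · exact congrArg (fun y => tensorSquareMap (DirectSum.lmap fun n => (e n).toLinearMap)
      (G.cobracket y)) (h x)

end Transport

end

/-! ### The theorem for bialgebras -/

theorem proposition5p6 (k : Type u) [CommRing k] (B : Type u) [Ring B] [Bialgebra k B] :
    ∃ X : ComultiplicativeCooperad k (BarChain k B),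
      -- the cooperad with comultiplication has the explicit structure maps
      (∀ (n p q i : ℕ) (h : p + q = n + 1), X.decomp p q i h = barDecomp k B p q i h) ∧
      X.counit = Coalgebra.counit ∘ₗ
        (PiTensorProduct.subsingletonEquiv (R := k) (s := fun _ : Fin 1 => B) 0).toLinearMap ∧
      (∀ n, X.psi.map n = barPsi k B n) ∧
      -- its induced differential is the standard one
      (∀ n, X.diff n = barDiff k B n) ∧
      -- over any ground ring, the axioms hold in the homology of the tensor powers of the complex
      IsGerstenhaberOnHomology (barDiff k B) X.cup X.cobracket X.cupCounit ∧
      -- the induced Gerstenhaber coalgebra structure on homology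
      (Module.Projective k B → (∀ n, Module.Projective k (HopfHomology k B n)) →
        ∃! G : GerstenhaberCoalgebra k (HopfHomology k B),
          G.IsInducedBy (barDiff k B) X.cup X.cobracket X.cupCounit) ∧
      -- the torsion groups
      (Module.Projective k B →
        ∃ e : ∀ n, HopfHomology k B n ≃ₗ[k] bialgebraTor k B n,
          IsBarTorIso k B e ∧
          ((∀ n, Module.Projective k (HopfHomology k B n)) →
            ∃ (G : GerstenhaberCoalgebra k (HopfHomology k B))
              (T : GerstenhaberCoalgebra k (fun n => bialgebraTor k B n)),
              G.IsInducedBy (barDiff k B) X.cup X.cobracket X.cupCounit ∧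
              G.IsHom T (fun n => (e n).toLinearMap))) := by
  have hd : (barCooperad k B).diff = barDiff k B := funext barCooperad_diff
  have hG : IsGerstenhaberOnHomology (barDiff k B) (barCooperad k B).cup
      (barCooperad k B).cobracket (barCooperad k B).cupCounit :=
    -- The general result concerns the induced differential; it is carried over to the standard one
    -- along their equality.
    hd ▸ (barCooperad k B).isGerstenhaberOnHomology
  have hproj : Module.Projective k B → ∀ n, Module.Projective k (BarChain k B n) := fun _ =>
    barChain_projective
  refine ⟨barCooperad k B, fun _ _ _ _ _ => rfl, rfl, fun _ => rfl, barCooperad_diff, hG,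
    fun hB hH => ?_, fun hB => ?_⟩
  · have := hproj hB
    exact hG.existsUnique_isInducedBy
  · obtain ⟨e, he⟩ := exists_isBarTorIso k B
    refine ⟨e, he, fun hH => ?_⟩
    have := hproj hB
    obtain ⟨G, hGi, -⟩ := hG.existsUnique_isInducedBy
    -- The structure on the torsion groups is defined by transport, so the given isomorphisms
    -- preserve all operations.
    exact ⟨G, (G.transfer e).coalgebra, hGi, G.isHom_transfer e⟩
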